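/- **Setting.** Let $M=\{z\in\mathbb{C}:\rho(z)\ge 0\}$ be a non-empty compact domain with smooth boundary ($\rho\in C^\infty(\mathbb{C},\mathbb{R})$, $d\rho\neq0$ on $\partial M=\{\rho=0\}$) with metric $g=e^{2\lambda}(dx^2+dy^2)$, $\lambda$ smooth up to the boundary (global isothermal coordinates of a simply connected surface). Points $(x,\theta)\in M\times\mathbb{R}/2\pi\mathbb{Z}$ denote the unit tangent vectors $e^{-\lambda(x)}(\cos\theta,\sin\theta)$, which form $SM$; $d\Sigma^3=e^{2\lambda}dx\,dy\,d\theta$; $\kappa=-e^{-2\lambda}\Delta\lambda$ is the Gaussian curvature, and $\|\kappa\|_\infty$, $\|\nabla\kappa\|_\infty$ are the maxima over $M$ of $|\kappa|$ and of the $g$-length of $\nabla\kappa$. Let $\varphi_t$ be the geodesic flow and $X$ its generator, $\tau(x,\theta)$ the exit time, $V=\partial_\theta$, $X_\perp=[X,V]$. The surface is *simple* if it is non-trapping, $\partial M$ is strictly convex, there are no conjugate points and, for every $x\in M$, $\exp_x$ maps its domain bijectively onto $M$. Let $\partial_+SM$ be the set of unit vectors at $\partial M$ with $\langle v,\nu\rangle>0$,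 where $\nu$ is the inner normal. For a function $f$ on $SM$ put $u^f(x,\theta)=\int_0^{\tau(x,\theta)}f(\varphi_t(x,\theta))\,dt$ and $If=u^f|_{\partial_+SM}$, extended by $0$ to the rest of $\partial SM$. For $w$ on $\partial_+SM$, $w_\psi$ is the function constant along geodesics with $w_\psi=w$ on $\partial_+SM$. Let $u_k(x,\theta)=\frac{e^{ik\theta}}{2\pi}\int_0^{2\pi}u(x,\phi)e^{-ik\phi}d\phi$, let $H_{(k)}u=\sum_{l}-i\,\mathrm{sgn}(l-k)\,u_l$, let $u_{+}$, $u_-$ be the even and odd parts of $u$ under $\theta\mapsto\theta+\pi$, and let $\sigma_k=+$ for $k$ even, $\sigma_k=-$ for $k$ odd. Let $\Omega_k=\{f\in C^\infty(SM):\partial_\theta f=ikf\}$, and let $H_k$ be the closure in $L^2(SM,d\Sigma^3)$ of $\{e^{ik\theta}g:g\in C_c^\infty(\mathrm{int}\,M)\}$. Put $W_kf=(X_\perp u^f)_k$ for $f\in\Omega_k$, and $W_k^\star h=(u^{X_\perp h})_k$ for $h\in\Omega_k$ with $h|_{\partial M}=0$. **Statement.** For every $k\in\mathbb{Z}$ and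 $D>0$ there is a constant $C_k=C_k(D)>0$ such that for every simple surface $(M,g)$ as above, all of whose geodesics have length at most $D$, the condition $$\|\kappa\|_\infty+\|\nabla\kappa\|_\infty\le C_k$$ implies the following. The operators $W_k$ and $W_k^\star$ extend to bounded operators on $H_k$, denoted by the same letters, which are adjoint to each other, and 1. $\|W_k\|_{\mathcal L(H_k)}<1$ and $\|W_k^\star\|_{\mathcal L(H_k)}<1$; 2. $I+W_k^2$ and $I+(W_k^\star)^2$ are invertible in $\mathcal L(H_k)$; 3. for every $f\in\Omega_k$, with convergence in $H_k$, $$f=-\sum_{p=0}^\infty(-W_k^2)^p\,(X_\perp w^{(f)}_\psi)_k,\qquad w^{(f)}=H_{(k)}(If)_{-\sigma_k}\big|_{\partial_+SM};$$ 4. for every $h\in\Omega_k$ with $h|_{\partial M}=0$ and $W_k^\star h|_{\partial M}=0$, with convergence in $H_k$, $$h=-\sum_{p=0}^\infty\big(-(W_k^{\star})^2\big)^p\,(w^{(h)}_\psi)_k,\qquad w^{(h)}=H_{(k)}\big(I[X_\perp h]\big)_{\sigma_k}\big|_{\partial_+SM};$$ 5. for every $h\in\Omega_k$ with $h|_{\partial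 M}=0$, the formula of 4 holds with $w^{(h)}$ replaced by $$w^{(h)}+\frac{\langle X_\perp,\nu\rangle}{\langle X,\nu\rangle}\,\big(I[X_\perp h]\big)_k\Big|_{\partial_+SM},$$ where $\langle X,\nu\rangle$ and $\langle X_\perp,\nu\rangle$ are the inner products of $\nu$ with the projections of $X$ and $X_\perp$ to $TM$. (The second summand is determined by the data $I[X_\perp h]$; since $(I[X_\perp h])_k=W_k^\star h$ on $\partial SM$, it vanishes under the hypothesis of 4.) -/

import Mathlib

open MeasureTheory Set Complex
open scoped ContDiff

noncomputable section

/-- A compact Riemannian surface with smooth boundary in a global chart of isothermal coordinates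
`z = x + i y`: the surface is the compact domain `{rho ≥ 0}` of the plane, `rho` being a boundary
defining function, and the metric is `exp (2 lam) (dx² + dy²)`. Smoothness up to the boundary is
expressed by smooth extensions to the plane; nothing below depends on the extensions. -/
structure IsothermalSurface where
  lam : ℂ → ℝ
  rho : ℂ → ℝ
  lam_smooth : ContDiff ℝ ∞ lam
  rho_smooth : ContDiff ℝ ∞ rho
  isCompact_domain : IsCompact {z : ℂ | 0 ≤ rho z}
  nonempty_domain : {z : ℂ | 0 ≤ rho z}.Nonempty
  rho_regular : ∀ z, rho z = 0 → fderiv ℝ rho z ≠ 0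

namespace IsothermalSurface

variable (S : IsothermalSurface)

/-- The surface `M`. -/
def M : Set ℂ := {z | 0 ≤ S.rho z}

/-- Gaussian curvature `κ = - exp (-2 lam) (∂ₓ² lam + ∂ᵧ² lam)`. -/
def curv (z : ℂ) : ℝ := -Real.exp (-2 * S.lam z) * Laplacian.laplacian S.lam z

/-- Sup norm of the curvature over `M`. -/
def curvNorm : ℝ := ⨆ z : S.M, |S.curv z|

/-- Sup norm over `M` of the Riemannian length of the gradient of the curvature. -/
def gradCurvNorm : ℝ := ⨆ z : S.M, Real.exp (-S.lam z) * ‖fderiv ℝ S.curv z‖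

/-! Points `(z, θ)` of `ℂ × ℝ` with `z ∈ M` stand for the unit tangent vector at `z` with angle `θ`,
that is, `exp (-lam z) (cos θ, sin θ)`; functions on the unit circle bundle `SM` are functions of
`(z, θ)` that are `2π`-periodic in `θ`. -/

/-- The unit circle bundle `SM`. -/
def SM : Set (ℂ × ℝ) := {p | p.1 ∈ S.M}

/-- The geodesic vector field in the coordinates `(z, θ)`. -/
def geodField (p : ℂ × ℝ) : ℂ × ℝ :=
  (Real.exp (-S.lam p.1) • exp (p.2 * I),
    Real.exp (-S.lam p.1) * fderiv ℝ S.lam p.1 (I * exp (p.2 * I)))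

/-- The transverse vector field `[X, V]` in the coordinates `(z, θ)`. -/
def perpField (p : ℂ × ℝ) : ℂ × ℝ :=
  (-(Real.exp (-S.lam p.1) • (I * exp (p.2 * I))),
    Real.exp (-S.lam p.1) * fderiv ℝ S.lam p.1 (exp (p.2 * I)))

section operators

variable {E : Type*} [NormedAddCommGroup E] [NormedSpace ℝ E]

/-- The derivation `X` along the geodesic flow. -/
def X (u : ℂ × ℝ → E) (p : ℂ × ℝ) : E := fderiv ℝ u p (S.geodField p)

/-- The derivation `X_⊥ = [X, V]`. -/
def Xperp (u : ℂ × ℝ → E) (p : ℂ × ℝ) : E := fderiv ℝ u p (S.perpField p)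

end operators

/-- `γ` is, on `[0, T]`, the lift to `SM` of the unit speed geodesic issued from `p`, and it stays
in `M`. -/
def IsGeodesic (p : ℂ × ℝ) (T : ℝ) (γ : ℝ → ℂ × ℝ) : Prop :=
  γ 0 = p ∧ ∀ t ∈ Icc 0 T, (γ t).1 ∈ S.M ∧ HasDerivWithinAt γ (S.geodField (γ t)) (Icc 0 T) t

/-- The times up to which the geodesic issued from `p` exists within `M`. -/
def geodTimes (p : ℂ × ℝ) : Set ℝ := {T | 0 ≤ T ∧ ∃ γ, S.IsGeodesic p T γ}

/-- The exit time `τ`. -/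
def exitTime (p : ℂ × ℝ) : ℝ := sSup (S.geodTimes p)

open Classical in
/-- The geodesic flow `φ_t p`; it is meaningful for `0 ≤ t ≤ τ p`, where the geodesic is unique. -/
def flow (p : ℂ × ℝ) : ℝ → ℂ × ℝ :=
  if h : ∃ γ, S.IsGeodesic p (S.exitTime p) γ then h.choose else fun _ => p

/-- `(M, g)` is simple: it is non-trapping, its boundary is strictly convex, there are no conjugate
points, and for each `x ∈ M` the exponential map at `x` is a bijection onto `M` (so that, by the
absence of conjugate points, it is a diffeomorphism), which is stated in polar coordinates. -/
structure IsSimple : Prop where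
  nontrapping : ∀ p ∈ S.SM, BddAbove (S.geodTimes p)
  strictly_convex : ∀ p : ℂ × ℝ, S.rho p.1 = 0 → S.X (fun q => S.rho q.1) p = 0 →
    S.X (S.X (fun q => S.rho q.1)) p < 0
  no_conjugate_points : ∀ p ∈ S.SM, ∀ b b' : ℝ → ℝ, b 0 = 0 → b' 0 = 1 →
    (∀ t ∈ Icc 0 (S.exitTime p),
      HasDerivWithinAt b (b' t) (Icc 0 (S.exitTime p)) t ∧
      HasDerivWithinAt b' (-S.curv (S.flow p t).1 * b t) (Icc 0 (S.exitTime p)) t) →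
    ∀ t ∈ Ioc 0 (S.exitTime p), b t ≠ 0
  exp_bijective : ∀ x ∈ S.M, BijOn (fun q : ℝ × ℝ => (S.flow (x, q.1) q.2).1)
    {q | q.1 ∈ Ico 0 (2 * Real.pi) ∧ q.2 ∈ Ioc 0 (S.exitTime (x, q.1))} (S.M \ {x})

/-- The involution `(x, θ) ↦ (x, θ + π)`. -/
def rev (p : ℂ × ℝ) : ℂ × ℝ := (p.1, p.2 + Real.pi)

/-- The influx boundary `∂₊SM`. -/
def influx : Set (ℂ × ℝ) := {p | S.rho p.1 = 0 ∧ 0 < S.X (fun q => S.rho q.1) p}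

/-- The solution `u^f` of `X u = - f`, `u = 0` on the outflux boundary. -/
def transport (f : ℂ × ℝ → ℂ) (p : ℂ × ℝ) : ℂ := ∫ t in (0 : ℝ)..S.exitTime p, f (S.flow p t)

open Classical in
/-- The ray transform `I f` on the influx boundary, extended by zero to the rest of `∂SM`
(these are the boundary values of `u^f`). -/
def ray (f : ℂ × ℝ → ℂ) : ℂ × ℝ → ℂ := S.influx.indicator (S.transport f)

/-- The exit point `ψ`. -/
def exitPoint (p : ℂ × ℝ) : ℂ × ℝ := S.flow p (S.exitTime p)

/-- The scattering relation `α` on the outflux boundary: it sends the exit point of a geodesic to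
its entry point. -/
def scatter (p : ℂ × ℝ) : ℂ × ℝ := rev (S.exitPoint (rev p))

/-- `w_ψ = w ∘ α ∘ ψ`, the solution of `X u = 0`, `u = w` on the influx boundary. -/
def extend (w : ℂ × ℝ → ℂ) (p : ℂ × ℝ) : ℂ := w (S.scatter (S.exitPoint p))

/-- The Fourier component `u_k` of `u` in the fibres. -/
def mode (k : ℤ) (u : ℂ × ℝ → ℂ) (p : ℂ × ℝ) : ℂ :=
  exp (k * p.2 * I) *
    ((1 / (2 * Real.pi) : ℂ) * ∫ φ in (0 : ℝ)..(2 * Real.pi), u (p.1, φ) * exp (-(k * φ * I)))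

/-- The shifted fibrewise Hilbert transform `H_(k) u = ∑_l -i sgn(l - k) u_l`. -/
def hilbert (k : ℤ) (u : ℂ × ℝ → ℂ) (p : ℂ × ℝ) : ℂ :=
  ∑' l : ℤ, -I * ((l - k).sign : ℂ) * mode l u p

/-- The even (`n` even) or odd (`n` odd) part of `u` for the involution `θ ↦ θ + π`. -/
def parityPart (n : ℤ) (u : ℂ × ℝ → ℂ) (p : ℂ × ℝ) : ℂ :=
  if Even n then (u p + u (rev p)) / 2 else (u p - u (rev p)) / 2

/-- `Ω_k`: smooth functions with `∂_θ f = i k f`. -/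
def Omega (k : ℤ) : Set (ℂ × ℝ → ℂ) :=
  {f | ContDiff ℝ ∞ f ∧ ∀ p, fderiv ℝ f p (0, 1) = I * k * f p}

/-- The volume measure `exp (2 lam) dx dy dθ` of `SM`. -/
def volSM : Measure (ℂ × ℝ) :=
  (volume.restrict (S.M ×ˢ Ioc 0 (2 * Real.pi))).withDensity
    fun p => ENNReal.ofReal (Real.exp (2 * S.lam p.1))

/-- `H_k`: the closure in `L²(SM)` of the functions `g(z) exp(i k θ)` with `g` smooth and compactly
supported in the interior of `M`. -/
def Hk (k : ℤ) : Submodule ℂ (Lp ℂ 2 S.volSM) :=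
  (Submodule.span ℂ {F : Lp ℂ 2 S.volSM | ∃ g : ℂ → ℂ, ContDiff ℝ ∞ g ∧ HasCompactSupport g ∧
    tsupport g ⊆ interior S.M ∧
    (F : ℂ × ℝ → ℂ) =ᵐ[S.volSM] fun p => g p.1 * exp (k * p.2 * I)}).topologicalClosure

/-- The element `F` of `H_k` is the class of the function `f`. -/
def Represents {k : ℤ} (F : S.Hk k) (f : ℂ × ℝ → ℂ) : Prop :=
  ((F : Lp ℂ 2 S.volSM) : ℂ × ℝ → ℂ) =ᵐ[S.volSM] f

/-- `W_k f = (X_⊥ u^f)_k` for `f ∈ Ω_k`. -/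
def opW (k : ℤ) (f : ℂ × ℝ → ℂ) : ℂ × ℝ → ℂ := mode k (S.Xperp (S.transport f))

/-- `W_k^* h = (u^{X_⊥ h})_k` for `h ∈ Ω_k` with `h = 0` on the boundary. -/
def opWstar (k : ℤ) (h : ℂ × ℝ → ℂ) : ℂ × ℝ → ℂ := mode k (S.transport (S.Xperp h))

/-- `f` vanishes on `∂SM`. -/
def VanishesOnBoundary (f : ℂ × ℝ → ℂ) : Prop := ∀ p : ℂ × ℝ, S.rho p.1 = 0 → f p = 0

/-- The data `w^(f) = H_(k) (I f)_{-σ_k}`. -/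
def dataW (k : ℤ) (f : ℂ × ℝ → ℂ) : ℂ × ℝ → ℂ := hilbert k (parityPart (k + 1) (S.ray f))

/-- The data `w^(h) = H_(k) (I [X_⊥ h])_{σ_k}`. -/
def dataWstar (k : ℤ) (h : ℂ × ℝ → ℂ) : ℂ × ℝ → ℂ :=
  hilbert k (parityPart k (S.ray (S.Xperp h)))

/-- The boundary datum `(⟨X_⊥, ν⟩ / ⟨X, ν⟩) (I [X_⊥ h])_k` on the influx boundary, where `ν` is the
inner normal and `(I [X_⊥ h])_k` is the boundary value of `W_k^* h`. -/
def boundaryTerm (k : ℤ) (h : ℂ × ℝ → ℂ) (p : ℂ × ℝ) : ℂ :=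
  ((S.Xperp (fun q => S.rho q.1) p / S.X (fun q => S.rho q.1) p : ℝ) : ℂ) *
    mode k (S.ray (S.Xperp h)) p

end IsothermalSurface

end

/-! Two mechanisms carry the theorem: W_k^* is a small integral operator when the curvature is
small, and a commutator formula expresses the recovered boundary data through I + W_k² and I +
(W_k^*)².

Smallness. In geodesic polar coordinates (t, φ) about x, the φ-derivative of the flow is -b X_⊥ + b'
V, where b is the Jacobi field b'' = -κ b, b(0) = 0, b'(0) = 1 (`jac_eq`). For f in Ω_k vanishing
near the boundary this trades X_⊥ f for ∂_φ f and i k f. Integration by parts in φ then writes the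
k-th coefficient of u^{X_⊥ f} at x as an integral of f over the geodesics from x, with weight i k
(b' - 1)/b - ∂_φ b / b² up to a unimodular factor. The weight vanishes when b = t, the flat case,
and bounds on κ and ∇κ keep it small (`norm_add_deriv_polarPrimitive_le`). Cauchy–Schwarz, together
with the fact that ∫ u^{|f|²} is the integral of |f|² times the time elapsed since entry, gives the
L² bound (`integral_sq_norm_opWstar_le`). So W_k^* extends from test functions to a contraction of
H_k. W_k is taken to be its Hilbert space adjoint, and formal adjointness identifies both operators
with their defining formulas (`represents_opW`, `represents_opWstar`).

Reconstruction. Since X shifts fibre degrees by ±1, X H_(k) u = H_(k) X u - (X_⊥ u)_k - X_⊥ u_k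
(`FibreSmooth.X_hilbert`). If V is H_(k) of the part of u^f of parity opposite to k, then X V = -W_k
f and (X_⊥ V)_k = -f. Let E be constant along geodesics with the influx values of V. For a test
function G with U = u^{X_⊥ G}, Green's formula for (V - E)(Ū X + Ḡ X_⊥) yields (X_⊥ E)_k = -f - W_k²
f in weak form. The dual computation starts from V = H_(k) of the part of u^{X_⊥ h} of the parity of
k, for which V_k = 0 and X V = X h - X_⊥ W_k^* h, and yields -h - (W_k^*)² h; the boundary values of
W_k^* h contribute a flux, which the term with ⟨X_⊥, ν⟩/⟨X, ν⟩ cancels. The Neumann series inverts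
both relations.

Boundary regularity. u^q need not be smooth at directions tangent to the boundary. The relevant
parity part of its boundary values, however, is an integral over the signed chord, and strict
convexity makes the chord length a nondegenerate root of a smooth equation, glancing directions
included (`bdfQuot_chord`). Hence the data extend smoothly across the boundary, while from inside
Parseval's identity gives convergence to them in square mean on fibres
(`fibreTendsto_hilbertTransport`). This is enough for Green's formula in the form
`integral_X_add_Xperp_eq_zero`, which asks only that fibre integrals of the flux tend to zero,
because boundary layers of height ε have area O(ε). -/

/-! ### Integrals depending on a parameter and roots of smooth equations -/

open Filter Topology in
-- A tube argument: near each (p, t) the norm stays below C + 1, and compactness of K provides one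
-- neighbourhood of p for all t. It supplies the constant dominating functions used for parametric
-- integrals.
theorem exists_bound_near_compact {P E : Type*} [TopologicalSpace P] [NormedAddCommGroup E]
    {F : P × ℝ → E} {p : P} {K : Set ℝ} (hK : IsCompact K)
    (hF : ∀ t ∈ K, ContinuousAt F (p, t)) :
    ∃ C : ℝ, ∀ᶠ x in 𝓝 p, ∀ t ∈ K, ‖F (x, t)‖ ≤ C := by
  have hc : ContinuousOn (fun t => F (p, t)) K := fun t ht =>
    ((hF t ht).comp (by fun_prop : ContinuousAt (fun t : ℝ => (p, t)) t)).continuousWithinAt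
  obtain ⟨C, hC⟩ := hK.exists_bound_of_continuousOn hc
  refine ⟨C + 1, ?_⟩
  refine hK.eventually_forall_of_forall_eventually fun t ht => ?_
  have h1 : ∀ᶠ z in 𝓝 (p, t), ‖F z‖ < C + 1 :=
    (hF t ht).norm.eventually (gt_mem_nhds (by linarith [hC t ht]))
  exact h1.mono fun z hz => hz.le

open Filter Topology in
/-- Differentiation under the integral sign. -/
theorem hasFDerivAt_parametric_integral {P : Type*} [NormedAddCommGroup P] [NormedSpace ℝ P]
    {O : Set P} (hO : IsOpen O) (a b : ℝ) {E : Type*} [NormedAddCommGroup E] [NormedSpace ℝ E]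
    {F : P × ℝ → E} (hF : ∀ p ∈ O, ∀ t, ContDiffAt ℝ 1 F (p, t)) {q : P} (hq : q ∈ O) :
    HasFDerivAt (fun p => ∫ t in a..b, F (p, t))
      (∫ t in a..b, (fderiv ℝ F (q, t)).comp (ContinuousLinearMap.inl ℝ P ℝ)) q := by
  have hF1 : ∀ q ∈ O, ∀ t, ContinuousAt (fun z => (fderiv ℝ F z).comp
      (ContinuousLinearMap.inl ℝ P ℝ)) (q, t) := by
    intro q hq t
    have h : ContDiffAt ℝ 0 (fderiv ℝ F) (q, t) := (hF q hq t).fderiv_right (by simp)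
    exact h.continuousAt.clm_comp continuousAt_const
  obtain ⟨C, hC⟩ := exists_bound_near_compact (isCompact_uIcc (a := a) (b := b))
    (fun t _ => hF1 q hq t)
  have hcont : ∀ x ∈ O, Continuous fun t => F (x, t) := fun x hx =>
    continuous_iff_continuousAt.2 fun t =>
      ((hF x hx t).continuousAt).comp (by fun_prop : ContinuousAt (fun t : ℝ => (x, t)) t)
  have hs : {x | x ∈ O ∧ ∀ t ∈ uIcc a b, ‖(fderiv ℝ F (x, t)).comp
      (ContinuousLinearMap.inl ℝ P ℝ)‖ ≤ C} ∈ 𝓝 q := by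
    filter_upwards [hO.mem_nhds hq, hC] with x h1 h2 using ⟨h1, h2⟩
  refine intervalIntegral.hasFDerivAt_integral_of_dominated_of_fderiv_le
    (F := fun x t => F (x, t))
    (F' := fun x t => (fderiv ℝ F (x, t)).comp (ContinuousLinearMap.inl ℝ P ℝ))
    (bound := fun _ => C) hs ?_ ?_ ?_ ?_ ?_ ?_
  · filter_upwards [hO.mem_nhds hq] with x hx
    exact (hcont x hx).aestronglyMeasurable
  · exact (hcont q hq).intervalIntegrable _ _
  · have : Continuous fun t => (fderiv ℝ F (q, t)).comp (ContinuousLinearMap.inl ℝ P ℝ) :=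
      continuous_iff_continuousAt.2 fun t => (hF1 q hq t).comp
        (by fun_prop : ContinuousAt (fun t : ℝ => (q, t)) t)
    exact this.aestronglyMeasurable
  · exact Eventually.of_forall fun t ht x hx => hx.2 t (uIoc_subset_uIcc ht)
  · exact intervalIntegrable_const
  · refine Eventually.of_forall fun t _ x hx => ?_
    have h1 : HasFDerivAt F (fderiv ℝ F (x, t)) (x, t) :=
      ((hF x hx.1 t).differentiableAt one_ne_zero).hasFDerivAt
    exact HasFDerivAt.comp x h1 ((hasFDerivAt_id x).prodMk (hasFDerivAt_const t x))

open Filter Topology in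
-- Induction on the order: the derivative of the integral is the integral of the partial derivative.
-- The target space is quantified after `n` because differentiation replaces `E` by `P →L[ℝ] E`.
theorem contDiffAt_nat_parametric_integral {P : Type} [NormedAddCommGroup P] [NormedSpace ℝ P]
    {O : Set P} (hO : IsOpen O) (a b : ℝ) (n : ℕ) :
    ∀ {E : Type} [NormedAddCommGroup E] [NormedSpace ℝ E] {F : P × ℝ → E},
      (∀ p ∈ O, ∀ t, ContDiffAt ℝ n F (p, t)) →
      ∀ p ∈ O, ContDiffAt ℝ n (fun p => ∫ t in a..b, F (p, t)) p := by
  induction n with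
  | zero =>
    intro E _ _ F hF p hp
    have hcont : ∀ q ∈ O, ∀ t, ContinuousAt F (q, t) := fun q hq t => (hF q hq t).continuousAt
    have hca : ∀ q ∈ O, ContinuousAt (fun p => ∫ t in a..b, F (p, t)) q := by
      intro q hq
      obtain ⟨C, hC⟩ := exists_bound_near_compact (isCompact_uIcc (a := a) (b := b))
        (fun t _ => hcont q hq t)
      refine intervalIntegral.continuousAt_of_dominated_interval (bound := fun _ => C) ?_ ?_ ?_ ?_
      · filter_upwards [hO.mem_nhds hq] with x hx
        have : Continuous fun t => F (x, t) := continuous_iff_continuousAt.2 fun t =>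
          (hcont x hx t).comp (by fun_prop : ContinuousAt (fun t : ℝ => (x, t)) t)
        exact this.aestronglyMeasurable
      · filter_upwards [hC] with x hx
        exact Eventually.of_forall fun t ht => hx t (uIoc_subset_uIcc ht)
      · exact intervalIntegrable_const
      · exact Eventually.of_forall fun t _ =>
          ContinuousAt.comp (g := F) (f := fun x : P => (x, t)) (hcont q hq t) (by fun_prop)
    have : ContDiffOn ℝ 0 (fun p => ∫ t in a..b, F (p, t)) O :=
      contDiffOn_zero.2 fun q hq => (hca q hq).continuousWithinAt
    exact_mod_cast this.contDiffAt (hO.mem_nhds hp)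
  | succ n ih =>
    intro E _ _ F hF p hp
    have hF1 : ∀ q ∈ O, ∀ t, ContDiffAt ℝ n (fun z => (fderiv ℝ F z).comp
        (ContinuousLinearMap.inl ℝ P ℝ)) (q, t) := by
      intro q hq t
      have h : ContDiffAt ℝ n (fderiv ℝ F) (q, t) :=
        (hF q hq t).fderiv_right (by push_cast; exact le_rfl)
      exact h.clm_comp contDiffAt_const
    have key := ih hF1
    have hone : ((1 : WithTop ℕ∞)) ≤ ((n + 1 : ℕ) : WithTop ℕ∞) := by
      exact_mod_cast Nat.succ_le_succ (Nat.zero_le n)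
    have hd : ∀ q ∈ O, HasFDerivAt (fun p => ∫ t in a..b, F (p, t))
        (∫ t in a..b, (fderiv ℝ F (q, t)).comp (ContinuousLinearMap.inl ℝ P ℝ)) q := fun q hq =>
      hasFDerivAt_parametric_integral hO a b (fun p hp t => (hF p hp t).of_le hone) hq
    have : ContDiffAt ℝ ((n : WithTop ℕ∞) + 1) (fun p => ∫ t in a..b, F (p, t)) p := by
      rw [contDiffAt_succ_iff_hasFDerivAt]
      exact ⟨_, ⟨O, hO.mem_nhds hp, hd⟩, key p hp⟩
    exact_mod_cast this

/-- An integral depending smoothly on a parameter in an open set is a smooth function of it. -/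
theorem contDiffAt_parametric_integral {P : Type} [NormedAddCommGroup P] [NormedSpace ℝ P]
    {O : Set P} (hO : IsOpen O) (a b : ℝ) {E : Type} [NormedAddCommGroup E] [NormedSpace ℝ E]
    {F : P × ℝ → E} (hF : ∀ p ∈ O, ∀ t, ContDiffAt ℝ ∞ F (p, t)) {p : P} (hp : p ∈ O) :
    ContDiffAt ℝ ∞ (fun p => ∫ t in a..b, F (p, t)) p :=
  contDiffAt_infty.2 fun n => contDiffAt_nat_parametric_integral hO a b n
    (fun q hq t => contDiffAt_infty.1 (hF q hq t) n) p hp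

open Filter Topology in
/-- A continuous root of a smooth equation, nondegenerate in the unknown, is smooth. -/
theorem contDiffAt_of_root {P : Type*} [NormedAddCommGroup P] [NormedSpace ℝ P] [CompleteSpace P]
    {G : P × ℝ → ℝ} {T : P → ℝ} {a : P} (hG : ContDiffAt ℝ ∞ G (a, T a))
    (hd : fderiv ℝ G (a, T a) (0, 1) ≠ 0) (hT : ContinuousAt T a)
    (hz : ∀ᶠ x in 𝓝 a, G (x, T x) = 0) : ContDiffAt ℝ ∞ T a := by
  have h0 : G (a, T a) = 0 := hz.self_of_nhds
  have hinv : (fderiv ℝ G (a, T a) ∘L ContinuousLinearMap.inr ℝ P ℝ).IsInvertible := by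
    refine ⟨(ContinuousLinearEquiv.smulLeft (Units.mk0 _ hd) :
      ℝ ≃L[ℝ] ℝ), ?_⟩
    ext
    simp
  have hne : (∞ : WithTop ℕ∞) ≠ 0 := by simp
  have h1 := hG.eventually_apply_eq_iff_implicitFunction hne hinv
  have h2 := hG.contDiffAt_implicitFunction hne hinv
  refine h2.congr_of_eventuallyEq ?_
  -- By continuity (x, T x) stays where the implicit function is the only root, so T coincides with
  -- it near a.
  have hc : Tendsto (fun x => (x, T x)) (𝓝 a) (𝓝 (a, T a)) :=
    (continuousAt_id.prodMk hT)
  filter_upwards [hz, hc.eventually h1] with x hx hx1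
  rw [h0] at hx1
  exact (hx1.1 hx).symm

/-! ### Superposition operators on continuous functions -/

section Nemytskii

variable {K : Type} [TopologicalSpace K] [CompactSpace K]

/-- Pointwise application of a family of continuous linear maps. -/
noncomputable def pointwiseApply (K : Type) [TopologicalSpace K] [CompactSpace K] (E G : Type)
    [NormedAddCommGroup E] [NormedSpace ℝ E] [NormedAddCommGroup G] [NormedSpace ℝ G] :
    C(K, E →L[ℝ] G) →L[ℝ] C(K, E) →L[ℝ] C(K, G) :=
  LinearMap.mkContinuous₂
    (LinearMap.mk₂ ℝ (fun (A : C(K, E →L[ℝ] G)) (h : C(K, E)) =>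
        (⟨fun k => A k (h k), by fun_prop⟩ : C(K, G)))
      (by intros; ext; simp) (by intros; ext; simp) (by intros; ext; simp) (by intros; ext; simp))
    1 (by
      intro A h
      rw [ContinuousMap.norm_le _ (by positivity)]
      intro k
      calc ‖A k (h k)‖ ≤ ‖A k‖ * ‖h k‖ := (A k).le_opNorm _
        _ ≤ ‖A‖ * ‖h‖ := mul_le_mul (A.norm_coe_le_norm k) (h.norm_coe_le_norm k)
          (norm_nonneg _) (norm_nonneg A)
        _ = 1 * ‖A‖ * ‖h‖ := by ring)

open Filter Topology in
/-- Composition with a function of class `C^n` is of class `C^n` on continuous functions. -/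
theorem contDiff_comp_continuousMap {E : Type} [NormedAddCommGroup E] [NormedSpace ℝ E] (n : ℕ) :
    ∀ {G : Type} [NormedAddCommGroup G] [NormedSpace ℝ G] (f : C(E, G)), ContDiff ℝ n f →
      ContDiff ℝ n (fun γ : C(K, E) => f.comp γ) := by
  induction n with
  | zero =>
    intro G _ _ f _
    exact contDiff_zero.2 (ContinuousMap.continuous_postcomp f)
  | succ n ih =>
    intro G _ _ f hf
    have hf' : ContDiff ℝ ((n : WithTop ℕ∞) + 1) f := by exact_mod_cast hf
    obtain ⟨f', hf'c, hd⟩ := contDiff_succ_iff_hasFDerivAt.1 hf'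
    let df : C(E, E →L[ℝ] G) := ⟨f', hf'c.continuous⟩
    have hbil : IsBoundedLinearMap ℝ (fun A : C(K, E →L[ℝ] G) => pointwiseApply K E G A) := by
      refine IsLinearMap.with_bound ⟨fun _ _ => map_add _ _ _, fun _ _ => map_smul _ _ _⟩ 1
        fun A => ?_
      refine ContinuousLinearMap.opNorm_le_bound _ (by positivity) fun h => ?_
      rw [ContinuousMap.norm_le _ (by positivity)]
      intro k
      calc ‖A k (h k)‖ ≤ ‖A k‖ * ‖h k‖ := (A k).le_opNorm _
        _ ≤ ‖A‖ * ‖h‖ := mul_le_mul (A.norm_coe_le_norm k) (h.norm_coe_le_norm k)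
          (norm_nonneg _) (norm_nonneg A)
        _ = 1 * ‖A‖ * ‖h‖ := by ring
    have : ContDiff ℝ ((n : WithTop ℕ∞) + 1) (fun γ : C(K, E) => f.comp γ) := by
      -- The derivative at γ is pointwise application of f' ∘ γ. It is of class C^n in γ by the
      -- induction hypothesis for f', followed by a bounded linear map.
      refine contDiff_succ_iff_hasFDerivAt.2
        ⟨fun γ => pointwiseApply K E G (df.comp γ), ContDiff.comp (g := pointwiseApply K E G)
          (f := fun γ : C(K, E) => df.comp γ) hbil.contDiff (ih df hf'c), ?_⟩
      intro γ
      rw [hasFDerivAt_iff_isLittleO_nhds_zero, Asymptotics.isLittleO_iff]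
      intro ε hε
      have hcont : Continuous fun γ : C(K, E) => df.comp γ := ContinuousMap.continuous_postcomp df
      obtain ⟨δ, hδ, hδ'⟩ := (Metric.continuousAt_iff (f := fun γ : C(K, E) => df.comp γ)
        (a := γ)).1 hcont.continuousAt ε hε
      filter_upwards [Metric.ball_mem_nhds (0 : C(K, E)) hδ] with h hh
      rw [mem_ball_zero_iff] at hh
      rw [ContinuousMap.norm_le _ (by positivity)]
      intro k
      -- Continuity of γ ↦ f' ∘ γ in the uniform norm controls f' on the whole segment from γ k to γ
      -- k + h k, uniformly in k; the mean value inequality then bounds the remainder.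
      have hb : ∀ y ∈ segment ℝ (γ k) (γ k + h k), ‖f' y - f' (γ k)‖ ≤ ε := by
        intro y hy
        rw [segment_eq_image'] at hy
        obtain ⟨s, hs, rfl⟩ := hy
        have hs' : dist (γ + s • h) γ < δ := by
          rw [dist_eq_norm, add_sub_cancel_left, norm_smul, Real.norm_of_nonneg hs.1]
          exact lt_of_le_of_lt (mul_le_of_le_one_left (norm_nonneg _) hs.2) hh
        have h2 := (hδ' hs').le
        have h3 := (ContinuousMap.dist_le hε.le).1 h2 k
        rw [dist_eq_norm] at h3
        simpa [df] using h3
      have h4 := Convex.norm_image_sub_le_of_norm_hasFDerivWithin_le' (𝕜 := ℝ) (f := f) (f' := f')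
        (φ := f' (γ k)) (fun y _ => (hd y).hasFDerivWithinAt) hb (convex_segment _ _)
        (left_mem_segment ℝ _ _) (right_mem_segment ℝ _ _)
      rw [add_sub_cancel_left] at h4
      calc _ = ‖f (γ k + h k) - f (γ k) - (f' (γ k)) (h k)‖ := rfl
        _ ≤ ε * ‖h k‖ := h4
        _ ≤ ε * ‖h‖ := by gcongr; exact ContinuousMap.norm_coe_le_norm _ _
    exact_mod_cast this

end Nemytskii

/-! ### Global flows of bounded smooth vector fields -/

section Flow

variable {E : Type} [NormedAddCommGroup E] [NormedSpace ℝ E]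

/-- Primitive vanishing at `0`, on continuous functions on the unit interval. -/
noncomputable def unitPrimitive (E : Type) [NormedAddCommGroup E] [NormedSpace ℝ E] :
    C(Icc (0 : ℝ) 1, E) →L[ℝ] C(Icc (0 : ℝ) 1, E) :=
  LinearMap.mkContinuous
    { toFun := fun γ => ⟨fun s => ∫ σ in (0 : ℝ)..s, γ (projIcc 0 1 zero_le_one σ), by
        have h : Continuous fun σ : ℝ => γ (projIcc 0 1 zero_le_one σ) := by fun_prop
        exact (intervalIntegral.continuous_primitive (fun a b => h.intervalIntegrable a b) 0).comp
          continuous_subtype_val⟩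
      map_add' := by
        intro γ γ'
        ext s
        have h : ∀ γ : C(Icc (0 : ℝ) 1, E), Continuous fun σ : ℝ => γ (projIcc 0 1 zero_le_one σ) :=
          fun γ => by fun_prop
        simpa using intervalIntegral.integral_add ((h γ).intervalIntegrable _ _)
          ((h γ').intervalIntegrable _ _)
      map_smul' := by
        intro c γ
        ext s
        simp }
    1 (by
      intro γ
      rw [ContinuousMap.norm_le _ (by positivity)]
      intro s
      have h1 : ‖∫ σ in (0 : ℝ)..s, γ (projIcc 0 1 zero_le_one σ)‖ ≤ ‖γ‖ * |(s : ℝ) - 0| :=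
        intervalIntegral.norm_integral_le_of_norm_le_const fun σ _ =>
          ContinuousMap.norm_coe_le_norm _ _
      have h2 : |(s : ℝ) - 0| ≤ 1 := by
        rw [sub_zero, abs_of_nonneg s.2.1]; exact s.2.2
      calc _ ≤ ‖γ‖ * |(s : ℝ) - 0| := h1
        _ ≤ ‖γ‖ * 1 := by gcongr
        _ = 1 * ‖γ‖ := by ring)

theorem unitPrimitive_apply (γ : C(Icc (0 : ℝ) 1, E)) (s : Icc (0 : ℝ) 1) :
    unitPrimitive E γ s = ∫ σ in (0 : ℝ)..s, γ (projIcc 0 1 zero_le_one σ) := rfl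

variable [FiniteDimensional ℝ E]

open Filter Topology in
/-- Uniqueness for autonomous equations with a `C^1` right hand side. -/
theorem ode_unique_Icc {f : E → E} (hf : ContDiff ℝ 1 f) {α β : ℝ → E} {T : ℝ}
    (hα : ∀ t ∈ Icc 0 T, HasDerivWithinAt α (f (α t)) (Icc 0 T) t)
    (hβ : ∀ t ∈ Icc 0 T, HasDerivWithinAt β (f (β t)) (Icc 0 T) t) (h0 : α 0 = β 0) :
    EqOn α β (Icc 0 T) := by
  have hαc : ContinuousOn α (Icc 0 T) := fun t ht => (hα t ht).continuousWithinAt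
  have hβc : ContinuousOn β (Icc 0 T) := fun t ht => (hβ t ht).continuousWithinAt
  obtain ⟨A, hA⟩ := isCompact_Icc.exists_bound_of_continuousOn hαc
  obtain ⟨B, hB⟩ := isCompact_Icc.exists_bound_of_continuousOn hβc
  have := FiniteDimensional.proper_real E
  obtain ⟨L, hL⟩ := hf.contDiffOn.exists_lipschitzOnWith one_ne_zero
    (convex_closedBall (0 : E) (max A B)) (isCompact_closedBall (0 : E) (max A B))
  have hmem : ∀ {γ : ℝ → E}, (∀ t ∈ Icc 0 T, HasDerivWithinAt γ (f (γ t)) (Icc 0 T) t) →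
      ∀ t ∈ Ico 0 T, HasDerivWithinAt γ (f (γ t)) (Ici t) t := by
    intro γ h t ht
    have h1 := (h t ⟨ht.1, ht.2.le⟩).mono (Icc_subset_Icc_left ht.1)
    exact h1.mono_of_mem_nhdsWithin (Icc_mem_nhdsGE ht.2)
  exact ODE_solution_unique_of_mem_Icc_right (v := fun _ => f) (s := fun _ => Metric.closedBall 0 (max A B))
    (fun _ _ => hL) hαc (hmem hα)
    (fun t ht => by simpa using Or.inl (hA t ⟨ht.1, ht.2.le⟩)) hβc (hmem hβ)
    (fun t ht => by simpa using Or.inr (hB t ⟨ht.1, ht.2.le⟩)) h0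

/-- Negative times reduce to positive ones by time reversal, which replaces f by -f. -/
theorem ode_unique {f : E → E} (hf : ContDiff ℝ 1 f) {α β : ℝ → E}
    (hα : ∀ t, HasDerivAt α (f (α t)) t) (hβ : ∀ t, HasDerivAt β (f (β t)) t)
    (h0 : α 0 = β 0) : α = β := by
  funext t
  rcases le_total 0 t with ht | ht
  · exact ode_unique_Icc hf (T := t) (fun s _ => (hα s).hasDerivWithinAt)
      (fun s _ => (hβ s).hasDerivWithinAt) h0 ⟨ht, le_rfl⟩
  · have hneg : ∀ {γ : ℝ → E}, (∀ t, HasDerivAt γ (f (γ t)) t) →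
        ∀ s, HasDerivAt (fun s => γ (-s)) (-f (γ (-s))) s := by
      intro γ h s
      have := (h (-s)).scomp s (hasDerivAt_neg s)
      simp only [neg_smul, one_smul] at this
      exact this
    have := ode_unique_Icc (f := fun x => -f x) hf.neg (T := -t)
      (fun s _ => (hneg hα s).hasDerivWithinAt) (fun s _ => (hneg hβ s).hasDerivWithinAt)
      (by simpa using h0) (right_mem_Icc.2 (by linarith))
    simpa using this

/-- A bounded `C^1` vector field has global integral curves. -/
theorem exists_global_integral_curve {f : E → E} (hf : ContDiff ℝ 1 f) {L : ℝ}
    (hL : ∀ x, ‖f x‖ ≤ L) (x : E) :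
    ∃ α : ℝ → E, α 0 = x ∧ ∀ t, HasDerivAt α (f (α t)) t := by
  have := FiniteDimensional.proper_real E
  have hL0 : 0 ≤ L := (norm_nonneg _).trans (hL x)
  -- A field bounded by L moves points by at most L (n + 1) in time n + 1, so Picard–Lindelöf on the
  -- ball of that radius covers the whole interval.
  have hloc : ∀ n : ℕ, ∃ α : ℝ → E, α 0 = x ∧
      ∀ t ∈ Ioo (-(n + 1 : ℝ)) (n + 1), HasDerivAt α (f (α t)) t := by
    intro n
    have hn : (0 : ℝ) ≤ n + 1 := by positivity
    obtain ⟨K, hK⟩ := hf.contDiffOn.exists_lipschitzOnWith one_ne_zero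
      (convex_closedBall x (L * (n + 1))) (isCompact_closedBall x (L * (n + 1)))
    have hP : IsPicardLindelof (fun _ => f) (tmin := -(n + 1 : ℝ)) (tmax := n + 1)
        ⟨0, by simp only [mem_Icc]; constructor <;> linarith⟩ x
        ⟨L * (n + 1), mul_nonneg hL0 hn⟩ 0 ⟨L, hL0⟩ K := by
      refine IsPicardLindelof.of_time_independent (fun y _ => hL y) hK ?_
      simp only [sub_zero, zero_sub, neg_neg, max_self, NNReal.coe_zero]
      exact le_rfl
    obtain ⟨α, h0, h1⟩ := hP.exists_eq_forall_mem_Icc_hasDerivWithinAt₀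
    exact ⟨α, h0, fun t ht => (h1 t ⟨ht.1.le, ht.2.le⟩).hasDerivAt (Icc_mem_nhds ht.1 ht.2)⟩
  choose α h0 h1 using hloc
  have heq : ∀ (m n : ℕ) (t : ℝ), |t| < m + 1 → |t| < n + 1 → α m t = α n t := by
    intro m n t hm hn
    rcases le_total 0 t with ht | ht
    · rw [abs_of_nonneg ht] at hm hn
      refine ode_unique_Icc hf (T := t) (fun s hs => ?_) (fun s hs => ?_) ((h0 m).trans (h0 n).symm)
        ⟨ht, le_rfl⟩
      · exact (h1 m s ⟨by linarith [hs.1], by linarith [hs.2]⟩).hasDerivWithinAt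
      · exact (h1 n s ⟨by linarith [hs.1], by linarith [hs.2]⟩).hasDerivWithinAt
    · rw [abs_of_nonpos ht] at hm hn
      have hneg : ∀ (k : ℕ), -t < k + 1 → ∀ s ∈ Icc 0 (-t),
          HasDerivWithinAt (fun s => α k (-s)) (-f (α k (-s))) (Icc 0 (-t)) s := by
        intro k hk s hs
        have := (h1 k (-s) ⟨by linarith [hs.2], by linarith [hs.1]⟩).scomp s (hasDerivAt_neg s)
        simp only [neg_smul, one_smul] at this
        exact this.hasDerivWithinAt
      have := ode_unique_Icc (f := fun x => -f x) hf.neg (hneg m hm) (hneg n hn)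
        (by simp [h0]) (right_mem_Icc.2 (by linarith))
      simpa using this
  -- The local solutions agree on overlaps; the index ⌈|t|⌉₊ is chosen so that t lies strictly
  -- inside its interval.
  refine ⟨fun t => α ⌈|t|⌉₊ t, by simp [h0], fun t => ?_⟩
  have hlt : ∀ t : ℝ, |t| < (⌈|t|⌉₊ : ℝ) + 1 := fun t => by linarith [Nat.le_ceil |t|]
  have hd := h1 ⌈|t|⌉₊ t (abs_lt.1 (hlt t))
  refine hd.congr_of_eventuallyEq ?_
  filter_upwards [(continuous_abs.continuousAt (x := t)).eventually (gt_mem_nhds (hlt t))] with s hs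
  exact heq _ _ s (hlt s) hs

variable {f : E → E} {Φ : ℝ → E → E}

theorem flow_add (hf : ContDiff ℝ 1 f) (h0 : ∀ x, Φ 0 x = x)
    (hΦ : ∀ x t, HasDerivAt (fun t => Φ t x) (f (Φ t x)) t) (s t : ℝ) (x : E) :
    Φ (s + t) x = Φ s (Φ t x) := by
  have := ode_unique hf (α := fun s => Φ (s + t) x) (β := fun s => Φ s (Φ t x))
    (fun s => by simpa using (hΦ x (s + t)).comp_add_const s t) (fun s => hΦ _ s) (by simp [h0])
  exact congrFun this s

open Filter Topology in
-- Implicit function theorem in C([0, 1], E). After rescaling time, the integral curve of duration t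
-- from x is a zero γ of γ - x - t ∫ f ∘ γ. At t = 0 the partial derivative in γ is the identity,
-- and the smoothness of the equation is that of the superposition operator.
theorem contDiffAt_flow_zero (hf : ContDiff ℝ ∞ f) (h0 : ∀ x, Φ 0 x = x)
    (hΦ : ∀ x t, HasDerivAt (fun t => Φ t x) (f (Φ t x)) t) (x₀ : E) (n : ℕ) :
    ContDiffAt ℝ (n + 1 : ℕ) (fun p : ℝ × E => Φ p.1 p.2) (0, x₀) := by
  let fc : C(E, E) := ⟨f, hf.continuous⟩
  let cst : E →L[ℝ] C(Icc (0 : ℝ) 1, E) := ContinuousLinearMap.const ℝ _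
  let G : (ℝ × E) × C(Icc (0 : ℝ) 1, E) → C(Icc (0 : ℝ) 1, E) := fun q =>
    q.2 - cst q.1.2 - q.1.1 • unitPrimitive E (fc.comp q.2)
  have hN : ContDiff ℝ (n + 1 : ℕ) (fun γ : C(Icc (0 : ℝ) 1, E) => fc.comp γ) :=
    contDiff_comp_continuousMap (n + 1) fc (contDiff_infty.1 hf (n + 1))
  have hG : ContDiff ℝ (n + 1 : ℕ) G := by
    have h1 : ContDiff ℝ (n + 1 : ℕ) (fun q : (ℝ × E) × C(Icc (0 : ℝ) 1, E) =>
        unitPrimitive E (fc.comp q.2)) := (unitPrimitive E).contDiff.comp (hN.comp contDiff_snd)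
    have h2 : ContDiff ℝ (n + 1 : ℕ) (fun q : (ℝ × E) × C(Icc (0 : ℝ) 1, E) => cst q.1.2) :=
      cst.contDiff.comp (contDiff_snd.comp contDiff_fst)
    exact (contDiff_snd.sub h2).sub ((contDiff_fst.comp contDiff_fst).smul h1)
  set u : (ℝ × E) × C(Icc (0 : ℝ) 1, E) := ((0, x₀), cst x₀) with hu
  have hne : (((n + 1 : ℕ) : ℕ∞) : WithTop ℕ∞) ≠ 0 := by
    exact_mod_cast Nat.succ_ne_zero n
  have hGu : G u = 0 := by simp [G, u]
  have hpart : fderiv ℝ G u ∘L ContinuousLinearMap.inr ℝ (ℝ × E) C(Icc (0 : ℝ) 1, E) =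
      ContinuousLinearMap.id ℝ _ := by
    have h1 : HasFDerivAt G (fderiv ℝ G u) u := (hG.differentiable hne u).hasFDerivAt
    have h2 : HasFDerivAt (fun γ => G ((0, x₀), γ))
        (fderiv ℝ G u ∘L ContinuousLinearMap.inr ℝ (ℝ × E) C(Icc (0 : ℝ) 1, E)) (cst x₀) := by
      have h3 : HasFDerivAt (fun γ : C(Icc (0 : ℝ) 1, E) => (((0 : ℝ), x₀), γ))
        (ContinuousLinearMap.inr ℝ (ℝ × E) C(Icc (0 : ℝ) 1, E)) (cst x₀) :=
        (hasFDerivAt_const _ _).prodMk (hasFDerivAt_id _)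
      exact HasFDerivAt.comp _ h1 h3
    have h4 : HasFDerivAt (fun γ => G ((0, x₀), γ))
        (ContinuousLinearMap.id ℝ C(Icc (0 : ℝ) 1, E)) (cst x₀) := by
      have : (fun γ => G ((0, x₀), γ)) = fun γ => γ - cst x₀ := by
        funext γ; simp [G]
      rw [this]
      exact (hasFDerivAt_id _).sub_const _
    exact h2.unique h4
  have hinv : (fderiv ℝ G u ∘L
      ContinuousLinearMap.inr ℝ (ℝ × E) C(Icc (0 : ℝ) 1, E)).IsInvertible := by
    rw [hpart]; exact ⟨ContinuousLinearEquiv.refl ℝ _, rfl⟩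
  have cdf : ContDiffAt ℝ (n + 1 : ℕ) G u := hG.contDiffAt
  have : CompleteSpace E := FiniteDimensional.complete ℝ E
  have hψ := cdf.contDiffAt_implicitFunction hne hinv
  have hψG := cdf.eventually_apply_implicitFunction hne hinv
  set ψ := cdf.implicitFunction hne hinv
  let ev : C(Icc (0 : ℝ) 1, E) →L[ℝ] E := ContinuousMap.evalCLM ℝ ⟨1, by simp⟩
  have hev : ContDiffAt ℝ (n + 1 : ℕ) (fun p => ev (ψ p)) ((0 : ℝ), x₀) :=
    ev.contDiff.contDiffAt.comp _ hψ
  refine hev.congr_of_eventuallyEq ?_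
  filter_upwards [hψG] with p hp
  rw [hGu] at hp
  set γ := ψ p
  have hγ : ∀ s : Icc (0 : ℝ) 1,
      γ s = p.2 + p.1 • ∫ σ in (0 : ℝ)..s, f (γ (projIcc 0 1 zero_le_one σ)) := by
    intro s
    have h1 := congrArg (fun g : C(Icc (0 : ℝ) 1, E) => g s) hp
    simp only [G, ContinuousMap.sub_apply, ContinuousMap.smul_apply, unitPrimitive_apply,
      ContinuousMap.zero_apply] at h1
    have h2 : cst p.2 s = p.2 := rfl
    rw [h2, sub_sub, sub_eq_zero] at h1
    exact h1
  have hcont : Continuous fun σ : ℝ => f (γ (projIcc 0 1 zero_le_one σ)) :=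
    hf.continuous.comp (by fun_prop)
  have hsol : ∀ t ∈ Icc (0 : ℝ) 1, HasDerivWithinAt
      (fun s => p.2 + p.1 • ∫ σ in (0 : ℝ)..s, f (γ (projIcc 0 1 zero_le_one σ)))
      (p.1 • f (p.2 + p.1 • ∫ σ in (0 : ℝ)..t, f (γ (projIcc 0 1 zero_le_one σ)))) (Icc 0 1) t := by
    intro t ht
    have h1 := (intervalIntegral.integral_hasDerivAt_right (hcont.intervalIntegrable 0 t)
      hcont.aestronglyMeasurable.stronglyMeasurableAtFilter hcont.continuousAt)
    have h2 := ((h1.const_smul p.1).const_add p.2).hasDerivWithinAt (s := Icc 0 1)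
    rw [projIcc_of_mem _ ht, hγ ⟨t, ht⟩] at h2
    exact h2
  have hsol2 : ∀ t ∈ Icc (0 : ℝ) 1, HasDerivWithinAt (fun s => Φ (p.1 * s) p.2)
      (p.1 • f (Φ (p.1 * t) p.2)) (Icc 0 1) t := by
    intro t _
    have h1 : HasDerivAt (fun s : ℝ => p.1 * s) p.1 t := by
      simpa using (hasDerivAt_id t).const_mul p.1
    exact ((hΦ p.2 (p.1 * t)).scomp t h1).hasDerivWithinAt
  -- A zero of G is an integral curve of p.1 • f, as is s ↦ Φ (p.1 s) p.2; evaluation at s = 1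
  -- returns the flow.
  have := ode_unique_Icc (f := fun x => p.1 • f x) (hf.of_le (by simp)|>.const_smul p.1) hsol2 hsol
    (by simp [h0]) (right_mem_Icc.2 zero_le_one)
  simp only [mul_one] at this
  change Φ p.1 p.2 = γ ⟨1, _⟩
  rw [this, hγ]

open Filter Topology in
/-- The flow of a smooth vector field depends smoothly on time and initial condition. -/
theorem contDiff_flow (hf : ContDiff ℝ ∞ f) (h0 : ∀ x, Φ 0 x = x)
    (hΦ : ∀ x t, HasDerivAt (fun t => Φ t x) (f (Φ t x)) t) :
    ContDiff ℝ ∞ (fun p : ℝ × E => Φ p.1 p.2) := by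
  have hf1 : ContDiff ℝ 1 f := hf.of_le (by simp)
  have key : ∀ (n : ℕ) (x₀ : E) (t : ℝ),
      ContDiffAt ℝ (n + 1 : ℕ) (fun p : ℝ × E => Φ p.1 p.2) (t, x₀) := by
    intro n x₀
    have hopen : ∀ q : ℝ × E, ContDiffAt ℝ (n + 1 : ℕ) (fun p : ℝ × E => Φ p.1 p.2) q →
        ∀ᶠ q' in 𝓝 q, ContDiffAt ℝ (n + 1 : ℕ) (fun p : ℝ × E => Φ p.1 p.2) q' :=
      fun q hq => hq.eventually (by simp)
    -- Regularity propagates in time by connectedness: the set of good times contains 0 and is open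
    -- and closed.
    set S : Set ℝ := {t | ContDiffAt ℝ (n + 1 : ℕ) (fun p : ℝ × E => Φ p.1 p.2) (t, x₀)} with hS
    have hSo : IsOpen S := by
      rw [isOpen_iff_mem_nhds]
      intro t ht
      have : Tendsto (fun t : ℝ => (t, x₀)) (𝓝 t) (𝓝 (t, x₀)) :=
        (by fun_prop : Continuous fun t : ℝ => (t, x₀)).continuousAt
      exact this.eventually (hopen _ ht)
    have hSc : IsClosed S := by
      rw [← closure_subset_iff_isClosed]
      intro t ht
      -- For t in the closure, a good time t₁ close to t leaves only the short time t - t₁ from the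
      -- point Φ t₁ x₀, where the result near time zero applies; then compose.
      have hev := hopen _ (contDiffAt_flow_zero hf h0 hΦ (Φ t x₀) n)
      have hcont : ContinuousAt (fun t₁ : ℝ => (t - t₁, Φ t₁ x₀)) t :=
        (by fun_prop : ContinuousAt (fun t₁ : ℝ => t - t₁) t).prodMk (hΦ x₀ t).continuousAt
      have hev' : ∀ᶠ t₁ in 𝓝 t, ContDiffAt ℝ (n + 1 : ℕ) (fun p : ℝ × E => Φ p.1 p.2)
          (t - t₁, Φ t₁ x₀) := by
        refine hcont.eventually ?_
        simpa using hev
      obtain ⟨t₁, h1, h2⟩ := mem_closure_iff_nhds.1 ht _ hev'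
      have h1 : ContDiffAt ℝ (n + 1 : ℕ) (fun p : ℝ × E => Φ p.1 p.2) (t - t₁, Φ t₁ x₀) := h1
      have hcomp : ContDiffAt ℝ (n + 1 : ℕ) (fun p : ℝ × E => (p.1 - t₁, Φ t₁ p.2)) (t, x₀) := by
        refine (contDiffAt_fst.sub contDiffAt_const).prodMk ?_
        have h3 : ContDiffAt ℝ (n + 1 : ℕ) (fun p : ℝ × E => (t₁, p.2)) (t, x₀) :=
          contDiffAt_const.prodMk contDiffAt_snd
        exact ContDiffAt.comp (t, x₀) (g := fun p : ℝ × E => Φ p.1 p.2)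
          (f := fun p : ℝ × E => (t₁, p.2)) h2 h3
      have h4 := ContDiffAt.comp (t, x₀) (g := fun p : ℝ × E => Φ p.1 p.2)
        (f := fun p : ℝ × E => (p.1 - t₁, Φ t₁ p.2)) h1 hcomp
      refine h4.congr_of_eventuallyEq (Eventually.of_forall fun p => ?_)
      simp only [Function.comp]
      rw [← flow_add hf1 h0 hΦ, sub_add_cancel]
    have hne : S.Nonempty := ⟨0, contDiffAt_flow_zero hf h0 hΦ x₀ n⟩
    have := IsClopen.eq_univ ⟨hSc, hSo⟩ hne
    intro t
    have ht : t ∈ S := by rw [this]; trivial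
    exact ht
  rw [contDiff_iff_contDiffAt]
  rintro ⟨t, x⟩
  rw [contDiffAt_infty]
  exact fun n => (key n x t).of_le (by exact_mod_cast Nat.le_succ n)

/-- A bounded smooth vector field has a smooth global flow. -/
theorem exists_smooth_flow (hf : ContDiff ℝ ∞ f) {L : ℝ} (hL : ∀ x, ‖f x‖ ≤ L) :
    ∃ Φ : ℝ → E → E, (∀ x, Φ 0 x = x) ∧ (∀ x t, HasDerivAt (fun t => Φ t x) (f (Φ t x)) t) ∧
      ContDiff ℝ ∞ (fun p : ℝ × E => Φ p.1 p.2) := by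
  choose α h0 h1 using exists_global_integral_curve (hf.of_le (by simp)) hL
  exact ⟨fun t x => α x t, h0, h1, contDiff_flow (Φ := fun t x => α x t) hf h0 h1⟩

end Flow

/-! ### The complete geodesic flow of an extended surface and the exit time -/

noncomputable section

open Filter Topology in
theorem sign_near_of_hasDerivAt_neg {g : ℝ → ℝ} {a c : ℝ} (h : HasDerivAt g c a) (hc : c < 0)
    (h0 : g a = 0) : (∀ᶠ s in 𝓝[>] a, g s < 0) ∧ (∀ᶠ s in 𝓝[<] a, 0 < g s) := by
  have h1 : ∀ᶠ s in 𝓝[≠] a, slope g a s < 0 :=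
    (hasDerivAt_iff_tendsto_slope.1 h).eventually (gt_mem_nhds hc)
  constructor
  · have h2 : ∀ᶠ s in 𝓝[>] a, slope g a s < 0 := h1.filter_mono (nhdsWithin_mono _ fun s hs => (ne_of_gt hs))
    filter_upwards [h2, self_mem_nhdsWithin] with s hs hsa
    have hsa' : 0 < s - a := sub_pos.2 hsa
    rw [slope_def_field, h0, sub_zero, div_neg_iff] at hs
    rcases hs with hs | hs
    · linarith [hs.2]
    · exact hs.1
  · have h2 : ∀ᶠ s in 𝓝[<] a, slope g a s < 0 := h1.filter_mono (nhdsWithin_mono _ fun s hs => (ne_of_lt hs))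
    filter_upwards [h2, self_mem_nhdsWithin] with s hs hsa
    have hsa' : s - a < 0 := sub_neg.2 hsa
    rw [slope_def_field, h0, sub_zero, div_neg_iff] at hs
    rcases hs with hs | hs
    · exact hs.1
    · linarith [hs.2]

open Filter Topology in
-- g' changes sign at a, and the mean value theorem carries the sign over to g on both sides. The
-- application is to ρ along geodesics tangent to the boundary.
theorem neg_near_of_second_derivative_neg {g g' : ℝ → ℝ} {a c : ℝ}
    (hg : ∀ᶠ s in 𝓝 a, HasDerivAt g (g' s) s) (hg' : HasDerivAt g' c a) (hc : c < 0)
    (h0 : g a = 0) (h0' : g' a = 0) : (∀ᶠ s in 𝓝[>] a, g s < 0) ∧ (∀ᶠ s in 𝓝[<] a, g s < 0) := by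
  obtain ⟨h1, h2⟩ := sign_near_of_hasDerivAt_neg hg' hc h0'
  obtain ⟨ε, hε, hball⟩ := Metric.eventually_nhds_iff.1 hg
  constructor
  · obtain ⟨u, hu, hu'⟩ := (mem_nhdsGT_iff_exists_Ioo_subset).1 h1
    have hu : a < u := hu
    filter_upwards [Ioo_mem_nhdsGT (show a < min u (a + ε) from lt_min hu (by linarith))] with s hs
    have hd : ∀ x ∈ Icc a s, HasDerivAt g (g' x) x := fun x hx => hball (by
      rw [Real.dist_eq, abs_of_nonneg (by linarith [hx.1])]
      linarith [hx.2, hs.2, min_le_right u (a + ε)])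
    obtain ⟨ξ, hξ, he⟩ := exists_hasDerivAt_eq_slope g g' hs.1
      (fun x hx => (hd x hx).continuousAt.continuousWithinAt)
      (fun x hx => hd x ⟨hx.1.le, hx.2.le⟩)
    have hneg : g' ξ < 0 := hu' ⟨hξ.1, by linarith [hξ.2, hs.2, min_le_left u (a + ε)]⟩
    rw [eq_div_iff (by linarith [hs.1]), h0] at he
    nlinarith [hs.1]
  · obtain ⟨l, hl, hl'⟩ := (mem_nhdsLT_iff_exists_Ioo_subset).1 h2
    have hl : l < a := hl
    filter_upwards [Ioo_mem_nhdsLT (show max l (a - ε) < a from max_lt hl (by linarith))] with s hs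
    have hd : ∀ x ∈ Icc s a, HasDerivAt g (g' x) x := fun x hx => hball (by
      rw [Real.dist_eq, abs_of_nonpos (by linarith [hx.2])]
      linarith [hx.1, hs.1, le_max_right l (a - ε)])
    obtain ⟨ξ, hξ, he⟩ := exists_hasDerivAt_eq_slope g g' hs.2
      (fun x hx => (hd x hx).continuousAt.continuousWithinAt)
      (fun x hx => hd x ⟨hx.1.le, hx.2.le⟩)
    have hneg : 0 < g' ξ := hl' ⟨by linarith [hξ.1, hs.1, le_max_left l (a - ε)], hξ.2⟩
    rw [eq_div_iff (by linarith [hs.2]), h0] at he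
    nlinarith [hs.2]

namespace IsothermalSurface

variable (S : IsothermalSurface)

theorem contDiff_geodField : ContDiff ℝ ∞ S.geodField := by
  have h1 : ContDiff ℝ ∞ fun p : ℂ × ℝ => Real.exp (-S.lam p.1) :=
    (S.lam_smooth.comp contDiff_fst).neg.exp
  have h2 : ContDiff ℝ ∞ fun p : ℂ × ℝ => exp (p.2 * I) :=
    ((ofRealCLM.contDiff.comp contDiff_snd).mul contDiff_const).cexp
  have h3 : ContDiff ℝ ∞ fun p : ℂ × ℝ => fderiv ℝ S.lam p.1 :=
    (S.lam_smooth.fderiv_right (m := ∞) (by simp)).comp contDiff_fst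
  exact (h1.smul h2).prodMk (h1.mul (h3.clm_apply (contDiff_const.mul h2)))

theorem contDiff_perpField : ContDiff ℝ ∞ S.perpField := by
  have h1 : ContDiff ℝ ∞ fun p : ℂ × ℝ => Real.exp (-S.lam p.1) :=
    (S.lam_smooth.comp contDiff_fst).neg.exp
  have h2 : ContDiff ℝ ∞ fun p : ℂ × ℝ => exp (p.2 * I) :=
    ((ofRealCLM.contDiff.comp contDiff_snd).mul contDiff_const).cexp
  have h3 : ContDiff ℝ ∞ fun p : ℂ × ℝ => fderiv ℝ S.lam p.1 :=
    (S.lam_smooth.fderiv_right (m := ∞) (by simp)).comp contDiff_fst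
  exact (h1.smul (contDiff_const.mul h2)).neg.prodMk (h1.mul (h3.clm_apply h2))

section derivations

variable {E : Type*} [NormedAddCommGroup E] [NormedSpace ℝ E]

theorem contDiffAt_X {u : ℂ × ℝ → E} {p : ℂ × ℝ} (hu : ContDiffAt ℝ ∞ u p) :
    ContDiffAt ℝ ∞ (S.X u) p :=
  (hu.fderiv_right (m := ∞) (by simp)).clm_apply S.contDiff_geodField.contDiffAt

theorem contDiffAt_Xperp {u : ℂ × ℝ → E} {p : ℂ × ℝ} (hu : ContDiffAt ℝ ∞ u p) :
    ContDiffAt ℝ ∞ (S.Xperp u) p :=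
  (hu.fderiv_right (m := ∞) (by simp)).clm_apply S.contDiff_perpField.contDiffAt

theorem contDiff_X {u : ℂ × ℝ → E} (hu : ContDiff ℝ ∞ u) : ContDiff ℝ ∞ (S.X u) :=
  contDiff_iff_contDiffAt.2 fun _ => S.contDiffAt_X hu.contDiffAt

theorem contDiff_Xperp {u : ℂ × ℝ → E} (hu : ContDiff ℝ ∞ u) : ContDiff ℝ ∞ (S.Xperp u) :=
  contDiff_iff_contDiffAt.2 fun _ => S.contDiffAt_Xperp hu.contDiffAt

theorem rev_eq_add (p : ℂ × ℝ) : rev p = p + (0, Real.pi) := by simp [rev, Prod.ext_iff]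

theorem fderiv_comp_rev (u : ℂ × ℝ → E) (p : ℂ × ℝ) :
    fderiv ℝ (fun q => u (rev q)) p = fderiv ℝ u (rev p) := by
  simp only [rev_eq_add]
  exact fderiv_comp_add_right (f := u) (0, Real.pi)

theorem exp_add_pi_mul_I (θ : ℝ) : exp (((θ + Real.pi : ℝ) : ℂ) * I) = -exp (θ * I) := by
  push_cast
  rw [add_mul, Complex.exp_add, exp_pi_mul_I]; ring

theorem geodField_rev (p : ℂ × ℝ) : S.geodField (rev p) = -S.geodField p := by
  simp only [geodField, rev, exp_add_pi_mul_I]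
  ext <;> simp

theorem perpField_rev (p : ℂ × ℝ) : S.perpField (rev p) = -S.perpField p := by
  simp only [perpField, rev, exp_add_pi_mul_I]
  ext <;> simp

theorem X_comp_rev (u : ℂ × ℝ → E) (p : ℂ × ℝ) : S.X (fun q => u (rev q)) p = -S.X u (rev p) := by
  simp only [X, fderiv_comp_rev, geodField_rev, map_neg, neg_neg]

theorem Xperp_comp_rev (u : ℂ × ℝ → E) (p : ℂ × ℝ) :
    S.Xperp (fun q => u (rev q)) p = -S.Xperp u (rev p) := by
  simp only [Xperp, fderiv_comp_rev, perpField_rev, map_neg, neg_neg]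

end derivations

theorem contDiff_rev : ContDiff ℝ ∞ rev := by
  have : rev = fun p => p + (0, Real.pi) := funext rev_eq_add
  rw [this]; fun_prop

theorem continuous_rev : Continuous rev := contDiff_rev.continuous

/-- The boundary defining function on the unit circle bundle. -/
def bdf (p : ℂ × ℝ) : ℝ := S.rho p.1

theorem contDiff_bdf : ContDiff ℝ ∞ S.bdf := S.rho_smooth.comp contDiff_fst

theorem continuous_bdf : Continuous S.bdf := S.contDiff_bdf.continuous

theorem bdf_rev (p : ℂ × ℝ) : S.bdf (rev p) = S.bdf p := rfl

theorem X_bdf_rev (p : ℂ × ℝ) : S.X S.bdf (rev p) = -S.X S.bdf p := by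
  have := S.X_comp_rev S.bdf p
  simp only [bdf_rev] at this
  have h : (fun q => S.bdf q) = S.bdf := rfl
  rw [h] at this; linarith

theorem exists_radius : ∃ R : ℝ, 0 < R ∧ S.M ⊆ Metric.ball 0 R := by
  obtain ⟨R, hR⟩ := S.isCompact_domain.isBounded.subset_ball 0
  exact ⟨max R 1, by positivity, hR.trans (Metric.ball_subset_ball (le_max_left _ _))⟩

/-- A radius such that the surface lies in the corresponding ball. -/
def radius : ℝ := S.exists_radius.choose

theorem radius_pos : 0 < S.radius := S.exists_radius.choose_spec.1

theorem M_subset_ball : S.M ⊆ Metric.ball 0 S.radius := S.exists_radius.choose_spec.2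

/-- A cutoff function equal to one near the surface. -/
def cutoff : ContDiffBump (0 : ℂ) := ⟨S.radius, S.radius + 1, S.radius_pos, by linarith⟩

/-- The same surface, with a compactly supported conformal factor. -/
def ext : IsothermalSurface where
  lam := fun z => S.cutoff z * S.lam z
  rho := S.rho
  lam_smooth := S.cutoff.contDiff.mul S.lam_smooth
  rho_smooth := S.rho_smooth
  isCompact_domain := S.isCompact_domain
  nonempty_domain := S.nonempty_domain
  rho_regular := S.rho_regular

open Filter Topology in
theorem ext_lam_eventuallyEq {z : ℂ} (hz : z ∈ Metric.ball 0 S.radius) :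
    S.ext.lam =ᶠ[𝓝 z] S.lam := by
  filter_upwards [Metric.isOpen_ball.mem_nhds hz] with w hw
  have : S.cutoff w = 1 := S.cutoff.one_of_mem_closedBall (Metric.ball_subset_closedBall hw)
  simp [ext, this]

theorem ext_geodField {p : ℂ × ℝ} (hp : p.1 ∈ Metric.ball 0 S.radius) :
    S.ext.geodField p = S.geodField p := by
  have h := S.ext_lam_eventuallyEq hp
  simp only [geodField, h.eq_of_nhds, h.fderiv_eq]

theorem ext_perpField {p : ℂ × ℝ} (hp : p.1 ∈ Metric.ball 0 S.radius) :
    S.ext.perpField p = S.perpField p := by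
  have h := S.ext_lam_eventuallyEq hp
  simp only [perpField, h.eq_of_nhds, h.fderiv_eq]

/-- The cut-off conformal factor has compact support, so it and its gradient are bounded; this is
what makes the extended flow complete. -/
theorem exists_bound_ext_geodField : ∃ L : ℝ, ∀ p, ‖S.ext.geodField p‖ ≤ L := by
  have hcs : HasCompactSupport S.ext.lam := S.cutoff.hasCompactSupport.mul_right
  obtain ⟨A, hA⟩ := hcs.exists_bound_of_continuous S.ext.lam_smooth.continuous
  obtain ⟨B, hB⟩ := (hcs.fderiv (𝕜 := ℝ)).exists_bound_of_continuous
    (S.ext.lam_smooth.continuous_fderiv (by simp))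
  have hn : ∀ θ : ℝ, ‖exp (θ * I)‖ = 1 := norm_exp_ofReal_mul_I
  have he : ∀ z, Real.exp (-S.ext.lam z) ≤ Real.exp A := fun z =>
    Real.exp_le_exp.2 ((neg_le_abs _).trans (hA z))
  refine ⟨max (Real.exp A) (Real.exp A * B), fun p => ?_⟩
  rw [Prod.norm_def]
  refine max_le_max ?_ ?_
  · simp only [geodField, norm_smul, hn, mul_one, Real.norm_eq_abs, Real.abs_exp]
    exact he _
  · simp only [geodField, norm_mul, Real.norm_eq_abs, Real.abs_exp]
    refine mul_le_mul (he _) ?_ (abs_nonneg _) (Real.exp_pos _).le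
    have := (fderiv ℝ S.ext.lam p.1).le_opNorm (I * exp (p.2 * I))
    rw [norm_mul, norm_I, hn, mul_one, mul_one] at this
    exact this.trans (hB _)

theorem exists_flow : ∃ Φ : ℝ → ℂ × ℝ → ℂ × ℝ, (∀ p, Φ 0 p = p) ∧
    (∀ p t, HasDerivAt (fun t => Φ t p) (S.ext.geodField (Φ t p)) t) ∧
      ContDiff ℝ ∞ (fun q : ℝ × (ℂ × ℝ) => Φ q.1 q.2) :=
  exists_smooth_flow S.ext.contDiff_geodField S.exists_bound_ext_geodField.choose_spec

/-- The complete geodesic flow of the surface extended to the plane. -/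
def gflow : ℝ → ℂ × ℝ → ℂ × ℝ := S.exists_flow.choose

@[simp] theorem gflow_zero (p : ℂ × ℝ) : S.gflow 0 p = p := S.exists_flow.choose_spec.1 p

theorem hasDerivAt_gflow (p : ℂ × ℝ) (t : ℝ) :
    HasDerivAt (fun t => S.gflow t p) (S.ext.geodField (S.gflow t p)) t :=
  S.exists_flow.choose_spec.2.1 p t

theorem contDiff_gflow : ContDiff ℝ ∞ (fun q : ℝ × (ℂ × ℝ) => S.gflow q.1 q.2) :=
  S.exists_flow.choose_spec.2.2

theorem continuous_gflow : Continuous (fun q : ℝ × (ℂ × ℝ) => S.gflow q.1 q.2) :=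
  S.contDiff_gflow.continuous

theorem gflow_add (s t : ℝ) (p : ℂ × ℝ) : S.gflow (s + t) p = S.gflow s (S.gflow t p) :=
  flow_add (S.ext.contDiff_geodField.of_le (by simp)) S.gflow_zero S.hasDerivAt_gflow s t p

theorem gflow_neg_rev (t : ℝ) (p : ℂ × ℝ) : S.gflow (-t) (rev p) = rev (S.gflow t p) := by
  have h := ode_unique (f := fun x => -S.ext.geodField x)
    ((S.ext.contDiff_geodField.of_le (by simp)).neg)
    (α := fun t => S.gflow (-t) (rev p)) (β := fun t => rev (S.gflow t p))
    (fun t => by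
      have := (S.hasDerivAt_gflow (rev p) (-t)).scomp t (hasDerivAt_neg t)
      simp only [neg_smul, one_smul] at this
      exact this)
    (fun t => by
      have := (S.hasDerivAt_gflow p t).add_const ((0, Real.pi) : ℂ × ℝ)
      simpa [rev_eq_add, ← rev_eq_add, geodField_rev] using this)
    (by simp)
  exact congrFun h t

theorem gflow_rev (t : ℝ) (p : ℂ × ℝ) : S.gflow t (rev p) = rev (S.gflow (-t) p) := by
  rw [← gflow_neg_rev, neg_neg]

theorem gflow_rev_rev (t : ℝ) (p : ℂ × ℝ) : S.gflow t (rev (rev p)) = rev (rev (S.gflow t p)) := by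
  rw [gflow_rev, gflow_neg_rev]

theorem hasDerivAt_comp_gflow {E : Type*} [NormedAddCommGroup E] [NormedSpace ℝ E]
    {u : ℂ × ℝ → E} {p : ℂ × ℝ} {t : ℝ} (hu : DifferentiableAt ℝ u (S.gflow t p))
    (hM : (S.gflow t p).1 ∈ S.M) :
    HasDerivAt (fun t => u (S.gflow t p)) (S.X u (S.gflow t p)) t := by
  have h := hu.hasFDerivAt.comp_hasDerivAt t (S.hasDerivAt_gflow p t)
  rwa [S.ext_geodField (S.M_subset_ball hM)] at h

/-- By uniqueness, a geodesic that stays in M is a piece of the complete flow. Every later statement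
on exit times is made through `gflow`. -/
theorem mem_geodTimes_iff (p : ℂ × ℝ) (T : ℝ) :
    T ∈ S.geodTimes p ↔ 0 ≤ T ∧ ∀ s ∈ Icc 0 T, S.gflow s p ∈ S.SM := by
  constructor
  · rintro ⟨hT, γ, h0, hγ⟩
    have heq : EqOn γ (fun t => S.gflow t p) (Icc 0 T) := by
      refine ode_unique_Icc (S.ext.contDiff_geodField.of_le (by simp)) (fun t ht => ?_)
        (fun t _ => (S.hasDerivAt_gflow p t).hasDerivWithinAt) (by simp [h0])
      rw [S.ext_geodField (S.M_subset_ball (hγ t ht).1)]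
      exact (hγ t ht).2
    exact ⟨hT, fun s hs => by
      have h1 := heq hs
      simp only at h1
      rw [← h1]; exact (hγ s hs).1⟩
  · rintro ⟨hT, h⟩
    refine ⟨hT, fun t => S.gflow t p, by simp, fun t ht => ⟨h t ht, ?_⟩⟩
    rw [← S.ext_geodField (S.M_subset_ball (h t ht))]
    exact (S.hasDerivAt_gflow p t).hasDerivWithinAt

theorem isClosed_M : IsClosed S.M := isClosed_le continuous_const S.rho_smooth.continuous

theorem isClosed_SM : IsClosed S.SM := S.isClosed_M.preimage continuous_fst

theorem mem_SM_iff (p : ℂ × ℝ) : p ∈ S.SM ↔ 0 ≤ S.bdf p := Iff.rfl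

theorem rev_mem_SM {p : ℂ × ℝ} : rev p ∈ S.SM ↔ p ∈ S.SM := Iff.rfl

theorem continuous_gflow_left (p : ℂ × ℝ) : Continuous fun t => S.gflow t p :=
  S.continuous_gflow.comp (by fun_prop : Continuous fun t : ℝ => (t, p))

variable {S} (h : S.IsSimple)
include h

/-- The supremum is attained because SM is closed and the flow is continuous. -/
theorem IsSimple.exitTime_mem {p : ℂ × ℝ} (hp : p ∈ S.SM) : S.exitTime p ∈ S.geodTimes p := by
  have h0 : (0 : ℝ) ∈ S.geodTimes p := by
    rw [mem_geodTimes_iff]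
    refine ⟨le_rfl, fun s hs => ?_⟩
    have : s = 0 := le_antisymm hs.2 hs.1
    simpa [this] using hp
  have hbd := h.nontrapping p hp
  have hτ0 : 0 ≤ S.exitTime p := le_csSup hbd h0
  rw [mem_geodTimes_iff]
  refine ⟨hτ0, fun s hs => ?_⟩
  have hlt : ∀ s, 0 ≤ s → s < S.exitTime p → S.gflow s p ∈ S.SM := by
    intro s hs0 hs
    obtain ⟨T, hT, hsT⟩ := exists_lt_of_lt_csSup ⟨0, h0⟩ hs
    exact ((S.mem_geodTimes_iff p T).1 hT).2 s ⟨hs0, hsT.le⟩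
  rcases hs.2.lt_or_eq with hs2 | hs2
  · exact hlt s hs.1 hs2
  · rcases hτ0.lt_or_eq with h1 | h1
    · have hmem : s ∈ closure (Ico 0 (S.exitTime p)) := by
        rw [closure_Ico h1.ne]; exact hs
      have hcl : IsClosed {s | S.gflow s p ∈ S.SM} :=
        S.isClosed_SM.preimage (S.continuous_gflow_left p)
      exact (closure_minimal (fun s hs => hlt s hs.1 hs.2) hcl) hmem
    · have : s = 0 := by rw [hs2, ← h1]
      simpa [this] using hp

theorem IsSimple.exitTime_nonneg {p : ℂ × ℝ} (hp : p ∈ S.SM) : 0 ≤ S.exitTime p :=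
  (h.exitTime_mem hp).1

theorem IsSimple.gflow_mem {p : ℂ × ℝ} (hp : p ∈ S.SM) {s : ℝ} (hs : s ∈ Icc 0 (S.exitTime p)) :
    S.gflow s p ∈ S.SM :=
  ((S.mem_geodTimes_iff p _).1 (h.exitTime_mem hp)).2 s hs

theorem IsSimple.le_exitTime {p : ℂ × ℝ} {T : ℝ} (hT : 0 ≤ T)
    (hs : ∀ s ∈ Icc 0 T, S.gflow s p ∈ S.SM) : T ≤ S.exitTime p := by
  have hp : p ∈ S.SM := by simpa using hs 0 ⟨le_rfl, hT⟩
  exact le_csSup (h.nontrapping p hp) ((S.mem_geodTimes_iff p T).2 ⟨hT, hs⟩)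

theorem IsSimple.flow_eq {p : ℂ × ℝ} (hp : p ∈ S.SM) {t : ℝ} (ht : t ∈ Icc 0 (S.exitTime p)) :
    S.flow p t = S.gflow t p := by
  have hex := (h.exitTime_mem hp).2
  have hγ := hex.choose_spec
  rw [flow, dif_pos hex]
  have heq : EqOn hex.choose (fun t => S.gflow t p) (Icc 0 (S.exitTime p)) := by
    refine ode_unique_Icc (S.ext.contDiff_geodField.of_le (by simp)) (fun t ht => ?_)
      (fun t _ => (S.hasDerivAt_gflow p t).hasDerivWithinAt) (by simp [hγ.1])
    rw [S.ext_geodField (S.M_subset_ball (hγ.2 t ht).1)]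
    exact (hγ.2 t ht).2
  exact heq ht

theorem IsSimple.exists_exit {p : ℂ × ℝ} (hp : p ∈ S.SM) {ε : ℝ} (hε : 0 < ε) :
    ∃ s ∈ Ioo (S.exitTime p) (S.exitTime p + ε), S.bdf (S.gflow s p) < 0 := by
  by_contra hcon
  push Not at hcon
  have := h.le_exitTime (p := p) (T := S.exitTime p + ε / 2)
    (by linarith [h.exitTime_nonneg hp]) (fun s hs => by
      rcases le_or_gt s (S.exitTime p) with h1 | h1
      · exact h.gflow_mem hp ⟨hs.1, h1⟩
      · exact hcon s ⟨h1, by linarith [hs.2]⟩)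
  linarith

omit h in
open Filter Topology in
theorem eventually_mem_ball_gflow {p : ℂ × ℝ} (hp : p ∈ S.SM) :
    ∀ᶠ s in 𝓝 (0 : ℝ), (S.gflow s p).1 ∈ Metric.ball 0 S.radius := by
  have hc : ContinuousAt (fun s => (S.gflow s p).1) 0 :=
    (continuous_fst.comp (S.continuous_gflow_left p)).continuousAt
  refine hc.eventually (Metric.isOpen_ball.mem_nhds ?_)
  simpa using S.M_subset_ball hp

omit h in
theorem hasDerivAt_comp_gflow_of_mem_ball {E : Type*} [NormedAddCommGroup E] [NormedSpace ℝ E]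
    {u : ℂ × ℝ → E} {p : ℂ × ℝ} {t : ℝ} (hu : DifferentiableAt ℝ u (S.gflow t p))
    (hM : (S.gflow t p).1 ∈ Metric.ball 0 S.radius) :
    HasDerivAt (fun t => u (S.gflow t p)) (S.X u (S.gflow t p)) t := by
  have h := hu.hasFDerivAt.comp_hasDerivAt t (S.hasDerivAt_gflow p t)
  rwa [S.ext_geodField hM] at h

open Filter Topology in
-- Strict convexity makes the second derivative of ρ negative along a geodesic tangent to the
-- boundary, so such a geodesic is outside M just before and just after.
theorem IsSimple.glancing {p : ℂ × ℝ} (hp : S.bdf p = 0) (hp1 : S.X S.bdf p = 0) :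
    (∀ᶠ s in 𝓝[>] (0 : ℝ), S.bdf (S.gflow s p) < 0) ∧
      (∀ᶠ s in 𝓝[<] (0 : ℝ), S.bdf (S.gflow s p) < 0) := by
  have hM : p ∈ S.SM := (S.mem_SM_iff p).2 hp.ge
  have hball := S.eventually_mem_ball_gflow hM
  refine neg_near_of_second_derivative_neg (g' := fun s => S.X S.bdf (S.gflow s p))
    (c := S.X (S.X S.bdf) p) ?_ ?_ (h.strictly_convex p hp hp1) (by simpa) (by simpa)
  · filter_upwards [hball] with s hs
    exact S.hasDerivAt_comp_gflow_of_mem_ball (S.contDiff_bdf.differentiable (by simp) _) hs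
  · have := S.hasDerivAt_comp_gflow_of_mem_ball (u := S.X S.bdf) (p := p) (t := 0)
      ((S.contDiff_X S.contDiff_bdf).differentiable (by simp) _) hball.self_of_nhds
    simpa using this

omit h in
theorem hasDerivAt_bdf_gflow {p : ℂ × ℝ} (hp : p ∈ S.SM) :
    HasDerivAt (fun s => S.bdf (S.gflow s p)) (S.X S.bdf p) 0 := by
  have := S.hasDerivAt_comp_gflow (u := S.bdf) (p := p) (t := 0)
    (S.contDiff_bdf.differentiable (by simp) _) (by rw [gflow_zero]; exact hp)
  simpa using this

open Filter Topology in
theorem IsSimple.exit_soon {p : ℂ × ℝ} (hp : S.bdf p = 0) (hp1 : S.X S.bdf p ≤ 0) :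
    ∀ᶠ s in 𝓝[>] (0 : ℝ), S.bdf (S.gflow s p) < 0 := by
  rcases hp1.lt_or_eq with h1 | h1
  · exact (sign_near_of_hasDerivAt_neg (S.hasDerivAt_bdf_gflow hp.ge) h1 (by simpa)).1
  · exact (h.glancing hp h1).1

open Filter Topology in
theorem IsSimple.entered_just_before {p : ℂ × ℝ} (hp : S.bdf p = 0) (hp1 : 0 ≤ S.X S.bdf p) :
    ∀ᶠ s in 𝓝[<] (0 : ℝ), S.bdf (S.gflow s p) < 0 := by
  rcases hp1.lt_or_eq with h1 | h1
  · have := (sign_near_of_hasDerivAt_neg (S.hasDerivAt_bdf_gflow hp.ge).neg (neg_lt_zero.2 h1)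
      (by simpa)).2
    filter_upwards [this] with s hs
    simpa using hs
  · exact (h.glancing hp h1.symm).2

open Filter Topology in
theorem IsSimple.exitTime_eq_zero {p : ℂ × ℝ} (hp : S.bdf p = 0) (hp1 : S.X S.bdf p ≤ 0) :
    S.exitTime p = 0 := by
  by_contra hne
  have hpos := lt_of_le_of_ne (h.exitTime_nonneg hp.ge) (Ne.symm hne)
  obtain ⟨s, hs, hs'⟩ := ((h.exit_soon hp hp1).and (Ioo_mem_nhdsGT hpos)).exists
  exact absurd (h.gflow_mem hp.ge ⟨hs'.1.le, hs'.2.le⟩) (not_le.2 hs)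

open Filter Topology in
-- A boundary point at an intermediate time would force ρ < 0 just after it or just before it,
-- according to the sign of X ρ there.
theorem IsSimple.bdf_pos_of_mem_Ioo {p : ℂ × ℝ} (hp : p ∈ S.SM) {t : ℝ}
    (ht : t ∈ Ioo 0 (S.exitTime p)) : 0 < S.bdf (S.gflow t p) := by
  have hge : ∀ᶠ s in 𝓝 (0 : ℝ), 0 ≤ S.bdf (S.gflow s (S.gflow t p)) := by
    have hc : ContinuousAt (fun s : ℝ => s + t) 0 := by fun_prop
    have h1 : ∀ᶠ s in 𝓝 (0 : ℝ), s + t ∈ Ioo 0 (S.exitTime p) :=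
      hc.eventually_mem (by rw [zero_add]; exact isOpen_Ioo.mem_nhds ht)
    filter_upwards [h1] with s hs
    rw [← gflow_add]
    exact h.gflow_mem hp ⟨hs.1.le, hs.2.le⟩
  by_contra hcon
  have h0 : S.bdf (S.gflow t p) = 0 :=
    le_antisymm (not_lt.1 hcon) (h.gflow_mem hp ⟨ht.1.le, ht.2.le⟩)
  rcases le_total (S.X S.bdf (S.gflow t p)) 0 with h1 | h1
  · obtain ⟨s, hs, hs'⟩ := ((h.exit_soon h0 h1).and (hge.filter_mono nhdsWithin_le_nhds)).exists
    linarith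
  · obtain ⟨s, hs, hs'⟩ :=
      ((h.entered_just_before h0 h1).and (hge.filter_mono nhdsWithin_le_nhds)).exists
    linarith

open Filter Topology in
theorem IsSimple.bdf_exit {p : ℂ × ℝ} (hp : p ∈ S.SM) :
    S.bdf (S.gflow (S.exitTime p) p) = 0 := by
  have hτ := h.exitTime_nonneg hp
  refine le_antisymm ?_ (h.gflow_mem hp ⟨hτ, le_rfl⟩)
  by_contra hcon
  push Not at hcon
  have hc : ContinuousAt (fun s => S.bdf (S.gflow s p)) (S.exitTime p) :=
    (S.continuous_bdf.comp (S.continuous_gflow_left p)).continuousAt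
  obtain ⟨ε, hε, hball⟩ := Metric.eventually_nhds_iff.1 (hc.eventually (lt_mem_nhds hcon))
  obtain ⟨s, hs, hs'⟩ := h.exists_exit hp hε
  have := hball (y := s) (by rw [Real.dist_eq, abs_of_pos (by linarith [hs.1])]; linarith [hs.2])
  linarith

open Filter Topology in
-- If X ρ were nonnegative at the exit point, ρ would have been negative just before. Transversality
-- at the exit is the nondegeneracy needed for smoothness of the exit time.
theorem IsSimple.X_bdf_exit_neg {p : ℂ × ℝ} (hp : p ∈ S.SM) (hτ : 0 < S.exitTime p) :
    S.X S.bdf (S.gflow (S.exitTime p) p) < 0 := by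
  by_contra hcon
  push Not at hcon
  have h1 := h.entered_just_before (h.bdf_exit hp) hcon
  obtain ⟨s, hs, hs'⟩ := (h1.and (Ioo_mem_nhdsLT (neg_lt_zero.2 hτ))).exists
  rw [← gflow_add] at hs
  have := h.gflow_mem hp (s := s + S.exitTime p) ⟨by linarith [hs'.1], by linarith [hs'.2]⟩
  rw [mem_SM_iff] at this
  linarith

open Filter Topology in
theorem IsSimple.exitTime_pos_of_bdf_pos {p : ℂ × ℝ} (hp : 0 < S.bdf p) : 0 < S.exitTime p := by
  refine lt_of_le_of_ne (h.exitTime_nonneg hp.le) fun heq => ?_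
  have := h.bdf_exit hp.le
  rw [← heq, gflow_zero] at this
  linarith

open Filter Topology in
theorem IsSimple.exitTime_pos_of_influx {p : ℂ × ℝ} (hp : S.bdf p = 0) (hp1 : 0 < S.X S.bdf p) :
    0 < S.exitTime p := by
  have h1 := (sign_near_of_hasDerivAt_neg (S.hasDerivAt_bdf_gflow hp.ge).neg (neg_lt_zero.2 hp1)
      (by simpa)).1
  obtain ⟨u, hu, hu'⟩ := (mem_nhdsGT_iff_exists_Ioo_subset).1 h1
  have hu : 0 < u := hu
  refine lt_of_lt_of_le (half_pos hu) (h.le_exitTime (half_pos hu).le fun s hs => ?_)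
  rcases hs.1.lt_or_eq with h2 | h2
  · have : -S.bdf (S.gflow s p) < 0 := hu' ⟨h2, by linarith [hs.2]⟩
    rw [mem_SM_iff]; linarith
  · rw [← h2, gflow_zero, mem_SM_iff, hp]

theorem IsSimple.exitTime_pos_iff {p : ℂ × ℝ} (hp : S.bdf p = 0) :
    0 < S.exitTime p ↔ 0 < S.X S.bdf p := by
  refine ⟨fun h1 => ?_, h.exitTime_pos_of_influx hp⟩
  by_contra h2
  rw [h.exitTime_eq_zero hp (not_lt.1 h2)] at h1
  exact lt_irrefl _ h1

theorem IsSimple.exitTime_gflow {p : ℂ × ℝ} (hp : p ∈ S.SM) {s : ℝ}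
    (hs : s ∈ Icc 0 (S.exitTime p)) : S.exitTime (S.gflow s p) = S.exitTime p - s := by
  have hps := h.gflow_mem hp hs
  refine le_antisymm ?_ ?_
  · have : S.exitTime (S.gflow s p) + s ≤ S.exitTime p := by
      refine h.le_exitTime (by linarith [h.exitTime_nonneg hps, hs.1]) fun σ hσ => ?_
      rcases le_total σ s with h1 | h1
      · exact h.gflow_mem hp ⟨hσ.1, h1.trans hs.2⟩
      · have := h.gflow_mem hps (s := σ - s) ⟨by linarith, by linarith [hσ.2]⟩
        rwa [← gflow_add, sub_add_cancel] at this
    linarith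
  · refine h.le_exitTime (by linarith [hs.2]) fun σ hσ => ?_
    rw [← gflow_add]
    exact h.gflow_mem hp ⟨by linarith [hσ.1, hs.1], by linarith [hσ.2]⟩

theorem IsSimple.exitTime_rev_rev {p : ℂ × ℝ} (hp : p ∈ S.SM) :
    S.exitTime (rev (rev p)) = S.exitTime p := by
  refine le_antisymm ?_ ?_
  · refine h.le_exitTime (h.exitTime_nonneg (p := rev (rev p)) hp) fun s hs => ?_
    have := h.gflow_mem (p := rev (rev p)) hp hs
    rwa [gflow_rev_rev, rev_mem_SM, rev_mem_SM] at this
  · refine h.le_exitTime (h.exitTime_nonneg hp) fun s hs => ?_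
    rw [gflow_rev_rev, rev_mem_SM, rev_mem_SM]
    exact h.gflow_mem hp hs

open Filter Topology in
-- Below: ρ > 0 on a compact range of intermediate times persists for nearby vectors, and a short
-- initial piece is treated separately. Above: the geodesic is strictly outside at some time shortly
-- after the exit, and so are its neighbours.
theorem IsSimple.continuousOn_exitTime : ContinuousOn S.exitTime S.SM := by
  intro p hp
  have hτ := h.exitTime_nonneg hp
  have hcj : Continuous fun q : ℝ × (ℂ × ℝ) => S.bdf (S.gflow q.1 q.2) :=
    S.continuous_bdf.comp S.continuous_gflow
  refine tendsto_order.2 ⟨fun a ha => ?_, fun b hb => ?_⟩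
  · rcases lt_or_ge a 0 with ha0 | ha0
    · filter_upwards [self_mem_nhdsWithin] with q hq
      exact ha0.trans_le (h.exitTime_nonneg hq)
    obtain ⟨t, hat, htτ⟩ := exists_between ha
    have ht0 : 0 < t := ha0.trans_lt hat
    have hpos : 0 < S.bdf p ∨ (S.bdf p = 0 ∧ 0 < S.X S.bdf p) := by
      rcases (show 0 ≤ S.bdf p from hp).lt_or_eq with h1 | h1
      · exact Or.inl h1
      · exact Or.inr ⟨h1.symm, (h.exitTime_pos_iff h1.symm).1 (ha0.trans_lt ha)⟩
    -- Interior points cause no difficulty. Near an influx vector, ρ is nondecreasing along nearby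
    -- geodesics for a uniform time, so starting in M they remain there.
    have hstart : ∃ ε > 0, ∀ᶠ q in 𝓝[S.SM] p, ∀ s ∈ Icc 0 ε, S.gflow s q ∈ S.SM := by
      rcases hpos with h1 | ⟨_, h1⟩
      · have : ∀ᶠ z in 𝓝 ((0 : ℝ), p), 0 < S.bdf (S.gflow z.1 z.2) :=
          hcj.continuousAt.eventually (lt_mem_nhds (by simpa using h1))
        obtain ⟨ε, hε, hb⟩ := Metric.eventually_nhds_iff_ball.1 this
        refine ⟨ε / 2, by positivity, nhdsWithin_le_nhds ?_⟩
        filter_upwards [Metric.ball_mem_nhds p hε] with q hq s hs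
        refine (hb (s, q) ?_).le
        rw [Metric.mem_ball, Prod.dist_eq, max_lt_iff]
        refine ⟨?_, hq⟩
        rw [Real.dist_eq, sub_zero, abs_of_nonneg hs.1]; linarith [hs.2]
      · have hX : Continuous fun q : ℝ × (ℂ × ℝ) => S.X S.bdf (S.gflow q.1 q.2) :=
          (S.contDiff_X S.contDiff_bdf).continuous.comp S.continuous_gflow
        have e1 : ∀ᶠ z in 𝓝 ((0 : ℝ), p), 0 < S.X S.bdf (S.gflow z.1 z.2) :=
          hX.continuousAt.eventually (lt_mem_nhds (by simpa using h1))
        have e2 : ∀ᶠ z in 𝓝 ((0 : ℝ), p), (S.gflow z.1 z.2).1 ∈ Metric.ball 0 S.radius :=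
          (continuous_fst.comp S.continuous_gflow).continuousAt.eventually
            (Metric.isOpen_ball.mem_nhds (by simpa using S.M_subset_ball hp))
        obtain ⟨ε, hε, hb⟩ := Metric.eventually_nhds_iff_ball.1 (e1.and e2)
        refine ⟨ε / 2, by positivity, ?_⟩
        filter_upwards [self_mem_nhdsWithin, nhdsWithin_le_nhds (Metric.ball_mem_nhds p hε)]
          with q hqM hq s hs
        have hmem : ∀ σ ∈ Icc 0 s, (σ, q) ∈ Metric.ball ((0 : ℝ), p) ε := by
          intro σ hσ
          rw [Metric.mem_ball, Prod.dist_eq, max_lt_iff]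
          refine ⟨?_, hq⟩
          rw [Real.dist_eq, sub_zero, abs_of_nonneg hσ.1]; linarith [hs.2, hσ.2]
        have hmono : MonotoneOn (fun σ => S.bdf (S.gflow σ q)) (Icc 0 s) := by
          have hd : ∀ σ ∈ Icc 0 s, HasDerivAt (fun σ => S.bdf (S.gflow σ q))
              (S.X S.bdf (S.gflow σ q)) σ := fun σ hσ =>
            S.hasDerivAt_comp_gflow_of_mem_ball (S.contDiff_bdf.differentiable (by simp) _)
              (hb _ (hmem σ hσ)).2
          refine monotoneOn_of_deriv_nonneg (convex_Icc _ _)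
            (fun σ hσ => (hd σ hσ).continuousAt.continuousWithinAt)
            (fun σ hσ => (hd σ (interior_subset hσ)).differentiableAt.differentiableWithinAt) ?_
          intro σ hσ
          rw [(hd σ (interior_subset hσ)).deriv]
          exact (hb _ (hmem σ (interior_subset hσ))).1.le
        have := hmono (left_mem_Icc.2 hs.1) (right_mem_Icc.2 hs.1) hs.1
        simp only [gflow_zero] at this
        rw [mem_SM_iff]
        exact le_trans hqM this
    obtain ⟨ε, hε, hev⟩ := hstart
    have hmid : ∀ᶠ q in 𝓝 p, ∀ s ∈ Icc ε t, 0 < S.bdf (S.gflow s q) := by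
      refine isCompact_Icc.eventually_forall_of_forall_eventually fun s hs => ?_
      have hc : ContinuousAt (fun z : (ℂ × ℝ) × ℝ => S.bdf (S.gflow z.2 z.1)) (p, s) :=
        (hcj.comp (by fun_prop : Continuous fun z : (ℂ × ℝ) × ℝ => (z.2, z.1))).continuousAt
      exact hc.eventually (lt_mem_nhds
        (h.bdf_pos_of_mem_Ioo hp ⟨hε.trans_le hs.1, hs.2.trans_lt htτ⟩))
    filter_upwards [hev, nhdsWithin_le_nhds hmid] with q h1 h2
    refine hat.trans_le (h.le_exitTime ht0.le fun s hs => ?_)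
    rcases le_total s ε with h3 | h3
    · exact h1 s ⟨hs.1, h3⟩
    · exact (h2 s ⟨h3, hs.2⟩).le
  · obtain ⟨s, hs, hs'⟩ := h.exists_exit hp (sub_pos.2 hb)
    have hc : ContinuousAt (fun q => S.bdf (S.gflow s q)) p :=
      (hcj.comp (by fun_prop : Continuous fun q : ℂ × ℝ => (s, q))).continuousAt
    filter_upwards [self_mem_nhdsWithin, nhdsWithin_le_nhds (hc.eventually (gt_mem_nhds hs'))]
      with q hq hqs
    by_contra hcon
    have := h.gflow_mem hq (s := s) ⟨by linarith [hs.1], by linarith [hs.2, not_lt.1 hcon]⟩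
    rw [mem_SM_iff] at this
    linarith

omit h in
theorem isOpen_interior_bdf : IsOpen {p | 0 < S.bdf p} := isOpen_lt continuous_const S.continuous_bdf

omit h in
theorem fderiv_bdf_gflow_time {p : ℂ × ℝ} {t : ℝ} (hM : S.gflow t p ∈ S.SM) :
    fderiv ℝ (fun z : (ℂ × ℝ) × ℝ => S.bdf (S.gflow z.2 z.1)) (p, t) (0, 1) =
      S.X S.bdf (S.gflow t p) := by
  have hG : ContDiff ℝ ∞ fun z : (ℂ × ℝ) × ℝ => S.bdf (S.gflow z.2 z.1) :=
    S.contDiff_bdf.comp (S.contDiff_gflow.comp (contDiff_snd.prodMk contDiff_fst))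
  have h1 := (hG.differentiable (by simp) (p, t)).hasFDerivAt
  have h2 : HasDerivAt (fun t : ℝ => (p, t)) ((0 : ℂ × ℝ), (1 : ℝ)) t :=
    (hasDerivAt_const t p).prodMk (hasDerivAt_id t)
  have h3 := h1.comp_hasDerivAt t h2
  exact h3.unique (S.hasDerivAt_comp_gflow (S.contDiff_bdf.differentiable (by simp) _) hM)

open Filter Topology in
-- The exit time is a continuous root of ρ(φ_t p) = 0 whose t-derivative there is X ρ < 0.
theorem IsSimple.contDiffAt_exitTime {p : ℂ × ℝ} (hp : 0 < S.bdf p) :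
    ContDiffAt ℝ ∞ S.exitTime p := by
  have hG : ContDiff ℝ ∞ fun z : (ℂ × ℝ) × ℝ => S.bdf (S.gflow z.2 z.1) :=
    S.contDiff_bdf.comp (S.contDiff_gflow.comp (contDiff_snd.prodMk contDiff_fst))
  have hnhds : {p | 0 < S.bdf p} ∈ 𝓝 p := S.isOpen_interior_bdf.mem_nhds hp
  have hsub : {p | 0 < S.bdf p} ⊆ S.SM := fun q hq => (show 0 < S.bdf q from hq).le
  refine contDiffAt_of_root (G := fun z : (ℂ × ℝ) × ℝ => S.bdf (S.gflow z.2 z.1))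
    hG.contDiffAt ?_ ?_ ?_
  · rw [fderiv_bdf_gflow_time (h.gflow_mem hp.le ⟨h.exitTime_nonneg hp.le, le_rfl⟩)]
    exact (h.X_bdf_exit_neg hp.le (h.exitTime_pos_of_bdf_pos hp)).ne
  · exact (h.continuousOn_exitTime p hp.le).continuousAt (mem_of_superset hnhds hsub)
  · filter_upwards [hnhds] with q hq
    exact h.bdf_exit (hsub hq)

end IsothermalSurface

end

/-! ### Solutions of the transport equation and the entry point of a geodesic -/

noncomputable section

namespace IsothermalSurface

variable {S : IsothermalSurface}

/-- Functions of `(z, θ)` that are `2π`-periodic in `θ`. -/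
def IsPeriodic {E : Type*} (u : ℂ × ℝ → E) : Prop := ∀ p, u (rev (rev p)) = u p

theorem rev_rev_eq (z : ℂ) (θ : ℝ) : rev (rev (z, θ)) = (z, θ + 2 * Real.pi) := by
  simp only [rev, Prod.mk.injEq, true_and]; ring

theorem IsPeriodic.periodic {E : Type*} {u : ℂ × ℝ → E} (hu : IsPeriodic u) (z : ℂ) :
    Function.Periodic (fun θ => u (z, θ)) (2 * Real.pi) := fun θ => by
  have := hu (z, θ)
  rwa [rev_rev_eq] at this

theorem isPeriodic_iff {E : Type*} {u : ℂ × ℝ → E} :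
    IsPeriodic u ↔ ∀ z θ, u (z, θ + 2 * Real.pi) = u (z, θ) :=
  ⟨fun h z θ => h.periodic z θ, fun h p => by rw [show p = (p.1, p.2) from rfl, rev_rev_eq, h]⟩

theorem IsPeriodic.comp_rev {E : Type*} {u : ℂ × ℝ → E} (hu : IsPeriodic u) :
    IsPeriodic fun p => u (rev p) := fun p => hu (rev p)

theorem IsPeriodic.exists_eq {E : Type*} {u : ℂ × ℝ → E} (hu : IsPeriodic u) (p : ℂ × ℝ) :
    ∃ θ ∈ Icc 0 (2 * Real.pi), u p = u (p.1, θ) := by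
  obtain ⟨y, hy, he⟩ := (hu.periodic p.1).exists_mem_Ico₀ Real.two_pi_pos p.2
  exact ⟨y, ⟨hy.1, hy.2.le⟩, he⟩

theorem IsPeriodic.exists_bound {E : Type*} [NormedAddCommGroup E] {u : ℂ × ℝ → E}
    (hu : IsPeriodic u) (hc : ContinuousOn u S.SM) : ∃ C : ℝ, 0 ≤ C ∧ ∀ p ∈ S.SM, ‖u p‖ ≤ C := by
  have hK : IsCompact (S.M ×ˢ Icc 0 (2 * Real.pi)) := S.isCompact_domain.prod isCompact_Icc
  obtain ⟨C, hC⟩ := hK.exists_bound_of_continuousOn (f := u) (hc.mono fun p hp => hp.1)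
  refine ⟨max C 0, le_max_right _ _, fun p hp => ?_⟩
  obtain ⟨θ, hθ, he⟩ := hu.exists_eq p
  rw [he]
  exact (hC (p.1, θ) ⟨hp, hθ⟩).trans (le_max_left _ _)

theorem IsPeriodic.fderiv {E : Type*} [NormedAddCommGroup E] [NormedSpace ℝ E] {u : ℂ × ℝ → E}
    (hu : IsPeriodic u) : IsPeriodic (fderiv ℝ u) := fun p => by
  rw [← fderiv_comp_rev u (rev p), ← fderiv_comp_rev (fun q => u (rev q)) p]
  congr 1
  exact funext hu

theorem IsPeriodic.X {E : Type*} [NormedAddCommGroup E] [NormedSpace ℝ E] {u : ℂ × ℝ → E}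
    (hu : IsPeriodic u) : IsPeriodic (S.X u) := fun p => by
  simp only [IsothermalSurface.X, hu.fderiv p, geodField_rev, neg_neg]

theorem IsPeriodic.Xperp {E : Type*} [NormedAddCommGroup E] [NormedSpace ℝ E] {u : ℂ × ℝ → E}
    (hu : IsPeriodic u) : IsPeriodic (S.Xperp u) := fun p => by
  simp only [IsothermalSurface.Xperp, hu.fderiv p, perpField_rev, neg_neg]

variable (S)

/-- The integral of a function along the complete geodesic flow. -/
def flowInt (q : ℂ × ℝ → ℂ) (z : (ℂ × ℝ) × ℝ) : ℂ :=
  z.2 • ∫ s in (0 : ℝ)..1, q (S.gflow (s * z.2) z.1)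

variable {S}

/-- Rescaling to the unit interval fixes the limits of integration, so joint smoothness in the
starting point and the length follows from that of parametric integrals. -/
theorem contDiff_flowInt {q : ℂ × ℝ → ℂ} (hq : ContDiff ℝ ∞ q) : ContDiff ℝ ∞ (S.flowInt q) := by
  refine contDiff_snd.smul (contDiff_iff_contDiffAt.2 fun z => ?_)
  have hF : ContDiff ℝ ∞ fun w : ((ℂ × ℝ) × ℝ) × ℝ => q (S.gflow (w.2 * w.1.2) w.1.1) :=
    hq.comp (S.contDiff_gflow.comp ((contDiff_snd.mul (contDiff_snd.comp contDiff_fst)).prodMk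
      (contDiff_fst.comp contDiff_fst)))
  exact contDiffAt_parametric_integral isOpen_univ 0 1
    (F := fun w : ((ℂ × ℝ) × ℝ) × ℝ => q (S.gflow (w.2 * w.1.2) w.1.1))
    (fun p _ t => hF.contDiffAt) (mem_univ z)

theorem flowInt_eq (q : ℂ × ℝ → ℂ) (p : ℂ × ℝ) (t : ℝ) :
    S.flowInt q (p, t) = ∫ s in (0 : ℝ)..t, q (S.gflow s p) := by
  have := intervalIntegral.smul_integral_comp_mul_right (a := 0) (b := 1)
    (fun s => q (S.gflow s p)) t
  simpa [flowInt] using this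

theorem continuous_comp_gflow {E : Type*} [TopologicalSpace E] {q : ℂ × ℝ → E} (hq : Continuous q)
    (p : ℂ × ℝ) : Continuous fun s => q (S.gflow s p) :=
  hq.comp (S.continuous_gflow_left p)

theorem hasDerivAt_flowInt {q : ℂ × ℝ → ℂ} (hq : Continuous q) (p : ℂ × ℝ) (t : ℝ) :
    HasDerivAt (fun t => S.flowInt q (p, t)) (q (S.gflow t p)) t := by
  have hc := continuous_comp_gflow (S := S) hq p
  simp only [flowInt_eq]
  exact intervalIntegral.integral_hasDerivAt_right (hc.intervalIntegrable 0 t)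
    hc.aestronglyMeasurable.stronglyMeasurableAtFilter hc.continuousAt

theorem flowInt_gflow {q : ℂ × ℝ → ℂ} (hq : Continuous q) (p : ℂ × ℝ) (s t : ℝ) :
    S.flowInt q (S.gflow s p, t) = S.flowInt q (p, t + s) - S.flowInt q (p, s) := by
  have hc := continuous_comp_gflow (S := S) hq p
  simp only [flowInt_eq, ← gflow_add]
  rw [intervalIntegral.integral_comp_add_right (fun σ => q (S.gflow σ p)) s,
    intervalIntegral.integral_interval_sub_left (hc.intervalIntegrable _ _)
      (hc.intervalIntegrable _ _), zero_add]

theorem transport_of_notMem {q : ℂ × ℝ → ℂ} {p : ℂ × ℝ} (hp : p ∉ S.SM) : S.transport q p = 0 := by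
  have : S.geodTimes p = ∅ := by
    ext T
    simp only [mem_empty_iff_false, iff_false, mem_geodTimes_iff]
    rintro ⟨hT, h⟩
    exact hp (by simpa using h 0 ⟨le_rfl, hT⟩)
  -- The exit time is then the supremum of the empty set, which is 0 by convention.
  simp [transport, exitTime, this]

open Filter Topology in
-- Forward times suffice: a derivative known to exist is determined by its restriction to [0, ∞).
-- The identities along geodesics are available only for times between 0 and the exit.
theorem X_eq_of_eventually {E : Type*} [NormedAddCommGroup E] [NormedSpace ℝ E]
    {u : ℂ × ℝ → E} {p : ℂ × ℝ} (hp : p ∈ S.SM) (hu : DifferentiableAt ℝ u p) {g : ℝ → E} {c : E}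
    (hg : HasDerivAt g c 0) (he : ∀ᶠ s in 𝓝[≥] (0 : ℝ), u (S.gflow s p) = g s) : S.X u p = c := by
  have h1 := S.hasDerivAt_comp_gflow (u := u) (p := p) (t := 0) (by simpa using hu)
    (by rw [gflow_zero]; exact hp)
  rw [gflow_zero] at h1
  have h2 : HasDerivWithinAt (fun s => u (S.gflow s p)) c (Ici 0) 0 :=
    hg.hasDerivWithinAt.congr_of_eventuallyEq he (he.self_of_nhdsWithin self_mem_Ici)
  exact (uniqueDiffWithinAt_Ici (0 : ℝ)).eq_deriv _ h1.hasDerivWithinAt h2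

variable (S) in
/-- The point where the geodesic through a given vector enters the surface. -/
def entry (p : ℂ × ℝ) : ℂ × ℝ := S.gflow (-S.exitTime (rev p)) p

variable (h : S.IsSimple)
include h

theorem IsSimple.transport_eq {q : ℂ × ℝ → ℂ} {p : ℂ × ℝ} (hp : p ∈ S.SM) :
    S.transport q p = S.flowInt q (p, S.exitTime p) := by
  rw [flowInt_eq, transport]
  refine intervalIntegral.integral_congr fun t ht => ?_
  rw [uIcc_of_le (h.exitTime_nonneg hp)] at ht
  simp only [h.flow_eq hp ht]

theorem IsSimple.continuousOn_transport {q : ℂ × ℝ → ℂ} (hq : ContDiff ℝ ∞ q) :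
    ContinuousOn (S.transport q) S.SM := by
  have : ContinuousOn (fun p => S.flowInt q (p, S.exitTime p)) S.SM :=
    (contDiff_flowInt hq).continuous.comp_continuousOn
      (continuousOn_id.prodMk h.continuousOn_exitTime)
  exact this.congr fun p hp => h.transport_eq hp

open Filter Topology in
theorem IsSimple.transport_eventuallyEq {q : ℂ × ℝ → ℂ} {p : ℂ × ℝ} (hp : 0 < S.bdf p) :
    S.transport q =ᶠ[𝓝 p] fun p => S.flowInt q (p, S.exitTime p) := by
  filter_upwards [S.isOpen_interior_bdf.mem_nhds hp] with x hx
  exact h.transport_eq (show 0 < S.bdf x from hx).le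

open Filter Topology in
theorem IsSimple.contDiffAt_transport {q : ℂ × ℝ → ℂ} (hq : ContDiff ℝ ∞ q) {p : ℂ × ℝ}
    (hp : 0 < S.bdf p) : ContDiffAt ℝ ∞ (S.transport q) p := by
  refine ContDiffAt.congr_of_eventuallyEq ?_ (h.transport_eventuallyEq hp)
  exact (contDiff_flowInt hq).contDiffAt.comp p (contDiffAt_id.prodMk (h.contDiffAt_exitTime hp))

theorem IsSimple.transport_eq_zero {q : ℂ × ℝ → ℂ} {p : ℂ × ℝ} (hp : S.bdf p = 0)
    (hp1 : S.X S.bdf p ≤ 0) : S.transport q p = 0 := by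
  rw [h.transport_eq (S := S) (p := p) hp.ge, h.exitTime_eq_zero hp hp1, flowInt_eq]; simp

theorem IsSimple.transport_gflow {q : ℂ × ℝ → ℂ} (hq : Continuous q) {p : ℂ × ℝ} (hp : p ∈ S.SM)
    {s : ℝ} (hs : s ∈ Icc 0 (S.exitTime p)) :
    S.transport q (S.gflow s p) = S.transport q p - S.flowInt q (p, s) := by
  rw [h.transport_eq (h.gflow_mem hp hs), h.transport_eq hp, h.exitTime_gflow hp hs,
    flowInt_gflow hq, sub_add_cancel]

omit h in
open Filter Topology in
theorem IsSimple.eventually_mem_Icc (h : S.IsSimple) {p : ℂ × ℝ} (hp : 0 < S.bdf p) :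
    ∀ᶠ s in 𝓝[≥] (0 : ℝ), s ∈ Icc 0 (S.exitTime p) :=
  Icc_mem_nhdsGE (h.exitTime_pos_of_bdf_pos hp)

theorem IsSimple.X_transport {q : ℂ × ℝ → ℂ} (hq : ContDiff ℝ ∞ q) {p : ℂ × ℝ}
    (hp : 0 < S.bdf p) : S.X (S.transport q) p = -q p := by
  have hd := (hasDerivAt_flowInt (S := S) hq.continuous p 0).const_sub (S.transport q p)
  rw [gflow_zero] at hd
  refine X_eq_of_eventually (S := S) (p := p) hp.le
    ((h.contDiffAt_transport hq hp).differentiableAt (by simp)) hd ?_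
  filter_upwards [h.eventually_mem_Icc hp] with s hs
  exact h.transport_gflow hq.continuous hp.le hs

theorem IsSimple.isPeriodic_transport {q : ℂ × ℝ → ℂ} (hq : IsPeriodic q) :
    IsPeriodic (S.transport q) := fun p => by
  by_cases hp : p ∈ S.SM
  · rw [h.transport_eq hp, h.transport_eq (p := rev (rev p)) hp, h.exitTime_rev_rev hp, flowInt_eq,
      flowInt_eq]
    simp only [gflow_rev_rev, hq _]
  · rw [transport_of_notMem hp, transport_of_notMem (p := rev (rev p)) hp]

theorem IsSimple.exitTime_rev_gflow {p : ℂ × ℝ} (hp : p ∈ S.SM) {s : ℝ}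
    (hs : s ∈ Icc 0 (S.exitTime p)) :
    S.exitTime (rev (S.gflow s p)) = S.exitTime (rev p) + s := by
  have hq : rev (S.gflow s p) ∈ S.SM := h.gflow_mem hp hs
  have hle : s ≤ S.exitTime (rev (S.gflow s p)) := by
    refine h.le_exitTime hs.1 fun σ hσ => ?_
    rw [gflow_rev, ← gflow_add, rev_mem_SM]
    exact h.gflow_mem hp ⟨by linarith [hσ.2], by linarith [hσ.1, hs.2]⟩
  have := h.exitTime_gflow hq ⟨hs.1, hle⟩
  rw [gflow_rev, ← gflow_add, neg_add_cancel, gflow_zero] at this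
  linarith

theorem IsSimple.entry_gflow {p : ℂ × ℝ} (hp : p ∈ S.SM) {s : ℝ}
    (hs : s ∈ Icc 0 (S.exitTime p)) : S.entry (S.gflow s p) = S.entry p := by
  rw [entry, h.exitTime_rev_gflow hp hs, ← gflow_add, entry]
  congr 1; ring

theorem IsSimple.rev_entry {p : ℂ × ℝ} :
    rev (S.entry p) = S.gflow (S.exitTime (rev p)) (rev p) := by
  rw [entry, gflow_rev]

theorem IsSimple.bdf_entry {p : ℂ × ℝ} (hp : p ∈ S.SM) : S.bdf (S.entry p) = 0 := by
  rw [← bdf_rev, h.rev_entry]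
  exact h.bdf_exit (p := rev p) hp

theorem IsSimple.X_bdf_entry_pos {p : ℂ × ℝ} (hp : p ∈ S.SM) (hτ : 0 < S.exitTime (rev p)) :
    0 < S.X S.bdf (S.entry p) := by
  have h1 := h.X_bdf_exit_neg (p := rev p) hp hτ
  rw [← h.rev_entry, X_bdf_rev] at h1
  linarith

theorem IsSimple.X_bdf_entry_pos_of_interior {p : ℂ × ℝ} (hp : 0 < S.bdf p) :
    0 < S.X S.bdf (S.entry p) :=
  h.X_bdf_entry_pos (p := p) hp.le (h.exitTime_pos_of_bdf_pos (p := rev p) hp)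

theorem IsSimple.entry_of_influx {p : ℂ × ℝ} (hp : S.bdf p = 0) (hp1 : 0 ≤ S.X S.bdf p) :
    S.entry p = p := by
  rw [entry, h.exitTime_eq_zero (p := rev p) hp (by rw [X_bdf_rev]; linarith), neg_zero, gflow_zero]

/-- The scattering relation runs back along the whole geodesic through p, so it reaches the entry
point; the two reversals add a rotation by 2π, which periodicity of w removes. -/
theorem IsSimple.extend_eq {w : ℂ × ℝ → ℂ} (hw : IsPeriodic w) {p : ℂ × ℝ} (hp : p ∈ S.SM) :
    S.extend w p = w (S.entry p) := by
  have hτ := h.exitTime_nonneg hp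
  have hr : rev p ∈ S.SM := hp
  have hex : S.exitPoint p = S.gflow (S.exitTime p) p := h.flow_eq hp ⟨hτ, le_rfl⟩
  have hq : S.gflow (S.exitTime p) p ∈ S.SM := h.gflow_mem hp ⟨hτ, le_rfl⟩
  have hrq : rev (S.gflow (S.exitTime p) p) ∈ S.SM := hq
  have h1 := h.exitTime_rev_gflow hp (s := S.exitTime p) ⟨hτ, le_rfl⟩
  rw [extend, scatter, hex, exitPoint, h.flow_eq hrq ⟨h.exitTime_nonneg hrq, le_rfl⟩, h1, gflow_rev,
    ← gflow_add, hw]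
  rw [entry]
  congr 2; ring

theorem IsSimple.contDiffAt_exitTime_rev {p : ℂ × ℝ} (hp : 0 < S.bdf p) :
    ContDiffAt ℝ ∞ (fun p => S.exitTime (rev p)) p :=
  ContDiffAt.comp p (g := S.exitTime) (f := rev) (h.contDiffAt_exitTime (p := rev p) hp)
    contDiff_rev.contDiffAt

theorem IsSimple.contDiffAt_entry {p : ℂ × ℝ} (hp : 0 < S.bdf p) : ContDiffAt ℝ ∞ S.entry p :=
  S.contDiff_gflow.contDiffAt.comp p ((h.contDiffAt_exitTime_rev hp).neg.prodMk contDiffAt_id)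

theorem IsSimple.continuousOn_exitTime_rev : ContinuousOn (fun p => S.exitTime (rev p)) S.SM :=
  h.continuousOn_exitTime.comp continuous_rev.continuousOn fun _ hp => hp

theorem IsSimple.continuousOn_entry : ContinuousOn S.entry S.SM :=
  S.continuous_gflow.comp_continuousOn (h.continuousOn_exitTime_rev.neg.prodMk continuousOn_id)

theorem IsSimple.X_comp_entry {w : ℂ × ℝ → ℂ} {p : ℂ × ℝ} (hp : 0 < S.bdf p)
    (hw : DifferentiableAt ℝ (fun p => w (S.entry p)) p) : S.X (fun p => w (S.entry p)) p = 0 := by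
  refine X_eq_of_eventually (S := S) (p := p) hp.le hw (hasDerivAt_const (0 : ℝ) (w (S.entry p))) ?_
  filter_upwards [h.eventually_mem_Icc hp] with s hs
  rw [h.entry_gflow hp.le hs]

end IsothermalSurface

end

/-! ### Volume of the bundle, area of boundary layers, divergence free fields -/

noncomputable section

theorem integral_fderiv_eq_zero_of_compact {E : Type*} [NormedAddCommGroup E] [NormedSpace ℝ E]
    [FiniteDimensional ℝ E] [MeasurableSpace E] [BorelSpace E] (μ : Measure E) [μ.IsAddHaarMeasure]
    {𝕜 : Type*} [RCLike 𝕜] {f : E → 𝕜} (hf : ContDiff ℝ 1 f)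
    (hc : HasCompactSupport f) (v : E) : ∫ x, fderiv ℝ f x v ∂μ = 0 := by
  have h1 : Integrable (fun x => fderiv ℝ f x v) μ :=
    ((hf.continuous_fderiv one_ne_zero).clm_apply continuous_const).integrable_of_hasCompactSupport
      (hc.fderiv_apply (𝕜 := ℝ) v)
  have h2 : Integrable f μ := hf.continuous.integrable_of_hasCompactSupport hc
  have := integral_mul_fderiv_eq_neg_fderiv_mul_of_integrable (μ := μ) (f := fun _ : E => (1 : 𝕜)) (g := f)
    (v := v) (by simp) (by simpa using h1) (by simpa using h2)
    (fun x _ => differentiableAt_const _) (fun x _ => hf.differentiable one_ne_zero x)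
  simpa using this

theorem fderiv_eq_of_hasDerivAt_line {E F : Type*} [NormedAddCommGroup E] [NormedSpace ℝ E]
    [NormedAddCommGroup F] [NormedSpace ℝ F] {f : E → F} {p v : E} {c : F}
    (hf : DifferentiableAt ℝ f p) (h : HasDerivAt (fun t : ℝ => f (p + t • v)) c 0) :
    fderiv ℝ f p v = c :=
  HasDerivAt.unique (hf.hasFDerivAt.hasLineDerivAt v) h

namespace IsothermalSurface

variable (S : IsothermalSurface)

/-- Squared Euclidean length of the gradient of the boundary defining function. -/
def gradSq (z : ℂ) : ℝ := fderiv ℝ S.rho z 1 ^ 2 + fderiv ℝ S.rho z I ^ 2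

theorem continuous_fderiv_rho (v : ℂ) : Continuous fun z => fderiv ℝ S.rho z v :=
  (S.rho_smooth.continuous_fderiv (by simp)).clm_apply continuous_const

theorem gradSq_pos {z : ℂ} (hz : S.rho z = 0) : 0 < S.gradSq z := by
  have hne := S.rho_regular z hz
  by_contra hcon
  have h1 : fderiv ℝ S.rho z 1 = 0 := by
    unfold gradSq at hcon; nlinarith [sq_nonneg (fderiv ℝ S.rho z 1), sq_nonneg (fderiv ℝ S.rho z I)]
  have h2 : fderiv ℝ S.rho z I = 0 := by
    unfold gradSq at hcon; nlinarith [sq_nonneg (fderiv ℝ S.rho z 1), sq_nonneg (fderiv ℝ S.rho z I)]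
  refine hne (ContinuousLinearMap.ext fun w => ?_)
  have : w = w.re • (1 : ℂ) + w.im • I := by
    simp [re_add_im]
  rw [this, map_add, map_smul, map_smul, h1, h2]
  simp

/-- On the compact surface max(ρ, |∇ρ|²) has a positive minimum m; with c = m / 2, wherever ρ ≤ c
the maximum must be the gradient. -/
theorem exists_gradSq_lower_bound :
    ∃ c > 0, ∀ z ∈ S.M, S.rho z ≤ c → 2 * c ≤ S.gradSq z := by
  have hc : ContinuousOn (fun z => max (S.rho z) (S.gradSq z)) S.M :=
    (S.rho_smooth.continuous.max (((S.continuous_fderiv_rho 1).pow 2).add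
      ((S.continuous_fderiv_rho I).pow 2))).continuousOn
  obtain ⟨z₀, hz₀, hmin⟩ := S.isCompact_domain.exists_isMinOn S.nonempty_domain hc
  set m := max (S.rho z₀) (S.gradSq z₀) with hm
  have hm0 : 0 < m := by
    rcases (show 0 ≤ S.rho z₀ from hz₀).lt_or_eq with h | h
    · exact lt_max_of_lt_left h
    · exact lt_max_of_lt_right (S.gradSq_pos h.symm)
  refine ⟨m / 2, by positivity, fun z hz hzm => ?_⟩
  have h1 : m ≤ max (S.rho z) (S.gradSq z) := hmin hz
  rcases le_max_iff.1 h1 with h2 | h2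
  · linarith
  · linarith

/-- In each coordinate direction, the derivative of 2 arctan(ρ/ε) η ∂ρ, with η the cutoff,
integrates to zero. One of its two terms is the integrand in question; the other is bounded by π
|∂(η ∂ρ)|, independently of ε. -/
theorem exists_layer_integral_bound : ∃ C : ℝ, ∀ ε > 0,
    ∫ z, 2 / (1 + (S.rho z / ε) ^ 2) / ε * S.gradSq z * S.cutoff z ≤ C := by
  have hη : ContDiff ℝ ∞ S.cutoff := S.cutoff.contDiff
  have hηc : HasCompactSupport S.cutoff := S.cutoff.hasCompactSupport
  have hρv : ∀ v : ℂ, ContDiff ℝ ∞ fun z => fderiv ℝ S.rho z v := fun v =>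
    (S.rho_smooth.fderiv_right (m := ∞) (by simp)).clm_apply contDiff_const
  set H : ℂ → ℂ → ℝ := fun v z => S.cutoff z * fderiv ℝ S.rho z v with hH
  have hHs : ∀ v, ContDiff ℝ ∞ (H v) := fun v => hη.mul (hρv v)
  have hHc : ∀ v, HasCompactSupport (H v) := fun v => hηc.mul_right
  have hHd : ∀ v, Continuous fun z => fderiv ℝ (H v) z v := fun v =>
    ((hHs v).continuous_fderiv (by simp)).clm_apply continuous_const
  have hHdc : ∀ v, HasCompactSupport fun z => fderiv ℝ (H v) z v := fun v =>
    (hHc v).fderiv_apply (𝕜 := ℝ) v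
  refine ⟨∑ v ∈ ({1, I} : Finset ℂ), Real.pi * ∫ z, |fderiv ℝ (H v) z v|, fun ε hε => ?_⟩
  have hψ : ContDiff ℝ ∞ fun z => 2 * Real.arctan (S.rho z / ε) :=
    contDiff_const.mul (S.rho_smooth.div_const ε).arctan
  have key : ∀ v : ℂ, ∫ z, 2 / (1 + (S.rho z / ε) ^ 2) / ε * fderiv ℝ S.rho z v ^ 2 * S.cutoff z ≤
      Real.pi * ∫ z, |fderiv ℝ (H v) z v| := by
    intro v
    have h0 := integral_fderiv_eq_zero_of_compact (volume : Measure ℂ)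
      (f := fun z => 2 * Real.arctan (S.rho z / ε) * H v z)
      ((hψ.mul (hHs v)).of_le (by simp)) ((hHc v).mul_left) v
    have hpt : ∀ z, fderiv ℝ (fun z => 2 * Real.arctan (S.rho z / ε) * H v z) z v =
        2 / (1 + (S.rho z / ε) ^ 2) / ε * fderiv ℝ S.rho z v ^ 2 * S.cutoff z +
          2 * Real.arctan (S.rho z / ε) * fderiv ℝ (H v) z v := by
      intro z
      have hr := (S.rho_smooth.differentiable (by simp) z).hasFDerivAt
      have h1 : HasFDerivAt (fun z => S.rho z / ε) ((ε⁻¹) • fderiv ℝ S.rho z) z := by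
        simpa [div_eq_mul_inv, mul_comm] using hr.const_mul ε⁻¹
      have h2 := (h1.arctan.const_mul 2).mul ((hHs v).differentiable (by simp) z).hasFDerivAt
      have h3 : fderiv ℝ (fun z => 2 * Real.arctan (S.rho z / ε) * H v z) z = _ := h2.fderiv
      rw [h3]
      simp only [add_apply, smul_apply, smul_eq_mul, hH]
      field_simp
      ring
    simp only [hpt] at h0
    have hi1 : Integrable fun z =>
        2 / (1 + (S.rho z / ε) ^ 2) / ε * fderiv ℝ S.rho z v ^ 2 * S.cutoff z := by
      refine Continuous.integrable_of_hasCompactSupport ?_ hηc.mul_left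
      have : Continuous fun z => 2 / (1 + (S.rho z / ε) ^ 2) :=
        continuous_const.div (continuous_const.add ((S.rho_smooth.continuous.div_const ε).pow 2))
          fun z => by positivity
      exact ((this.div_const ε).mul ((S.continuous_fderiv_rho v).pow 2)).mul hη.continuous
    have hi2 : Integrable fun z => 2 * Real.arctan (S.rho z / ε) * fderiv ℝ (H v) z v :=
      (hψ.continuous.mul (hHd v)).integrable_of_hasCompactSupport (hHdc v).mul_left
    rw [integral_add hi1 hi2] at h0
    have hi3 : Integrable fun z => |fderiv ℝ (H v) z v| :=
      (hHd v).abs.integrable_of_hasCompactSupport ((hHdc v).norm)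
    rw [eq_neg_of_add_eq_zero_left h0, ← integral_neg, ← integral_const_mul]
    refine integral_mono hi2.neg (hi3.const_mul _) fun z => ?_
    have ha : |2 * Real.arctan (S.rho z / ε)| ≤ Real.pi := by
      rw [abs_le]
      constructor <;> linarith [Real.neg_pi_div_two_lt_arctan (S.rho z / ε),
        Real.arctan_lt_pi_div_two (S.rho z / ε)]
    calc -(2 * Real.arctan (S.rho z / ε) * fderiv ℝ (H v) z v)
        ≤ |2 * Real.arctan (S.rho z / ε) * fderiv ℝ (H v) z v| := neg_le_abs _
      _ = |2 * Real.arctan (S.rho z / ε)| * |fderiv ℝ (H v) z v| := abs_mul _ _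
      _ ≤ Real.pi * |fderiv ℝ (H v) z v| := by gcongr
  have hne : (1 : ℂ) ≠ I := fun h => by simpa using congrArg Complex.re h
  rw [Finset.sum_pair hne]
  have hi : ∀ v, Integrable fun z =>
      2 / (1 + (S.rho z / ε) ^ 2) / ε * fderiv ℝ S.rho z v ^ 2 * S.cutoff z := by
    intro v
    refine Continuous.integrable_of_hasCompactSupport ?_ hηc.mul_left
    have : Continuous fun z => 2 / (1 + (S.rho z / ε) ^ 2) :=
      continuous_const.div (continuous_const.add ((S.rho_smooth.continuous.div_const ε).pow 2))
        fun z => by positivity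
    exact ((this.div_const ε).mul ((S.continuous_fderiv_rho v).pow 2)).mul hη.continuous
  calc _ = ∫ z, (2 / (1 + (S.rho z / ε) ^ 2) / ε * fderiv ℝ S.rho z 1 ^ 2 * S.cutoff z +
        2 / (1 + (S.rho z / ε) ^ 2) / ε * fderiv ℝ S.rho z I ^ 2 * S.cutoff z) := by
        congr 1; funext z; unfold gradSq; ring
    _ = _ := integral_add (hi 1) (hi I)
    _ ≤ _ := add_le_add (key 1) (key I)

/-- The part of the surface at height at most `ε` above the boundary. -/
def layer (ε : ℝ) : Set ℂ := {z | 0 ≤ S.rho z ∧ S.rho z ≤ ε}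

theorem isClosed_layer (ε : ℝ) : IsClosed (S.layer ε) :=
  (isClosed_le continuous_const S.rho_smooth.continuous).inter
    (isClosed_le S.rho_smooth.continuous continuous_const)

theorem volume_M_ne_top : volume S.M ≠ ⊤ := S.isCompact_domain.measure_lt_top.ne

theorem volume_layer_ne_top (ε : ℝ) : volume (S.layer ε) ≠ ⊤ :=
  measure_ne_top_of_subset (fun _ hz => hz.1) S.volume_M_ne_top

/-- Boundary layers have area at most proportional to their height. -/
theorem exists_layer_bound : ∃ C : ℝ, ∀ ε > 0, volume.real (S.layer ε) ≤ C * ε := by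
  obtain ⟨c, hc, hgrad⟩ := S.exists_gradSq_lower_bound
  obtain ⟨C, hC⟩ := S.exists_layer_integral_bound
  refine ⟨max (C / (2 * c)) (volume.real S.M / c), fun ε hε => ?_⟩
  rcases le_or_gt ε c with hεc | hεc
  · have hcut : ∀ z ∈ S.M, S.cutoff z = 1 := fun z hz =>
      S.cutoff.one_of_mem_closedBall (Metric.ball_subset_closedBall (S.M_subset_ball hz))
    have hint : Integrable fun z => 2 / (1 + (S.rho z / ε) ^ 2) / ε * S.gradSq z * S.cutoff z := by
      refine Continuous.integrable_of_hasCompactSupport ?_ S.cutoff.hasCompactSupport.mul_left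
      have : Continuous fun z => 2 / (1 + (S.rho z / ε) ^ 2) :=
        continuous_const.div (continuous_const.add ((S.rho_smooth.continuous.div_const ε).pow 2))
          fun z => by positivity
      exact ((this.div_const ε).mul (((S.continuous_fderiv_rho 1).pow 2).add
        ((S.continuous_fderiv_rho I).pow 2))).mul S.cutoff.continuous
    have h1 : ∫ z in S.layer ε, (2 * c / ε) ≤
        ∫ z in S.layer ε, 2 / (1 + (S.rho z / ε) ^ 2) / ε * S.gradSq z * S.cutoff z := by
      refine setIntegral_mono_on (integrableOn_const (S.volume_layer_ne_top ε)) hint.integrableOn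
        (S.isClosed_layer ε).measurableSet fun z hz => ?_
      rw [hcut z hz.1, mul_one]
      have hg := hgrad z hz.1 (hz.2.trans hεc)
      have hq : (S.rho z / ε) ^ 2 ≤ 1 := by
        have h0 : 0 ≤ S.rho z / ε := div_nonneg hz.1 hε.le
        have h1 : S.rho z / ε ≤ 1 := (div_le_one hε).2 hz.2
        nlinarith
      -- In the layer ρ/ε ≤ 1; the factor 2 in front of the arctangent makes the weight at least 1
      -- there.
      have h2 : 1 ≤ 2 / (1 + (S.rho z / ε) ^ 2) := by
        rw [le_div_iff₀ (by positivity)]; linarith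
      calc 2 * c / ε = 1 / ε * (2 * c) := by ring
        _ ≤ 2 / (1 + (S.rho z / ε) ^ 2) / ε * S.gradSq z := by gcongr
    have h2 : ∫ z in S.layer ε, 2 / (1 + (S.rho z / ε) ^ 2) / ε * S.gradSq z * S.cutoff z ≤ C := by
      refine (setIntegral_le_integral hint (Filter.Eventually.of_forall fun z => ?_)).trans (hC ε hε)
      have : 0 ≤ S.gradSq z := by unfold gradSq; positivity
      have := S.cutoff.nonneg (x := z)
      simp only [Pi.zero_apply]
      positivity
    rw [setIntegral_const, smul_eq_mul] at h1
    have h3 : volume.real (S.layer ε) * (2 * c / ε) ≤ C := h1.trans h2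
    have h4 : volume.real (S.layer ε) ≤ C / (2 * c) * ε := by
      rw [div_mul_eq_mul_div, le_div_iff₀ (by positivity)]
      rw [mul_div_assoc', div_le_iff₀ hε] at h3
      linarith
    exact h4.trans (by gcongr; exact le_max_left _ _)
  · have h1 : volume.real (S.layer ε) ≤ volume.real S.M :=
      measureReal_mono (fun _ hz => hz.1) S.volume_M_ne_top
    have h2 : volume.real S.M ≤ volume.real S.M / c * ε := by
      rw [div_mul_eq_mul_div, le_div_iff₀ hc]
      gcongr
    exact h1.trans (h2.trans (by gcongr; exact le_max_right _ _))

/-- The boundary lies in every layer, so its area is at most C ε for all ε > 0. -/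
theorem volume_boundary : volume {z | S.rho z = 0} = 0 := by
  obtain ⟨C, hC⟩ := S.exists_layer_bound
  have h1 : ∀ ε > 0, volume.real {z | S.rho z = 0} ≤ C * ε := fun ε hε =>
    (measureReal_mono (show {z | S.rho z = 0} ⊆ S.layer ε from
      fun z (hz : S.rho z = 0) => ⟨hz.ge, hz.le.trans hε.le⟩)
      (S.volume_layer_ne_top ε)).trans (hC ε hε)
  have h2 : volume.real {z | S.rho z = 0} ≤ 0 := by
    refine le_of_forall_pos_le_add fun δ hδ => ?_
    have := h1 (δ / (|C| + 1)) (by positivity)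
    refine this.trans ?_
    rw [zero_add, mul_div_assoc', div_le_iff₀ (by positivity)]
    nlinarith [le_abs_self C]
  have h3 : volume {z | S.rho z = 0} ≠ ⊤ :=
    measure_ne_top_of_subset (fun z (hz : S.rho z = 0) => hz.ge) S.volume_M_ne_top
  exact (measureReal_eq_zero_iff h3).1 (le_antisymm h2 measureReal_nonneg)

/-- The conformal density on the unit circle bundle. -/
def dens (p : ℂ × ℝ) : ℝ := Real.exp (2 * S.lam p.1)

theorem continuous_dens : Continuous S.dens :=
  Real.continuous_exp.comp (continuous_const.mul (S.lam_smooth.continuous.comp continuous_fst))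

theorem dens_pos (p : ℂ × ℝ) : 0 < S.dens p := Real.exp_pos _

/-- A fundamental domain of the unit circle bundle. -/
def box : Set (ℂ × ℝ) := S.M ×ˢ Ioc 0 (2 * Real.pi)

theorem measurableSet_box : MeasurableSet S.box := S.isClosed_M.measurableSet.prod measurableSet_Ioc

theorem volSM_eq : S.volSM = (volume.restrict S.box).withDensity fun p => ENNReal.ofReal (S.dens p) :=
  rfl

theorem integral_volSM {E : Type*} [NormedAddCommGroup E] [NormedSpace ℝ E] (A : ℂ × ℝ → E) :
    ∫ p, A p ∂S.volSM = ∫ p in S.box, S.dens p • A p := by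
  rw [volSM_eq, integral_withDensity_eq_integral_toReal_smul
    S.continuous_dens.measurable.ennreal_ofReal (by simp)]
  simp only [ENNReal.toReal_ofReal (S.dens_pos _).le]

theorem integrable_volSM_iff {E : Type*} [NormedAddCommGroup E] [NormedSpace ℝ E] (A : ℂ × ℝ → E) :
    Integrable A S.volSM ↔ IntegrableOn (fun p => S.dens p • A p) S.box := by
  rw [volSM_eq, integrable_withDensity_iff_integrable_smul'
    S.continuous_dens.measurable.ennreal_ofReal (by simp)]
  simp only [ENNReal.toReal_ofReal (S.dens_pos _).le]
  rfl

theorem volSM_ac : S.volSM ≪ volume.restrict S.box := withDensity_absolutelyContinuous _ _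

theorem exists_dens_bound : ∃ C : ℝ, 0 < C ∧ ∀ p ∈ S.box, S.dens p ≤ C := by
  have hK : IsCompact (S.M ×ˢ Icc 0 (2 * Real.pi)) := S.isCompact_domain.prod isCompact_Icc
  obtain ⟨C, hC⟩ := hK.exists_bound_of_continuousOn S.continuous_dens.continuousOn
  refine ⟨max C 1, by positivity, fun p hp => ?_⟩
  exact (le_abs_self _).trans ((hC p ⟨hp.1, Ioc_subset_Icc_self hp.2⟩).trans (le_max_left _ _))

theorem volume_box_ne_top : volume S.box ≠ ⊤ := by
  have hK : IsCompact (S.M ×ˢ Icc 0 (2 * Real.pi)) := S.isCompact_domain.prod isCompact_Icc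
  exact measure_ne_top_of_subset (prod_mono_right Ioc_subset_Icc_self) hK.measure_lt_top.ne

instance : IsFiniteMeasure S.volSM := by
  have h : Integrable (fun _ => (1 : ℝ)) S.volSM := by
    rw [integrable_volSM_iff]
    obtain ⟨C, _, hC⟩ := S.exists_dens_bound
    refine Measure.integrableOn_of_bounded (M := C) S.volume_box_ne_top
      (by simpa using S.continuous_dens.aestronglyMeasurable) ?_
    filter_upwards [ae_restrict_mem S.measurableSet_box] with p hp
    simpa [abs_of_pos (S.dens_pos p)] using hC p hp
  exact (integrable_const_iff_isFiniteMeasure (one_ne_zero)).1 h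

theorem ae_bdf_pos : ∀ᵐ p ∂S.volSM, 0 < S.bdf p := by
  refine S.volSM_ac.ae_le ?_
  have h0 : (volume : Measure (ℂ × ℝ)) (Prod.fst ⁻¹' {z | S.rho z = 0}) = 0 := by
    rw [show (Prod.fst ⁻¹' {z | S.rho z = 0} : Set (ℂ × ℝ)) = {z | S.rho z = 0} ×ˢ univ by
      ext; simp, Measure.volume_eq_prod, Measure.prod_prod, S.volume_boundary, zero_mul]
  have h1 : ∀ᵐ p ∂(volume.restrict S.box), p ∉ Prod.fst ⁻¹' {z | S.rho z = 0} :=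
    ae_restrict_of_ae (measure_eq_zero_iff_ae_notMem.1 h0)
  filter_upwards [h1, ae_restrict_mem S.measurableSet_box] with p hp hpb
  exact lt_of_le_of_ne hpb.1 fun he => hp he.symm

/-- A function continuous in the interior is measurable for the volume of the bundle. -/
theorem aestronglyMeasurable_of_continuousOn {E : Type*} [NormedAddCommGroup E]
    {A : ℂ × ℝ → E} (hA : ContinuousOn A {p | 0 < S.bdf p}) : AEStronglyMeasurable A S.volSM := by
  have hm : MeasurableSet {p | 0 < S.bdf p} := S.isOpen_interior_bdf.measurableSet
  have h1 : AEStronglyMeasurable A (S.volSM.restrict {p | 0 < S.bdf p}) := by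
    have : SecondCountableTopology (ℂ × ℝ) := inferInstance
    exact hA.aestronglyMeasurable hm
  have h2 : S.volSM.restrict {p | 0 < S.bdf p} = S.volSM :=
    Measure.restrict_eq_self_of_ae_mem S.ae_bdf_pos
  rwa [h2] at h1

theorem integrable_of_continuousOn_of_bounded {E : Type*} [NormedAddCommGroup E]
    {A : ℂ × ℝ → E} (hA : ContinuousOn A {p | 0 < S.bdf p}) {C : ℝ}
    (hC : ∀ p, 0 < S.bdf p → ‖A p‖ ≤ C) : Integrable A S.volSM := by
  refine Integrable.of_bound (S.aestronglyMeasurable_of_continuousOn hA) C ?_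
  filter_upwards [S.ae_bdf_pos] with p hp using hC p hp

/-- Integration over the bundle is iterated integration over the surface and the fibres. -/
theorem integral_volSM_iterated {E : Type*} [NormedAddCommGroup E] [NormedSpace ℝ E]
    {A : ℂ × ℝ → E} (hA : Integrable A S.volSM) :
    ∫ p, A p ∂S.volSM =
      ∫ z in S.M, Real.exp (2 * S.lam z) • ∫ θ in (0 : ℝ)..2 * Real.pi, A (z, θ) := by
  rw [integral_volSM, box, Measure.volume_eq_prod, setIntegral_prod]
  · refine integral_congr_ae (Filter.Eventually.of_forall fun z => ?_)
    simp only [dens, intervalIntegral.integral_of_le Real.two_pi_pos.le, integral_smul]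
  · rw [← Measure.volume_eq_prod]
    exact (S.integrable_volSM_iff A).1 hA

theorem integral_volSM_shift {E : Type*} [NormedAddCommGroup E] [NormedSpace ℝ E]
    {A : ℂ × ℝ → E} (hp : IsPeriodic A) (c : ℝ) (hA : Integrable A S.volSM)
    (hA' : Integrable (fun p => A (p.1, p.2 + c)) S.volSM) :
    ∫ p, A (p.1, p.2 + c) ∂S.volSM = ∫ p, A p ∂S.volSM := by
  rw [S.integral_volSM_iterated hA, S.integral_volSM_iterated hA']
  congr 1; funext z; congr 1
  rw [intervalIntegral.integral_comp_add_right (fun θ => A (z, θ)), zero_add, add_comm]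
  have := (hp.periodic z).intervalIntegral_add_eq c 0
  simpa using this

theorem integral_fderiv_base_eq_zero {G : ℂ × ℝ → ℂ} (hG : ContDiff ℝ 1 G) {K : Set ℂ}
    (hK : IsCompact K) (h0 : ∀ p, p.1 ∉ K → G p = 0) (hKM : K ⊆ S.M) (v : ℂ) :
    ∫ p in S.box, fderiv ℝ G p (v, 0) = 0 := by
  have hcont : Continuous fun p => fderiv ℝ G p (v, 0) :=
    (hG.continuous_fderiv one_ne_zero).clm_apply continuous_const
  have hzero : ∀ p : ℂ × ℝ, p.1 ∉ K → fderiv ℝ G p (v, 0) = 0 := by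
    intro p hp
    have : G =ᶠ[nhds p] fun _ => 0 := by
      filter_upwards [(hK.isClosed.isOpen_compl.preimage continuous_fst).mem_nhds
        (show p ∈ Prod.fst ⁻¹' Kᶜ from hp)] with q hq using h0 q hq
    rw [this.fderiv_eq]; simp
  have hint : IntegrableOn (fun p => fderiv ℝ G p (v, 0)) S.box :=
    (hcont.continuousOn.integrableOn_compact (S.isCompact_domain.prod isCompact_Icc)).mono_set
      (prod_mono_right Ioc_subset_Icc_self)
  rw [IntegrableOn, box, Measure.volume_eq_prod, ← Measure.prod_restrict] at hint
  rw [box, Measure.volume_eq_prod, ← Measure.prod_restrict, integral_prod_symm _ hint]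
  refine integral_eq_zero_of_ae (Filter.Eventually.of_forall fun θ => ?_)
  have hsub : ∀ z, z ∉ S.M → fderiv ℝ G (z, θ) (v, 0) = 0 := fun z hz =>
    hzero (z, θ) fun h => hz (hKM h)
  simp only [Pi.zero_apply]
  rw [setIntegral_eq_integral_of_forall_compl_eq_zero hsub]
  have hs : ContDiff ℝ 1 fun z : ℂ => G (z, θ) := hG.comp (contDiff_id.prodMk contDiff_const)
  have hcs : HasCompactSupport fun z : ℂ => G (z, θ) :=
    HasCompactSupport.intro hK fun z hz => h0 (z, θ) hz
  rw [← integral_fderiv_eq_zero_of_compact (volume : Measure ℂ) hs hcs v]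
  congr 1; funext z
  have h1 : HasFDerivAt (fun z : ℂ => G (z, θ)) _ z :=
    HasFDerivAt.comp z (hG.differentiable one_ne_zero (z, θ)).hasFDerivAt
      ((hasFDerivAt_id z).prodMk (hasFDerivAt_const θ z))
  rw [h1.fderiv]; simp

theorem integral_fderiv_fibre_eq_zero {G : ℂ × ℝ → ℂ} (hG : ContDiff ℝ 1 G) (hp : IsPeriodic G) :
    ∫ p in S.box, fderiv ℝ G p (0, 1) = 0 := by
  have hcont : Continuous fun p => fderiv ℝ G p (0, 1) :=
    (hG.continuous_fderiv one_ne_zero).clm_apply continuous_const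
  have hint : IntegrableOn (fun p => fderiv ℝ G p (0, 1)) S.box :=
    (hcont.continuousOn.integrableOn_compact (S.isCompact_domain.prod isCompact_Icc)).mono_set
      (prod_mono_right Ioc_subset_Icc_self)
  rw [IntegrableOn, box, Measure.volume_eq_prod, ← Measure.prod_restrict] at hint
  rw [box, Measure.volume_eq_prod, ← Measure.prod_restrict, integral_prod _ hint]
  refine integral_eq_zero_of_ae (Filter.Eventually.of_forall fun z => ?_)
  simp only [Pi.zero_apply]
  rw [← intervalIntegral.integral_of_le Real.two_pi_pos.le]
  have hd : ∀ θ : ℝ, HasDerivAt (fun θ : ℝ => G (z, θ)) (fderiv ℝ G (z, θ) (0, 1)) θ := fun θ =>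
    (hG.differentiable one_ne_zero (z, θ)).hasFDerivAt.comp_hasDerivAt θ
      ((hasDerivAt_const θ z).prodMk (hasDerivAt_id θ))
  rw [intervalIntegral.integral_eq_sub_of_hasDerivAt (fun θ _ => hd θ)
    ((hcont.comp (by fun_prop : Continuous fun θ : ℝ => (z, θ))).intervalIntegrable _ _)]
  have := hp.periodic z 0
  simp only [zero_add] at this
  rw [this, sub_self]

theorem fderiv_lam_expansion (z w : ℂ) :
    fderiv ℝ S.lam z w = w.re * fderiv ℝ S.lam z 1 + w.im * fderiv ℝ S.lam z I := by
  have : w = w.re • (1 : ℂ) + w.im • I := by simp [re_add_im]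
  conv_lhs => rw [this]
  rw [map_add, map_smul, map_smul, smul_eq_mul, smul_eq_mul]

/-- Divergence form of e^{2λ} X. Its coefficients e^λ cos θ, e^λ sin θ and e^λ (-sin θ λ_x + cos θ
λ_y), each differentiated in its own direction, sum to zero, so they may be moved inside the
derivatives. -/
theorem dens_smul_X_eq {A : ℂ × ℝ → ℂ} (hA : ContDiff ℝ 1 A) (p : ℂ × ℝ) :
    S.dens p • S.X A p =
      fderiv ℝ (fun p => (Real.exp (S.lam p.1) * Real.cos p.2) • A p) p (1, 0) +
      fderiv ℝ (fun p => (Real.exp (S.lam p.1) * Real.sin p.2) • A p) p (I, 0) +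
      fderiv ℝ (fun p => (Real.exp (S.lam p.1) *
        (-Real.sin p.2 * fderiv ℝ S.lam p.1 1 + Real.cos p.2 * fderiv ℝ S.lam p.1 I)) • A p)
        p (0, 1) := by
  obtain ⟨z, θ⟩ := p
  have hl := (S.lam_smooth.differentiable (by simp) z).hasFDerivAt
  have hlf : HasFDerivAt (fun p : ℂ × ℝ => S.lam p.1)
      ((fderiv ℝ S.lam z).comp (ContinuousLinearMap.fst ℝ ℂ ℝ)) (z, θ) :=
    HasFDerivAt.comp (z, θ) hl hasFDerivAt_fst
  have hsn : HasFDerivAt (fun p : ℂ × ℝ => p.2) (ContinuousLinearMap.snd ℝ ℂ ℝ) (z, θ) :=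
    hasFDerivAt_snd
  have hll : ∀ v : ℂ, DifferentiableAt ℝ (fun p : ℂ × ℝ => fderiv ℝ S.lam p.1 v) (z, θ) := fun v =>
    (((S.lam_smooth.fderiv_right (m := ∞) (by simp)).clm_apply
      (contDiff_const (c := v))).comp contDiff_fst).differentiable (by simp) _
  have hll0 : ∀ v : ℂ, fderiv ℝ (fun p : ℂ × ℝ => fderiv ℝ S.lam p.1 v) (z, θ) (0, 1) = 0 := by
    intro v
    refine fderiv_eq_of_hasDerivAt_line (hll v) ?_
    simpa using hasDerivAt_const (0 : ℝ) (fderiv ℝ S.lam z v)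
  have hAd := (hA.differentiable one_ne_zero (z, θ)).hasFDerivAt
  have e1 := (hlf.exp.mul hsn.cos).smul hAd
  have e2 := (hlf.exp.mul hsn.sin).smul hAd
  have e3 := (hlf.exp.mul ((hsn.sin.neg.mul (hll 1).hasFDerivAt).add
    (hsn.cos.mul (hll I).hasFDerivAt))).smul hAd
  have e1' : fderiv ℝ (fun p : ℂ × ℝ => (Real.exp (S.lam p.1) * Real.cos p.2) • A p) (z, θ) = _ :=
    e1.fderiv
  have e2' : fderiv ℝ (fun p : ℂ × ℝ => (Real.exp (S.lam p.1) * Real.sin p.2) • A p) (z, θ) = _ :=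
    e2.fderiv
  have e3' : fderiv ℝ (fun p : ℂ × ℝ => (Real.exp (S.lam p.1) *
        (-Real.sin p.2 * fderiv ℝ S.lam p.1 1 + Real.cos p.2 * fderiv ℝ S.lam p.1 I)) • A p)
        (z, θ) = _ := e3.fderiv
  rw [e1', e2', e3']
  have hY : S.dens (z, θ) • S.geodField (z, θ) = (Real.exp (S.lam z) * Real.cos θ) • ((1, 0) : ℂ × ℝ) +
      (Real.exp (S.lam z) * Real.sin θ) • ((I, 0) : ℂ × ℝ) +
      (Real.exp (S.lam z) * (-Real.sin θ * fderiv ℝ S.lam z 1 + Real.cos θ * fderiv ℝ S.lam z I)) •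
        ((0, 1) : ℂ × ℝ) := by
    have hexp : Real.exp (2 * S.lam z) * Real.exp (-S.lam z) = Real.exp (S.lam z) := by
      rw [← Real.exp_add]; congr 1; ring
    have hcs : exp (θ * I) = (Real.cos θ : ℂ) + (Real.sin θ : ℂ) * I := by
      rw [exp_mul_I]; push_cast; rfl
    have h2 : fderiv ℝ S.lam z (I * exp (θ * I)) =
        -Real.sin θ * fderiv ℝ S.lam z 1 + Real.cos θ * fderiv ℝ S.lam z I := by
      rw [S.fderiv_lam_expansion, hcs]
      simp [mul_add, ← mul_assoc, mul_comm I, -ofReal_cos, -ofReal_sin]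
    refine Prod.ext ?_ ?_
    · simp only [dens, geodField, Prod.smul_mk, Prod.mk_add_mk, smul_smul, hexp, smul_zero, add_zero,
        hcs]
      simp only [real_smul, ofReal_mul]; ring
    · simp only [dens, geodField, Prod.smul_mk, Prod.mk_add_mk, smul_eq_mul, ← mul_assoc, hexp,
        smul_zero, h2]
      ring
  have hXA : S.dens (z, θ) • S.X A (z, θ) = fderiv ℝ A (z, θ) (S.dens (z, θ) • S.geodField (z, θ)) := by
    rw [map_smul]; rfl
  rw [hXA, hY, map_add, map_add, map_smul, map_smul, map_smul]
  simp only [add_apply, smul_apply, Pi.mul_apply, Pi.add_apply, Pi.neg_apply,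
    ContinuousLinearMap.smulRight_apply, ContinuousLinearMap.comp_apply,
    ContinuousLinearMap.coe_fst', ContinuousLinearMap.coe_snd', neg_apply,
    hll0, map_zero, smul_zero, smul_eq_mul, mul_zero, mul_one, zero_add, add_zero]
  simp only [real_smul, ofReal_mul, ofReal_add, ofReal_neg, ofReal_zero]
  ring

/-- The geodesic vector field is divergence free. -/
theorem integral_X_eq_zero {A : ℂ × ℝ → ℂ} (hA : ContDiff ℝ 1 A) (hp : IsPeriodic A) {K : Set ℂ}
    (hK : IsCompact K) (h0 : ∀ p, p.1 ∉ K → A p = 0) (hKM : K ⊆ S.M) :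
    ∫ p, S.X A p ∂S.volSM = 0 := by
  have hl : ContDiff ℝ 1 fun p : ℂ × ℝ => S.lam p.1 := (S.lam_smooth.of_le (by simp)).comp contDiff_fst
  have hlv : ∀ v, ContDiff ℝ 1 fun p : ℂ × ℝ => fderiv ℝ S.lam p.1 v := fun v =>
    (((S.lam_smooth.fderiv_right (m := ∞) (by simp)).of_le (by simp)).comp
      contDiff_fst).clm_apply contDiff_const
  have h1 : ContDiff ℝ 1 fun p : ℂ × ℝ => (Real.exp (S.lam p.1) * Real.cos p.2) • A p :=
    (hl.exp.mul contDiff_snd.cos).smul hA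
  have h2 : ContDiff ℝ 1 fun p : ℂ × ℝ => (Real.exp (S.lam p.1) * Real.sin p.2) • A p :=
    (hl.exp.mul contDiff_snd.sin).smul hA
  have h3 : ContDiff ℝ 1 fun p : ℂ × ℝ => (Real.exp (S.lam p.1) *
        (-Real.sin p.2 * fderiv ℝ S.lam p.1 1 + Real.cos p.2 * fderiv ℝ S.lam p.1 I)) • A p :=
    (hl.exp.mul ((contDiff_snd.sin.neg.mul (hlv 1)).add (contDiff_snd.cos.mul (hlv I)))).smul hA
  have hper : IsPeriodic fun p : ℂ × ℝ => (Real.exp (S.lam p.1) *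
        (-Real.sin p.2 * fderiv ℝ S.lam p.1 1 + Real.cos p.2 * fderiv ℝ S.lam p.1 I)) • A p := by
    rw [isPeriodic_iff] at hp ⊢
    intro z θ
    simp only [Real.sin_add_two_pi, Real.cos_add_two_pi, hp]
  have hint : ∀ {G : ℂ × ℝ → ℂ} (_ : ContDiff ℝ 1 G) (e : ℂ × ℝ),
      IntegrableOn (fun p => fderiv ℝ G p e) S.box := fun hG e =>
    (((hG.continuous_fderiv one_ne_zero).clm_apply continuous_const).continuousOn.integrableOn_compact
      (S.isCompact_domain.prod isCompact_Icc)).mono_set (prod_mono_right Ioc_subset_Icc_self)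
  rw [integral_volSM]
  simp only [S.dens_smul_X_eq hA]
  rw [integral_add, integral_add, S.integral_fderiv_base_eq_zero h1 hK _ hKM,
    S.integral_fderiv_base_eq_zero h2 hK _ hKM, S.integral_fderiv_fibre_eq_zero h3 hper]
  · simp
  · intro p hp; simp [h0 p hp]
  · intro p hp; simp [h0 p hp]
  · exact hint h1 _
  · exact hint h2 _
  · exact (hint h1 _).add (hint h2 _)
  · exact hint h3 _

theorem perpField_eq_geodField (p : ℂ × ℝ) :
    S.perpField p = S.geodField (p.1, p.2 + -(Real.pi / 2)) := by
  have he : exp (((p.2 + -(Real.pi / 2) : ℝ) : ℂ) * I) = -(I * exp (p.2 * I)) := by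
    push_cast
    rw [add_mul, Complex.exp_add, neg_mul, Complex.exp_neg, exp_pi_div_two_mul_I, inv_I]
    ring
  have h2 : I * -(I * exp (p.2 * I)) = exp (p.2 * I) := by
    rw [mul_neg, ← mul_assoc, I_mul_I]; ring
  simp only [geodField, perpField, he, h2, smul_neg]

/-- X_⊥ is X conjugated by the rotation of the fibres through π/2. As this rotation preserves the
volume, the divergence theorem for X carries over to X_⊥. -/
theorem Xperp_eq_X {E : Type*} [NormedAddCommGroup E] [NormedSpace ℝ E] (u : ℂ × ℝ → E)
    (p : ℂ × ℝ) :
    S.Xperp u p = S.X (fun q => u (q.1, q.2 + Real.pi / 2)) (p.1, p.2 + -(Real.pi / 2)) := by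
  have h1 : (fun q : ℂ × ℝ => u (q.1, q.2 + Real.pi / 2)) = fun q => u (q + (0, Real.pi / 2)) := by
    funext q; congr 1; simp [Prod.ext_iff]
  rw [X, h1, fderiv_comp_add_right, Xperp, perpField_eq_geodField]
  congr 2
  simp [Prod.ext_iff]

theorem isPeriodic_shift {E : Type*} {u : ℂ × ℝ → E} (hu : IsPeriodic u) (c : ℝ) :
    IsPeriodic fun q : ℂ × ℝ => u (q.1, q.2 + c) := by
  rw [isPeriodic_iff] at hu ⊢
  intro z θ
  simp only
  rw [← hu z (θ + c)]
  congr 2; ring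

theorem integrable_of_continuous {E : Type*} [NormedAddCommGroup E] {A : ℂ × ℝ → E}
    (hA : Continuous A) (hp : IsPeriodic A) : Integrable A S.volSM := by
  obtain ⟨C, _, hC⟩ := hp.exists_bound (S := S) hA.continuousOn
  exact S.integrable_of_continuousOn_of_bounded hA.continuousOn fun p hp => hC p hp.le

/-- The transverse vector field is divergence free. -/
theorem integral_Xperp_eq_zero {A : ℂ × ℝ → ℂ} (hA : ContDiff ℝ 1 A) (hp : IsPeriodic A) {K : Set ℂ}
    (hK : IsCompact K) (h0 : ∀ p, p.1 ∉ K → A p = 0) (hKM : K ⊆ S.M) :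
    ∫ p, S.Xperp A p ∂S.volSM = 0 := by
  have hA' : ContDiff ℝ 1 fun q : ℂ × ℝ => A (q.1, q.2 + Real.pi / 2) :=
    hA.comp (contDiff_fst.prodMk (contDiff_snd.add contDiff_const))
  have hp' := isPeriodic_shift hp (Real.pi / 2)
  have hXc : Continuous (S.X fun q : ℂ × ℝ => A (q.1, q.2 + Real.pi / 2)) :=
    (hA'.continuous_fderiv one_ne_zero).clm_apply S.contDiff_geodField.continuous
  have hXp : IsPeriodic (S.X fun q : ℂ × ℝ => A (q.1, q.2 + Real.pi / 2)) := hp'.X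
  have h1 := S.integral_volSM_shift hXp (-(Real.pi / 2)) (S.integrable_of_continuous hXc hXp)
    (S.integrable_of_continuous (hXc.comp (by fun_prop :
      Continuous fun p : ℂ × ℝ => (p.1, p.2 + -(Real.pi / 2)))) (isPeriodic_shift hXp _))
  simp only [S.Xperp_eq_X]
  rw [h1]
  exact S.integral_X_eq_zero hA' hp' hK (fun p hpK => h0 _ hpK) hKM

end IsothermalSurface

end

/-! ### Green's formula under weak control of the flux -/

noncomputable section

theorem exists_deriv_smoothTransition_bound :
    ∃ C : ℝ, 0 ≤ C ∧ (∀ x, |deriv Real.smoothTransition x| ≤ C) ∧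
      ∀ x, (x ≤ 0 ∨ 1 < x) → deriv Real.smoothTransition x = 0 := by
  have hc : Continuous (deriv Real.smoothTransition) :=
    (Real.smoothTransition.contDiff (n := 1)).continuous_deriv (by simp)
  have h0 : ∀ x, (x < 0 ∨ 1 < x) → deriv Real.smoothTransition x = 0 := by
    intro x hx
    rcases hx with hx | hx
    · have : Real.smoothTransition =ᶠ[nhds x] fun _ => 0 := by
        filter_upwards [Iio_mem_nhds hx] with y hy using Real.smoothTransition.zero_of_nonpos hy.le
      rw [this.deriv_eq]; simp
    · have : Real.smoothTransition =ᶠ[nhds x] fun _ => 1 := by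
        filter_upwards [Ioi_mem_nhds hx] with y hy using Real.smoothTransition.one_of_one_le hy.le
      rw [this.deriv_eq]; simp
  -- At the transition point 0 the value is obtained as the limit from the left of the vanishing
  -- derivative.
  have h0' : deriv Real.smoothTransition 0 = 0 := by
    have h1 : Filter.Tendsto (deriv Real.smoothTransition) (nhdsWithin 0 (Iio 0)) (nhds 0) := by
      refine tendsto_const_nhds.congr' ?_
      filter_upwards [self_mem_nhdsWithin] with y hy using (h0 y (Or.inl hy)).symm
    exact tendsto_nhds_unique (hc.continuousAt.tendsto.mono_left nhdsWithin_le_nhds) h1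
  obtain ⟨C, hC⟩ := (isCompact_Icc (a := (0 : ℝ)) (b := 1)).exists_bound_of_continuousOn
    hc.continuousOn
  refine ⟨max C 0, le_max_right _ _, fun x => ?_, fun x hx => ?_⟩
  · by_cases hx : x ∈ Icc (0 : ℝ) 1
    · exact (hC x hx).trans (le_max_left _ _)
    · rw [h0 x (by by_contra! h; exact hx ⟨h.1, h.2⟩)]; simp
  · rcases hx with hx | hx
    · rcases hx.lt_or_eq with h | rfl
      · exact h0 x (Or.inl h)
      · exact h0'
    · exact h0 x (Or.inr hx)

namespace IsothermalSurface

variable (S : IsothermalSurface)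

/-- Cut-off functions exhausting the interior of the surface. -/
def exhaust (n : ℕ) (p : ℂ × ℝ) : ℝ := Real.smoothTransition ((n + 1) * S.bdf p - 1)

theorem contDiff_exhaust (n : ℕ) : ContDiff ℝ ∞ (S.exhaust n) :=
  (Real.smoothTransition.contDiff (n := ⊤)).comp
    ((contDiff_const.mul S.contDiff_bdf).sub contDiff_const)

theorem exhaust_eq_zero {n : ℕ} {p : ℂ × ℝ} (hp : (n + 1) * S.bdf p ≤ 1) : S.exhaust n p = 0 :=
  Real.smoothTransition.zero_of_nonpos (by linarith)

theorem fderiv_exhaust (n : ℕ) (p v : ℂ × ℝ) : fderiv ℝ (S.exhaust n) p v =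
    deriv Real.smoothTransition ((n + 1) * S.bdf p - 1) * ((n + 1) * fderiv ℝ S.bdf p v) := by
  have h1 : HasFDerivAt (fun p => ((n : ℝ) + 1) * S.bdf p - 1) (((n : ℝ) + 1) • fderiv ℝ S.bdf p) p :=
    ((S.contDiff_bdf.differentiable (by simp) p).hasFDerivAt.const_mul _).sub_const 1
  have h2 : HasDerivAt Real.smoothTransition _ ((n + 1) * S.bdf p - 1) :=
    ((Real.smoothTransition.contDiff (n := 1)).differentiable (by simp) _).hasDerivAt
  have h3 : HasFDerivAt (S.exhaust n) _ p := h2.comp_hasFDerivAt p h1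
  rw [h3.fderiv]
  simp

theorem norm_exhaust_le (n : ℕ) (p : ℂ × ℝ) : ‖S.exhaust n p‖ ≤ 1 := by
  rw [exhaust, Real.norm_of_nonneg (Real.smoothTransition.nonneg _)]
  exact Real.smoothTransition.le_one _

theorem eventually_mul_bdf_lt (n : ℕ) {p : ℂ × ℝ} (hp : ¬ 0 < S.bdf p) :
    ∀ᶠ q in nhds p, ((n : ℝ) + 1) * S.bdf q < 1 :=
  (continuous_const.mul S.continuous_bdf).continuousAt.eventually_lt continuousAt_const
    (lt_of_le_of_lt (mul_nonpos_of_nonneg_of_nonpos (by positivity : (0 : ℝ) ≤ n + 1) (not_lt.1 hp))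
      one_pos)

/-- The cut-off vanishes in a neighbourhood of each point with ρ ≤ 0, so the product is regular
there whatever A does. -/
theorem contDiff_exhaust_smul {A : ℂ × ℝ → ℂ} (hA : ∀ p, 0 < S.bdf p → ContDiffAt ℝ 1 A p) (n : ℕ) :
    ContDiff ℝ 1 fun p => S.exhaust n p • A p := by
  rw [contDiff_iff_contDiffAt]
  intro p
  by_cases hp : 0 < S.bdf p
  · exact ((S.contDiff_exhaust n).contDiffAt.of_le (by simp)).smul (hA p hp)
  · have : (fun p => S.exhaust n p • A p) =ᶠ[nhds p] fun _ => 0 := by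
      have h1 : ∀ᶠ q in nhds p, ((n : ℝ) + 1) * S.bdf q < 1 :=
        S.eventually_mul_bdf_lt n hp
      filter_upwards [h1] with q hq
      rw [S.exhaust_eq_zero hq.le, zero_smul]
    exact contDiffAt_const.congr_of_eventuallyEq this

theorem fderiv_exhaust_smul {A : ℂ × ℝ → ℂ} (hA : ∀ p, 0 < S.bdf p → ContDiffAt ℝ 1 A p) (n : ℕ)
    {p : ℂ × ℝ} (hp : 0 < S.bdf p) (v : ℂ × ℝ) :
    fderiv ℝ (fun p => S.exhaust n p • A p) p v =
      S.exhaust n p • fderiv ℝ A p v + fderiv ℝ (S.exhaust n) p v • A p := by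
  have h1 := ((S.contDiff_exhaust n).differentiable (by simp) p).hasFDerivAt.smul
    ((hA p hp).differentiableAt one_ne_zero).hasFDerivAt
  have h2 : fderiv ℝ (fun p => S.exhaust n p • A p) p = _ := h1.fderiv
  rw [h2]
  simp

theorem isPeriodic_bdf : IsPeriodic S.bdf := fun _ => rfl

theorem isPeriodic_exhaust (n : ℕ) : IsPeriodic (S.exhaust n) := fun _ => rfl

/-- The normal flux density of the field `A₁ X + A₂ X_⊥`. -/
def flux (A₁ A₂ : ℂ × ℝ → ℂ) (p : ℂ × ℝ) : ℂ := S.X S.bdf p • A₁ p + S.Xperp S.bdf p • A₂ p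

theorem contDiff_X_bdf : ContDiff ℝ ∞ (S.X S.bdf) := S.contDiff_X S.contDiff_bdf

theorem contDiff_Xperp_bdf : ContDiff ℝ ∞ (S.Xperp S.bdf) := S.contDiff_Xperp S.contDiff_bdf

/-- The inner integral of the norm of the flux is uniformly small close to the boundary. -/
theorem exists_uniform_of_tendsto {Q : ℂ → ℝ}
    (hlim : ∀ x, S.rho x = 0 → Filter.Tendsto Q (nhdsWithin x {z | 0 < S.rho z}) (nhds 0))
    {ε : ℝ} (hε : 0 < ε) : ∃ δ > 0, ∀ z, 0 < S.rho z → S.rho z < δ → Q z ≤ ε := by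
  -- Otherwise points violating the bound with ρ tending to 0 accumulate at a point of the boundary,
  -- against the limit assumed there.
  by_contra! hcon
  choose z hz0 hz1 hz2 using fun n : ℕ => hcon (1 / (n + 1)) (by positivity)
  obtain ⟨x, hx, φ, hφ, hlimx⟩ := S.isCompact_domain.tendsto_subseq (fun n => (hz0 n).le)
  have h1 : Filter.Tendsto (fun n => S.rho (z (φ n))) Filter.atTop (nhds 0) := by
    refine squeeze_zero (fun n => (hz0 _).le) (fun n => (hz1 _).le) ?_
    exact tendsto_one_div_add_atTop_nhds_zero_nat.comp hφ.tendsto_atTop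
  have h2 : S.rho x = 0 :=
    tendsto_nhds_unique ((S.rho_smooth.continuous.tendsto x).comp hlimx) h1
  have h3 : Filter.Tendsto (fun n => z (φ n)) Filter.atTop (nhdsWithin x {z | 0 < S.rho z}) :=
    tendsto_nhdsWithin_iff.2 ⟨hlimx, Filter.Eventually.of_forall fun n => hz0 _⟩
  have h4 := (hlim x h2).comp h3
  have h5 : ∀ᶠ n in Filter.atTop, (Q ∘ fun n => z (φ n)) n < ε := h4.eventually_lt_const hε
  obtain ⟨n, hn⟩ := h5.exists
  exact absurd hn (not_lt.2 (hz2 _).le)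

/-- The derivative of the cut-off along the field is at most C (n + 1) times the flux and lives
where 1 < (n + 1) ρ ≤ 2. The fibre integral contributes ε and the base contributes the area of a
layer of height 2 / (n + 1), which will absorb the factor n + 1. -/
theorem norm_integral_flux_le {A₁ A₂ : ℂ × ℝ → ℂ}
    (h₁ : ∀ p, 0 < S.bdf p → ContDiffAt ℝ 1 A₁ p) (h₂ : ∀ p, 0 < S.bdf p → ContDiffAt ℝ 1 A₂ p)
    (hp₁ : IsPeriodic A₁) (hp₂ : IsPeriodic A₂) (n : ℕ) {ε C : ℝ} (hε : 0 ≤ ε) (hC : 0 ≤ C)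
    (hCd : ∀ x, |deriv Real.smoothTransition x| ≤ C)
    (hCz : ∀ x, (x ≤ 0 ∨ 1 < x) → deriv Real.smoothTransition x = 0)
    (hQ : ∀ z, 0 < S.rho z → S.rho z ≤ 2 / (n + 1) →
      ∫ θ in (0 : ℝ)..2 * Real.pi, ‖S.flux A₁ A₂ (z, θ)‖ ≤ ε)
    {c : ℝ} (hc : ∀ z ∈ S.M, Real.exp (2 * S.lam z) ≤ c) :
    ‖∫ p, (fderiv ℝ (S.exhaust n) p (S.geodField p) • A₁ p +
      fderiv ℝ (S.exhaust n) p (S.perpField p) • A₂ p) ∂S.volSM‖ ≤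
      c * (C * (n + 1) * ε) * volume.real (S.layer (2 / (n + 1))) := by
  have hc0 : 0 ≤ c := by
    obtain ⟨z, hz⟩ := S.nonempty_domain
    exact (Real.exp_pos _).le.trans (hc z hz)
  set d : ℂ × ℝ → ℝ := fun p => deriv Real.smoothTransition ((n + 1) * S.bdf p - 1) with hd
  have hpt : ∀ p, fderiv ℝ (S.exhaust n) p (S.geodField p) • A₁ p +
      fderiv ℝ (S.exhaust n) p (S.perpField p) • A₂ p = (d p * (n + 1)) • S.flux A₁ A₂ p := by
    intro p
    rw [S.fderiv_exhaust, S.fderiv_exhaust, flux, smul_add, smul_smul, smul_smul, mul_assoc, mul_assoc]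
    rfl
  have hn : ∀ p, ‖(d p * (n + 1)) • S.flux A₁ A₂ p‖ = |d p| * (n + 1) * ‖S.flux A₁ A₂ p‖ := by
    intro p
    rw [norm_smul, Real.norm_eq_abs, abs_mul, abs_of_pos (by positivity : (0 : ℝ) < n + 1)]
  refine (norm_integral_le_integral_norm _).trans ?_
  simp only [hpt, hn]
  -- the integrand is integrable
  have hcd : Continuous d := ((Real.smoothTransition.contDiff (n := 1)).continuous_deriv
    (by simp)).comp ((continuous_const.mul S.continuous_bdf).sub continuous_const)
  have hd0 : ∀ p, (n + 1) * S.bdf p ≤ 1 → d p = 0 := fun p hp => hCz _ (Or.inl (by linarith))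
  have hcont : Continuous fun p => |d p| * (n + 1) * ‖S.flux A₁ A₂ p‖ := by
    rw [continuous_iff_continuousAt]
    intro p
    by_cases hp : 0 < S.bdf p
    · exact (hcd.abs.continuousAt.mul continuousAt_const).mul
        ((S.contDiff_X_bdf.continuous.continuousAt.smul (h₁ p hp).continuousAt).add
        (S.contDiff_Xperp_bdf.continuous.continuousAt.smul (h₂ p hp).continuousAt)).norm
    · have : (fun p => |d p| * (n + 1) * ‖S.flux A₁ A₂ p‖) =ᶠ[nhds p] fun _ => 0 := by
        have h1 : ∀ᶠ q in nhds p, ((n : ℝ) + 1) * S.bdf q < 1 :=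
          S.eventually_mul_bdf_lt n hp
        filter_upwards [h1] with q hq
        rw [hd0 q hq.le]; simp
      exact continuousAt_const.congr this.symm
  have hper : IsPeriodic fun p => |d p| * (n + 1) * ‖S.flux A₁ A₂ p‖ := by
    intro p
    have e1 := (S.isPeriodic_bdf.X (S := S)) p
    have e2 := (S.isPeriodic_bdf.Xperp (S := S)) p
    simp only [flux, hd, e1, e2, hp₁ p, hp₂ p, S.isPeriodic_bdf p]
  have hint := S.integrable_of_continuous hcont hper
  rw [S.integral_volSM_iterated hint]
  -- bound on the fibres
  have hin : ∀ z, ∫ θ in (0 : ℝ)..2 * Real.pi, |d (z, θ)| * (n + 1) * ‖S.flux A₁ A₂ (z, θ)‖ =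
      |d (z, 0)| * (n + 1) * ∫ θ in (0 : ℝ)..2 * Real.pi, ‖S.flux A₁ A₂ (z, θ)‖ := by
    intro z
    rw [← intervalIntegral.integral_const_mul]
    rfl
  simp only [hin, smul_eq_mul]
  have hpos : ∀ z, 0 ≤ ∫ θ in (0 : ℝ)..2 * Real.pi, ‖S.flux A₁ A₂ (z, θ)‖ := fun z =>
    intervalIntegral.integral_nonneg Real.two_pi_pos.le fun _ _ => norm_nonneg _
  have hlay := (S.isClosed_layer (2 / (n + 1))).measurableSet
  have hbd : ∀ z ∈ S.M, Real.exp (2 * S.lam z) * (|d (z, 0)| * (n + 1) *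
      ∫ θ in (0 : ℝ)..2 * Real.pi, ‖S.flux A₁ A₂ (z, θ)‖) ≤
      (S.layer (2 / (n + 1))).indicator (fun _ => c * (C * (n + 1) * ε)) z := by
    intro z hz
    have hz' : 0 ≤ S.rho z := hz
    by_cases hzl : z ∈ S.layer (2 / (n + 1))
    · rw [indicator_of_mem hzl]
      rcases hz'.lt_or_eq with h0 | h0
      · have := hQ z h0 hzl.2
        have h3 := hc z hz
        have h4 := hCd ((n + 1) * S.bdf (z, 0) - 1)
        have h5 := hpos z
        gcongr
      · rw [hd0 (z, 0) (by simp [bdf, ← h0])]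
        simp only [abs_zero, zero_mul, mul_zero]
        positivity
    · rw [indicator_of_notMem hzl]
      have h0 : d (z, 0) = 0 := by
        refine hCz _ (Or.inr ?_)
        have : 2 / ((n : ℝ) + 1) < S.rho z := by
          by_contra hcon
          exact hzl ⟨hz', not_lt.1 hcon⟩
        rw [div_lt_iff₀ (by positivity)] at this
        simp only [bdf]; linarith
      rw [h0]; simp
  calc _ ≤ ∫ z in S.M, (S.layer (2 / (n + 1))).indicator (fun _ => c * (C * (n + 1) * ε)) z := by
        refine integral_mono_of_nonneg (Filter.Eventually.of_forall fun z => ?_) ?_ ?_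
        · have := hpos z
          simp only [Pi.zero_apply]; positivity
        · exact (integrableOn_const S.volume_M_ne_top).indicator hlay
        · filter_upwards [ae_restrict_mem S.isClosed_M.measurableSet] with z hz using hbd z hz
    _ = _ := by
        rw [integral_indicator hlay, Measure.restrict_restrict hlay,
          inter_eq_left.2 (fun z hz => hz.1), setIntegral_const, smul_eq_mul, mul_comm]

/-- Product rule for the truncated functions: since X and X_⊥ are divergence free, only the
derivative of the cut-off remains. -/
theorem integral_exhaust_smul {A₁ A₂ : ℂ × ℝ → ℂ}
    (h₁ : ∀ p, 0 < S.bdf p → ContDiffAt ℝ 1 A₁ p) (h₂ : ∀ p, 0 < S.bdf p → ContDiffAt ℝ 1 A₂ p)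
    (hp₁ : IsPeriodic A₁) (hp₂ : IsPeriodic A₂)
    (hint : Integrable (fun p => S.X A₁ p + S.Xperp A₂ p) S.volSM) (n : ℕ) :
    ∫ p, S.exhaust n p • (S.X A₁ p + S.Xperp A₂ p) ∂S.volSM =
      -∫ p, (fderiv ℝ (S.exhaust n) p (S.geodField p) • A₁ p +
        fderiv ℝ (S.exhaust n) p (S.perpField p) • A₂ p) ∂S.volSM := by
  set K : Set ℂ := S.M ∩ {z | 1 ≤ ((n : ℝ) + 1) * S.rho z} with hK
  have hKc : IsCompact K := S.isCompact_domain.inter_right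
    (isClosed_le continuous_const (continuous_const.mul S.rho_smooth.continuous))
  have hz : ∀ (A : ℂ × ℝ → ℂ) (p : ℂ × ℝ), p.1 ∉ K → S.exhaust n p • A p = 0 := by
    intro A p hp
    rw [S.exhaust_eq_zero, zero_smul]
    by_contra! hcon
    refine hp ⟨?_, hcon.le⟩
    have hb : ((n : ℝ) + 1) * S.rho p.1 > 1 := hcon
    show 0 ≤ S.rho p.1
    by_contra! hneg
    nlinarith [mul_neg_of_pos_of_neg (by positivity : (0 : ℝ) < n + 1) hneg]
  have hcA₁ := S.contDiff_exhaust_smul h₁ n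
  have hcA₂ := S.contDiff_exhaust_smul h₂ n
  have hpA₁ : IsPeriodic fun p => S.exhaust n p • A₁ p := fun p => by
    simp only [S.isPeriodic_exhaust n p, hp₁ p]
  have hpA₂ : IsPeriodic fun p => S.exhaust n p • A₂ p := fun p => by
    simp only [S.isPeriodic_exhaust n p, hp₂ p]
  have e1 := S.integral_X_eq_zero hcA₁ hpA₁ hKc (hz A₁) inter_subset_left
  have e2 := S.integral_Xperp_eq_zero hcA₂ hpA₂ hKc (hz A₂) inter_subset_left
  have i1 : Integrable (S.X fun p => S.exhaust n p • A₁ p) S.volSM :=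
    S.integrable_of_continuous ((hcA₁.continuous_fderiv one_ne_zero).clm_apply
      S.contDiff_geodField.continuous) hpA₁.X
  have i2 : Integrable (S.Xperp fun p => S.exhaust n p • A₂ p) S.volSM :=
    S.integrable_of_continuous ((hcA₂.continuous_fderiv one_ne_zero).clm_apply
      S.contDiff_perpField.continuous) hpA₂.Xperp
  have i3 : Integrable (fun p => S.exhaust n p • (S.X A₁ p + S.Xperp A₂ p)) S.volSM := by
    refine hint.mono ((S.contDiff_exhaust n).continuous.aestronglyMeasurable.smul hint.1)
      (Filter.Eventually.of_forall fun p => ?_)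
    rw [norm_smul]
    exact mul_le_of_le_one_left (norm_nonneg _) (S.norm_exhaust_le n p)
  have hae : ∀ᵐ p ∂S.volSM, S.exhaust n p • (S.X A₁ p + S.Xperp A₂ p) =
      (S.X (fun p => S.exhaust n p • A₁ p) p + S.Xperp (fun p => S.exhaust n p • A₂ p) p) -
      (fderiv ℝ (S.exhaust n) p (S.geodField p) • A₁ p +
        fderiv ℝ (S.exhaust n) p (S.perpField p) • A₂ p) := by
    filter_upwards [S.ae_bdf_pos] with p hp
    simp only [X, Xperp]
    rw [S.fderiv_exhaust_smul h₁ n hp, S.fderiv_exhaust_smul h₂ n hp, smul_add]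
    abel
  have i4 : Integrable (fun p => fderiv ℝ (S.exhaust n) p (S.geodField p) • A₁ p +
        fderiv ℝ (S.exhaust n) p (S.perpField p) • A₂ p) S.volSM := by
    refine ((i1.add i2).sub i3).congr ?_
    filter_upwards [hae] with p hp
    simp only [Pi.sub_apply, Pi.add_apply, hp]
    abel
  have e3 := integral_sub (i1.add i2) i4
  simp only [Pi.add_apply] at e3
  rw [integral_congr_ae hae, e3, integral_add i1 i2, e1, e2]
  simp

/-- **Green's formula** for fields whose flux through the boundary vanishes. -/
theorem integral_X_add_Xperp_eq_zero {A₁ A₂ : ℂ × ℝ → ℂ}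
    (h₁ : ∀ p, 0 < S.bdf p → ContDiffAt ℝ 1 A₁ p) (h₂ : ∀ p, 0 < S.bdf p → ContDiffAt ℝ 1 A₂ p)
    (hp₁ : IsPeriodic A₁) (hp₂ : IsPeriodic A₂)
    (hint : Integrable (fun p => S.X A₁ p + S.Xperp A₂ p) S.volSM)
    (hlim : ∀ x, S.rho x = 0 → Filter.Tendsto
      (fun z => ∫ θ in (0 : ℝ)..2 * Real.pi, ‖S.flux A₁ A₂ (z, θ)‖)
      (nhdsWithin x {z | 0 < S.rho z}) (nhds 0)) :
    ∫ p, (S.X A₁ p + S.Xperp A₂ p) ∂S.volSM = 0 := by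
  obtain ⟨C, hC, hCd, hCz⟩ := exists_deriv_smoothTransition_bound
  obtain ⟨C', hC'⟩ := S.exists_layer_bound
  obtain ⟨c, hc⟩ := S.isCompact_domain.exists_bound_of_continuousOn
    (f := fun z => Real.exp (2 * S.lam z))
    (Real.continuous_exp.comp (continuous_const.mul S.lam_smooth.continuous)).continuousOn
  have hc : ∀ z ∈ S.M, Real.exp (2 * S.lam z) ≤ c := fun z hz => (le_abs_self _).trans (hc z hz)
  have hc0 : 0 ≤ c := by
    obtain ⟨z, hz⟩ := S.nonempty_domain
    exact (Real.exp_pos _).le.trans (hc z hz)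
  set E : ℕ → ℂ := fun n => ∫ p, (fderiv ℝ (S.exhaust n) p (S.geodField p) • A₁ p +
      fderiv ℝ (S.exhaust n) p (S.perpField p) • A₂ p) ∂S.volSM with hE
  have key : ∀ n, ∫ p, S.exhaust n p • (S.X A₁ p + S.Xperp A₂ p) ∂S.volSM = -E n :=
    S.integral_exhaust_smul h₁ h₂ hp₁ hp₂ hint
  -- the left side converges to the integral
  have hL : Filter.Tendsto (fun n => ∫ p, S.exhaust n p • (S.X A₁ p + S.Xperp A₂ p) ∂S.volSM)
      Filter.atTop (nhds (∫ p, (S.X A₁ p + S.Xperp A₂ p) ∂S.volSM)) := by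
    refine tendsto_integral_of_dominated_convergence (fun p => ‖S.X A₁ p + S.Xperp A₂ p‖)
      (fun n => (S.contDiff_exhaust n).continuous.aestronglyMeasurable.smul hint.1) hint.norm
      (fun n => Filter.Eventually.of_forall fun p => ?_) ?_
    · rw [norm_smul]
      exact mul_le_of_le_one_left (norm_nonneg _) (S.norm_exhaust_le n p)
    · filter_upwards [S.ae_bdf_pos] with p hp
      refine tendsto_const_nhds.congr' ?_
      obtain ⟨N, hN⟩ := exists_nat_gt (2 / S.bdf p)
      filter_upwards [Filter.eventually_ge_atTop N] with n hn
      have h1 : 2 < N * S.bdf p := by rwa [div_lt_iff₀ hp] at hN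
      have h2 : (N : ℝ) ≤ n := by exact_mod_cast hn
      have : S.exhaust n p = 1 := Real.smoothTransition.one_of_one_le (by nlinarith)
      rw [this, one_smul]
  -- the right side converges to zero
  have hR : Filter.Tendsto E Filter.atTop (nhds 0) := by
    rw [Metric.tendsto_atTop]
    intro η hη
    -- B majorizes the constants of the flux estimate after the area bound; the added 1 keeps it
    -- positive, so that η / (2 B) is a legitimate tolerance.
    set B : ℝ := c * C * (2 * |C'|) + 1 with hB
    have hB0 : 0 < B := by positivity
    obtain ⟨δ, hδ, hδQ⟩ := S.exists_uniform_of_tendsto hlim (ε := η / (2 * B)) (by positivity)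
    obtain ⟨N, hN⟩ := exists_nat_gt (2 / δ)
    refine ⟨N, fun n hn => ?_⟩
    have h2 : (N : ℝ) ≤ n := by exact_mod_cast hn
    have hnδ : 2 / ((n : ℝ) + 1) < δ := by
      rw [div_lt_iff₀ hδ] at hN
      rw [div_lt_iff₀ (by positivity)]
      nlinarith
    have h3 := S.norm_integral_flux_le h₁ h₂ hp₁ hp₂ n (ε := η / (2 * B)) (by positivity) hC hCd hCz
      (fun z hz hz' => hδQ z hz (hz'.trans_lt hnδ)) hc
    rw [dist_zero_right]
    refine h3.trans_lt ?_
    have h4 : volume.real (S.layer (2 / (n + 1))) ≤ |C'| * (2 / (n + 1)) :=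
      (hC' _ (by positivity)).trans (by gcongr; exact le_abs_self _)
    calc c * (C * (n + 1) * (η / (2 * B))) * volume.real (S.layer (2 / (n + 1)))
        ≤ c * (C * (n + 1) * (η / (2 * B))) * (|C'| * (2 / (n + 1))) := by gcongr
      _ = (c * C * (2 * |C'|)) * (η / (2 * B)) := by field_simp
      _ ≤ B * (η / (2 * B)) := by gcongr; linarith
      _ = η / 2 := by field_simp
      _ < η := by linarith
  have := tendsto_nhds_unique hL ((by simpa using hR.neg : Filter.Tendsto (fun n => -E n)
    Filter.atTop (nhds 0)).congr fun n => (key n).symm)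
  exact this

end IsothermalSurface

end

/-! ### Fourier series and bounded multipliers along the fibres -/

noncomputable section

theorem summable_one_div_one_add_sq : Summable fun l : ℤ => 1 / (1 + (l : ℝ) ^ 2) := by
  have h1 : Summable fun l : ℤ => 1 / (l : ℝ) ^ 2 := Real.summable_one_div_int_pow.2 one_lt_two
  have h2 : Summable fun l : ℤ => if l = 0 then (1 : ℝ) else 0 := (hasSum_ite_eq 0 (1 : ℝ)).summable
  refine Summable.of_nonneg_of_le (fun l => by positivity) (fun l => ?_) (h1.add h2)
  rcases eq_or_ne l 0 with rfl | hl
  · simp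
  · have : (0 : ℝ) < (l : ℝ) ^ 2 := by positivity
    simp only [hl, if_false, add_zero]
    gcongr
    linarith

theorem integral_exp_int_mul (n : ℤ) :
    ∫ φ in (0 : ℝ)..2 * Real.pi, exp (n * φ * I) = if n = 0 then (2 * Real.pi : ℂ) else 0 := by
  split_ifs with hn
  · simp [hn]
  · have hc : (n : ℂ) * I ≠ 0 := mul_ne_zero (by exact_mod_cast hn) I_ne_zero
    have h1 := integral_exp_mul_complex (a := 0) (b := 2 * Real.pi) hc
    have h2 : ∀ φ : ℝ, exp (n * φ * I) = exp (n * I * φ) := fun φ => by congr 1; ring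
    simp only [h2, h1]
    have h3 : (n : ℂ) * I * ((2 * Real.pi : ℝ) : ℂ) = n * (2 * Real.pi * I) := by push_cast; ring
    rw [h3, exp_int_mul_two_pi_mul_I]
    simp

theorem norm_exp_int_mul (n : ℤ) (φ : ℝ) : ‖exp (n * φ * I)‖ = 1 := by
  have : (n : ℂ) * φ * I = ((n * φ : ℝ) : ℂ) * I := by push_cast; ring
  rw [this, norm_exp_ofReal_mul_I]

theorem norm_exp_neg_int_mul (n : ℤ) (φ : ℝ) : ‖exp (-(n * φ * I))‖ = 1 := by
  rw [Complex.exp_neg, norm_inv, norm_exp_int_mul, inv_one]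

/-- Termwise integration of an absolutely convergent trigonometric series. -/
theorem hasSum_integral_trig {a : ℤ → ℂ} (ha : Summable fun l => ‖a l‖) {g : ℝ → ℂ}
    (hg : Continuous g) :
    HasSum (fun l => a l * ∫ φ in (0 : ℝ)..2 * Real.pi, exp (l * φ * I) * g φ)
      (∫ φ in (0 : ℝ)..2 * Real.pi, (∑' l, a l * exp (l * φ * I)) * g φ) := by
  obtain ⟨C, hC⟩ := (isCompact_Icc (a := (0 : ℝ)) (b := 2 * Real.pi)).exists_bound_of_continuousOn
    hg.continuousOn
  have h1 := intervalIntegral.hasSum_integral_of_dominated_convergence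
    (a := 0) (b := 2 * Real.pi) (μ := volume)
    (F := fun (l : ℤ) φ => a l * exp (l * φ * I) * g φ)
    (f := fun φ => (∑' l, a l * exp (l * φ * I)) * g φ) (bound := fun l _ => ‖a l‖ * C)
    (fun l => by fun_prop) ?_ ?_ ?_ ?_
  · refine h1.congr_fun fun l => ?_
    rw [← intervalIntegral.integral_const_mul]
    congr 1; funext φ; ring
  · intro l
    refine Filter.Eventually.of_forall fun φ hφ => ?_
    rw [uIoc_of_le Real.two_pi_pos.le] at hφ
    rw [norm_mul, norm_mul, norm_exp_int_mul, mul_one]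
    gcongr
    exact hC φ (Ioc_subset_Icc_self hφ)
  · exact Filter.Eventually.of_forall fun φ _ => ha.mul_right C
  · exact intervalIntegrable_const
  · refine Filter.Eventually.of_forall fun φ _ => HasSum.mul_right _ (Summable.hasSum ?_)
    refine Summable.of_norm (ha.congr fun l => ?_)
    rw [norm_mul, norm_exp_int_mul, mul_one]

theorem continuous_trig {a : ℤ → ℂ} (ha : Summable fun l => ‖a l‖) :
    Continuous fun φ : ℝ => ∑' l : ℤ, a l * exp (l * φ * I) := by
  refine continuous_tsum (fun l => by fun_prop) ha fun l φ => ?_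
  rw [norm_mul, norm_exp_int_mul, mul_one]

/-- Fourier coefficients of an absolutely convergent trigonometric series. -/
theorem integral_trig_mul_exp {a : ℤ → ℂ} (ha : Summable fun l => ‖a l‖) (m : ℤ) :
    ∫ φ in (0 : ℝ)..2 * Real.pi, (∑' l, a l * exp (l * φ * I)) * exp (-(m * φ * I)) =
      2 * Real.pi * a m := by
  have h1 := hasSum_integral_trig ha (g := fun φ => exp (-(m * φ * I))) (by fun_prop)
  have h2 : ∀ l : ℤ, (∫ φ in (0 : ℝ)..2 * Real.pi, exp (l * φ * I) * exp (-(m * φ * I))) =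
      if l = m then (2 * Real.pi : ℂ) else 0 := by
    intro l
    have := integral_exp_int_mul (l - m)
    simp only [sub_eq_zero] at this
    rw [← this]
    congr 1; funext φ
    rw [← Complex.exp_add]; congr 1; push_cast; ring
  simp only [h2] at h1
  have h3 := hasSum_ite_eq m (a m * (2 * Real.pi : ℂ))
  have h4 : (fun l => a l * if l = m then (2 * Real.pi : ℂ) else 0) =
      fun l => if l = m then a m * (2 * Real.pi : ℂ) else 0 := by
    funext l; split_ifs with h <;> simp [h]
  rw [h4] at h1
  rw [h1.unique h3, mul_comm]

/-- Parseval's identity for an absolutely convergent trigonometric series. -/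
theorem integral_norm_sq_trig {a : ℤ → ℂ} (ha : Summable fun l => ‖a l‖) :
    ∫ φ in (0 : ℝ)..2 * Real.pi, ‖∑' l, a l * exp (l * φ * I)‖ ^ 2 =
      2 * Real.pi * ∑' l, ‖a l‖ ^ 2 := by
  have h1 := hasSum_integral_trig ha
    (g := fun φ => (starRingEnd ℂ) (∑' l, a l * exp (l * φ * I)))
    (continuous_conj.comp (continuous_trig ha))
  have h2 : ∀ l : ℤ, (∫ φ in (0 : ℝ)..2 * Real.pi, exp (l * φ * I) *
      (starRingEnd ℂ) (∑' l, a l * exp (l * φ * I))) = (starRingEnd ℂ) (2 * Real.pi * a l) := by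
    intro l
    rw [← integral_trig_mul_exp ha l, ← intervalIntegral.intervalIntegral_conj]
    congr 1; funext φ
    rw [map_mul, mul_comm, ← exp_conj]
    congr 2
    simp
  have h3 : ∀ l, a l * (starRingEnd ℂ) (2 * Real.pi * a l) =
      ((2 * Real.pi * ‖a l‖ ^ 2 : ℝ) : ℂ) := by
    intro l
    rw [map_mul, mul_left_comm, mul_conj, normSq_eq_norm_sq, map_mul, conj_ofReal, conj_ofNat]
    push_cast; ring
  simp only [h2, h3, mul_conj, normSq_eq_norm_sq] at h1
  rw [intervalIntegral.integral_ofReal, hasSum_ofReal] at h1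
  rw [← h1.tsum_eq, tsum_mul_left]

namespace IsothermalSurface

/-- Fibrewise Fourier coefficients. -/
def fcoef (l : ℤ) (u : ℂ × ℝ → ℂ) (z : ℂ) : ℂ :=
  (1 / (2 * Real.pi) : ℂ) * ∫ φ in (0 : ℝ)..(2 * Real.pi), u (z, φ) * exp (-(l * φ * I))

theorem mode_eq (l : ℤ) (u : ℂ × ℝ → ℂ) (p : ℂ × ℝ) :
    mode l u p = exp (l * p.2 * I) * fcoef l u p.1 := rfl

theorem norm_mode (l : ℤ) (u : ℂ × ℝ → ℂ) (p : ℂ × ℝ) : ‖mode l u p‖ = ‖fcoef l u p.1‖ := by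
  rw [mode_eq, norm_mul, norm_exp_int_mul, one_mul]

theorem fcoef_congr {u v : ℂ × ℝ → ℂ} {l : ℤ} {z : ℂ} (h : ∀ θ, u (z, θ) = v (z, θ)) :
    fcoef l u z = fcoef l v z := by simp only [fcoef, h]

theorem mode_congr {u v : ℂ × ℝ → ℂ} {l : ℤ} {p : ℂ × ℝ} (h : ∀ θ, u (p.1, θ) = v (p.1, θ)) :
    mode l u p = mode l v p := by rw [mode_eq, mode_eq, fcoef_congr h]

theorem fcoef_mul_left (c : ℂ → ℂ) (l : ℤ) (u : ℂ × ℝ → ℂ) (z : ℂ) :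
    fcoef l (fun q => c q.1 * u q) z = c z * fcoef l u z := by
  simp only [fcoef, mul_assoc, intervalIntegral.integral_const_mul]
  ring

theorem mode_mul_left (c : ℂ → ℂ) (l : ℤ) (u : ℂ × ℝ → ℂ) (p : ℂ × ℝ) :
    mode l (fun q => c q.1 * u q) p = c p.1 * mode l u p := by
  rw [mode_eq, mode_eq, fcoef_mul_left]; ring

theorem mode_const_mul (c : ℂ) (l : ℤ) (u : ℂ × ℝ → ℂ) (p : ℂ × ℝ) :
    mode l (fun q => c * u q) p = c * mode l u p := mode_mul_left (fun _ => c) l u p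

theorem fcoef_add {u v : ℂ × ℝ → ℂ} {z : ℂ} (l : ℤ) (hu : Continuous fun θ => u (z, θ))
    (hv : Continuous fun θ => v (z, θ)) :
    fcoef l (fun q => u q + v q) z = fcoef l u z + fcoef l v z := by
  simp only [fcoef, add_mul]
  rw [intervalIntegral.integral_add, mul_add]
  · exact (hu.mul (by fun_prop)).intervalIntegrable _ _
  · exact (hv.mul (by fun_prop)).intervalIntegrable _ _

theorem mode_add {u v : ℂ × ℝ → ℂ} {p : ℂ × ℝ} (l : ℤ) (hu : Continuous fun θ => u (p.1, θ))
    (hv : Continuous fun θ => v (p.1, θ)) :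
    mode l (fun q => u q + v q) p = mode l u p + mode l v p := by
  rw [mode_eq, fcoef_add l hu hv, mul_add]; rfl

theorem fcoef_sub {u v : ℂ × ℝ → ℂ} {z : ℂ} (l : ℤ) (hu : Continuous fun θ => u (z, θ))
    (hv : Continuous fun θ => v (z, θ)) :
    fcoef l (fun q => u q - v q) z = fcoef l u z - fcoef l v z := by
  simp only [fcoef, sub_mul]
  rw [intervalIntegral.integral_sub, mul_sub]
  · exact (hu.mul (by fun_prop)).intervalIntegrable _ _
  · exact (hv.mul (by fun_prop)).intervalIntegrable _ _

theorem mode_sub {u v : ℂ × ℝ → ℂ} {p : ℂ × ℝ} (l : ℤ) (hu : Continuous fun θ => u (p.1, θ))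
    (hv : Continuous fun θ => v (p.1, θ)) :
    mode l (fun q => u q - v q) p = mode l u p - mode l v p := by
  rw [mode_eq, fcoef_sub l hu hv, mul_sub]; rfl

theorem mode_exp_mul (m l : ℤ) (u : ℂ × ℝ → ℂ) (p : ℂ × ℝ) :
    mode l (fun q => exp (m * q.2 * I) * u q) p = exp (m * p.2 * I) * mode (l - m) u p := by
  rw [mode_eq, mode_eq, ← mul_assoc, ← Complex.exp_add]
  congr 1
  · congr 1; push_cast; ring
  · simp only [fcoef]
    congr 2; funext φ
    rw [mul_right_comm, ← Complex.exp_add, mul_comm]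
    congr 2; push_cast; ring

theorem fcoef_exp_mul (m l : ℤ) (c : ℂ → ℂ) (z : ℂ) :
    fcoef l (fun q => exp (m * q.2 * I) * c q.1) z = if l = m then c z else 0 := by
  have h := integral_exp_int_mul (m - l)
  have h2 : ∀ φ : ℝ, exp (m * φ * I) * c z * exp (-(l * φ * I)) = c z * exp ((m - l : ℤ) * φ * I) := by
    intro φ
    rw [mul_right_comm, ← Complex.exp_add, mul_comm]
    congr 2; push_cast; ring
  simp only [fcoef, h2, intervalIntegral.integral_const_mul, h, sub_eq_zero, eq_comm (a := m)]
  split_ifs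
  · have : (Real.pi : ℂ) ≠ 0 := by exact_mod_cast Real.pi_ne_zero
    field_simp
  · simp

theorem mode_of_exp_mul (m l : ℤ) (c : ℂ → ℂ) (p : ℂ × ℝ) :
    mode l (fun q => exp (m * q.2 * I) * c q.1) p =
      if l = m then exp (m * p.2 * I) * c p.1 else 0 := by
  rw [mode_eq, fcoef_exp_mul]
  split_ifs with h
  · rw [h]
  · simp

theorem norm_fcoef_le {u : ℂ × ℝ → ℂ} {z : ℂ} {C : ℝ} (l : ℤ)
    (hC : ∀ θ ∈ Icc 0 (2 * Real.pi), ‖u (z, θ)‖ ≤ C) : ‖fcoef l u z‖ ≤ C := by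
  rw [fcoef, norm_mul]
  have h1 : ‖∫ φ in (0 : ℝ)..2 * Real.pi, u (z, φ) * exp (-(l * φ * I))‖ ≤
      C * |2 * Real.pi - 0| := by
    refine intervalIntegral.norm_integral_le_of_norm_le_const fun φ hφ => ?_
    rw [uIoc_of_le Real.two_pi_pos.le] at hφ
    rw [norm_mul, norm_exp_neg_int_mul, mul_one]
    exact hC φ (Ioc_subset_Icc_self hφ)
  rw [sub_zero, abs_of_pos Real.two_pi_pos] at h1
  have h2 : ‖(1 / (2 * Real.pi) : ℂ)‖ = 1 / (2 * Real.pi) := by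
    rw [show (1 / (2 * Real.pi) : ℂ) = ((1 / (2 * Real.pi) : ℝ) : ℂ) by push_cast; rfl,
      norm_real, Real.norm_of_nonneg (by positivity)]
  rw [h2]
  calc _ ≤ 1 / (2 * Real.pi) * (C * (2 * Real.pi)) := by gcongr
    _ = C := by field_simp

/-- Functions smooth over an open subset of the plane, periodic along the fibres. -/
def FibreSmooth (O : Set ℂ) (u : ℂ × ℝ → ℂ) : Prop :=
  IsPeriodic u ∧ ∀ p : ℂ × ℝ, p.1 ∈ O → ContDiffAt ℝ ∞ u p

/-- The derivative in a constant direction. -/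
def dir (v : ℂ × ℝ) (u : ℂ × ℝ → ℂ) (p : ℂ × ℝ) : ℂ := fderiv ℝ u p v

variable {O : Set ℂ} {u : ℂ × ℝ → ℂ}

theorem FibreSmooth.dir (hu : FibreSmooth O u) (v : ℂ × ℝ) : FibreSmooth O (dir v u) :=
  ⟨fun p => by simp only [IsothermalSurface.dir, hu.1.fderiv p],
    fun p hp => ((hu.2 p hp).fderiv_right (m := ∞) (by simp)).clm_apply contDiffAt_const⟩

theorem FibreSmooth.continuous_fibre (hu : FibreSmooth O u) {z : ℂ} (hz : z ∈ O) :
    Continuous fun θ => u (z, θ) :=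
  continuous_iff_continuousAt.2 fun θ => (hu.2 (z, θ) hz).continuousAt.comp
    (by fun_prop : ContinuousAt (fun θ : ℝ => (z, θ)) θ)

theorem FibreSmooth.differentiableAt (hu : FibreSmooth O u) {p : ℂ × ℝ} (hp : p.1 ∈ O) :
    DifferentiableAt ℝ u p := (hu.2 p hp).differentiableAt (by simp)

/-- Integration by parts on the circle; the end point contributions cancel by periodicity. -/
theorem fcoef_dir_fibre (hu : FibreSmooth O u) {z : ℂ} (hz : z ∈ O) (l : ℤ) :
    fcoef l (dir (0, 1) u) z = l * I * fcoef l u z := by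
  have hd : ∀ φ : ℝ, HasDerivAt (fun φ : ℝ => u (z, φ) * exp (-(l * φ * I)))
      (dir (0, 1) u (z, φ) * exp (-(l * φ * I)) + u (z, φ) * (exp (-(l * φ * I)) * -(l * I))) φ := by
    intro φ
    have h1 : HasDerivAt (fun φ : ℝ => u (z, φ)) (dir (0, 1) u (z, φ)) φ :=
      (hu.differentiableAt (p := (z, φ)) hz).hasFDerivAt.comp_hasDerivAt φ
        ((hasDerivAt_const φ z).prodMk (hasDerivAt_id φ))
    have h2 : HasDerivAt (fun φ : ℝ => -((l : ℂ) * φ * I)) (-(l * I)) φ := by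
      have h := (((hasDerivAt_id φ).ofReal_comp.const_mul (l : ℂ)).mul_const I).neg
      simp only [id, ofReal_one, mul_one] at h
      exact h
    exact h1.mul h2.cexp
  have hc1 : Continuous fun φ : ℝ => dir (0, 1) u (z, φ) * exp (-(l * φ * I)) :=
    ((hu.dir _).continuous_fibre hz).mul (by fun_prop)
  have hc2 : Continuous fun φ : ℝ => u (z, φ) * (exp (-(l * φ * I)) * -(l * I)) :=
    (hu.continuous_fibre hz).mul (by fun_prop)
  have h1 := intervalIntegral.integral_eq_sub_of_hasDerivAt (a := 0) (b := 2 * Real.pi)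
    (fun φ _ => hd φ) ((hc1.add hc2).intervalIntegrable _ _)
  have h2 : u (z, 2 * Real.pi) = u (z, 0) := by simpa using hu.1.periodic z 0
  have h3 : exp (-((l : ℂ) * ((2 * Real.pi : ℝ) : ℂ) * I)) = 1 := by
    rw [show -((l : ℂ) * ((2 * Real.pi : ℝ) : ℂ) * I) = ((-l : ℤ) : ℂ) * (2 * Real.pi * I) by
      push_cast; ring, exp_int_mul_two_pi_mul_I]
  rw [intervalIntegral.integral_add (hc1.intervalIntegrable _ _) (hc2.intervalIntegrable _ _), h2,
    h3] at h1
  simp only [ofReal_zero, mul_zero, zero_mul, neg_zero, Complex.exp_zero, sub_self, ← mul_assoc,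
    intervalIntegral.integral_mul_const] at h1
  simp only [fcoef]
  linear_combination (1 / (2 * Real.pi) : ℂ) * h1

theorem fcoef_fderiv (hO : IsOpen O) (hu : FibreSmooth O u) {z : ℂ} (hz : z ∈ O) (l : ℤ) :
    DifferentiableAt ℝ (fcoef l u) z ∧ ∀ a, fderiv ℝ (fcoef l u) z a = fcoef l (dir (a, 0) u) z := by
  have hF : ∀ w ∈ O, ∀ t : ℝ, ContDiffAt ℝ 1 (fun q : ℂ × ℝ => u q * exp (-(l * q.2 * I))) (w, t) := by
    intro w hw t
    refine ((hu.2 (w, t) hw).of_le (by simp)).mul ?_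
    have : ContDiff ℝ 1 fun q : ℂ × ℝ => -((l : ℂ) * (q.2 : ℂ) * I) :=
      ((contDiff_const.mul (ofRealCLM.contDiff.comp contDiff_snd)).mul contDiff_const).neg
    exact this.cexp.contDiffAt
  have he : ContDiff ℝ 1 fun q : ℂ × ℝ => exp (-(l * q.2 * I)) := by
    have : ContDiff ℝ 1 fun q : ℂ × ℝ => -((l : ℂ) * (q.2 : ℂ) * I) :=
      ((contDiff_const.mul (ofRealCLM.contDiff.comp contDiff_snd)).mul contDiff_const).neg
    exact this.cexp
  have h1 := (hasFDerivAt_parametric_integral hO 0 (2 * Real.pi) hF hz).const_mul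
    (1 / (2 * Real.pi) : ℂ)
  refine ⟨h1.differentiableAt, fun a => ?_⟩
  have h2 : fderiv ℝ (fcoef l u) z = _ := h1.fderiv
  rw [h2, smul_apply, smul_eq_mul, fcoef]
  congr 1
  rw [ContinuousLinearMap.intervalIntegral_apply]
  · congr 1; funext φ
    have h3 : DifferentiableAt ℝ (fun q : ℂ × ℝ => exp (-(l * q.2 * I))) (z, φ) :=
      (he.differentiable one_ne_zero) _
    have h4 : fderiv ℝ (fun q : ℂ × ℝ => exp (-(l * q.2 * I))) (z, φ) (a, 0) = 0 := by
      refine fderiv_eq_of_hasDerivAt_line h3 ?_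
      have : (fun t : ℝ => exp (-((l : ℂ) * ((((z, φ) + t • (a, 0) : ℂ × ℝ).2 : ℝ) : ℂ) * I))) =
          fun _ => exp (-(l * φ * I)) := by
        funext t; simp
      rw [this]
      exact hasDerivAt_const _ _
    have h5 : fderiv ℝ (fun q : ℂ × ℝ => u q * exp (-(l * q.2 * I))) (z, φ) = _ :=
      ((hu.differentiableAt (p := (z, φ)) hz).hasFDerivAt.mul h3.hasFDerivAt).fderiv
    simp only [ContinuousLinearMap.comp_apply, ContinuousLinearMap.inl_apply, h5]
    rw [add_apply, smul_apply, smul_apply, h4]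
    simp only [smul_zero, zero_add, smul_eq_mul, dir]
    ring
  · have : Continuous fun t : ℝ => (fderiv ℝ (fun q : ℂ × ℝ => u q * exp (-(l * q.2 * I))) (z, t)).comp
        (ContinuousLinearMap.inl ℝ ℂ ℝ) := by
      rw [continuous_iff_continuousAt]
      intro t
      have h : ContDiffAt ℝ 0 (fderiv ℝ (fun q : ℂ × ℝ => u q * exp (-(l * q.2 * I)))) (z, t) :=
        (hF z hz t).fderiv_right (by simp)
      exact (h.continuousAt.comp (by fun_prop : ContinuousAt (fun t : ℝ => (z, t)) t)).clm_comp
        continuousAt_const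
    exact this.intervalIntegrable _ _

theorem hasFDerivAt_exp_fibre (l : ℤ) (p : ℂ × ℝ) : HasFDerivAt (fun q : ℂ × ℝ => exp (l * q.2 * I))
    ((exp (l * p.2 * I) * (l * I)) • (ofRealCLM.comp (ContinuousLinearMap.snd ℝ ℂ ℝ))) p := by
  have h1 : HasFDerivAt (fun q : ℂ × ℝ => (q.2 : ℂ)) (ofRealCLM.comp (ContinuousLinearMap.snd ℝ ℂ ℝ)) p :=
    (ofRealCLM.comp (ContinuousLinearMap.snd ℝ ℂ ℝ)).hasFDerivAt
  have h2 : HasFDerivAt (fun q : ℂ × ℝ => (l : ℂ) * q.2 * I) _ p := (h1.const_mul (l : ℂ)).mul_const I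
  refine h2.cexp.congr_fderiv ?_
  ext v
  · simp
  · simp; ring

/-- Fourier projection commutes with coordinate derivatives: differentiation under the integral
handles the base directions, and in the fibre direction both sides are multiplication by i l. -/
theorem mode_fderiv (hO : IsOpen O) (hu : FibreSmooth O u) {p : ℂ × ℝ} (hp : p.1 ∈ O) (l : ℤ) :
    DifferentiableAt ℝ (mode l u) p ∧ ∀ v, fderiv ℝ (mode l u) p v = mode l (dir v u) p := by
  obtain ⟨h1, h2⟩ := fcoef_fderiv hO hu hp l
  have h3 : HasFDerivAt (fun q : ℂ × ℝ => fcoef l u q.1)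
      ((fderiv ℝ (fcoef l u) p.1).comp (ContinuousLinearMap.fst ℝ ℂ ℝ)) p :=
    h1.hasFDerivAt.comp p hasFDerivAt_fst
  have h4 : HasFDerivAt (fun q => exp (l * q.2 * I) * fcoef l u q.1) _ p :=
    (hasFDerivAt_exp_fibre l p).mul h3
  refine ⟨h4.differentiableAt, fun v => ?_⟩
  have h7 : fderiv ℝ (mode l u) p = _ := h4.fderiv
  have h5 : dir v u = fun q => dir (v.1, 0) u q + (v.2 : ℂ) * dir (0, 1) u q := by
    funext q
    have hv : v = (v.1, 0) + v.2 • ((0, 1) : ℂ × ℝ) := by simp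
    conv_lhs => rw [hv]
    simp only [dir, map_add, map_smul, real_smul]
  have h6 := ((hu.dir (0, 1)).continuous_fibre hp)
  rw [h5, mode_add l ((hu.dir _).continuous_fibre hp) (continuous_const.mul h6), mode_const_mul,
    h7, mode_eq, mode_eq, ← h2, fcoef_dir_fibre hu hp]
  simp
  ring

theorem contDiffAt_fcoef (hO : IsOpen O) (hu : FibreSmooth O u) {z : ℂ} (hz : z ∈ O) (l : ℤ) :
    ContDiffAt ℝ ∞ (fcoef l u) z := by
  refine contDiffAt_const.mul (contDiffAt_parametric_integral hO 0 (2 * Real.pi)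
    (F := fun q : ℂ × ℝ => u q * exp (-(l * q.2 * I))) (fun w hw t => ?_) hz)
  refine (hu.2 (w, t) hw).mul ?_
  have : ContDiff ℝ ∞ fun q : ℂ × ℝ => -((l : ℂ) * (q.2 : ℂ) * I) :=
    ((contDiff_const.mul (ofRealCLM.contDiff.comp contDiff_snd)).mul contDiff_const).neg
  exact this.cexp.contDiffAt

theorem contDiff_exp_fibre (l : ℤ) : ContDiff ℝ ∞ fun q : ℂ × ℝ => exp (l * q.2 * I) := by
  have : ContDiff ℝ ∞ fun q : ℂ × ℝ => (l : ℂ) * (q.2 : ℂ) * I :=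
    (contDiff_const.mul (ofRealCLM.contDiff.comp contDiff_snd)).mul contDiff_const
  exact this.cexp

theorem exp_fibre_periodic (l : ℤ) (θ : ℝ) :
    exp (l * ((θ + 2 * Real.pi : ℝ) : ℂ) * I) = exp (l * θ * I) := by
  rw [show (l : ℂ) * ((θ + 2 * Real.pi : ℝ) : ℂ) * I = l * θ * I + (l : ℂ) * (2 * Real.pi * I) by
    push_cast; ring, Complex.exp_add, exp_int_mul_two_pi_mul_I, mul_one]

theorem isPeriodic_mode (l : ℤ) (u : ℂ × ℝ → ℂ) : IsPeriodic (mode l u) :=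
  isPeriodic_iff.2 fun z θ => by simp only [mode_eq, exp_fibre_periodic]

theorem FibreSmooth.mode (hO : IsOpen O) (hu : FibreSmooth O u) (l : ℤ) :
    FibreSmooth O (mode l u) :=
  ⟨isPeriodic_mode l u, fun p hp => (contDiff_exp_fibre l).contDiffAt.mul
    (ContDiffAt.comp (g := fcoef l u) p (contDiffAt_fcoef hO hu hp l) contDiffAt_fst)⟩

/-- Locally uniform decay of the Fourier coefficients of smooth functions. -/
theorem FibreSmooth.exists_decay (hu : FibreSmooth O u) (hO : IsOpen O) {z : ℂ} (hz : z ∈ O) :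
    ∃ C : ℝ, 0 ≤ C ∧ ∀ᶠ w in nhds z, ∀ l : ℤ, ‖fcoef l u w‖ ≤ C * (1 / (1 + (l : ℝ) ^ 2)) := by
  -- The coefficients of (1 - ∂_θ²) u are 1 + l² times those of u, and the former are bounded near z
  -- by a compactness argument on the fibre.
  set v : ℂ × ℝ → ℂ := fun q => u q - IsothermalSurface.dir (0, 1) (IsothermalSurface.dir (0, 1) u) q with hv
  have h2 := (hu.dir (0, 1)).dir (0, 1)
  obtain ⟨C, hC⟩ := exists_bound_near_compact (F := v) (p := z)
    (isCompact_Icc (a := (0 : ℝ)) (b := 2 * Real.pi)) fun t _ =>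
      ((hu.2 (z, t) hz).continuousAt.sub (h2.2 (z, t) hz).continuousAt)
  refine ⟨max C 0, le_max_right _ _, ?_⟩
  filter_upwards [hC, hO.mem_nhds hz] with w hw hwO l
  have h3 : fcoef l v w = (1 + (l : ℂ) ^ 2) * fcoef l u w := by
    rw [hv, fcoef_sub l (hu.continuous_fibre hwO) (h2.continuous_fibre hwO),
      fcoef_dir_fibre (hu.dir _) hwO, fcoef_dir_fibre hu hwO]
    linear_combination -(l : ℂ) ^ 2 * fcoef l u w * I_sq
  have h4 : ‖fcoef l v w‖ ≤ max C 0 := (norm_fcoef_le l hw).trans (le_max_left _ _)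
  have h5 : ‖(1 + (l : ℂ) ^ 2)‖ = 1 + (l : ℝ) ^ 2 := by
    rw [show (1 + (l : ℂ) ^ 2) = ((1 + (l : ℝ) ^ 2 : ℝ) : ℂ) by push_cast; rfl, norm_real,
      Real.norm_of_nonneg (by positivity)]
  rw [h3, norm_mul, h5] at h4
  rw [mul_one_div, le_div_iff₀ (by positivity)]
  linarith

theorem FibreSmooth.summable_fcoef (hu : FibreSmooth O u) (hO : IsOpen O) {z : ℂ} (hz : z ∈ O) :
    Summable fun l => ‖fcoef l u z‖ := by
  obtain ⟨C, _, hC⟩ := hu.exists_decay hO hz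
  exact Summable.of_nonneg_of_le (fun _ => norm_nonneg _) hC.self_of_nhds
    (summable_one_div_one_add_sq.mul_left C)

/-- Fibrewise Fourier multipliers. -/
def mult (m : ℤ → ℂ) (u : ℂ × ℝ → ℂ) (p : ℂ × ℝ) : ℂ := ∑' l, m l * mode l u p

theorem mult_congr {m : ℤ → ℂ} {u v : ℂ × ℝ → ℂ} {p : ℂ × ℝ} (h : ∀ θ, u (p.1, θ) = v (p.1, θ)) :
    mult m u p = mult m v p := by simp only [mult, mode_congr h]

theorem isPeriodic_mult (m : ℤ → ℂ) (u : ℂ × ℝ → ℂ) : IsPeriodic (mult m u) := fun p => by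
  simp only [mult, isPeriodic_mode _ u p]

variable {m : ℤ → ℂ}

theorem summable_mult (hm : ∀ l, ‖m l‖ ≤ 1) {p : ℂ × ℝ} (hs : Summable fun l => ‖fcoef l u p.1‖) :
    Summable fun l => m l * mode l u p := by
  refine Summable.of_norm_bounded hs fun l => ?_
  rw [norm_mul, norm_mode]
  exact mul_le_of_le_one_left (norm_nonneg _) (hm l)

theorem summable_norm_mul_fcoef (hm : ∀ l, ‖m l‖ ≤ 1) {z : ℂ} (hs : Summable fun l => ‖fcoef l u z‖) :
    Summable fun l => ‖m l * fcoef l u z‖ := by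
  refine Summable.of_nonneg_of_le (fun _ => norm_nonneg _) (fun l => ?_) hs
  rw [norm_mul]
  exact mul_le_of_le_one_left (norm_nonneg _) (hm l)

theorem mult_eq_trig (m : ℤ → ℂ) (u : ℂ × ℝ → ℂ) (z : ℂ) (θ : ℝ) :
    mult m u (z, θ) = ∑' l : ℤ, (m l * fcoef l u z) * exp (l * θ * I) := by
  simp only [mult, mode_eq]
  congr 1; funext l; ring

theorem fcoef_mult (hm : ∀ l, ‖m l‖ ≤ 1) {z : ℂ} (hs : Summable fun l => ‖fcoef l u z‖) (l : ℤ) :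
    fcoef l (mult m u) z = m l * fcoef l u z := by
  rw [fcoef]
  simp only [mult_eq_trig]
  rw [integral_trig_mul_exp (summable_norm_mul_fcoef hm hs)]
  have : (Real.pi : ℂ) ≠ 0 := by exact_mod_cast Real.pi_ne_zero
  field_simp

theorem mode_mult (hm : ∀ l, ‖m l‖ ≤ 1) {p : ℂ × ℝ} (hs : Summable fun l => ‖fcoef l u p.1‖) (l : ℤ) :
    mode l (mult m u) p = m l * mode l u p := by
  rw [mode_eq, fcoef_mult hm hs, mode_eq]; ring

theorem continuous_mult_fibre (hm : ∀ l, ‖m l‖ ≤ 1) {z : ℂ} (hs : Summable fun l => ‖fcoef l u z‖) :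
    Continuous fun θ => mult m u (z, θ) := by
  simp only [mult_eq_trig]
  exact continuous_trig (summable_norm_mul_fcoef hm hs)

theorem norm_le_of_directions (L : ℂ × ℝ →L[ℝ] ℂ) :
    ‖L‖ ≤ ‖L (1, 0)‖ + ‖L (I, 0)‖ + ‖L (0, 1)‖ := by
  refine L.opNorm_le_bound (by positivity) fun v => ?_
  have hv : v = v.1.re • ((1, 0) : ℂ × ℝ) + v.1.im • ((I, 0) : ℂ × ℝ) + v.2 • ((0, 1) : ℂ × ℝ) := by
    ext <;> simp
  have h1 : |v.1.re| ≤ ‖v‖ := (abs_re_le_norm _).trans (norm_fst_le v)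
  have h2 : |v.1.im| ≤ ‖v‖ := (abs_im_le_norm _).trans (norm_fst_le v)
  have h3 : |v.2| ≤ ‖v‖ := norm_snd_le v
  calc ‖L v‖ = ‖v.1.re • L (1, 0) + v.1.im • L (I, 0) + v.2 • L (0, 1)‖ := by
        conv_lhs => rw [hv]
        simp only [map_add, map_smul]
    _ ≤ |v.1.re| * ‖L (1, 0)‖ + |v.1.im| * ‖L (I, 0)‖ + |v.2| * ‖L (0, 1)‖ := by
        refine (norm_add₃_le).trans ?_
        simp only [norm_smul, Real.norm_eq_abs]; rfl
    _ ≤ ‖v‖ * ‖L (1, 0)‖ + ‖v‖ * ‖L (I, 0)‖ + ‖v‖ * ‖L (0, 1)‖ := by gcongr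
    _ = _ := by ring

/-- Termwise differentiation. Quadratic decay for the three coordinate derivatives bounds the
differentiated series uniformly over a ball of the base; multipliers bounded by 1 do not spoil the
bound and commute with the derivatives. -/
theorem mult_fderiv (hO : IsOpen O) (hu : FibreSmooth O u) (hm : ∀ l, ‖m l‖ ≤ 1) {p : ℂ × ℝ}
    (hp : p.1 ∈ O) :
    DifferentiableAt ℝ (mult m u) p ∧ ∀ v, fderiv ℝ (mult m u) p v = mult m (dir v u) p := by
  obtain ⟨C₁, hC₁, h₁⟩ := (hu.dir (1, 0)).exists_decay hO hp
  obtain ⟨C₂, hC₂, h₂⟩ := (hu.dir (I, 0)).exists_decay hO hp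
  obtain ⟨C₃, hC₃, h₃⟩ := (hu.dir (0, 1)).exists_decay hO hp
  obtain ⟨r, hr, hball⟩ := Metric.eventually_nhds_iff_ball.1
    (((h₁.and h₂).and h₃).and (hO.mem_nhds hp))
  have hopen : IsOpen (Prod.fst ⁻¹' Metric.ball p.1 r : Set (ℂ × ℝ)) :=
    Metric.isOpen_ball.preimage continuous_fst
  have hconv : IsPreconnected (Prod.fst ⁻¹' Metric.ball p.1 r : Set (ℂ × ℝ)) :=
    ((convex_ball p.1 r).linear_preimage (LinearMap.fst ℝ ℂ ℝ)).isPreconnected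
  have hmem : p ∈ (Prod.fst ⁻¹' Metric.ball p.1 r : Set (ℂ × ℝ)) := Metric.mem_ball_self hr
  have hfd : ∀ l, ∀ q ∈ (Prod.fst ⁻¹' Metric.ball p.1 r : Set (ℂ × ℝ)),
      HasFDerivAt (fun q => m l * mode l u q) (m l • fderiv ℝ (mode l u) q) q := fun l q hq =>
    ((mode_fderiv hO hu (hball _ hq).2 l).1.hasFDerivAt).const_mul (m l)
  have hbd : ∀ l : ℤ, ∀ q ∈ (Prod.fst ⁻¹' Metric.ball p.1 r : Set (ℂ × ℝ)),
      ‖m l • fderiv ℝ (mode l u) q‖ ≤ (C₁ + C₂ + C₃) * (1 / (1 + (l : ℝ) ^ 2)) := by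
    intro l q hq
    obtain ⟨⟨⟨b₁, b₂⟩, b₃⟩, hqO⟩ := hball _ hq
    rw [norm_smul]
    refine (mul_le_of_le_one_left (norm_nonneg _) (hm l)).trans ((norm_le_of_directions _).trans ?_)
    simp only [(mode_fderiv hO hu hqO l).2, norm_mode]
    linarith [b₁ l, b₂ l, b₃ l]
  have key := hasFDerivAt_tsum_of_isPreconnected (𝕜 := ℝ)
    (summable_one_div_one_add_sq.mul_left _) hopen hconv hfd hbd hmem
    (summable_mult hm (hu.summable_fcoef hO hp)) hmem
  have hk : HasFDerivAt (mult m u) _ p := key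
  refine ⟨hk.differentiableAt, fun v => ?_⟩
  have hs : Summable fun l => m l • fderiv ℝ (mode l u) p :=
    Summable.of_norm_bounded (summable_one_div_one_add_sq.mul_left (C₁ + C₂ + C₃))
      fun l => hbd l p hmem
  have h1 := (ContinuousLinearMap.apply ℝ ℂ v).map_tsum hs
  rw [hk.fderiv, mult]
  refine h1.trans ?_
  congr 1; funext l
  simp [(mode_fderiv hO hu hp l).2 v]

/-- The derivative is assembled from the multipliers of the coordinate derivatives of u, which are
continuous because they are themselves differentiable. Class C^1 is all that Green's formula
requires. -/
theorem FibreSmooth.contDiffAt_mult (hu : FibreSmooth O u) (hO : IsOpen O) (hm : ∀ l, ‖m l‖ ≤ 1)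
    {p : ℂ × ℝ} (hp : p.1 ∈ O) : ContDiffAt ℝ 1 (mult m u) p := by
  have hOO : (Prod.fst ⁻¹' O : Set (ℂ × ℝ)) ∈ nhds p := (hO.preimage continuous_fst).mem_nhds hp
  have hfd : ∀ q ∈ (Prod.fst ⁻¹' O : Set (ℂ × ℝ)),
      fderiv ℝ (mult m u) q = (reCLM.comp (ContinuousLinearMap.fst ℝ ℂ ℝ)).smulRight
          (mult m (IsothermalSurface.dir (1, 0) u) q) +
        (imCLM.comp (ContinuousLinearMap.fst ℝ ℂ ℝ)).smulRight
          (mult m (IsothermalSurface.dir (I, 0) u) q) +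
        (ContinuousLinearMap.snd ℝ ℂ ℝ).smulRight
          (mult m (IsothermalSurface.dir (0, 1) u) q) := by
    intro q hq
    simp only [← (mult_fderiv hO hu hm hq).2]
    ext v
    · have hv : ((v, 0) : ℂ × ℝ) = v.re • ((1, 0) : ℂ × ℝ) + v.im • ((I, 0) : ℂ × ℝ) := by
        ext <;> simp
      simp only [ContinuousLinearMap.comp_apply, ContinuousLinearMap.inl_apply]
      rw [hv, map_add, map_add, map_smul, map_smul, map_smul, map_smul]
      simp
    · simp
  have hc : ∀ v : ℂ × ℝ, ContinuousOn (mult m (IsothermalSurface.dir v u)) (Prod.fst ⁻¹' O) :=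
    fun v q hq => (mult_fderiv hO (hu.dir v) hm hq).1.continuousAt.continuousWithinAt
  rw [contDiffAt_one_iff]
  refine ⟨fderiv ℝ (mult m u), _, hOO, ContinuousOn.congr ?_ hfd,
    fun q hq => (mult_fderiv hO hu hm hq).1.hasFDerivAt⟩
  have hsr : ∀ L : ℂ × ℝ →L[ℝ] ℝ, Continuous fun c : ℂ => L.smulRight c := fun L =>
    (ContinuousLinearMap.smulRightL ℝ (ℂ × ℝ) ℂ L).continuous
  exact (((hsr _).comp_continuousOn (hc _)).add ((hsr _).comp_continuousOn (hc _))).add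
    ((hsr _).comp_continuousOn (hc _))

/-- Fourier inversion along a fibre. -/
theorem mult_one {z : ℂ} (hp : IsPeriodic u) (hc : Continuous fun θ => u (z, θ))
    (hs : Summable fun l => ‖fcoef l u z‖) (θ : ℝ) : mult 1 u (z, θ) = u (z, θ) := by
  haveI : Fact (0 < 2 * Real.pi) := ⟨Real.two_pi_pos⟩
  have hper := hp.periodic z
  set f : C(AddCircle (2 * Real.pi), ℂ) :=
    ⟨hper.lift, continuous_coinduced_dom.2 hc⟩ with hf
  have hcoef : ∀ l, fourierCoeff f l = fcoef l u z := by
    intro l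
    rw [fourierCoeff_eq_intervalIntegral f l 0, fcoef, zero_add, real_smul]
    push_cast
    congr 1
    refine intervalIntegral.integral_congr fun φ _ => ?_
    have h1 : f ((φ : ℝ) : AddCircle (2 * Real.pi)) = u (z, φ) := hper.lift_coe φ
    simp only [h1, fourier_coe_apply, smul_eq_mul]
    rw [mul_comm]
    congr 2
    have : (Real.pi : ℂ) ≠ 0 := by exact_mod_cast Real.pi_ne_zero
    push_cast
    field_simp
  have h1 := has_pointwise_sum_fourier_series_of_summable (f := f)
    (Summable.of_norm (by simpa only [hcoef] using hs)) (θ : AddCircle (2 * Real.pi))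
  have h2 : f ((θ : ℝ) : AddCircle (2 * Real.pi)) = u (z, θ) := hper.lift_coe θ
  rw [h2] at h1
  rw [← h1.tsum_eq, mult]
  congr 1; funext l
  rw [hcoef, fourier_coe_apply, mode_eq, smul_eq_mul, Pi.one_apply, one_mul, mul_comm]
  congr 2
  have : (Real.pi : ℂ) ≠ 0 := by exact_mod_cast Real.pi_ne_zero
  push_cast
  field_simp

/-- Bounded multipliers are bounded in mean square along the fibres. -/
theorem integral_norm_sq_mult_le {z : ℂ} (hp : IsPeriodic u) (hc : Continuous fun θ => u (z, θ))
    (hs : Summable fun l => ‖fcoef l u z‖) (hm : ∀ l, ‖m l‖ ≤ 1) :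
    ∫ θ in (0 : ℝ)..2 * Real.pi, ‖mult m u (z, θ)‖ ^ 2 ≤
      ∫ θ in (0 : ℝ)..2 * Real.pi, ‖u (z, θ)‖ ^ 2 := by
  have hs1 := summable_norm_mul_fcoef hm hs
  have hsq : ∀ {a : ℤ → ℂ}, (Summable fun l => ‖a l‖) → Summable fun l => ‖a l‖ ^ 2 := by
    intro a ha
    refine Summable.of_nonneg_of_le (fun _ => by positivity) (fun l => ?_)
      (ha.mul_left (∑' l, ‖a l‖))
    rw [sq]
    gcongr
    exact ha.le_tsum l fun _ _ => norm_nonneg _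
  -- Fourier inversion and Parseval reduce the comparison to one between coefficients.
  have h1 : ∫ θ in (0 : ℝ)..2 * Real.pi, ‖u (z, θ)‖ ^ 2 = 2 * Real.pi * ∑' l, ‖fcoef l u z‖ ^ 2 := by
    rw [← integral_norm_sq_trig hs]
    congr 1; funext θ
    rw [← mult_one hp hc hs θ, mult_eq_trig]
    simp
  rw [h1]
  simp only [mult_eq_trig]
  rw [integral_norm_sq_trig hs1]
  have h2 : ∀ l, ‖m l * fcoef l u z‖ ^ 2 ≤ ‖fcoef l u z‖ ^ 2 := fun l => by
    rw [norm_mul]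
    gcongr
    exact mul_le_of_le_one_left (norm_nonneg _) (hm l)
  exact mul_le_mul_of_nonneg_left ((hsq hs1).tsum_le_tsum h2 (hsq hs)) Real.two_pi_pos.le

end IsothermalSurface

end

/-! ### The shifted Hilbert transform and its commutator with X -/

noncomputable section

namespace IsothermalSurface

variable {O : Set ℂ} {u v : ℂ × ℝ → ℂ}

/-- The multiplier of the shifted Hilbert transform. -/
def hilbertMult (k l : ℤ) : ℂ := -I * ((l - k).sign : ℂ)

theorem hilbert_eq_mult (k : ℤ) (u : ℂ × ℝ → ℂ) : hilbert k u = mult (hilbertMult k) u := rfl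

theorem norm_hilbertMult_le (k l : ℤ) : ‖hilbertMult k l‖ ≤ 1 := by
  rw [hilbertMult, norm_mul, norm_neg, norm_I, one_mul]
  rcases lt_trichotomy (l - k) 0 with h | h | h
  · simp [Int.sign_eq_neg_one_of_neg h]
  · simp [h]
  · simp [Int.sign_eq_one_of_pos h]

theorem hilbertMult_of_lt {k l : ℤ} (h : l < k) : hilbertMult k l = I := by
  rw [hilbertMult, Int.sign_eq_neg_one_of_neg (by omega)]; simp

theorem hilbertMult_of_gt {k l : ℤ} (h : k < l) : hilbertMult k l = -I := by
  rw [hilbertMult, Int.sign_eq_one_of_pos (by omega)]; simp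

theorem hilbertMult_self (k : ℤ) : hilbertMult k k = 0 := by simp [hilbertMult]

theorem mult_add {m : ℤ → ℂ} (hm : ∀ l, ‖m l‖ ≤ 1) {p : ℂ × ℝ}
    (hu : Continuous fun θ => u (p.1, θ)) (hv : Continuous fun θ => v (p.1, θ))
    (hsu : Summable fun l => ‖fcoef l u p.1‖) (hsv : Summable fun l => ‖fcoef l v p.1‖) :
    mult m (fun q => u q + v q) p = mult m u p + mult m v p := by
  simp only [mult, mode_add _ hu hv, mul_add]
  exact (summable_mult hm hsu).tsum_add (summable_mult hm hsv)

theorem mult_mul_left (m : ℤ → ℂ) (c : ℂ → ℂ) (u : ℂ × ℝ → ℂ) (p : ℂ × ℝ) :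
    mult m (fun q => c q.1 * u q) p = c p.1 * mult m u p := by
  simp only [mult, mode_mul_left, ← tsum_mul_left]
  congr 1; funext l; ring

/-- Multiplication by e^{inθ} shifts all fibre degrees by n, and therefore shifts the centre of the
sign sequence. -/
theorem hilbert_exp_mul (k n : ℤ) (u : ℂ × ℝ → ℂ) (p : ℂ × ℝ) :
    hilbert k (fun q => exp (n * q.2 * I) * u q) p = exp (n * p.2 * I) * hilbert (k - n) u p := by
  simp only [hilbert, mode_exp_mul, ← tsum_mul_left]
  rw [← (Equiv.subRight n).tsum_eq (fun l => exp (n * p.2 * I) *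
    (-I * ((l - (k - n)).sign : ℂ) * mode l u p))]
  congr 1; funext l
  simp only [Equiv.subRight_apply, sub_sub_sub_cancel_right]
  ring

/-- The sign sequences centred at k and at k + 1 differ only in these two degrees, by one unit each.
This finite discrepancy is the source of the commutator formula. -/
theorem hilbert_succ (k : ℤ) {p : ℂ × ℝ} (hs : Summable fun l => ‖fcoef l u p.1‖) :
    hilbert (k + 1) u p = hilbert k u p + I * (mode (k + 1) u p + mode k u p) := by
  have h1 := (summable_mult (norm_hilbertMult_le k) hs).hasSum
  have h2 := hasSum_ite_eq (k + 1) (I * mode (k + 1) u p)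
  have h3 := hasSum_ite_eq k (I * mode k u p)
  have h4 := (h1.add h2).add h3
  rw [hilbert_eq_mult, hilbert_eq_mult, mult, mult, mul_add, ← add_assoc, ← h4.tsum_eq]
  congr 1; funext l
  rcases lt_trichotomy l k with h | rfl | h
  · rw [hilbertMult_of_lt h, hilbertMult_of_lt (by omega), if_neg (by omega), if_neg (by omega)]
    ring
  · rw [hilbertMult_self, hilbertMult_of_lt (by omega), if_neg (by omega), if_pos rfl]
    ring
  · rcases (show k + 1 ≤ l from h).eq_or_lt with rfl | h'
    · rw [hilbertMult_self, hilbertMult_of_gt h, if_pos rfl, if_neg (by omega)]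
      ring
    · rw [hilbertMult_of_gt h, hilbertMult_of_gt h', if_neg (by omega), if_neg (by omega)]
      ring

/-- First order operators with coefficients depending on the base point only. -/
def baseOp (c : ℂ → ℂ × ℂ × ℂ) (u : ℂ × ℝ → ℂ) (q : ℂ × ℝ) : ℂ :=
  ((c q.1).1 * dir (1, 0) u q + (c q.1).2.1 * dir (I, 0) u q) + (c q.1).2.2 * dir (0, 1) u q

section
variable (hO : IsOpen O) (hu : FibreSmooth O u) {p : ℂ × ℝ} (hp : p.1 ∈ O) (c : ℂ → ℂ × ℂ × ℂ)
include hu hp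

theorem FibreSmooth.continuous_mul_dir (a : ℂ) (v : ℂ × ℝ) :
    Continuous fun θ => a * IsothermalSurface.dir v u (p.1, θ) :=
  continuous_const.mul ((hu.dir _).continuous_fibre hp)

theorem FibreSmooth.continuous_baseOp : Continuous fun θ => baseOp c u (p.1, θ) :=
  ((hu.continuous_mul_dir hp (c p.1).1 (1, 0)).add (hu.continuous_mul_dir hp (c p.1).2.1 (I, 0))).add
    (hu.continuous_mul_dir hp (c p.1).2.2 (0, 1))

include hO

theorem FibreSmooth.fcoef_baseOp (l : ℤ) : fcoef l (baseOp c u) p.1 =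
    ((c p.1).1 * fcoef l (IsothermalSurface.dir (1, 0) u) p.1 +
      (c p.1).2.1 * fcoef l (IsothermalSurface.dir (I, 0) u) p.1) +
      (c p.1).2.2 * fcoef l (IsothermalSurface.dir (0, 1) u) p.1 := by
  rw [← fcoef_mul_left (fun z => (c z).1), ← fcoef_mul_left (fun z => (c z).2.1),
    ← fcoef_mul_left (fun z => (c z).2.2),
    ← fcoef_add l (hu.continuous_mul_dir hp (c p.1).1 (1, 0))
      (hu.continuous_mul_dir hp (c p.1).2.1 (I, 0))]
  exact fcoef_add l ((hu.continuous_mul_dir hp (c p.1).1 (1, 0)).add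
    (hu.continuous_mul_dir hp (c p.1).2.1 (I, 0))) (hu.continuous_mul_dir hp (c p.1).2.2 (0, 1))

theorem FibreSmooth.summable_baseOp : Summable fun l => ‖fcoef l (baseOp c u) p.1‖ := by
  simp only [hu.fcoef_baseOp hO hp]
  refine Summable.of_nonneg_of_le (fun _ => norm_nonneg _) (fun l => norm_add₃_le)
    (((((hu.dir (1, 0)).summable_fcoef hO hp).mul_left ‖(c p.1).1‖).add
      (((hu.dir (I, 0)).summable_fcoef hO hp).mul_left ‖(c p.1).2.1‖)).add
      (((hu.dir (0, 1)).summable_fcoef hO hp).mul_left ‖(c p.1).2.2‖) |>.congr fun l => ?_)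
  simp only [norm_mul]

theorem FibreSmooth.mode_baseOp (l : ℤ) :
    IsothermalSurface.mode l (baseOp c u) p = baseOp c (IsothermalSurface.mode l u) p := by
  rw [mode_eq, hu.fcoef_baseOp hO hp]
  simp only [baseOp, IsothermalSurface.dir, (mode_fderiv hO hu hp l).2]
  simp only [mode_eq]
  ring

/-- The coefficients are constant on each fibre and the coordinate derivatives commute with
multipliers. Only the factors e^{±iθ} in X and X_⊥ fail to commute with H_(k). -/
theorem FibreSmooth.mult_baseOp {m : ℤ → ℂ} (hm : ∀ l, ‖m l‖ ≤ 1) :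
    mult m (baseOp c u) p = baseOp c (mult m u) p := by
  have hs : ∀ v (c : ℂ → ℂ), Summable fun l =>
      ‖fcoef l (fun q => c q.1 * IsothermalSurface.dir v u q) p.1‖ := fun v c => by
    simp only [fcoef_mul_left, norm_mul]
    exact ((hu.dir v).summable_fcoef hO hp).mul_left _
  have hc : ∀ v (c : ℂ → ℂ), Continuous fun θ => c p.1 * IsothermalSurface.dir v u (p.1, θ) :=
    fun v c => continuous_const.mul ((hu.dir v).continuous_fibre hp)
  have hc2 : Continuous fun θ => (c p.1).1 * IsothermalSurface.dir (1, 0) u (p.1, θ) +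
      (c p.1).2.1 * IsothermalSurface.dir (I, 0) u (p.1, θ) :=
    (hc (1, 0) fun z => (c z).1).add (hc (I, 0) fun z => (c z).2.1)
  have hs2 : Summable fun l => ‖fcoef l (fun q => (c q.1).1 * IsothermalSurface.dir (1, 0) u q +
      (c q.1).2.1 * IsothermalSurface.dir (I, 0) u q) p.1‖ := by
    have h : ∀ l, fcoef l (fun q => (c q.1).1 * IsothermalSurface.dir (1, 0) u q +
      (c q.1).2.1 * IsothermalSurface.dir (I, 0) u q) p.1 = _ := fun l =>
      fcoef_add l (hc (1, 0) fun z => (c z).1) (hc (I, 0) fun z => (c z).2.1)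
    simp only [h]
    exact Summable.of_nonneg_of_le (fun _ => norm_nonneg _) (fun l => norm_add_le _ _)
      ((hs (1, 0) fun z => (c z).1).add (hs (I, 0) fun z => (c z).2.1))
  rw [show baseOp c u = fun q => ((c q.1).1 * IsothermalSurface.dir (1, 0) u q +
    (c q.1).2.1 * IsothermalSurface.dir (I, 0) u q) + (c q.1).2.2 * IsothermalSurface.dir (0, 1) u q
    from rfl, mult_add hm hc2 (hc (0, 1) fun z => (c z).2.2) hs2 (hs (0, 1) fun z => (c z).2.2),
    mult_add hm (hc (1, 0) fun z => (c z).1) (hc (I, 0) fun z => (c z).2.1)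
      (hs (1, 0) fun z => (c z).1) (hs (I, 0) fun z => (c z).2.1),
    mult_mul_left m (fun z => (c z).1), mult_mul_left m (fun z => (c z).2.1),
    mult_mul_left m (fun z => (c z).2.2)]
  simp only [baseOp, IsothermalSurface.dir, (mult_fderiv hO hu hm hp).2]

end

variable (S : IsothermalSurface)

/-- The coefficients of the raising operator `½ (X + i X_⊥) = exp (iθ) A`. -/
def raiseCoef (z : ℂ) : ℂ × ℂ × ℂ :=
  let e : ℂ := (Real.exp (-S.lam z) / 2 : ℝ)
  (e, -I * e, (I * (fderiv ℝ S.lam z 1 : ℝ) + (fderiv ℝ S.lam z I : ℝ)) * e)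

/-- The coefficients of the lowering operator `½ (X - i X_⊥) = exp (-iθ) B`. -/
def lowerCoef (z : ℂ) : ℂ × ℂ × ℂ :=
  let e : ℂ := (Real.exp (-S.lam z) / 2 : ℝ)
  (e, I * e, (-I * (fderiv ℝ S.lam z 1 : ℝ) + (fderiv ℝ S.lam z I : ℝ)) * e)

theorem exp_fibre_eq (θ : ℝ) : exp (θ * I) = (Real.cos θ : ℂ) + (Real.sin θ : ℂ) * I := by
  rw [exp_mul_I]; push_cast; rfl

theorem fderiv_lam_exp (z : ℂ) (θ : ℝ) : fderiv ℝ S.lam z (exp (θ * I)) =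
    Real.cos θ * fderiv ℝ S.lam z 1 + Real.sin θ * fderiv ℝ S.lam z I := by
  rw [S.fderiv_lam_expansion, exp_fibre_eq]
  simp [-ofReal_cos, -ofReal_sin]

theorem fderiv_lam_I_exp (z : ℂ) (θ : ℝ) : fderiv ℝ S.lam z (I * exp (θ * I)) =
    -Real.sin θ * fderiv ℝ S.lam z 1 + Real.cos θ * fderiv ℝ S.lam z I := by
  rw [S.fderiv_lam_expansion, exp_fibre_eq]
  simp [mul_add, ← mul_assoc, mul_comm I, -ofReal_cos, -ofReal_sin]

theorem geodField_eq (p : ℂ × ℝ) : S.geodField p =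
    (Real.exp (-S.lam p.1) * Real.cos p.2) • ((1, 0) : ℂ × ℝ) +
    (Real.exp (-S.lam p.1) * Real.sin p.2) • ((I, 0) : ℂ × ℝ) +
    (Real.exp (-S.lam p.1) * (-Real.sin p.2 * fderiv ℝ S.lam p.1 1 +
      Real.cos p.2 * fderiv ℝ S.lam p.1 I)) • ((0, 1) : ℂ × ℝ) := by
  refine Prod.ext ?_ ?_
  · simp only [geodField, Prod.smul_mk, Prod.mk_add_mk, smul_zero, add_zero, exp_fibre_eq]
    simp only [real_smul, ofReal_mul]; ring
  · simp only [geodField, Prod.smul_mk, Prod.mk_add_mk, smul_eq_mul, smul_zero, fderiv_lam_I_exp]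
    ring

theorem perpField_eq (p : ℂ × ℝ) : S.perpField p =
    (Real.exp (-S.lam p.1) * Real.sin p.2) • ((1, 0) : ℂ × ℝ) +
    (-Real.exp (-S.lam p.1) * Real.cos p.2) • ((I, 0) : ℂ × ℝ) +
    (Real.exp (-S.lam p.1) * (Real.cos p.2 * fderiv ℝ S.lam p.1 1 +
      Real.sin p.2 * fderiv ℝ S.lam p.1 I)) • ((0, 1) : ℂ × ℝ) := by
  refine Prod.ext ?_ ?_
  · simp only [perpField, Prod.smul_mk, Prod.mk_add_mk, smul_zero, add_zero, exp_fibre_eq]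
    simp only [real_smul, ofReal_mul, ofReal_neg]
    linear_combination (-(Real.exp (-S.lam p.1) : ℂ) * (Real.sin p.2 : ℂ)) * I_sq
  · simp only [perpField, Prod.smul_mk, Prod.mk_add_mk, smul_eq_mul, smul_zero, fderiv_lam_exp]
    ring

/-- Splits X into parts raising and lowering the fibre degree by one; `Xperp_eq` does the same with
-i times their difference. All degree bookkeeping rests on this pair. -/
theorem X_eq (u : ℂ × ℝ → ℂ) : S.X u = fun q => exp ((1 : ℤ) * q.2 * I) * baseOp S.raiseCoef u q +
    exp ((-1 : ℤ) * q.2 * I) * baseOp S.lowerCoef u q := by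
  funext q
  have h1 : exp ((1 : ℤ) * q.2 * I) = (Real.cos q.2 : ℂ) + (Real.sin q.2 : ℂ) * I := by
    rw [← exp_fibre_eq]; simp
  have h2 : exp ((-1 : ℤ) * q.2 * I) = (Real.cos q.2 : ℂ) - (Real.sin q.2 : ℂ) * I := by
    have := exp_fibre_eq (-q.2)
    rw [Real.cos_neg, Real.sin_neg, ofReal_neg, ofReal_neg] at this
    simpa [sub_eq_add_neg] using this
  rw [X, geodField_eq, h1, h2]
  simp only [map_add, map_smul, baseOp, raiseCoef, lowerCoef, dir, real_smul, ofReal_mul, ofReal_add,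
    ofReal_neg, ofReal_div, ofReal_ofNat]
  generalize (Real.exp (-S.lam q.1) : ℂ) = e
  generalize (Real.cos q.2 : ℂ) = x
  generalize (Real.sin q.2 : ℂ) = y
  ring_nf
  simp only [I_sq]
  ring

theorem Xperp_eq (u : ℂ × ℝ → ℂ) : S.Xperp u = fun q => -I * (exp ((1 : ℤ) * q.2 * I) *
    baseOp S.raiseCoef u q - exp ((-1 : ℤ) * q.2 * I) * baseOp S.lowerCoef u q) := by
  funext q
  have h1 : exp ((1 : ℤ) * q.2 * I) = (Real.cos q.2 : ℂ) + (Real.sin q.2 : ℂ) * I := by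
    rw [← exp_fibre_eq]; simp
  have h2 : exp ((-1 : ℤ) * q.2 * I) = (Real.cos q.2 : ℂ) - (Real.sin q.2 : ℂ) * I := by
    have := exp_fibre_eq (-q.2)
    rw [Real.cos_neg, Real.sin_neg, ofReal_neg, ofReal_neg] at this
    simpa [sub_eq_add_neg] using this
  rw [Xperp, perpField_eq, h1, h2]
  simp only [map_add, map_smul, baseOp, raiseCoef, lowerCoef, dir, real_smul, ofReal_mul, ofReal_add,
    ofReal_neg, ofReal_div, ofReal_ofNat]
  generalize (Real.exp (-S.lam q.1) : ℂ) = e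
  generalize (Real.cos q.2 : ℂ) = x
  generalize (Real.sin q.2 : ℂ) = y
  ring_nf
  simp only [I_sq, I_pow_three]
  ring

theorem continuous_exp_fibre (n : ℤ) : Continuous fun θ : ℝ => exp (n * θ * I) := by fun_prop

theorem FibreSmooth.mode_X (hO : IsOpen O) (hu : FibreSmooth O u) {p : ℂ × ℝ} (hp : p.1 ∈ O)
    (l : ℤ) : IsothermalSurface.mode l (S.X u) p =
      exp ((1 : ℤ) * p.2 * I) * baseOp S.raiseCoef (IsothermalSurface.mode (l - 1) u) p +
      exp ((-1 : ℤ) * p.2 * I) * baseOp S.lowerCoef (IsothermalSurface.mode (l + 1) u) p := by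
  rw [X_eq, mode_add, mode_exp_mul, mode_exp_mul, hu.mode_baseOp hO hp, hu.mode_baseOp hO hp,
    sub_neg_eq_add]
  · exact (continuous_exp_fibre _).mul (hu.continuous_baseOp hp _)
  · exact (continuous_exp_fibre _).mul (hu.continuous_baseOp hp _)

theorem FibreSmooth.mode_Xperp (hO : IsOpen O) (hu : FibreSmooth O u) {p : ℂ × ℝ} (hp : p.1 ∈ O)
    (l : ℤ) : IsothermalSurface.mode l (S.Xperp u) p =
      -I * (exp ((1 : ℤ) * p.2 * I) * baseOp S.raiseCoef (IsothermalSurface.mode (l - 1) u) p -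
      exp ((-1 : ℤ) * p.2 * I) * baseOp S.lowerCoef (IsothermalSurface.mode (l + 1) u) p) := by
  rw [Xperp_eq, mode_const_mul, mode_sub, mode_exp_mul, mode_exp_mul, hu.mode_baseOp hO hp,
    hu.mode_baseOp hO hp, sub_neg_eq_add]
  · exact (continuous_exp_fibre _).mul (hu.continuous_baseOp hp _)
  · exact (continuous_exp_fibre _).mul (hu.continuous_baseOp hp _)

/-- The commutator of the geodesic vector field and the shifted Hilbert transform. -/
theorem FibreSmooth.X_hilbert (hO : IsOpen O) (hu : FibreSmooth O u) {p : ℂ × ℝ} (hp : p.1 ∈ O)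
    (k : ℤ) : S.X (IsothermalSurface.hilbert k u) p = IsothermalSurface.hilbert k (S.X u) p -
      IsothermalSurface.mode k (S.Xperp u) p - S.Xperp (IsothermalSurface.mode k u) p := by
  have hm := norm_hilbertMult_le k
  have hA := hu.continuous_baseOp hp S.raiseCoef
  have hB := hu.continuous_baseOp hp S.lowerCoef
  have hsA := hu.summable_baseOp hO hp S.raiseCoef
  have hsB := hu.summable_baseOp hO hp S.lowerCoef
  have hexp : ∀ (n : ℤ) (w : ℂ × ℝ → ℂ), (Summable fun l => ‖fcoef l w p.1‖) →
      Summable fun l => ‖fcoef l (fun q => exp (n * q.2 * I) * w q) p.1‖ := by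
    intro n w hw
    have h : ∀ l, ‖fcoef l (fun q => exp (n * q.2 * I) * w q) p.1‖ = ‖fcoef (l - n) w p.1‖ := by
      intro l
      rw [← norm_mode l _ p, mode_exp_mul, norm_mul, norm_exp_int_mul, one_mul, norm_mode]
    simp only [h]
    exact (Equiv.subRight n).summable_iff.2 hw
  -- Passing e^{iθ} and e^{-iθ} through H_(k) recentres it at k - 1 and k + 1. Restoring the centre
  -- k by `hilbert_succ` leaves terms that regroup as (X_⊥ u)_k and X_⊥ u_k.
  have h1 : IsothermalSurface.hilbert k (S.X u) p = exp ((1 : ℤ) * p.2 * I) *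
      IsothermalSurface.hilbert (k - 1) (baseOp S.raiseCoef u) p + exp ((-1 : ℤ) * p.2 * I) *
      IsothermalSurface.hilbert (k + 1) (baseOp S.lowerCoef u) p := by
    rw [X_eq, hilbert_eq_mult, mult_add hm ((continuous_exp_fibre 1).mul hA)
      ((continuous_exp_fibre (-1)).mul hB) (hexp 1 _ hsA) (hexp (-1) _ hsB), ← hilbert_eq_mult,
      ← hilbert_eq_mult, hilbert_exp_mul, hilbert_exp_mul, sub_neg_eq_add]
  have h2 := hilbert_succ (k - 1) hsA
  have h3 := hilbert_succ k hsB
  rw [sub_add_cancel] at h2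
  rw [h1, hu.mode_Xperp S hO hp, S.X_eq, S.Xperp_eq, hilbert_eq_mult]
  simp only []
  rw [← hu.mult_baseOp hO hp _ hm,
    ← hu.mult_baseOp hO hp _ hm, ← hilbert_eq_mult, ← hilbert_eq_mult, h2, h3,
    hu.mode_baseOp hO hp, hu.mode_baseOp hO hp, hu.mode_baseOp hO hp, hu.mode_baseOp hO hp]
  ring

theorem FibreSmooth.mode_hilbert (hO : IsOpen O) (hu : FibreSmooth O u) {p : ℂ × ℝ} (hp : p.1 ∈ O)
    (k l : ℤ) : IsothermalSurface.mode l (IsothermalSurface.hilbert k u) p =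
      hilbertMult k l * IsothermalSurface.mode l u p :=
  mode_mult (norm_hilbertMult_le k) (hu.summable_fcoef hO hp) l

end IsothermalSurface

end

/-! ### Parity, homogeneous functions, and the equations for the transformed solutions -/

noncomputable section

namespace IsothermalSurface

open Classical in
/-- The sign `(-1)^n`. -/
def par (n : ℤ) : ℂ := if Even n then 1 else -1

theorem par_add_one (n : ℤ) : par (n + 1) = -par n := by
  unfold par
  by_cases h : Even n <;> simp [h, Int.even_add_one]

theorem par_mul_self (n : ℤ) : par n * par n = 1 := by
  unfold par
  by_cases h : Even n <;> simp [h]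

theorem exp_int_mul_pi (n : ℤ) : exp (n * Real.pi * I) = par n := by
  unfold par
  split_ifs with h
  · obtain ⟨m, rfl⟩ := h
    rw [← exp_int_mul_two_pi_mul_I m]
    congr 1; push_cast; ring
  · obtain ⟨m, rfl⟩ := Int.not_even_iff_odd.1 h
    rw [show ((2 * m + 1 : ℤ) : ℂ) * Real.pi * I = m * (2 * Real.pi * I) + Real.pi * I by
      push_cast; ring, Complex.exp_add, exp_int_mul_two_pi_mul_I, exp_pi_mul_I, one_mul]

theorem parityPart_eq (n : ℤ) (u : ℂ × ℝ → ℂ) (p : ℂ × ℝ) :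
    parityPart n u p = (u p + par n * u (rev p)) / 2 := by
  unfold parityPart par
  split_ifs with h
  · ring
  · ring

theorem exp_rev (n : ℤ) (θ : ℝ) :
    exp (n * ((θ + Real.pi : ℝ) : ℂ) * I) = par n * exp (n * θ * I) := by
  rw [← exp_int_mul_pi, ← Complex.exp_add]; congr 1; push_cast; ring

theorem fcoef_comp_rev {u : ℂ × ℝ → ℂ} (hu : IsPeriodic u) (l : ℤ) (z : ℂ) :
    fcoef l (fun q => u (rev q)) z = par l * fcoef l u z := by
  have h1 : ∀ φ : ℝ, u (rev (z, φ)) * exp (-(l * φ * I)) =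
      par l * (fun φ : ℝ => u (z, φ) * exp (-(l * φ * I))) (φ + Real.pi) := by
    intro φ
    have : exp (-(l * φ * I)) = par l * exp (-(l * ((φ + Real.pi : ℝ) : ℂ) * I)) := by
      rw [← exp_int_mul_pi, ← Complex.exp_add]; congr 1; push_cast; ring
    simp only [rev, this]; ring
  have hper : Function.Periodic (fun φ : ℝ => u (z, φ) * exp (-(l * φ * I))) (2 * Real.pi) := by
    intro φ
    have h2 := exp_fibre_periodic (-l) φ
    simp only [Int.cast_neg, neg_mul] at h2
    simp only [h2, hu.periodic z φ]
  have h3 := hper.intervalIntegral_add_eq Real.pi 0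
  simp only [fcoef, h1, intervalIntegral.integral_const_mul]
  have h4 := intervalIntegral.integral_comp_add_right (a := 0) (b := 2 * Real.pi)
    (fun φ : ℝ => u (z, φ) * exp (-(l * φ * I))) Real.pi
  rw [zero_add, add_comm (2 * Real.pi), h3, zero_add] at h4
  rw [h4]
  ring

theorem mode_comp_rev {u : ℂ × ℝ → ℂ} (hu : IsPeriodic u) (l : ℤ) (p : ℂ × ℝ) :
    mode l (fun q => u (rev q)) p = par l * mode l u p := by
  rw [mode_eq, mode_eq, fcoef_comp_rev hu]; ring

theorem mode_parityPart {u : ℂ × ℝ → ℂ} {p : ℂ × ℝ} (hu : IsPeriodic u)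
    (hc : Continuous fun θ => u (p.1, θ)) (n l : ℤ) :
    mode l (parityPart n u) p = (1 + par n * par l) / 2 * mode l u p := by
  have h1 : parityPart n u = fun q => 1 / 2 * (u q + par n * u (rev q)) := by
    funext q; rw [parityPart_eq]; ring
  have h2 : Continuous fun θ => u (rev (p.1, θ)) := hc.comp (continuous_id.add continuous_const)
  rw [h1, mode_const_mul, mode_add l hc (continuous_const.mul h2), mode_const_mul, mode_comp_rev hu]
  ring

theorem mode_parityPart_self {u : ℂ × ℝ → ℂ} {p : ℂ × ℝ} (hu : IsPeriodic u)
    (hc : Continuous fun θ => u (p.1, θ)) (n : ℤ) : mode n (parityPart n u) p = mode n u p := by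
  rw [mode_parityPart hu hc, par_mul_self]; ring

theorem mode_parityPart_succ {u : ℂ × ℝ → ℂ} {p : ℂ × ℝ} (hu : IsPeriodic u)
    (hc : Continuous fun θ => u (p.1, θ)) (n : ℤ) : mode n (parityPart (n + 1) u) p = 0 := by
  rw [mode_parityPart hu hc, par_add_one, neg_mul, par_mul_self]; ring

theorem isPeriodic_parityPart {u : ℂ × ℝ → ℂ} (hu : IsPeriodic u) (n : ℤ) :
    IsPeriodic (parityPart n u) := fun p => by
  simp only [parityPart_eq, hu p, hu (rev p)]

variable {O : Set ℂ} {u : ℂ × ℝ → ℂ}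

theorem FibreSmooth.comp_rev (hu : FibreSmooth O u) : FibreSmooth O fun q => u (rev q) :=
  ⟨hu.1.comp_rev, fun p hp => ContDiffAt.comp p (hu.2 (rev p) hp) contDiff_rev.contDiffAt⟩

theorem FibreSmooth.parityPart (hu : FibreSmooth O u) (n : ℤ) :
    FibreSmooth O (parityPart n u) := by
  refine ⟨isPeriodic_parityPart hu.1 n, fun p hp => ?_⟩
  have h1 : IsothermalSurface.parityPart n u = fun q => (u q + par n * u (rev q)) / 2 :=
    funext fun q => parityPart_eq n u q
  rw [h1]
  exact ((hu.2 p hp).add (contDiffAt_const.mul (hu.comp_rev.2 p hp))).div_const _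

theorem fderiv_parityPart (hu : FibreSmooth O u) (n : ℤ) {p : ℂ × ℝ} (hp : p.1 ∈ O) (v : ℂ × ℝ) :
    fderiv ℝ (parityPart n u) p v = (fderiv ℝ u p v + par n * fderiv ℝ (fun q => u (rev q)) p v) / 2 := by
  have h1 : parityPart n u = fun q => (1 / 2 : ℂ) * (u q + par n * u (rev q)) :=
    funext fun q => by rw [parityPart_eq]; ring
  have h2 : HasFDerivAt (fun q => (1 / 2 : ℂ) * (u q + par n * u (rev q))) _ p :=
    ((hu.differentiableAt hp).hasFDerivAt.add
    ((hu.comp_rev.differentiableAt hp).hasFDerivAt.const_mul (par n))).const_mul (1 / 2 : ℂ)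
  rw [h1, h2.fderiv]
  simp; ring

variable (S : IsothermalSurface)

/-- X changes sign under θ ↦ θ + π, so it exchanges even and odd parts. -/
theorem FibreSmooth.X_parityPart (hu : FibreSmooth O u) (n : ℤ) {p : ℂ × ℝ} (hp : p.1 ∈ O) :
    S.X (IsothermalSurface.parityPart n u) p = IsothermalSurface.parityPart (n + 1) (S.X u) p := by
  have h := S.X_comp_rev u p
  rw [X] at h
  rw [X, fderiv_parityPart hu n hp, h, parityPart_eq, par_add_one]; simp only [X]; ring

theorem FibreSmooth.Xperp_parityPart (hu : FibreSmooth O u) (n : ℤ) {p : ℂ × ℝ} (hp : p.1 ∈ O) :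
    S.Xperp (IsothermalSurface.parityPart n u) p =
      IsothermalSurface.parityPart (n + 1) (S.Xperp u) p := by
  have h := S.Xperp_comp_rev u p
  rw [Xperp] at h
  rw [Xperp, fderiv_parityPart hu n hp, h, parityPart_eq, par_add_one]; simp only [Xperp]; ring

/-! Smooth functions homogeneous of degree `k` along the fibres. -/

variable {k : ℤ} {f : ℂ × ℝ → ℂ}

theorem Omega_eq (hf : f ∈ Omega k) (p : ℂ × ℝ) : f p = exp (k * p.2 * I) * f (p.1, 0) := by
  obtain ⟨hs, hd⟩ := hf
  have h1 : ∀ θ : ℝ, HasDerivAt (fun θ : ℝ => exp (-(k * θ * I)) * f (p.1, θ)) 0 θ := by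
    intro θ
    have e1 : HasDerivAt (fun θ : ℝ => f (p.1, θ)) (I * k * f (p.1, θ)) θ := by
      rw [← hd]
      exact (hs.differentiable (by simp) (p.1, θ)).hasFDerivAt.comp_hasDerivAt θ
        ((hasDerivAt_const θ p.1).prodMk (hasDerivAt_id θ))
    have e2 : HasDerivAt (fun φ : ℝ => -((k : ℂ) * φ * I)) (-(k * I)) θ := by
      have h := (((hasDerivAt_id θ).ofReal_comp.const_mul (k : ℂ)).mul_const I).neg
      simp only [id, ofReal_one, mul_one] at h
      exact h
    refine (e2.cexp.mul e1).congr_deriv ?_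
    ring
  have h2 := is_const_of_deriv_eq_zero (fun θ => (h1 θ).differentiableAt) (fun θ => (h1 θ).deriv) p.2 0
  simp only [ofReal_zero, mul_zero, zero_mul, neg_zero, Complex.exp_zero, one_mul] at h2
  rw [← h2, ← mul_assoc, ← Complex.exp_add, add_neg_cancel, Complex.exp_zero, one_mul]

theorem Omega_isPeriodic (hf : f ∈ Omega k) : IsPeriodic f := isPeriodic_iff.2 fun z θ => by
  rw [Omega_eq hf (z, θ + _), Omega_eq hf (z, θ), exp_fibre_periodic]

theorem Omega_fibreSmooth (hf : f ∈ Omega k) (O : Set ℂ) : FibreSmooth O f :=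
  ⟨Omega_isPeriodic hf, fun _ _ => hf.1.contDiffAt⟩

theorem Omega_rev (hf : f ∈ Omega k) (p : ℂ × ℝ) : f (rev p) = par k * f p := by
  rw [Omega_eq hf (rev p), Omega_eq hf p]
  simp only [rev, exp_rev]; ring

theorem Omega_mode (hf : f ∈ Omega k) (l : ℤ) (p : ℂ × ℝ) :
    mode l f p = if l = k then f p else 0 := by
  have h1 : f = fun q => exp (k * q.2 * I) * (fun z => f (z, 0)) q.1 := funext (Omega_eq hf)
  rw [h1]
  exact mode_of_exp_mul k l (fun z => f (z, 0)) p

theorem Omega_Xperp_rev (hf : f ∈ Omega k) (p : ℂ × ℝ) :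
    S.Xperp f (rev p) = par (k + 1) * S.Xperp f p := by
  have h1 := S.Xperp_comp_rev f p
  have h2 : (fun q => f (rev q)) = fun q => par k * f q := funext (Omega_rev hf)
  have h3 : HasFDerivAt (fun q => par k * f q) _ p :=
    ((hf.1.differentiable (by simp) p).hasFDerivAt.const_mul (par k))
  rw [h2, Xperp, h3.fderiv] at h1
  rw [par_add_one, ← neg_eq_iff_eq_neg.2 h1, Xperp]
  simp

theorem hilbert_of_mode_eq_zero {n : ℤ} {v : ℂ × ℝ → ℂ} {p : ℂ × ℝ}
    (h : ∀ l, l ≠ n → mode l v p = 0) (k : ℤ) : hilbert k v p = hilbertMult k n * mode n v p := by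
  rw [hilbert_eq_mult, mult, tsum_eq_single n fun l hl => by rw [h l hl, mul_zero]]

theorem hilbert_neg (k : ℤ) (v : ℂ × ℝ → ℂ) (p : ℂ × ℝ) :
    hilbert k (fun q => -v q) p = -hilbert k v p := by
  have := mult_mul_left (hilbertMult k) (fun _ => -1) v p
  simpa [hilbert_eq_mult] using this

theorem Omega_hilbert (hf : f ∈ Omega k) (p : ℂ × ℝ) : hilbert k f p = 0 := by
  rw [hilbert_of_mode_eq_zero (n := k) (fun l hl => by rw [Omega_mode hf, if_neg hl]),
    hilbertMult_self, zero_mul]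

theorem baseOp_eq_of_eventuallyEq_zero {c : ℂ → ℂ × ℂ × ℂ} {p : ℂ × ℝ} (h : u =ᶠ[nhds p] fun _ => 0) :
    baseOp c u p = 0 := by
  simp [baseOp, dir, h.fderiv_eq]

/-- X_⊥ f has degrees k ± 1 only. H_(k) acts there as ∓ i, which turns -i times the difference of
the raising and lowering parts into minus their sum. -/
theorem Omega_hilbert_Xperp (hf : f ∈ Omega k) (p : ℂ × ℝ) : hilbert k (S.Xperp f) p = -S.X f p := by
  have hu := Omega_fibreSmooth hf univ
  have h0 : ∀ l, l ≠ k → mode l f = fun _ => 0 := fun l hl => funext fun q => by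
    rw [Omega_mode hf, if_neg hl]
  have hk : mode k f = f := funext fun q => by rw [Omega_mode hf, if_pos rfl]
  have hz : ∀ c, baseOp c (fun _ => 0) p = 0 := fun c =>
    baseOp_eq_of_eventuallyEq_zero (Filter.Eventually.of_forall fun _ => rfl)
  have h1 : ∀ l, mode l (S.Xperp f) p = _ := fun l => hu.mode_Xperp S isOpen_univ (mem_univ _) l
  have hp : mode (k + 1) (S.Xperp f) p = -I * (exp ((1 : ℤ) * p.2 * I) * baseOp S.raiseCoef f p) := by
    rw [h1, add_sub_cancel_right, hk, h0 _ (by omega), hz]; ring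
  have hq : mode (k - 1) (S.Xperp f) p = I * (exp ((-1 : ℤ) * p.2 * I) * baseOp S.lowerCoef f p) := by
    rw [h1, sub_add_cancel, hk, h0 _ (by omega), hz]; ring
  have hr : ∀ l, l ≠ k + 1 → l ≠ k - 1 → mode l (S.Xperp f) p = 0 := fun l hl1 hl2 => by
    rw [h1, h0 _ (by omega), h0 _ (by omega), hz, hz]; ring
  rw [hilbert_eq_mult, mult, tsum_eq_sum (s := {k + 1, k - 1}) fun l hl => by
    rw [hr l (fun h => hl (by simp [h])) (fun h => hl (by simp [h])), mul_zero],
    Finset.sum_pair (by omega), hilbertMult_of_gt (by omega), hilbertMult_of_lt (by omega), hp, hq,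
    S.X_eq]
  linear_combination (exp ((1 : ℤ) * p.2 * I) * baseOp S.raiseCoef f p +
    exp ((-1 : ℤ) * p.2 * I) * baseOp S.lowerCoef f p) * I_sq

/-- The interior of the surface. -/
def inside : Set ℂ := {z | 0 < S.rho z}

theorem isOpen_inside : IsOpen S.inside := isOpen_lt continuous_const S.rho_smooth.continuous

variable {S}

theorem IsSimple.fibreSmooth_transport (h : S.IsSimple) {q : ℂ × ℝ → ℂ} (hq : ContDiff ℝ ∞ q)
    (hp : IsPeriodic q) : FibreSmooth S.inside (S.transport q) :=
  ⟨h.isPeriodic_transport hp, fun _ hp => h.contDiffAt_transport hq hp⟩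

/-- The Hilbert transform of the relevant part of `u^f`. -/
def hilbertW (S : IsothermalSurface) (k : ℤ) (f : ℂ × ℝ → ℂ) : ℂ × ℝ → ℂ :=
  hilbert k (parityPart (k + 1) (S.transport f))

/-- The Hilbert transform of the relevant part of `u^{X_⊥ h}`. -/
def hilbertWstar (S : IsothermalSurface) (k : ℤ) (h : ℂ × ℝ → ℂ) : ℂ × ℝ → ℂ :=
  hilbert k (parityPart k (S.transport (S.Xperp h)))

theorem FibreSmooth.continuous_Xperp (hu : FibreSmooth O u) {p : ℂ × ℝ} (hp : p.1 ∈ O) :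
    Continuous fun θ => S.Xperp u (p.1, θ) := by
  rw [Xperp_eq]
  exact continuous_const.mul (((continuous_exp_fibre _).mul (hu.continuous_baseOp hp _)).sub
    ((continuous_exp_fibre _).mul (hu.continuous_baseOp hp _)))

/-- The component of degree `k` of `X_⊥` applied to a shifted Hilbert transform. -/
theorem FibreSmooth.mode_Xperp_hilbert (hO : IsOpen O) (hu : FibreSmooth O u) {p : ℂ × ℝ}
    (hp : p.1 ∈ O) (k : ℤ) : IsothermalSurface.mode k (S.Xperp (IsothermalSurface.hilbert k u)) p =
      IsothermalSurface.mode k (S.X u) p := by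
  have hm := norm_hilbertMult_le k
  have h1 : ∀ θ, S.Xperp (IsothermalSurface.hilbert k u) (p.1, θ) =
      (fun q => -I * (exp ((1 : ℤ) * q.2 * I) * mult (hilbertMult k) (baseOp S.raiseCoef u) q -
        exp ((-1 : ℤ) * q.2 * I) * mult (hilbertMult k) (baseOp S.lowerCoef u) q)) (p.1, θ) := by
    intro θ
    rw [S.Xperp_eq, hilbert_eq_mult]
    simp only [hu.mult_baseOp hO (p := (p.1, θ)) hp _ hm]
  have hsA := hu.summable_baseOp hO hp S.raiseCoef
  have hsB := hu.summable_baseOp hO hp S.lowerCoef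
  rw [mode_congr (v := fun q => -I * (exp ((1 : ℤ) * q.2 * I) *
      mult (hilbertMult k) (baseOp S.raiseCoef u) q -
      exp ((-1 : ℤ) * q.2 * I) * mult (hilbertMult k) (baseOp S.lowerCoef u) q)) h1,
    mode_const_mul, mode_sub, mode_exp_mul, mode_exp_mul, mode_mult hm hsA,
    mode_mult hm hsB, hu.mode_baseOp hO hp, hu.mode_baseOp hO hp, sub_neg_eq_add, hu.mode_X S hO hp,
    hilbertMult_of_lt (by omega), hilbertMult_of_gt (by omega)]
  · linear_combination (-(exp ((1 : ℤ) * p.2 * I) *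
      baseOp S.raiseCoef (IsothermalSurface.mode (k - 1) u) p) -
      exp ((-1 : ℤ) * p.2 * I) * baseOp S.lowerCoef (IsothermalSurface.mode (k + 1) u) p) * I_sq
  · exact (continuous_exp_fibre _).mul (continuous_mult_fibre hm hsA)
  · exact (continuous_exp_fibre _).mul (continuous_mult_fibre hm hsB)

/-- f has the parity of k, so the part of u^f of the opposite parity already solves the transport
equation with the full right hand side. -/
theorem IsSimple.X_parityPart_transport (h : S.IsSimple) (hf : f ∈ Omega k) {z : ℂ}
    (hz : z ∈ S.inside) (θ : ℝ) :
    S.X (parityPart (k + 1) (S.transport f)) (z, θ) = (fun q => -f q) (z, θ) := by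
  have hu := h.fibreSmooth_transport hf.1 (Omega_isPeriodic hf)
  rw [hu.X_parityPart S (k + 1) (p := (z, θ)) hz, parityPart_eq, par_add_one, par_add_one,
    h.X_transport hf.1 (p := (z, θ)) hz, h.X_transport hf.1 (p := rev (z, θ)) hz, Omega_rev hf]
  linear_combination (-f (z, θ) / 2) * par_mul_self k

/-- In the commutator formula for this part of u^f, its k-th mode vanishes by parity and H_(k) f =
0; only the k-th mode of X_⊥ u^f survives. -/
theorem IsSimple.X_hilbertW (h : S.IsSimple) (hf : f ∈ Omega k) {p : ℂ × ℝ} (hp : p.1 ∈ S.inside) :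
    S.X (hilbertW S k f) p = -S.opW k f p := by
  have hu := h.fibreSmooth_transport hf.1 (Omega_isPeriodic hf)
  have hU := hu.parityPart (k + 1)
  have h1 := h.X_parityPart_transport hf hp
  have h2 : mode k (S.Xperp (parityPart (k + 1) (S.transport f))) p = S.opW k f p := by
    rw [mode_congr (fun θ => hu.Xperp_parityPart S (k + 1) (p := (p.1, θ)) hp),
      mode_parityPart hu.1.Xperp (hu.continuous_Xperp hp), par_add_one, par_add_one, neg_neg,
      par_mul_self, opW]
    ring
  have h3 : S.Xperp (mode k (parityPart (k + 1) (S.transport f))) p = 0 := by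
    have : mode k (parityPart (k + 1) (S.transport f)) =ᶠ[nhds p] fun _ => 0 := by
      filter_upwards [(S.isOpen_inside.preimage continuous_fst).mem_nhds hp] with q hq
      exact mode_parityPart_succ hu.1 (hu.continuous_fibre hq) k
    simp [Xperp, this.fderiv_eq]
  rw [hilbertW, hU.X_hilbert S S.isOpen_inside hp, h2, h3, hilbert_eq_mult,
    mult_congr (v := fun q => -f q) h1, ← hilbert_eq_mult, hilbert_neg, Omega_hilbert hf]
  ring

/-- In degree k the signs of H_(k) at k - 1 and k + 1 convert X_⊥ into X, and X of the relevant part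
of u^f is -f. -/
theorem IsSimple.mode_Xperp_hilbertW (h : S.IsSimple) (hf : f ∈ Omega k) {p : ℂ × ℝ}
    (hp : p.1 ∈ S.inside) : mode k (S.Xperp (hilbertW S k f)) p = -f p := by
  have hU := (h.fibreSmooth_transport hf.1 (Omega_isPeriodic hf)).parityPart (k + 1)
  rw [hilbertW, hU.mode_Xperp_hilbert S.isOpen_inside hp, 
    mode_congr (v := fun q => -f q) (h.X_parityPart_transport hf hp)]
  have := mode_const_mul (-1) k f p
  simp only [neg_one_mul] at this
  rw [this, Omega_mode hf, if_pos rfl]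

/-- For the part of u^{X_⊥ f} with the parity of k the roles are exchanged: X_⊥ of it has no k-th
mode, while its own k-th mode is W_k^* f. The term X f is -H_(k) X_⊥ f. -/
theorem IsSimple.X_hilbertWstar (h : S.IsSimple) (hf : f ∈ Omega k) {p : ℂ × ℝ}
    (hp : p.1 ∈ S.inside) : S.X (hilbertWstar S k f) p = S.X f p - S.Xperp (S.opWstar k f) p := by
  have hq := S.contDiff_Xperp hf.1
  have hu := h.fibreSmooth_transport hq (Omega_isPeriodic hf).Xperp
  have hU := hu.parityPart k
  have h1 : ∀ θ, S.X (parityPart k (S.transport (S.Xperp f))) (p.1, θ) =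
      (fun q => -S.Xperp f q) (p.1, θ) := by
    intro θ
    rw [hu.X_parityPart S k (p := (p.1, θ)) hp, parityPart_eq,
      h.X_transport hq (p := (p.1, θ)) hp, h.X_transport hq (p := rev (p.1, θ)) hp,
      Omega_Xperp_rev S hf]
    linear_combination (-S.Xperp f (p.1, θ) / 2) * par_mul_self (k + 1)
  have h2 : mode k (S.Xperp (parityPart k (S.transport (S.Xperp f)))) p = 0 := by
    rw [mode_congr (fun θ => hu.Xperp_parityPart S k (p := (p.1, θ)) hp),
      mode_parityPart_succ hu.1.Xperp (hu.continuous_Xperp hp)]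
  have h3 : S.Xperp (mode k (parityPart k (S.transport (S.Xperp f)))) p =
      S.Xperp (S.opWstar k f) p := by
    have : mode k (parityPart k (S.transport (S.Xperp f))) =ᶠ[nhds p] S.opWstar k f := by
      filter_upwards [(S.isOpen_inside.preimage continuous_fst).mem_nhds hp] with q hq
      exact mode_parityPart_self hu.1 (hu.continuous_fibre hq) k
    simp [Xperp, this.fderiv_eq]
  rw [hilbertWstar, hU.X_hilbert S S.isOpen_inside hp, h2, h3, hilbert_eq_mult,
    mult_congr (v := fun q => -S.Xperp f q) h1, ← hilbert_eq_mult, hilbert_neg,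
    Omega_hilbert_Xperp S hf]
  ring

theorem IsSimple.mode_hilbertWstar (h : S.IsSimple) (hf : f ∈ Omega k) {p : ℂ × ℝ}
    (hp : p.1 ∈ S.inside) : mode k (hilbertWstar S k f) p = 0 := by
  have hu := (h.fibreSmooth_transport (S.contDiff_Xperp hf.1)
    (Omega_isPeriodic hf).Xperp).parityPart k
  rw [hilbertWstar, hu.mode_hilbert S.isOpen_inside hp, hilbertMult_self, zero_mul]

end IsothermalSurface

end

/-! ### The signed chord and smooth extension of the boundary data -/

noncomputable section

open Filter Topology in
/-- The implicit function theorem for one unknown, with smoothness near the base point. -/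
theorem exists_smooth_root {P : Type*} [NormedAddCommGroup P] [NormedSpace ℝ P] [CompleteSpace P]
    {G : P × ℝ → ℝ} {a : P} {t : ℝ} (hG : ContDiff ℝ ∞ G) (h0 : G (a, t) = 0)
    (hd : fderiv ℝ G (a, t) (0, 1) ≠ 0) : ∃ T : P → ℝ, T a = t ∧
      (∀ᶠ x in 𝓝 a, ContDiffAt ℝ ∞ T x ∧ G (x, T x) = 0) ∧
      ∀ᶠ z in 𝓝 (a, t), G z = 0 → T z.1 = z.2 := by
  have hinv : (fderiv ℝ G (a, t) ∘L ContinuousLinearMap.inr ℝ P ℝ).IsInvertible := by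
    refine ⟨(ContinuousLinearEquiv.smulLeft (Units.mk0 _ hd) : ℝ ≃L[ℝ] ℝ), ?_⟩
    ext
    simp
  have hne : (∞ : WithTop ℕ∞) ≠ 0 := by simp
  have h1 := hG.contDiffAt.eventually_apply_eq_iff_implicitFunction hne hinv
  have h2 := hG.contDiffAt.contDiffAt_implicitFunction hne hinv
  set T := hG.contDiffAt.implicitFunction hne hinv with hT
  have hTa : T a = t := (h1.self_of_nhds.1 rfl)
  have hc : ∀ᶠ x in 𝓝 a, ContinuousAt T x := by
    filter_upwards [(contDiffAt_infty.1 h2 1).eventually (by simp)] with x hx using hx.continuousAt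
  have hlim : Tendsto (fun x => (x, T x)) (𝓝 a) (𝓝 (a, t)) := by
    have := (continuousAt_id (x := a)).prodMk hc.self_of_nhds
    rw [ContinuousAt] at this
    simpa only [hTa, id] using this
  have hz : ∀ᶠ x in 𝓝 a, G (x, T x) = 0 := by
    filter_upwards [hlim.eventually h1] with x hx
    rw [← h0]; exact hx.2 rfl
  have hd' : ∀ᶠ x in 𝓝 a, fderiv ℝ G (x, T x) (0, 1) ≠ 0 := by
    have hcd : Continuous fun z => fderiv ℝ G z (0, 1) :=
      (hG.continuous_fderiv (by simp)).clm_apply continuous_const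
    exact hlim.eventually ((hcd.tendsto (a, t)).eventually_ne hd)
  refine ⟨T, hTa, ?_, ?_⟩
  · filter_upwards [hc, hd', hz.eventually_nhds, hz] with x h1 h2 h3 h4
    exact ⟨contDiffAt_of_root hG.contDiffAt h2 h1 h3, h4⟩
  · filter_upwards [h1] with z hz h
    exact hz.1 (by rw [h, h0])

namespace IsothermalSurface

variable {S : IsothermalSurface}

open Filter Topology in
/-- A smooth local retraction onto the boundary. -/
theorem exists_boundary_retraction {x : ℂ} (hx : S.rho x = 0) : ∃ O : Set ℂ, IsOpen O ∧ x ∈ O ∧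
    ∃ π : ℂ → ℂ, (∀ z ∈ O, ContDiffAt ℝ ∞ π z ∧ S.rho (π z) = 0) ∧
      ∀ z ∈ O, S.rho z = 0 → π z = z := by
  -- Points are slid onto the boundary along a fixed direction v transversal to it at x; the sliding
  -- time is an implicit function.
  obtain ⟨v, hv⟩ : ∃ v, fderiv ℝ S.rho x v ≠ 0 := by
    by_contra hcon
    push Not at hcon
    exact S.rho_regular x hx (ContinuousLinearMap.ext hcon)
  have hG : ContDiff ℝ ∞ fun z : ℂ × ℝ => S.rho (z.1 + z.2 • v) :=
    S.rho_smooth.comp (contDiff_fst.add (contDiff_snd.smul contDiff_const))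
  have hd : fderiv ℝ (fun z : ℂ × ℝ => S.rho (z.1 + z.2 • v)) (x, 0) (0, 1) ≠ 0 := by
    have h1 : HasFDerivAt (fun z : ℂ × ℝ => z.1 + z.2 • v) (ContinuousLinearMap.fst ℝ ℂ ℝ +
        (ContinuousLinearMap.snd ℝ ℂ ℝ).smulRight v) (x, 0) :=
      ((ContinuousLinearMap.fst ℝ ℂ ℝ +
        (ContinuousLinearMap.snd ℝ ℂ ℝ).smulRight v).hasFDerivAt)
    have h2 : HasFDerivAt S.rho (fderiv ℝ S.rho x) ((fun z : ℂ × ℝ => z.1 + z.2 • v) (x, 0)) := by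
      simpa using (S.rho_smooth.differentiable (by simp) x).hasFDerivAt
    have h3 : HasFDerivAt (fun z : ℂ × ℝ => S.rho (z.1 + z.2 • v)) _ (x, 0) := HasFDerivAt.comp (g := S.rho) (x, (0 : ℝ)) h2 h1
    rw [h3.fderiv]
    simpa using hv
  obtain ⟨T, hT0, hT, hu⟩ := exists_smooth_root (G := fun z : ℂ × ℝ => S.rho (z.1 + z.2 • v)) hG
    (by simpa using hx) hd
  have hu' : ∀ᶠ z in 𝓝 x, S.rho z = 0 → T z = 0 := by
    have : Tendsto (fun z : ℂ => (z, (0 : ℝ))) (𝓝 x) (𝓝 (x, 0)) :=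
      (continuous_id.prodMk continuous_const).tendsto x
    filter_upwards [this.eventually hu] with z hz h
    exact hz (by simpa using h)
  obtain ⟨O, hO, hOo, hxO⟩ := eventually_nhds_iff.1 (hT.and hu')
  refine ⟨O, hOo, hxO, fun z => z + T z • v, fun z hz => ⟨?_, (hO z hz).1.2⟩, fun z hz h => ?_⟩
  · exact contDiffAt_id.add ((hO z hz).1.1.smul contDiffAt_const)
  · simp [(hO z hz).2 h]

variable (S)

/-- The difference quotient of the boundary defining function along the complete flow. -/
def bdfQuot (z : (ℂ × ℝ) × ℝ) : ℝ := ∫ s in (0 : ℝ)..1, S.ext.X S.bdf (S.gflow (s * z.2) z.1)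

theorem contDiff_bdfQuot : ContDiff ℝ ∞ S.bdfQuot := by
  refine contDiff_iff_contDiffAt.2 fun z => ?_
  have hF : ContDiff ℝ ∞ fun w : ((ℂ × ℝ) × ℝ) × ℝ =>
      S.ext.X S.bdf (S.gflow (w.2 * w.1.2) w.1.1) :=
    (S.ext.contDiff_X S.contDiff_bdf).comp
      (S.contDiff_gflow.comp ((contDiff_snd.mul (contDiff_snd.comp contDiff_fst)).prodMk
        (contDiff_fst.comp contDiff_fst)))
  exact contDiffAt_parametric_integral isOpen_univ 0 1
    (F := fun w : ((ℂ × ℝ) × ℝ) × ℝ => S.ext.X S.bdf (S.gflow (w.2 * w.1.2) w.1.1))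
    (fun p _ t => hF.contDiffAt) (mem_univ z)

theorem hasDerivAt_bdf_gflow_ext (p : ℂ × ℝ) (t : ℝ) :
    HasDerivAt (fun t => S.bdf (S.gflow t p)) (S.ext.X S.bdf (S.gflow t p)) t :=
  (S.contDiff_bdf.differentiable (by simp) _).hasFDerivAt.comp_hasDerivAt t (S.hasDerivAt_gflow p t)

/-- For p on the boundary, ρ(φ_t p) has the trivial zero t = 0. Dividing it out leaves a smooth
function of which the chord length will be a root. -/
theorem mul_bdfQuot (p : ℂ × ℝ) (t : ℝ) : t * S.bdfQuot (p, t) = S.bdf (S.gflow t p) - S.bdf p := by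
  have hc : Continuous fun t => S.ext.X S.bdf (S.gflow t p) :=
    (S.ext.contDiff_X S.contDiff_bdf).continuous.comp (S.continuous_gflow_left p)
  have h1 := intervalIntegral.integral_eq_sub_of_hasDerivAt
    (fun s _ => S.hasDerivAt_bdf_gflow_ext p s) (hc.intervalIntegrable 0 t)
  rw [S.gflow_zero] at h1
  have h2 := intervalIntegral.smul_integral_comp_mul_right (a := 0) (b := 1)
    (fun t => S.ext.X S.bdf (S.gflow t p)) t
  rw [← h1, bdfQuot, ← smul_eq_mul, h2, zero_mul, one_mul]

theorem bdfQuot_zero (p : ℂ × ℝ) : S.bdfQuot (p, 0) = S.ext.X S.bdf p := by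
  simp [bdfQuot, S.gflow_zero]

/-- The time derivative of the difference quotient. -/
def bdfQuot' (p : ℂ × ℝ) (t : ℝ) : ℝ := fderiv ℝ S.bdfQuot (p, t) (0, 1)

theorem hasDerivAt_bdfQuot (p : ℂ × ℝ) (t : ℝ) :
    HasDerivAt (fun t => S.bdfQuot (p, t)) (S.bdfQuot' p t) t :=
  (S.contDiff_bdfQuot.differentiable (by simp) _).hasFDerivAt.comp_hasDerivAt t
    ((hasDerivAt_const t p).prodMk (hasDerivAt_id t))

theorem X_bdf_gflow_eq (p : ℂ × ℝ) (t : ℝ) :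
    S.ext.X S.bdf (S.gflow t p) = S.bdfQuot (p, t) + t * S.bdfQuot' p t := by
  have h1 := (S.hasDerivAt_bdf_gflow_ext p t).sub_const (S.bdf p)
  have h2 : HasDerivAt (fun t => t * S.bdfQuot (p, t)) _ t :=
    (hasDerivAt_id t).mul (S.hasDerivAt_bdfQuot p t)
  simp only [S.mul_bdfQuot] at h2
  rw [h1.unique h2]
  simp

/-- The second derivative of t times the quotient at t = 0 is twice the first derivative of the
quotient. At a glancing vector this converts strict convexity into nondegeneracy of the root. -/
theorem XX_bdf_eq (p : ℂ × ℝ) : S.ext.X (S.ext.X S.bdf) p = 2 * S.bdfQuot' p 0 := by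
  have h1 : HasDerivAt (fun t => S.ext.X S.bdf (S.gflow t p)) (S.ext.X (S.ext.X S.bdf) p) 0 := by
    have h := ((S.ext.contDiff_X S.contDiff_bdf).differentiable (by simp)
      (S.gflow 0 p)).hasFDerivAt.comp_hasDerivAt 0 (S.hasDerivAt_gflow p 0)
    rw [S.gflow_zero] at h
    exact h
  have hd : Differentiable ℝ fun t => S.bdfQuot' p t := by
    have h : ContDiff ℝ ∞ fun t : ℝ => fderiv ℝ S.bdfQuot (p, t) (0, 1) :=
      ((S.contDiff_bdfQuot.fderiv_right (m := ∞) (by simp)).comp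
        (contDiff_const.prodMk contDiff_id)).clm_apply contDiff_const
    exact h.differentiable (by simp)
  have h2 : HasDerivAt (fun t => S.bdfQuot (p, t) + t * S.bdfQuot' p t) _ 0 :=
    (S.hasDerivAt_bdfQuot p 0).add ((hasDerivAt_id (0 : ℝ)).mul (hd 0).hasDerivAt)
  simp only [S.X_bdf_gflow_eq] at h1
  rw [h1.unique h2]
  simp; ring

theorem ext_X_eq {E : Type*} [NormedAddCommGroup E] [NormedSpace ℝ E] {u : ℂ × ℝ → E} {p : ℂ × ℝ}
    (hp : p ∈ S.SM) : S.ext.X u p = S.X u p := by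
  simp only [X, S.ext_geodField (S.M_subset_ball hp)]

open Filter Topology in
theorem ext_XX_eq {E : Type*} [NormedAddCommGroup E] [NormedSpace ℝ E] {u : ℂ × ℝ → E} {p : ℂ × ℝ}
    (hp : p ∈ S.SM) : S.ext.X (S.ext.X u) p = S.X (S.X u) p := by
  rw [ext_X_eq S hp]
  have : S.ext.X u =ᶠ[𝓝 p] S.X u := by
    filter_upwards [(Metric.isOpen_ball.preimage continuous_fst).mem_nhds (S.M_subset_ball hp)] with q hq
    simp only [X, S.ext_geodField hq]
  simp only [X] at this ⊢
  rw [this.fderiv_eq]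

/-- The signed length of the geodesic chord through a boundary point. -/
def chord (p : ℂ × ℝ) : ℝ := S.exitTime p - S.exitTime (rev p)

variable {S}

section chord

variable (h : S.IsSimple)
include h

theorem IsSimple.exitTime_rev_eq_zero {p : ℂ × ℝ} (hp : S.bdf p = 0) (hp1 : 0 ≤ S.X S.bdf p) :
    S.exitTime (rev p) = 0 := h.exitTime_eq_zero (p := rev p) hp (by rw [X_bdf_rev]; linarith)

theorem IsSimple.gflow_chord_mem {p : ℂ × ℝ} (hp : S.bdf p = 0) :
    S.gflow (S.chord p) p ∈ S.SM ∧ S.bdf (S.gflow (S.chord p) p) = 0 := by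
  have hM : p ∈ S.SM := hp.ge
  rcases le_total 0 (S.X S.bdf p) with h1 | h1
  · rw [chord, h.exitTime_rev_eq_zero hp h1, sub_zero]
    exact ⟨h.gflow_mem hM ⟨h.exitTime_nonneg hM, le_rfl⟩, h.bdf_exit hM⟩
  · rw [chord, h.exitTime_eq_zero hp h1, zero_sub]
    have := h.bdf_entry hM
    exact ⟨this.ge, this⟩

/-- For transversal p the far end of the chord is met transversally, forwards or backwards. For
glancing p the chord is 0 and the derivative is half of X² ρ < 0. The chord is thus a simple root in
every direction. -/
theorem IsSimple.bdfQuot_chord {p : ℂ × ℝ} (hp : S.bdf p = 0) :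
    S.bdfQuot (p, S.chord p) = 0 ∧ S.bdfQuot' p (S.chord p) ≠ 0 := by
  have hM : p ∈ S.SM := hp.ge
  obtain ⟨hcM, hc0⟩ := h.gflow_chord_mem hp
  have h2 := S.mul_bdfQuot p (S.chord p)
  rw [hp, hc0, sub_zero, mul_eq_zero] at h2
  have h3 := S.X_bdf_gflow_eq p (S.chord p)
  rw [S.ext_X_eq hcM] at h3
  rcases lt_trichotomy (S.X S.bdf p) 0 with h1 | h1 | h1
  · have he : S.chord p = -S.exitTime (rev p) := by
      rw [chord, h.exitTime_eq_zero hp h1.le, zero_sub]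
    have hpos : 0 < S.exitTime (rev p) := h.exitTime_pos_of_influx (p := rev p) hp
      (by rw [X_bdf_rev]; linarith)
    have h0 : S.bdfQuot (p, S.chord p) = 0 := h2.resolve_left (by rw [he]; linarith)
    refine ⟨h0, fun h4 => ?_⟩
    rw [h0, h4, mul_zero, add_zero, he] at h3
    exact (h.X_bdf_entry_pos hM hpos).ne' h3
  · have he : S.chord p = 0 := by
      rw [chord, h.exitTime_eq_zero hp h1.le, h.exitTime_rev_eq_zero hp h1.ge, sub_zero]
    rw [he, S.bdfQuot_zero, S.ext_X_eq hM, h1]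
    refine ⟨rfl, fun h4 => ?_⟩
    have h5 := S.XX_bdf_eq p
    rw [h4, S.ext_XX_eq hM, mul_zero] at h5
    exact (h.strictly_convex p hp h1).ne h5
  · have he : S.chord p = S.exitTime p := by
      rw [chord, h.exitTime_rev_eq_zero hp h1.le, sub_zero]
    have hpos : 0 < S.exitTime p := h.exitTime_pos_of_influx hp h1
    have h0 : S.bdfQuot (p, S.chord p) = 0 := h2.resolve_left (by rw [he]; linarith)
    refine ⟨h0, fun h4 => ?_⟩
    rw [h0, h4, mul_zero, add_zero, he] at h3
    exact (h.X_bdf_exit_neg hM hpos).ne h3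

theorem IsSimple.chord_rev_rev {p : ℂ × ℝ} (hp : p ∈ S.SM) : S.chord (rev (rev p)) = S.chord p := by
  rw [chord, h.exitTime_rev_rev hp, h.exitTime_rev_rev (p := rev p) hp, chord]

theorem IsSimple.continuousOn_chord : ContinuousOn S.chord S.SM :=
  h.continuousOn_exitTime.sub h.continuousOn_exitTime_rev

theorem IsSimple.ray_eq {q : ℂ × ℝ → ℂ} {p : ℂ × ℝ} (hp : S.bdf p = 0) :
    S.ray q p = S.transport q p := by
  rw [ray]
  by_cases h1 : p ∈ S.influx
  · rw [indicator_of_mem h1]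
  · rw [indicator_of_notMem h1, h.transport_eq_zero hp]
    by_contra h2
    exact h1 ⟨hp, not_le.1 h2⟩

/-- At a boundary vector, u^q vanishes at p or at rev p. The parity of q rewrites the remaining
value as an integral over the chord traversed with its sign, so influx and outflux share one
formula. -/
theorem IsSimple.parityPart_ray {q : ℂ × ℝ → ℂ} {n : ℤ}
    (hn : ∀ p, q (rev p) = par (n + 1) * q p) {p : ℂ × ℝ} (hp : S.bdf p = 0) :
    parityPart n (S.ray q) p = 1 / 2 * S.flowInt q (p, S.chord p) := by
  have hM : p ∈ S.SM := hp.ge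
  have h0 : S.flowInt q (p, 0) = 0 := by simp [flowInt]
  have h1 : S.transport q (rev p) = -par (n + 1) * S.flowInt q (p, -S.exitTime (rev p)) := by
    rw [h.transport_eq (p := rev p) hM, flowInt_eq, flowInt_eq]
    simp only [gflow_rev, hn, intervalIntegral.integral_const_mul]
    rw [intervalIntegral.integral_comp_neg (fun s => q (S.gflow s p)), neg_zero,
      intervalIntegral.integral_symm]
    ring
  rw [parityPart_eq, h.ray_eq hp, h.ray_eq (p := rev p) hp, h1, h.transport_eq hM, par_add_one]
  rcases le_total 0 (S.X S.bdf p) with h2 | h2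
  · rw [chord, h.exitTime_rev_eq_zero hp h2, sub_zero, neg_zero, h0]
    ring
  · rw [chord, h.exitTime_eq_zero hp h2, zero_sub, h0]
    linear_combination (S.flowInt q (p, -S.exitTime (rev p)) / 2) * par_mul_self n

open Filter Topology in
/-- The boundary values of the relevant part of `u^q` extend smoothly across the boundary. -/
theorem IsSimple.exists_extension_parityPart_ray {q : ℂ × ℝ → ℂ} (hq : ContDiff ℝ ∞ q)
    (hqp : IsPeriodic q) {n : ℤ} (hn : ∀ p, q (rev p) = par (n + 1) * q p) {x : ℂ}
    (hx : S.rho x = 0) : ∃ O : Set ℂ, IsOpen O ∧ x ∈ O ∧ ∃ B : ℂ × ℝ → ℂ, FibreSmooth O B ∧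
      ∀ z ∈ O, S.rho z = 0 → ∀ θ, parityPart n (S.ray q) (z, θ) = B (z, θ) := by
  obtain ⟨O, hO, hxO, π, hπ, hπ'⟩ := exists_boundary_retraction hx
  -- The boundary formula is composed with the retraction. The indicator of O, irrelevant inside O,
  -- ensures periodicity of the extension everywhere.
  refine ⟨O, hO, hxO, O.indicator 1 ∘ Prod.fst * fun p => 1 / 2 * S.flowInt q ((π p.1, p.2), S.chord (π p.1, p.2)),
    ⟨fun p => ?_, fun p hp => ?_⟩, fun z hz h0 θ => ?_⟩
  · by_cases hp : p.1 ∈ O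
    · have hM : (π p.1, p.2) ∈ S.SM := (hπ p.1 hp).2.ge
      have h1 : (π (rev (rev p)).1, (rev (rev p)).2) = rev (rev (π p.1, p.2)) := rfl
      simp only [Pi.mul_apply, Function.comp]
      rw [h1, h.chord_rev_rev hM, flowInt_eq, flowInt_eq]
      simp only [gflow_rev_rev, hqp _]
      rfl
    · have hp' : (rev (rev p)).1 ∉ O := hp
      simp [hp, hp']
  · have hnh : O ∈ 𝓝 p.1 := hO.mem_nhds hp
    have hev : ∀ᶠ q : ℂ × ℝ in 𝓝 p, q.1 ∈ O := continuous_fst.continuousAt.eventually hnh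
    have hπp : ContDiffAt ℝ ∞ (fun q : ℂ × ℝ => (π q.1, q.2)) p :=
      (ContDiffAt.comp (g := π) p (hπ p.1 hp).1 contDiffAt_fst).prodMk contDiffAt_snd
    have hT : ContDiffAt ℝ ∞ (fun q : ℂ × ℝ => S.chord (π q.1, q.2)) p := by
      refine contDiffAt_of_root
        (G := fun z : (ℂ × ℝ) × ℝ => S.bdfQuot ((π z.1.1, z.1.2), z.2)) ?_ ?_ ?_ ?_
      · have h1 : ContDiffAt ℝ ∞ (fun z : (ℂ × ℝ) × ℝ => (π z.1.1, z.1.2))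
            (p, S.chord (π p.1, p.2)) :=
          ContDiffAt.comp (g := fun q : ℂ × ℝ => (π q.1, q.2)) _ hπp contDiffAt_fst
        exact S.contDiff_bdfQuot.contDiffAt.comp _ (h1.prodMk contDiffAt_snd)
      · have h1 : ContDiffAt ℝ ∞ (fun z : (ℂ × ℝ) × ℝ => S.bdfQuot ((π z.1.1, z.1.2), z.2))
            (p, S.chord (π p.1, p.2)) := by
          have h1 : ContDiffAt ℝ ∞ (fun z : (ℂ × ℝ) × ℝ => (π z.1.1, z.1.2))
              (p, S.chord (π p.1, p.2)) :=
            ContDiffAt.comp (g := fun q : ℂ × ℝ => (π q.1, q.2)) _ hπp contDiffAt_fst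
          exact S.contDiff_bdfQuot.contDiffAt.comp _ (h1.prodMk contDiffAt_snd)
        have h2 := (h1.differentiableAt (by simp)).hasFDerivAt.comp_hasDerivAt
          (S.chord (π p.1, p.2)) ((hasDerivAt_const _ p).prodMk (hasDerivAt_id _))
        rw [h2.unique (S.hasDerivAt_bdfQuot (π p.1, p.2) _)]
        exact (h.bdfQuot_chord (p := (π p.1, p.2)) (hπ p.1 hp).2).2
      · have h1 := h.continuousOn_chord (π p.1, p.2) (hπ p.1 hp).2.ge
        exact h1.tendsto.comp (tendsto_nhdsWithin_iff.2 ⟨hπp.continuousAt,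
          hev.mono fun q hq => (hπ q.1 hq).2.ge⟩)
      · filter_upwards [hev] with q hq
        exact (h.bdfQuot_chord (p := (π q.1, q.2)) (hπ q.1 hq).2).1
    have h1 : ContDiffAt ℝ ∞ (fun p : ℂ × ℝ => 1 / 2 * S.flowInt q ((π p.1, p.2), S.chord (π p.1, p.2))) p :=
      contDiffAt_const.mul ((contDiff_flowInt hq).contDiffAt.comp p (hπp.prodMk hT))
    refine h1.congr_of_eventuallyEq ?_
    filter_upwards [hev] with q hq
    simp [hq]
  · rw [h.parityPart_ray hn (p := (z, θ)) h0]
    simp [hz, hπ' z hz h0]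

end chord

end IsothermalSurface

end

/-! ### Boundary behaviour of the Hilbert transform of the solutions -/

noncomputable section

namespace IsothermalSurface

variable {S : IsothermalSurface}

/-- The shifted Hilbert transform of a parity part of `u^q`. -/
def hilbertTransport (S : IsothermalSurface) (k n : ℤ) (q : ℂ × ℝ → ℂ) : ℂ × ℝ → ℂ :=
  hilbert k (parityPart n (S.transport q))

theorem isPeriodic_hilbert (k : ℤ) (u : ℂ × ℝ → ℂ) : IsPeriodic (hilbert k u) :=
  isPeriodic_mult (hilbertMult k) u

/-- Square-mean convergence of fibres at a point of the boundary. -/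
def FibreTendsto (S : IsothermalSurface) (v : ℂ × ℝ → ℂ) (x : ℂ) : Prop :=
  Filter.Tendsto (fun z => ∫ θ in (0 : ℝ)..2 * Real.pi, ‖v (z, θ) - v (x, θ)‖ ^ 2)
    (nhdsWithin x {z | 0 < S.rho z}) (nhds 0)

theorem continuousOn_parityPart {u : ℂ × ℝ → ℂ} (hu : ContinuousOn u S.SM) (n : ℤ) :
    ContinuousOn (parityPart n u) S.SM := by
  have h1 : parityPart n u = fun q => (u q + par n * u (rev q)) / 2 :=
    funext fun q => parityPart_eq n u q
  rw [h1]
  exact (hu.add (continuousOn_const.mul (hu.comp continuous_rev.continuousOn fun p hp => hp))).div_const _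

theorem continuous_fibre_of_continuousOn {u : ℂ × ℝ → ℂ} (hu : ContinuousOn u S.SM) {z : ℂ}
    (hz : z ∈ S.M) : Continuous fun θ => u (z, θ) :=
  hu.comp_continuous (by fun_prop) fun _ => hz

/-- The mean square bound for multipliers, applied to the difference of two fibres viewed as a
function on the single fibre over z. -/
theorem integral_norm_sq_mult_sub_le {U : ℂ × ℝ → ℂ} (hUp : IsPeriodic U) {m : ℤ → ℂ}
    (hm : ∀ l, ‖m l‖ ≤ 1) {x z : ℂ} (hcz : Continuous fun θ => U (z, θ))
    (hcx : Continuous fun θ => U (x, θ)) (hsz : Summable fun l => ‖fcoef l U z‖)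
    (hsx : Summable fun l => ‖fcoef l U x‖) :
    ∫ θ in (0 : ℝ)..2 * Real.pi, ‖mult m U (z, θ) - mult m U (x, θ)‖ ^ 2 ≤
      ∫ θ in (0 : ℝ)..2 * Real.pi, ‖U (z, θ) - U (x, θ)‖ ^ 2 := by
  have hdp : IsPeriodic fun p : ℂ × ℝ => U (z, p.2) - U (x, p.2) := isPeriodic_iff.2 fun y θ =>
    congrArg₂ (· - ·) (hUp.periodic z θ) (hUp.periodic x θ)
  have hco : ∀ l, fcoef l (fun p : ℂ × ℝ => U (z, p.2) - U (x, p.2)) z =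
      fcoef l U z - fcoef l U x := fun l => by
    rw [fcoef_sub (u := fun p => U (z, p.2)) (v := fun p => U (x, p.2)) (z := z) l hcz hcx]
    simp only [fcoef]
  have hds : Summable fun l => ‖fcoef l (fun p : ℂ × ℝ => U (z, p.2) - U (x, p.2)) z‖ := by
    refine Summable.of_nonneg_of_le (fun _ => norm_nonneg _) (fun l => ?_) (hsz.add hsx)
    rw [hco]; exact norm_sub_le _ _
  refine le_of_eq_of_le (intervalIntegral.integral_congr fun θ _ => ?_)
    (integral_norm_sq_mult_le hdp (z := z) (hcz.sub hcx) hds hm)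
  have s1 := summable_mult hm (p := (z, θ)) hsz
  have s2 := summable_mult hm (p := (x, θ)) hsx
  have e : mult m (fun p : ℂ × ℝ => U (z, p.2) - U (x, p.2)) (z, θ) =
      mult m U (z, θ) - mult m U (x, θ) := by
    simp only [mult]
    rw [← s1.tsum_sub s2]
    refine tsum_congr fun l => ?_
    simp only [mode_eq, hco]
    ring
  simp only [e]

/-- The Cauchy–Schwarz inequality against constants. -/
theorem sq_integral_le {α : Type*} [MeasurableSpace α] {μ : Measure α} [IsFiniteMeasure μ]
    {g : α → ℝ} (hg : Integrable g μ) (hg2 : Integrable (fun t => g t ^ 2) μ) :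
    (∫ t, g t ∂μ) ^ 2 ≤ μ.real univ * ∫ t, g t ^ 2 ∂μ := by
  rcases eq_or_ne μ 0 with rfl | hμ
  · simp
  have hm : 0 < μ.real univ := by
    rw [measureReal_def]
    exact ENNReal.toReal_pos (by simpa using hμ) (measure_ne_top _ _)
  set c := (∫ t, g t ∂μ) / μ.real univ with hc
  have h1 : 0 ≤ ∫ t, (g t - c) ^ 2 ∂μ := integral_nonneg fun _ => by positivity
  have h2 : ∀ t, (g t - c) ^ 2 = g t ^ 2 - (2 * c) * g t + c ^ 2 := fun t => by ring
  simp only [h2] at h1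
  have hg3 : Integrable (fun t => g t ^ 2 - (2 * c) * g t) μ := hg2.sub (hg.const_mul _)
  rw [integral_add hg3 (integrable_const _), integral_sub hg2 (hg.const_mul _), integral_const_mul, integral_const, smul_eq_mul] at h1
  have h3 : (∫ t, g t ∂μ) = c * μ.real univ := by rw [hc]; field_simp
  -- Nonnegativity of the variance, multiplied by the total mass.
  rw [h3] at h1 ⊢
  nlinarith [mul_nonneg hm.le h1]

/-- In a v + b, replacing v by its boundary fibre costs a term controlled by Cauchy–Schwarz on the
circle, and the rest tends to zero by dominated convergence. Pointwise continuity of v at the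
boundary is not required. -/
theorem tendsto_integral_of_fibreTendsto {v a b : ℂ × ℝ → ℂ} {x : ℂ} (hv : S.FibreTendsto v x)
    (hcv : ∀ z ∈ S.M, Continuous fun θ => v (z, θ)) (hx : x ∈ S.M)
    (ha : ∀ z ∈ S.inside, Continuous fun θ => a (z, θ))
    (hb : ∀ z ∈ S.inside, Continuous fun θ => b (z, θ)) {A B : ℝ}
    (hA : ∀ p : ℂ × ℝ, p.1 ∈ S.inside → ‖a p‖ ≤ A) (hB : ∀ p : ℂ × ℝ, p.1 ∈ S.inside → ‖b p‖ ≤ B)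
    (hlim : ∀ θ, Filter.Tendsto (fun z => a (z, θ) * v (x, θ) + b (z, θ)) (nhdsWithin x S.inside)
      (nhds 0)) :
    Filter.Tendsto (fun z => ∫ θ in (0 : ℝ)..2 * Real.pi, ‖a (z, θ) * v (z, θ) + b (z, θ)‖)
      (nhdsWithin x S.inside) (nhds 0) := by
  have hπ := Real.two_pi_pos
  have hx' := hcv x hx
  obtain ⟨N, hN⟩ := (isCompact_Icc (a := (0 : ℝ)) (b := 2 * Real.pi)).exists_bound_of_continuousOn
    hx'.continuousOn
  have hMz : ∀ z ∈ S.inside, z ∈ S.M := fun z (hz : 0 < S.rho z) => hz.le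
  have h1 : Filter.Tendsto (fun z => ∫ θ in (0 : ℝ)..2 * Real.pi, ‖a (z, θ) * v (x, θ) + b (z, θ)‖)
      (nhdsWithin x S.inside) (nhds (∫ θ in (0 : ℝ)..2 * Real.pi, (0 : ℝ))) := by
    refine intervalIntegral.tendsto_integral_filter_of_dominated_convergence
      (fun _ => A * N + B) ?_ ?_ intervalIntegrable_const ?_
    · filter_upwards [self_mem_nhdsWithin] with z hz
      exact (((ha z hz).mul hx').add (hb z hz)).norm.aestronglyMeasurable
    · filter_upwards [self_mem_nhdsWithin] with z hz
      refine Filter.Eventually.of_forall fun θ hθ => ?_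
      rw [uIoc_of_le hπ.le] at hθ
      rw [norm_norm]
      refine (norm_add_le _ _).trans (add_le_add ?_ (hB (z, θ) hz))
      rw [norm_mul]
      exact mul_le_mul (hA (z, θ) hz) (hN θ ⟨hθ.1.le, hθ.2⟩) (norm_nonneg _)
        ((norm_nonneg _).trans (hA (z, θ) hz))
    · exact Filter.Eventually.of_forall fun θ _ => by simpa using (hlim θ).norm
  have h2 : Filter.Tendsto (fun z => A * Real.sqrt (2 * Real.pi *
      ∫ θ in (0 : ℝ)..2 * Real.pi, ‖v (z, θ) - v (x, θ)‖ ^ 2)) (nhdsWithin x S.inside) (nhds 0) := by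
    have := ((Real.continuous_sqrt.tendsto _).comp (hv.const_mul (2 * Real.pi))).const_mul A
    rw [mul_zero, Real.sqrt_zero, mul_zero] at this
    exact this
  have h3 := h2.add h1
  rw [intervalIntegral.integral_zero, add_zero] at h3
  refine squeeze_zero' (Filter.Eventually.of_forall fun z =>
    intervalIntegral.integral_nonneg hπ.le fun _ _ => norm_nonneg _) ?_ h3
  filter_upwards [self_mem_nhdsWithin] with z hz
  have hcz := hcv z (hMz z hz)
  have hd : Continuous fun θ => ‖v (z, θ) - v (x, θ)‖ := (hcz.sub hx').norm
  have hA0 : 0 ≤ A := (norm_nonneg _).trans (hA (z, 0) hz)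
  calc ∫ θ in (0 : ℝ)..2 * Real.pi, ‖a (z, θ) * v (z, θ) + b (z, θ)‖
      ≤ ∫ θ in (0 : ℝ)..2 * Real.pi, (A * ‖v (z, θ) - v (x, θ)‖ +
          ‖a (z, θ) * v (x, θ) + b (z, θ)‖) := by
        refine intervalIntegral.integral_mono_on hπ.le
          ((((ha z hz).mul hcz).add (hb z hz)).norm.intervalIntegrable _ _)
          (((continuous_const.mul hd).add (((ha z hz).mul hx').add (hb z hz)).norm).intervalIntegrable _ _)
          fun θ _ => ?_
        have e : a (z, θ) * v (z, θ) + b (z, θ) = a (z, θ) * (v (z, θ) - v (x, θ)) +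
          (a (z, θ) * v (x, θ) + b (z, θ)) := by ring
        rw [e]
        refine (norm_add_le _ _).trans (add_le_add ?_ le_rfl)
        rw [norm_mul]
        exact mul_le_mul_of_nonneg_right (hA (z, θ) hz) (norm_nonneg _)
    _ = A * (∫ θ in (0 : ℝ)..2 * Real.pi, ‖v (z, θ) - v (x, θ)‖) +
          ∫ θ in (0 : ℝ)..2 * Real.pi, ‖a (z, θ) * v (x, θ) + b (z, θ)‖ := by
        have e1 : IntervalIntegrable (fun θ => A * ‖v (z, θ) - v (x, θ)‖) volume 0 (2 * Real.pi) :=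
          (continuous_const.mul hd).intervalIntegrable _ _
        have e2 : IntervalIntegrable (fun θ => ‖a (z, θ) * v (x, θ) + b (z, θ)‖) volume 0
            (2 * Real.pi) := (((ha z hz).mul hx').add (hb z hz)).norm.intervalIntegrable _ _
        rw [intervalIntegral.integral_add e1 e2, intervalIntegral.integral_const_mul]
    _ ≤ _ := by
        refine add_le_add (mul_le_mul_of_nonneg_left ?_ hA0) le_rfl
        have h4 := sq_integral_le (μ := volume.restrict (Ioc 0 (2 * Real.pi)))
          ((hd.intervalIntegrable 0 (2 * Real.pi)).1) (((hd.pow 2).intervalIntegrable 0 (2 * Real.pi)).1)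
        rw [measureReal_restrict_apply_univ, Real.volume_real_Ioc_of_le hπ.le, sub_zero,
          ← intervalIntegral.integral_of_le hπ.le, ← intervalIntegral.integral_of_le hπ.le] at h4
        exact Real.le_sqrt_of_sq_le h4

variable (h : S.IsSimple) {q : ℂ × ℝ → ℂ} (hq : ContDiff ℝ ∞ q) (hqp : IsPeriodic q) {n : ℤ}
  (hn : ∀ p, q (rev p) = par (n + 1) * q p)
include h

theorem IsSimple.hilbertTransport_boundary (k n : ℤ) (q : ℂ × ℝ → ℂ) {p : ℂ × ℝ} (hp : S.bdf p = 0) :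
    hilbert k (parityPart n (S.ray q)) p = S.hilbertTransport k n q p :=
  mult_congr (m := hilbertMult k) fun θ => by
    rw [parityPart_eq, parityPart_eq, h.ray_eq (p := (p.1, θ)) hp, h.ray_eq (p := rev (p.1, θ)) hp]

include hq hqp

theorem IsSimple.fibreSmooth_parityPart_transport (n : ℤ) :
    FibreSmooth S.inside (parityPart n (S.transport q)) :=
  (h.fibreSmooth_transport hq hqp).parityPart n

theorem IsSimple.contDiffAt_hilbertTransport (k n : ℤ) {p : ℂ × ℝ} (hp : 0 < S.bdf p) :
    ContDiffAt ℝ 1 (S.hilbertTransport k n q) p :=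
  (h.fibreSmooth_parityPart_transport hq hqp n).contDiffAt_mult S.isOpen_inside
    (norm_hilbertMult_le k) hp

include hn

/-- The transform acts within each fibre, so over the boundary it sees only the boundary data, and
transforming their smooth extension extends the result. -/
theorem IsSimple.exists_extension_hilbertTransport (k : ℤ) {x : ℂ} (hx : S.rho x = 0) :
    ∃ O : Set ℂ, IsOpen O ∧ x ∈ O ∧ ∃ w : ℂ × ℝ → ℂ, (∀ p : ℂ × ℝ, p.1 ∈ O → ContDiffAt ℝ 1 w p) ∧
      ∀ p : ℂ × ℝ, p.1 ∈ O → S.bdf p = 0 → S.hilbertTransport k n q p = w p := by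
  obtain ⟨O, hO, hxO, B, hB, hBe⟩ := h.exists_extension_parityPart_ray hq hqp hn hx
  refine ⟨O, hO, hxO, hilbert k B, fun p hp => hB.contDiffAt_mult hO (norm_hilbertMult_le k) hp,
    fun p hp h0 => ?_⟩
  rw [← h.hilbertTransport_boundary k n q h0]
  exact mult_congr (m := hilbertMult k) fun θ => hBe p.1 hp h0 θ

theorem IsSimple.summable_fcoef_parityPart_transport {z : ℂ} (hz : z ∈ S.M) :
    Summable fun l => ‖fcoef l (parityPart n (S.transport q)) z‖ := by
  rcases (show 0 ≤ S.rho z from hz).eq_or_lt with h0 | h0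
  · obtain ⟨O, hO, hxO, B, hB, hBe⟩ := h.exists_extension_parityPart_ray hq hqp hn h0.symm
    refine (hB.summable_fcoef hO hxO).congr fun l => ?_
    congr 1
    refine fcoef_congr fun θ => ?_
    rw [← hBe z hxO h0.symm, parityPart_eq, parityPart_eq, h.ray_eq (p := (z, θ)) h0.symm,
      h.ray_eq (p := rev (z, θ)) h0.symm]
  · exact (h.fibreSmooth_parityPart_transport hq hqp n).summable_fcoef S.isOpen_inside h0

theorem IsSimple.continuous_fibre_hilbertTransport (k : ℤ) {z : ℂ} (hz : z ∈ S.M) :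
    Continuous fun θ => S.hilbertTransport k n q (z, θ) :=
  continuous_mult_fibre (norm_hilbertMult_le k) (h.summable_fcoef_parityPart_transport hq hqp hn hz)

theorem IsSimple.continuousOn_hilbertTransport (k : ℤ) :
    ContinuousOn (S.hilbertTransport k n q) {p | S.bdf p = 0} := by
  intro p hp
  obtain ⟨O, hO, hxO, w, hw, hwe⟩ := h.exists_extension_hilbertTransport hq hqp hn k hp
  refine (hw p hxO).continuousAt.continuousWithinAt.congr_of_eventuallyEq ?_ (hwe p hxO hp)
  filter_upwards [mem_nhdsWithin_of_mem_nhds ((hO.preimage continuous_fst).mem_nhds hxO),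
    self_mem_nhdsWithin] with p' h1 h2
  exact hwe p' h1 h2

theorem IsSimple.contDiffAt_hilbertTransport_entry (k : ℤ) {p : ℂ × ℝ} (hp : 0 < S.bdf p) :
    ContDiffAt ℝ 1 (fun p => S.hilbertTransport k n q (S.entry p)) p := by
  obtain ⟨O, hO, hxO, w, hw, hwe⟩ :=
    h.exists_extension_hilbertTransport hq hqp hn k (h.bdf_entry (p := p) hp.le)
  have he : ContDiffAt ℝ 1 S.entry p := (h.contDiffAt_entry hp).of_le (by simp)
  have h1 := ContDiffAt.comp (g := w) p (hw _ hxO) he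
  refine h1.congr_of_eventuallyEq ?_
  filter_upwards [he.continuousAt.eventually ((hO.preimage continuous_fst).mem_nhds hxO),
    S.isOpen_interior_bdf.mem_nhds hp] with p' h1 h2
  exact hwe _ h1 (h.bdf_entry (show 0 < S.bdf p' from h2).le)

theorem IsSimple.integral_hilbertTransport_sub_le (k : ℤ) {x z : ℂ} (hx : x ∈ S.M) (hz : z ∈ S.M) :
    ∫ θ in (0 : ℝ)..2 * Real.pi,
      ‖S.hilbertTransport k n q (z, θ) - S.hilbertTransport k n q (x, θ)‖ ^ 2 ≤
    ∫ θ in (0 : ℝ)..2 * Real.pi, ‖parityPart n (S.transport q) (z, θ) -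
      parityPart n (S.transport q) (x, θ)‖ ^ 2 := by
  have hUc : ContinuousOn (parityPart n (S.transport q)) S.SM :=
    continuousOn_parityPart (h.continuousOn_transport hq) n
  exact integral_norm_sq_mult_sub_le (isPeriodic_parityPart (h.isPeriodic_transport hqp) n)
    (norm_hilbertMult_le k) (continuous_fibre_of_continuousOn hUc hz)
    (continuous_fibre_of_continuousOn hUc hx) (h.summable_fcoef_parityPart_transport hq hqp hn hz)
    (h.summable_fcoef_parityPart_transport hq hqp hn hx)

/-- u^q is continuous up to the boundary, and the fibrewise mean square bound passes its convergence
on to the transform. -/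
theorem IsSimple.fibreTendsto_hilbertTransport (k : ℤ) {x : ℂ} (hx : S.rho x = 0) :
    S.FibreTendsto (S.hilbertTransport k n q) x := by
  set U := parityPart n (S.transport q) with hU
  have hUc : ContinuousOn U S.SM := continuousOn_parityPart (h.continuousOn_transport hq) n
  have hUp : IsPeriodic U := isPeriodic_parityPart (h.isPeriodic_transport hqp) n
  have hxM : x ∈ S.M := hx.ge
  obtain ⟨C, hC0, hC⟩ := hUp.exists_bound hUc
  have h2 : Filter.Tendsto (fun z => ∫ θ in (0 : ℝ)..2 * Real.pi, ‖U (z, θ) - U (x, θ)‖ ^ 2)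
      (nhdsWithin x {z | 0 < S.rho z}) (nhds (∫ θ in (0 : ℝ)..2 * Real.pi, ‖U (x, θ) - U (x, θ)‖ ^ 2)) := by
    refine intervalIntegral.tendsto_integral_filter_of_dominated_convergence
      (fun _ => (C + C) ^ 2) ?_ ?_ intervalIntegrable_const ?_
    · filter_upwards [self_mem_nhdsWithin] with z hz
      exact (((continuous_fibre_of_continuousOn hUc (show 0 < S.rho z from hz).le).sub
        (continuous_fibre_of_continuousOn hUc hxM)).norm.pow 2).aestronglyMeasurable
    · filter_upwards [self_mem_nhdsWithin] with z hz
      refine Filter.Eventually.of_forall fun θ _ => ?_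
      rw [Real.norm_eq_abs, abs_of_nonneg (by positivity)]
      have : ‖U (z, θ) - U (x, θ)‖ ≤ C + C := (norm_sub_le _ _).trans
        (add_le_add (hC (z, θ) (show 0 < S.rho z from hz).le) (hC (x, θ) hxM))
      gcongr
    · refine Filter.Eventually.of_forall fun θ _ => ?_
      have h3 : ContinuousWithinAt (fun z => U (z, θ)) {z | 0 < S.rho z} x :=
        ContinuousWithinAt.comp (g := U) (f := fun z : ℂ => (z, θ)) (t := S.SM) (hUc (x, θ) hxM)
          (by fun_prop) fun z (hz : 0 < S.rho z) => hz.le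
      exact ((h3.sub continuousWithinAt_const).norm.pow 2)
  simp only [sub_self, norm_zero, ne_eq, OfNat.ofNat_ne_zero, not_false_eq_true, zero_pow,
    intervalIntegral.integral_zero] at h2
  refine squeeze_zero' ?_ ?_ h2
  · exact Filter.Eventually.of_forall fun z =>
      intervalIntegral.integral_nonneg (by positivity) fun _ _ => by positivity
  · filter_upwards [self_mem_nhdsWithin] with z hz
    exact h.integral_hilbertTransport_sub_le hq hqp hn k hxM (show 0 < S.rho z from hz).le

end IsothermalSurface

end

/-! ### Test functions and elements of H_k -/

noncomputable section

namespace IsothermalSurface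

variable (S : IsothermalSurface) (k : ℤ)

/-- A zero of ρ interior to M would be a local minimum of ρ, hence critical, which regularity of the
boundary excludes. -/
theorem interior_M : interior S.M = S.inside := by
  refine Subset.antisymm (fun z hz => ?_)
    (interior_maximal (fun z (hz : 0 < S.rho z) => hz.le) S.isOpen_inside)
  have h0 : z ∈ S.M := interior_subset hz
  refine lt_of_le_of_ne (show 0 ≤ S.rho z from h0) fun h1 => S.rho_regular z h1.symm ?_
  refine IsLocalMin.fderiv_eq_zero ?_
  filter_upwards [mem_interior_iff_mem_nhds.1 hz] with y hy
  rw [← h1]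
  exact hy

/-- Smooth functions with compact support in the interior of the surface. -/
def testSpace : Submodule ℂ (ℂ → ℂ) where
  carrier := {g | ContDiff ℝ ∞ g ∧ HasCompactSupport g ∧ tsupport g ⊆ interior S.M}
  add_mem' := fun {f g} hf hg => ⟨hf.1.add hg.1, hf.2.1.add hg.2.1,
    (tsupport_add f g).trans (union_subset hf.2.2 hg.2.2)⟩
  zero_mem' := ⟨contDiff_const, HasCompactSupport.zero, by simp [tsupport]⟩
  smul_mem' := fun c g hg => ⟨contDiff_const.smul hg.1, hg.2.1.smul_left (f := fun _ => c),
    (closure_mono (Function.support_const_smul_subset c g)).trans hg.2.2⟩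

/-- The function `g(z) exp(i k θ)`. -/
def lift (g : ℂ → ℂ) (p : ℂ × ℝ) : ℂ := g p.1 * exp (k * p.2 * I)

variable {S}

theorem lift_mem_Omega {g : ℂ → ℂ} (hg : ContDiff ℝ ∞ g) : lift k g ∈ Omega k := by
  have h1 : lift k g = fun p => g p.1 * exp (k * p.2 * I) := rfl
  refine ⟨(hg.comp contDiff_fst).mul (contDiff_exp_fibre k), fun p => ?_⟩
  have h2 : HasFDerivAt (fun p : ℂ × ℝ => g p.1) _ p :=
    ((hg.differentiable (by simp) p.1).hasFDerivAt.comp p hasFDerivAt_fst)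
  have h3 : HasFDerivAt (fun p : ℂ × ℝ => g p.1 * exp (k * p.2 * I)) _ p :=
    h2.mul (hasFDerivAt_exp_fibre k p)
  rw [h1, h3.fderiv]
  simp
  ring

theorem lift_vanishes (g : S.testSpace) : S.VanishesOnBoundary (lift k g) := fun p hp => by
  have h1 : p.1 ∉ tsupport (g : ℂ → ℂ) := fun hmem => by
    have h2 := g.2.2.2 hmem
    rw [interior_M] at h2
    exact (show 0 < S.rho p.1 from h2).ne' hp
  rw [lift, image_eq_zero_of_notMem_tsupport h1, zero_mul]

theorem testSpace_isCompact (g : S.testSpace) : IsCompact (tsupport (g : ℂ → ℂ)) := g.2.2.1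

theorem lift_eq_zero {g : ℂ → ℂ} {p : ℂ × ℝ} (hp : p.1 ∉ tsupport g) : lift k g p = 0 := by
  rw [lift, image_eq_zero_of_notMem_tsupport hp, zero_mul]

theorem testSpace_tsupport_subset (g : S.testSpace) : tsupport (g : ℂ → ℂ) ⊆ S.inside := by
  rw [← interior_M]; exact g.2.2.2

theorem isPeriodic_lift (g : ℂ → ℂ) : IsPeriodic (lift k g) := isPeriodic_iff.2 fun z θ => by
  simp only [lift, exp_fibre_periodic]

theorem IsPeriodic.mul {u v : ℂ × ℝ → ℂ} (hu : IsPeriodic u) (hv : IsPeriodic v) :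
    IsPeriodic fun p => u p * v p := fun p => by simp only [hu p, hv p]

theorem IsPeriodic.conj {u : ℂ × ℝ → ℂ} (hu : IsPeriodic u) :
    IsPeriodic fun p => (starRingEnd ℂ) (u p) := fun p => by simp only [hu p]

theorem continuous_of_eq_zero {A : ℂ × ℝ → ℂ} {K : Set ℂ} (hK : IsClosed K) (hKS : K ⊆ S.inside)
    (hA : ContinuousOn A {p | 0 < S.bdf p}) (h0 : ∀ p : ℂ × ℝ, p.1 ∉ K → A p = 0) :
    Continuous A := by
  refine continuous_iff_continuousAt.2 fun p => ?_
  by_cases hp : p.1 ∈ K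
  · exact hA.continuousAt (S.isOpen_interior_bdf.mem_nhds (hKS hp))
  · have : A =ᶠ[nhds p] fun _ => 0 := by
      filter_upwards [(hK.isOpen_compl.preimage continuous_fst).mem_nhds hp] with q hq
      exact h0 q hq
    exact continuousAt_const.congr this.symm

theorem memLp_of_bounded {A : ℂ × ℝ → ℂ} (hA : ContinuousOn A {p | 0 < S.bdf p}) {C : ℝ}
    (hC : ∀ p, 0 < S.bdf p → ‖A p‖ ≤ C) : MemLp A 2 S.volSM :=
  MemLp.of_bound (S.aestronglyMeasurable_of_continuousOn hA) C
    (S.ae_bdf_pos.mono fun p hp => hC p hp)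

theorem memLp_of_continuous {A : ℂ × ℝ → ℂ} (hA : Continuous A) (hp : IsPeriodic A) :
    MemLp A 2 S.volSM := by
  obtain ⟨C, -, hC⟩ := hp.exists_bound (S := S) hA.continuousOn
  exact memLp_of_bounded hA.continuousOn fun p hp => hC p (show 0 < S.bdf p from hp).le

theorem memLp_Omega {f : ℂ × ℝ → ℂ} (hf : f ∈ Omega k) : MemLp f 2 S.volSM :=
  memLp_of_continuous hf.1.continuous (Omega_isPeriodic hf)

theorem memLp_lift (g : S.testSpace) : MemLp (lift k g) 2 S.volSM :=
  memLp_Omega k (lift_mem_Omega k g.2.1)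

/-- The classes of the test functions. -/
def testLp : S.testSpace →ₗ[ℂ] Lp ℂ 2 S.volSM where
  toFun g := (memLp_lift k g).toLp _
  map_add' f g := by
    rw [← MemLp.toLp_add]
    congr 1
    funext p
    simp [lift, add_mul]
  map_smul' c g := by
    rw [RingHom.id_apply, ← MemLp.toLp_const_smul]
    congr 1
    funext p
    simp [lift, mul_assoc]

theorem Hk_eq : S.Hk k = (LinearMap.range (testLp (S := S) k)).topologicalClosure := by
  rw [Hk]
  congr 1
  apply le_antisymm
  · refine Submodule.span_le.2 ?_
    rintro F ⟨g, hg1, hg2, hg3, hF⟩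
    refine ⟨⟨g, hg1, hg2, hg3⟩, ?_⟩
    apply Lp.ext
    exact (MemLp.coeFn_toLp (memLp_lift k ⟨g, hg1, hg2, hg3⟩)).trans hF.symm
  · rintro _ ⟨g, rfl⟩
    exact Submodule.subset_span ⟨g, g.2.1, g.2.2.1, g.2.2.2, MemLp.coeFn_toLp (memLp_lift k g)⟩

/-- The classes of the test functions in `H_k`. -/
def testHk : S.testSpace →ₗ[ℂ] S.Hk k :=
  (testLp k).codRestrict (S.Hk k) fun g => by
    rw [Hk_eq]
    exact Submodule.le_topologicalClosure _ ⟨g, rfl⟩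

theorem represents_testHk (g : S.testSpace) : S.Represents (testHk k g) (lift k g) :=
  MemLp.coeFn_toLp (memLp_lift k g)

theorem denseRange_testHk : DenseRange (testHk (S := S) k) := by
  rw [DenseRange, Topology.IsInducing.subtypeVal.dense_iff]
  rintro ⟨F, hF⟩
  have h1 : Subtype.val '' range (testHk (S := S) k) = (LinearMap.range (testLp (S := S) k) : Set _) := by
    ext G
    constructor
    · rintro ⟨_, ⟨g, rfl⟩, rfl⟩
      exact ⟨g, rfl⟩
    · rintro ⟨g, rfl⟩
      exact ⟨_, ⟨g, rfl⟩, rfl⟩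
  rw [Hk_eq] at hF
  exact h1.symm ▸ hF

variable {k}

theorem inner_eq_of_represents {F G : S.Hk k} {f g : ℂ × ℝ → ℂ} (hF : S.Represents F f)
    (hG : S.Represents G g) : inner ℂ F G = ∫ p, g p * (starRingEnd ℂ) (f p) ∂S.volSM := by
  rw [Submodule.coe_inner, L2.inner_def]
  refine integral_congr_ae ?_
  filter_upwards [hF, hG] with p h1 h2
  rw [h1, h2]
  rfl

theorem Represents.memLp {F : S.Hk k} {f : ℂ × ℝ → ℂ} (hF : S.Represents F f) :
    MemLp f 2 S.volSM := (memLp_congr_ae hF).1 (Lp.memLp _)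

/-- A fibrewise homogeneous factor only sees the corresponding Fourier component. -/
theorem integral_mode_mul {u : ℂ × ℝ → ℂ} {c : ℂ → ℂ}
    (h1 : Integrable (fun p => mode k u p * (starRingEnd ℂ) (lift k c p)) S.volSM)
    (h2 : Integrable (fun p => u p * (starRingEnd ℂ) (lift k c p)) S.volSM) :
    ∫ p, mode k u p * (starRingEnd ℂ) (lift k c p) ∂S.volSM =
      ∫ p, u p * (starRingEnd ℂ) (lift k c p) ∂S.volSM := by
  rw [S.integral_volSM_iterated h1, S.integral_volSM_iterated h2]
  refine integral_congr_ae (Filter.Eventually.of_forall fun z => ?_)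
  simp only
  congr 1
  have e : ∀ θ : ℝ, (starRingEnd ℂ) (lift k c (z, θ)) = (starRingEnd ℂ) (c z) * exp (-(k * θ * I)) := by
    intro θ
    rw [lift, map_mul, ← exp_conj]
    simp
  have e2 : ∀ θ : ℝ, mode k u (z, θ) * (starRingEnd ℂ) (lift k c (z, θ)) =
      fcoef k u z * (starRingEnd ℂ) (c z) := by
    intro θ
    rw [e, mode_eq]
    have : exp (k * θ * I) * exp (-(k * θ * I)) = 1 := by
      rw [← Complex.exp_add, add_neg_cancel, Complex.exp_zero]
    linear_combination (fcoef k u z * (starRingEnd ℂ) (c z)) * this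
  have e3 : ∀ θ : ℝ, u (z, θ) * (starRingEnd ℂ) (lift k c (z, θ)) =
      (starRingEnd ℂ) (c z) * (u (z, θ) * exp (-(k * θ * I))) := by
    intro θ; rw [e]; ring
  simp only [e2, e3]
  rw [intervalIntegral.integral_const, intervalIntegral.integral_const_mul, fcoef, sub_zero,
    Complex.real_smul]
  have : (Real.pi : ℂ) ≠ 0 := by exact_mod_cast Real.pi_ne_zero
  push_cast
  generalize (∫ φ in (0 : ℝ)..2 * Real.pi, u (z, φ) * exp (-(k * φ * I))) = J
  field_simp

theorem lift_fcoef (u : ℂ × ℝ → ℂ) : lift k (fcoef k u) = mode k u := by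
  funext p
  rw [lift, mode_eq, mul_comm]

theorem mode_mem_testSpace {ψ : ℂ × ℝ → ℂ} (hψ : ContDiff ℝ ∞ ψ) (hc : HasCompactSupport ψ)
    (hs : ∀ p ∈ tsupport ψ, p.1 ∈ S.inside) : fcoef k ψ ∈ S.testSpace := by
  have hK : IsCompact (Prod.fst '' tsupport ψ) := hc.image continuous_fst
  have hsub : Function.support (fcoef k ψ) ⊆ Prod.fst '' tsupport ψ := by
    intro z hz
    by_contra hn
    refine hz ?_
    have h0 : ∀ φ : ℝ, ψ (z, φ) = 0 := fun φ => by
      by_contra h1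
      exact hn ⟨(z, φ), subset_closure h1, rfl⟩
    simp [fcoef, h0]
  have hts : tsupport (fcoef k ψ) ⊆ Prod.fst '' tsupport ψ := closure_minimal hsub hK.isClosed
  refine ⟨?_, hK.of_isClosed_subset (isClosed_tsupport _) hts, hts.trans ?_⟩
  · refine contDiff_iff_contDiffAt.2 fun z => contDiffAt_const.mul ?_
    have hF : ContDiff ℝ ∞ fun p : ℂ × ℝ => ψ (p.1, p.2) * exp (-(k * p.2 * I)) := by
      have := hψ.mul (contDiff_exp_fibre (-k))
      simpa only [Int.cast_neg, neg_mul] using this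
    exact contDiffAt_parametric_integral isOpen_univ 0 (2 * Real.pi)
      (F := fun p : ℂ × ℝ => ψ (p.1, p.2) * exp (-(k * p.2 * I))) (fun p _ t => hF.contDiffAt)
      (mem_univ z)
  · rw [interior_M]
    rintro _ ⟨p, hp, rfl⟩
    exact hs p hp

/-- Elements of `H_k` are orthogonal to functions without component of degree `k`. -/
theorem integral_mul_conj_eq_mode {ψ : ℂ × ℝ → ℂ} (hψ : ContDiff ℝ ∞ ψ) (hc : HasCompactSupport ψ)
    (hs : ∀ p ∈ tsupport ψ, p.1 ∈ S.inside) (F : S.Hk k) :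
    ∫ p, (F : Lp ℂ 2 S.volSM) p * (starRingEnd ℂ) (ψ p) ∂S.volSM =
      ∫ p, (F : Lp ℂ 2 S.volSM) p * (starRingEnd ℂ) (mode k ψ p) ∂S.volSM := by
  obtain ⟨C, hC⟩ := hψ.continuous.bounded_above_of_compact_support hc
  have m1 : MemLp ψ 2 S.volSM := memLp_of_bounded hψ.continuous.continuousOn fun p _ => hC p
  have hg := mode_mem_testSpace (S := S) (k := k) hψ hc hs
  have m2 : MemLp (mode k ψ) 2 S.volSM := by
    rw [← lift_fcoef]; exact memLp_lift k ⟨_, hg⟩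
  -- Orthogonality to ψ - ψ_k holds for test functions and is a closed condition.
  have key : (F : Lp ℂ 2 S.volSM) ∈ (Submodule.span ℂ {m1.toLp ψ - m2.toLp (mode k ψ)})ᗮ := by
    have hle : S.Hk k ≤ (Submodule.span ℂ {m1.toLp ψ - m2.toLp (mode k ψ)})ᗮ := by
      rw [Hk_eq]
      refine Submodule.topologicalClosure_minimal _ ?_ (Submodule.isClosed_orthogonal _)
      rintro _ ⟨g, rfl⟩
      rw [Submodule.mem_orthogonal_singleton_iff_inner_left, inner_sub_right, L2.inner_def,
        L2.inner_def]
      have mg := memLp_lift k g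
      have i1 : ∫ p, inner ℂ (testLp k g p) (m1.toLp ψ p) ∂S.volSM =
          ∫ p, ψ p * (starRingEnd ℂ) (lift k g p) ∂S.volSM := by
        refine integral_congr_ae ?_
        filter_upwards [m1.coeFn_toLp, (memLp_lift k g).coeFn_toLp] with p h1 h2
        rw [h1]
        change inner ℂ (((memLp_lift k g).toLp _) p) _ = _
        rw [h2]; rfl
      have i2 : ∫ p, inner ℂ (testLp k g p) (m2.toLp (mode k ψ) p) ∂S.volSM =
          ∫ p, mode k ψ p * (starRingEnd ℂ) (lift k g p) ∂S.volSM := by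
        refine integral_congr_ae ?_
        filter_upwards [m2.coeFn_toLp, (memLp_lift k g).coeFn_toLp] with p h1 h2
        rw [h1]
        change inner ℂ (((memLp_lift k g).toLp _) p) _ = _
        rw [h2]; rfl
      rw [i1, i2, integral_mode_mul (m2.integrable_mul mg.star) (m1.integrable_mul mg.star), sub_self]
    exact hle F.2
  rw [Submodule.mem_orthogonal_singleton_iff_inner_right, inner_sub_left, sub_eq_zero, L2.inner_def,
    L2.inner_def] at key
  have i1 : ∫ p, inner ℂ (m1.toLp ψ p) ((F : Lp ℂ 2 S.volSM) p) ∂S.volSM =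
      ∫ p, (F : Lp ℂ 2 S.volSM) p * (starRingEnd ℂ) (ψ p) ∂S.volSM := by
    refine integral_congr_ae ?_
    filter_upwards [m1.coeFn_toLp] with p h1
    rw [h1]; rfl
  have i2 : ∫ p, inner ℂ (m2.toLp (mode k ψ) p) ((F : Lp ℂ 2 S.volSM) p) ∂S.volSM =
      ∫ p, (F : Lp ℂ 2 S.volSM) p * (starRingEnd ℂ) (mode k ψ p) ∂S.volSM := by
    refine integral_congr_ae ?_
    filter_upwards [m2.coeFn_toLp] with p h1
    rw [h1]; rfl
  rw [← i1, ← i2, key]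

/-- Up to a null set the half-open fundamental domain is an open set, where smooth compactly
supported functions decide equality almost everywhere. -/
theorem ae_mem_Ioo : ∀ᵐ p ∂S.volSM, p ∈ S.inside ×ˢ Ioo 0 (2 * Real.pi) := by
  have h1 : ∀ᵐ p ∂S.volSM, p ∈ S.box :=
    S.volSM_ac.ae_le (ae_restrict_mem S.measurableSet_box)
  have h2 : ∀ᵐ p : ℂ × ℝ ∂S.volSM, p.2 ≠ 2 * Real.pi := by
    refine S.volSM_ac.ae_le (ae_restrict_of_ae ?_)
    rw [Measure.volume_eq_prod]
    have h3 : ∀ᵐ x : ℝ, x ≠ 2 * Real.pi := by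
      simp [ae_iff, measure_singleton]
    exact Measure.quasiMeasurePreserving_snd.ae h3
  filter_upwards [h1, h2, S.ae_bdf_pos] with p hp hp2 hp3
  exact ⟨hp3, hp.2.1, lt_of_le_of_ne hp.2.2 hp2⟩

/-- An element of `H_k` is determined by its pairings with test functions. -/
theorem represents_of_forall_test {G : S.Hk k} {c : ℂ → ℂ} (hc : ContinuousOn c S.inside)
    (hG : ∀ g : S.testSpace, inner ℂ (testHk k g) G =
      ∫ p, lift k c p * (starRingEnd ℂ) (lift k g p) ∂S.volSM) : S.Represents G (lift k c) := by
  have hcont : ContinuousOn (lift k c) {p | 0 < S.bdf p} :=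
    (hc.comp continuous_fst.continuousOn fun p hp => hp).mul
      (contDiff_exp_fibre k).continuous.continuousOn
  set U : Set (ℂ × ℝ) := S.inside ×ˢ Ioo 0 (2 * Real.pi) with hU
  have hUo : IsOpen U := S.isOpen_inside.prod isOpen_Ioo
  have hGi : Integrable (G : Lp ℂ 2 S.volSM) S.volSM := (Lp.memLp _).integrable (by norm_num)
  have hloc : LocallyIntegrableOn (fun p => (G : Lp ℂ 2 S.volSM) p - lift k c p) U S.volSM := by
    refine hGi.locallyIntegrable.locallyIntegrableOn U |>.sub ?_
    exact (hcont.mono fun p hp => hp.1).locallyIntegrableOn hUo.measurableSet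
  -- The probing functions are arbitrary in the fibre variable, but G and `lift k c` see only their
  -- k-th mode, which is an admissible test function.
  have h := hUo.ae_eq_zero_of_integral_contDiff_smul_eq_zero hloc ?_
  · filter_upwards [h, ae_mem_Ioo] with p h1 h2
    exact sub_eq_zero.1 (h1 h2)
  intro g hg hgc hgs
  have hψ : ContDiff ℝ ∞ fun p => (g p : ℂ) := ofRealCLM.contDiff.comp hg
  have hψc : HasCompactSupport fun p => (g p : ℂ) := hgc.comp_left (g := ofReal) ofReal_zero
  have hts : tsupport (fun p => (g p : ℂ)) ⊆ tsupport g :=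
    closure_mono (Function.support_comp_subset ofReal_zero g)
  have hψs : ∀ p ∈ tsupport (fun p => (g p : ℂ)), p.1 ∈ S.inside := fun p hp => (hgs (hts hp)).1
  have hm := mode_mem_testSpace (S := S) (k := k) hψ hψc hψs
  have e1 := integral_mul_conj_eq_mode hψ hψc hψs G
  have e2 := hG ⟨_, hm⟩
  rw [inner_eq_of_represents (represents_testHk k ⟨_, hm⟩) (Filter.EventuallyEq.refl _ _)] at e2
  have e3 : lift k (fcoef k fun p => (g p : ℂ)) = mode k fun p => (g p : ℂ) := lift_fcoef _
  simp only [e3] at e2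
  have i1 : Integrable (fun p => lift k c p * (g p : ℂ)) S.volSM := by
    have h1 : Continuous fun p => lift k c p * (g p : ℂ) :=
      continuous_of_eq_zero (hψc.image continuous_fst).isClosed
        (by rintro _ ⟨p, hp, rfl⟩; exact hψs p hp)
        (hcont.mul hψ.continuous.continuousOn) fun p hp => by
          rw [image_eq_zero_of_notMem_tsupport fun h => hp ⟨p, h, rfl⟩, mul_zero]
    obtain ⟨C, hC⟩ := h1.bounded_above_of_compact_support hψc.mul_left
    exact S.integrable_of_continuousOn_of_bounded h1.continuousOn fun p _ => hC p
  have i2 : Integrable (fun p => (G : Lp ℂ 2 S.volSM) p * (g p : ℂ)) S.volSM := by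
    obtain ⟨C, hC⟩ := hψ.continuous.bounded_above_of_compact_support hψc
    exact hGi.mul_bdd (c := C) hψ.continuous.aestronglyMeasurable (Filter.Eventually.of_forall hC)
  have hmc : Continuous (mode k fun p => (g p : ℂ)) := by
    rw [← e3]; exact (lift_mem_Omega k hm.1).1.continuous
  have i3 : Integrable (fun p => mode k (fun p => (g p : ℂ)) p * (starRingEnd ℂ) (lift k c p))
      S.volSM := by
    refine S.integrable_of_continuous ?_ ((isPeriodic_mode k _).mul (isPeriodic_lift k c).conj)
    refine continuous_of_eq_zero (testSpace_isCompact ⟨_, hm⟩).isClosed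
      (testSpace_tsupport_subset ⟨_, hm⟩)
      (hmc.continuousOn.mul (continuous_conj.comp_continuousOn hcont)) fun p hp => ?_
    rw [← e3, lift_eq_zero k hp, zero_mul]
  have i4 : Integrable (fun p => (g p : ℂ) * (starRingEnd ℂ) (lift k c p)) S.volSM := by
    have := (conjCLE : ℂ →L[ℝ] ℂ).integrable_comp i1
    refine this.congr (Filter.Eventually.of_forall fun p => ?_)
    simp [mul_comm]
  have e4 := congrArg (starRingEnd ℂ) (integral_mode_mul (S := S) (k := k) (c := c) i3 i4)
  rw [← integral_conj, ← integral_conj] at e4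
  simp only [map_mul, conj_conj, conj_ofReal] at e1 e2 e4
  have e5 : ∀ p, g p • ((G : Lp ℂ 2 S.volSM) p - lift k c p) =
      (G : Lp ℂ 2 S.volSM) p * (g p : ℂ) - lift k c p * (g p : ℂ) := fun p => by
    rw [Complex.real_smul]; ring
  simp only [e5]
  rw [integral_sub i2 i1, e1, e2, sub_eq_zero]
  simp only [mul_comm (lift k c _)]
  exact e4

/-- Bounded functions homogeneous along the fibres and continuous in the interior define elements
of `H_k`. -/
theorem exists_represents {c : ℂ → ℂ} (hc : ContinuousOn c S.inside) {C : ℝ}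
    (hC : ∀ z ∈ S.inside, ‖c z‖ ≤ C) : ∃ F : S.Hk k, S.Represents F (lift k c) := by
  have hcont : ContinuousOn (lift k c) {p | 0 < S.bdf p} :=
    (hc.comp continuous_fst.continuousOn fun p hp => hp).mul
      (contDiff_exp_fibre k).continuous.continuousOn
  have hm : MemLp (lift k c) 2 S.volSM := memLp_of_bounded hcont (C := C) fun p hp => by
    rw [lift, norm_mul, norm_exp_int_mul, mul_one]; exact hC _ hp
  haveI : CompleteSpace (S.Hk k) := by
    rw [Hk_eq]; infer_instance
  -- The projection onto H_k has the same pairings with test functions as the function itself, so it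
  -- represents that function.
  refine ⟨(S.Hk k).orthogonalProjection (hm.toLp _), represents_of_forall_test hc fun g => ?_⟩
  rw [Submodule.inner_orthogonalProjection_eq_of_mem_left, L2.inner_def]
  refine integral_congr_ae ?_
  filter_upwards [hm.coeFn_toLp, represents_testHk k g] with p h1 h2
  rw [h1, h2]
  rfl

end IsothermalSurface

end

/-! ### Geodesic polar coordinates and Jacobi fields -/

noncomputable section

theorem fderiv_fderiv_comm {E F : Type*} [NormedAddCommGroup E] [NormedSpace ℝ E]
    [NormedAddCommGroup F] [NormedSpace ℝ F] {f : E → F} (hf : ContDiff ℝ ∞ f) (x v w : E) :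
    fderiv ℝ (fun y => fderiv ℝ f y v) x w = fderiv ℝ (fun y => fderiv ℝ f y w) x v := by
  have h1 : ∀ a b, fderiv ℝ (fun y => fderiv ℝ f y a) x b = fderiv ℝ (fderiv ℝ f) x b a := by
    intro a b
    have hd : DifferentiableAt ℝ (fderiv ℝ f) x :=
      ((hf.fderiv_right (m := ∞) (by simp)).differentiable (by simp)) x
    rw [fderiv_clm_apply hd (differentiableAt_const a)]
    simp
  rw [h1, h1]
  exact (hf.contDiffAt.isSymmSndFDerivAt (by simp; exact WithTop.coe_le_coe.2 le_top)) w v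

theorem contDiff_fderiv_apply {E F : Type*} [NormedAddCommGroup E] [NormedSpace ℝ E]
    [NormedAddCommGroup F] [NormedSpace ℝ F] {f : E → F} (hf : ContDiff ℝ ∞ f) (v : E) :
    ContDiff ℝ ∞ fun y => fderiv ℝ f y v :=
  (hf.fderiv_right (m := ∞) (by simp)).clm_apply contDiff_const

namespace IsothermalSurface

variable (S : IsothermalSurface) (x : ℂ)

theorem laplacian_lam (z : ℂ) : Laplacian.laplacian S.lam z =
    fderiv ℝ (fun y => fderiv ℝ S.lam y 1) z 1 + fderiv ℝ (fun y => fderiv ℝ S.lam y I) z I := by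
  have hd : DifferentiableAt ℝ (fderiv ℝ S.lam) z :=
    ((S.lam_smooth.fderiv_right (m := ∞) (by simp)).differentiable (by simp)) z
  rw [InnerProductSpace.laplacian_eq_iteratedFDeriv_complexPlane]
  simp only [iteratedFDeriv_two_apply]
  rw [fderiv_clm_apply hd (differentiableAt_const _), fderiv_clm_apply hd (differentiableAt_const _)]
  simp

theorem contDiff_curv : ContDiff ℝ ∞ S.curv := by
  have h1 : S.curv = fun z => -Real.exp (-2 * S.lam z) *
      (fderiv ℝ (fun y => fderiv ℝ S.lam y 1) z 1 + fderiv ℝ (fun y => fderiv ℝ S.lam y I) z I) :=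
    funext fun z => by rw [curv, laplacian_lam]
  rw [h1]
  exact ((contDiff_const.mul S.lam_smooth).exp.neg).mul
    ((contDiff_fderiv_apply (contDiff_fderiv_apply S.lam_smooth 1) 1).add
      (contDiff_fderiv_apply (contDiff_fderiv_apply S.lam_smooth I) I))

/-- Geodesic polar coordinates: the geodesic with direction `y.2` at `x` after time `y.1`. -/
def polar (y : ℝ × ℝ) : ℂ × ℝ := S.gflow y.1 (x, y.2)

theorem contDiff_polar : ContDiff ℝ ∞ (S.polar x) :=
  S.contDiff_gflow.comp (contDiff_fst.prodMk (contDiff_const.prodMk contDiff_snd))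

theorem fderiv_polar_time (y : ℝ × ℝ) :
    fderiv ℝ (S.polar x) y (1, 0) = S.ext.geodField (S.polar x y) := by
  have h1 := (((S.contDiff_polar x).differentiable (by simp)) (y.1, y.2)).hasFDerivAt.comp_hasDerivAt
    y.1 ((hasDerivAt_id y.1).prodMk (hasDerivAt_const y.1 y.2))
  exact h1.unique (S.hasDerivAt_gflow (x, y.2) y.1)

/-- The variation of geodesic polar coordinates in the direction. -/
def jac (y : ℝ × ℝ) : ℂ × ℝ := fderiv ℝ (S.polar x) y (0, 1)

theorem contDiff_jac : ContDiff ℝ ∞ (S.jac x) := contDiff_fderiv_apply (S.contDiff_polar x) _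

theorem jac_zero (φ : ℝ) : S.jac x (0, φ) = (0, 1) := by
  have h1 := (((S.contDiff_polar x).differentiable (by simp)) (0, φ)).hasFDerivAt.comp_hasDerivAt
    φ ((hasDerivAt_const φ (0 : ℝ)).prodMk (hasDerivAt_id φ))
  have h2 : HasDerivAt (fun φ : ℝ => (x, φ)) ((0 : ℂ), (1 : ℝ)) φ :=
    (hasDerivAt_const φ x).prodMk (hasDerivAt_id φ)
  refine h1.unique (h2.congr_of_eventuallyEq (Filter.Eventually.of_forall fun ψ => ?_))
  simp [polar, S.gflow_zero]

/-- The normal component of the variation of polar coordinates. -/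
def jacB (y : ℝ × ℝ) : ℝ := Real.exp (S.ext.lam (S.polar x y).1) *
  (-Real.sin (S.polar x y).2 * (S.jac x y).1.re + Real.cos (S.polar x y).2 * (S.jac x y).1.im)

/-- The time derivative of the normal component of the variation of polar coordinates. -/
def jacB' (y : ℝ × ℝ) : ℝ :=
  (Real.cos (S.polar x y).2 * fderiv ℝ S.ext.lam (S.polar x y).1 1 +
    Real.sin (S.polar x y).2 * fderiv ℝ S.ext.lam (S.polar x y).1 I) *
  (-Real.sin (S.polar x y).2 * (S.jac x y).1.re + Real.cos (S.polar x y).2 * (S.jac x y).1.im) +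
  (S.jac x y).2

/-- The tangential component of the variation of polar coordinates. -/
def jacA (y : ℝ × ℝ) : ℝ := Real.exp (S.ext.lam (S.polar x y).1) *
  (Real.cos (S.polar x y).2 * (S.jac x y).1.re + Real.sin (S.polar x y).2 * (S.jac x y).1.im)

theorem contDiff_polar_comp {g : ℂ → ℝ} (hg : ContDiff ℝ ∞ g) :
    ContDiff ℝ ∞ fun y => g (S.polar x y).1 := hg.comp (contDiff_fst.comp (S.contDiff_polar x))

theorem contDiff_angle : ContDiff ℝ ∞ fun y => (S.polar x y).2 :=
  contDiff_snd.comp (S.contDiff_polar x)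

theorem contDiff_jac_re : ContDiff ℝ ∞ fun y => (S.jac x y).1.re :=
  reCLM.contDiff.comp (contDiff_fst.comp (S.contDiff_jac x))

theorem contDiff_jac_im : ContDiff ℝ ∞ fun y => (S.jac x y).1.im :=
  imCLM.contDiff.comp (contDiff_fst.comp (S.contDiff_jac x))

theorem contDiff_normal : ContDiff ℝ ∞ fun y => -Real.sin (S.polar x y).2 * (S.jac x y).1.re +
    Real.cos (S.polar x y).2 * (S.jac x y).1.im :=
  ((S.contDiff_angle x).sin.neg.mul (S.contDiff_jac_re x)).add
    ((S.contDiff_angle x).cos.mul (S.contDiff_jac_im x))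

theorem contDiff_jacB : ContDiff ℝ ∞ (S.jacB x) :=
  (S.contDiff_polar_comp x S.ext.lam_smooth).exp.mul (S.contDiff_normal x)

theorem contDiff_jacB' : ContDiff ℝ ∞ (S.jacB' x) :=
  ((((S.contDiff_angle x).cos.mul (S.contDiff_polar_comp x (contDiff_fderiv_apply S.ext.lam_smooth 1))).add
    ((S.contDiff_angle x).sin.mul (S.contDiff_polar_comp x (contDiff_fderiv_apply S.ext.lam_smooth I)))).mul
    (S.contDiff_normal x)).add (contDiff_snd.comp (S.contDiff_jac x))

theorem fderiv_expansion {g : ℂ → ℝ} (z w : ℂ) :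
    fderiv ℝ g z w = w.re * fderiv ℝ g z 1 + w.im * fderiv ℝ g z I := by
  have h : w = w.re • (1 : ℂ) + w.im • I := by
    apply Complex.ext <;> simp
  conv_lhs => rw [h]
  rw [map_add, map_smul, map_smul, smul_eq_mul, smul_eq_mul]

section derivatives

variable (t φ : ℝ)

theorem hasDerivAt_time {E : Type*} [NormedAddCommGroup E] [NormedSpace ℝ E] {F : ℝ × ℝ → E}
    (hF : ContDiff ℝ ∞ F) (t φ : ℝ) :
    HasDerivAt (fun t => F (t, φ)) (fderiv ℝ F (t, φ) (1, 0)) t :=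
  (hF.differentiable (by simp) (t, φ)).hasFDerivAt.comp_hasDerivAt t
    ((hasDerivAt_id t).prodMk (hasDerivAt_const t φ))

theorem hasDerivAt_dir {E : Type*} [NormedAddCommGroup E] [NormedSpace ℝ E] {F : ℝ × ℝ → E}
    (hF : ContDiff ℝ ∞ F) (t φ : ℝ) :
    HasDerivAt (fun φ => F (t, φ)) (fderiv ℝ F (t, φ) (0, 1)) φ :=
  (hF.differentiable (by simp) (t, φ)).hasFDerivAt.comp_hasDerivAt φ
    ((hasDerivAt_const φ t).prodMk (hasDerivAt_id φ))

theorem hasDerivAt_polar_time : HasDerivAt (fun t => S.polar x (t, φ))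
    (S.ext.geodField (S.polar x (t, φ))) t := S.hasDerivAt_gflow (x, φ) t

theorem hasDerivAt_polar_dir : HasDerivAt (fun φ => S.polar x (t, φ)) (S.jac x (t, φ)) φ :=
  hasDerivAt_dir (S.contDiff_polar x) t φ

/-- Linearization of a component of the geodesic equation. -/
theorem hasDerivAt_jac_component (L : ℂ × ℝ →L[ℝ] ℝ) {c : ℝ}
    (hc : HasDerivAt (fun φ => L (S.ext.geodField (S.polar x (t, φ)))) c φ) :
    HasDerivAt (fun t => L (S.jac x (t, φ))) c t := by
  have hf : ContDiff ℝ ∞ fun y => L (S.polar x y) := L.contDiff.comp (S.contDiff_polar x)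
  have e : ∀ v y, fderiv ℝ (fun y => L (S.polar x y)) y v = L (fderiv ℝ (S.polar x) y v) := by
    intro v y
    have h1 : HasFDerivAt (fun y => L (S.polar x y)) _ y := L.hasFDerivAt.comp y
      ((S.contDiff_polar x).differentiable (by simp) y).hasFDerivAt
    rw [h1.fderiv]; rfl
  -- Mixed partial derivatives commute: the time derivative of the variation is the variation of the
  -- geodesic field.
  have h1 := hasDerivAt_time (contDiff_fderiv_apply hf (0, 1)) t φ
  rw [fderiv_fderiv_comm hf] at h1
  have h2 := hasDerivAt_dir (contDiff_fderiv_apply hf (1, 0)) t φ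
  simp only [e, fderiv_polar_time] at h1 h2
  rw [h2.unique hc] at h1
  exact h1

/-- Chain rule for functions of the base point. -/
theorem hasDerivAt_base {g : ℂ → ℝ} (hg : ContDiff ℝ ∞ g) {γ : ℝ → ℂ × ℝ} {v : ℂ × ℝ} {s : ℝ}
    (hγ : HasDerivAt γ v s) : HasDerivAt (fun s => g (γ s).1)
      (v.1.re * fderiv ℝ g (γ s).1 1 + v.1.im * fderiv ℝ g (γ s).1 I) s := by
  rw [← fderiv_expansion]
  exact (hg.differentiable (by simp) _).hasFDerivAt.comp_hasDerivAt s
    ((hasFDerivAt_fst (p := γ s)).comp_hasDerivAt s hγ)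

theorem hasDerivAt_snd {γ : ℝ → ℂ × ℝ} {v : ℂ × ℝ} {s : ℝ} (hγ : HasDerivAt γ v s) :
    HasDerivAt (fun s => (γ s).2) v.2 s := (hasFDerivAt_snd (p := γ s)).comp_hasDerivAt s hγ

theorem geodField_re (S : IsothermalSurface) (p : ℂ × ℝ) :
    (S.geodField p).1.re = Real.exp (-S.lam p.1) * Real.cos p.2 := by
  rw [geodField, Complex.smul_re, exp_ofReal_mul_I_re, smul_eq_mul]

theorem geodField_im (S : IsothermalSurface) (p : ℂ × ℝ) :
    (S.geodField p).1.im = Real.exp (-S.lam p.1) * Real.sin p.2 := by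
  rw [geodField, Complex.smul_im, exp_ofReal_mul_I_im, smul_eq_mul]

theorem geodField_snd (S : IsothermalSurface) (p : ℂ × ℝ) :
    (S.geodField p).2 = Real.exp (-S.lam p.1) *
      (-Real.sin p.2 * fderiv ℝ S.lam p.1 1 + Real.cos p.2 * fderiv ℝ S.lam p.1 I) := by
  rw [geodField, fderiv_expansion]
  simp [exp_ofReal_mul_I_re, exp_ofReal_mul_I_im]

theorem hasDerivAt_ofBase_time {g : ℂ → ℝ} (hg : ContDiff ℝ ∞ g) :
    HasDerivAt (fun t => g (S.polar x (t, φ)).1) (Real.exp (-S.ext.lam (S.polar x (t, φ)).1) *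
      (Real.cos (S.polar x (t, φ)).2 * fderiv ℝ g (S.polar x (t, φ)).1 1 +
        Real.sin (S.polar x (t, φ)).2 * fderiv ℝ g (S.polar x (t, φ)).1 I)) t := by
  refine (hasDerivAt_base hg (S.hasDerivAt_polar_time x t φ)).congr_deriv ?_
  rw [geodField_re, geodField_im]; ring

theorem hasDerivAt_angle_time : HasDerivAt (fun t => (S.polar x (t, φ)).2)
    (Real.exp (-S.ext.lam (S.polar x (t, φ)).1) *
      (-Real.sin (S.polar x (t, φ)).2 * fderiv ℝ S.ext.lam (S.polar x (t, φ)).1 1 +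
        Real.cos (S.polar x (t, φ)).2 * fderiv ℝ S.ext.lam (S.polar x (t, φ)).1 I)) t :=
  (hasDerivAt_snd (S.hasDerivAt_polar_time x t φ)).congr_deriv (S.ext.geodField_snd _)

theorem hasDerivAt_jac_re : HasDerivAt (fun t => (S.jac x (t, φ)).1.re)
    (Real.exp (-S.ext.lam (S.polar x (t, φ)).1) *
      (-((S.jac x (t, φ)).1.re * fderiv ℝ S.ext.lam (S.polar x (t, φ)).1 1 +
        (S.jac x (t, φ)).1.im * fderiv ℝ S.ext.lam (S.polar x (t, φ)).1 I) *
        Real.cos (S.polar x (t, φ)).2 -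
        Real.sin (S.polar x (t, φ)).2 * (S.jac x (t, φ)).2)) t := by
  refine S.hasDerivAt_jac_component x t φ
    (reCLM.comp (ContinuousLinearMap.fst ℝ ℂ ℝ)) ?_
  have e : ∀ φ, (reCLM.comp (ContinuousLinearMap.fst ℝ ℂ ℝ)) (S.ext.geodField (S.polar x (t, φ))) =
      Real.exp (-S.ext.lam (S.polar x (t, φ)).1) * Real.cos (S.polar x (t, φ)).2 := fun φ =>
    S.ext.geodField_re _
  simp only [e]
  have hp := S.hasDerivAt_polar_dir x t φ
  have h1 : HasDerivAt (fun φ => Real.exp (-S.ext.lam (S.polar x (t, φ)).1) *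
    Real.cos (S.polar x (t, φ)).2) _ φ :=
    (hasDerivAt_base S.ext.lam_smooth hp).neg.exp.mul (hasDerivAt_snd hp).cos
  refine h1.congr_deriv ?_
  simp only [Pi.neg_apply]
  ring

theorem hasDerivAt_jac_im : HasDerivAt (fun t => (S.jac x (t, φ)).1.im)
    (Real.exp (-S.ext.lam (S.polar x (t, φ)).1) *
      (-((S.jac x (t, φ)).1.re * fderiv ℝ S.ext.lam (S.polar x (t, φ)).1 1 +
        (S.jac x (t, φ)).1.im * fderiv ℝ S.ext.lam (S.polar x (t, φ)).1 I) *
        Real.sin (S.polar x (t, φ)).2 +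
        Real.cos (S.polar x (t, φ)).2 * (S.jac x (t, φ)).2)) t := by
  refine S.hasDerivAt_jac_component x t φ
    (imCLM.comp (ContinuousLinearMap.fst ℝ ℂ ℝ)) ?_
  have e : ∀ φ, (imCLM.comp (ContinuousLinearMap.fst ℝ ℂ ℝ)) (S.ext.geodField (S.polar x (t, φ))) =
      Real.exp (-S.ext.lam (S.polar x (t, φ)).1) * Real.sin (S.polar x (t, φ)).2 := fun φ =>
    S.ext.geodField_im _
  simp only [e]
  have hp := S.hasDerivAt_polar_dir x t φ
  have h1 : HasDerivAt (fun φ => Real.exp (-S.ext.lam (S.polar x (t, φ)).1) *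
    Real.sin (S.polar x (t, φ)).2) _ φ :=
    (hasDerivAt_base S.ext.lam_smooth hp).neg.exp.mul (hasDerivAt_snd hp).sin
  refine h1.congr_deriv ?_
  simp only [Pi.neg_apply]
  ring

theorem hasDerivAt_jac_snd : HasDerivAt (fun t => (S.jac x (t, φ)).2)
    (Real.exp (-S.ext.lam (S.polar x (t, φ)).1) *
      (-((S.jac x (t, φ)).1.re * fderiv ℝ S.ext.lam (S.polar x (t, φ)).1 1 +
        (S.jac x (t, φ)).1.im * fderiv ℝ S.ext.lam (S.polar x (t, φ)).1 I) *
        (-Real.sin (S.polar x (t, φ)).2 * fderiv ℝ S.ext.lam (S.polar x (t, φ)).1 1 +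
          Real.cos (S.polar x (t, φ)).2 * fderiv ℝ S.ext.lam (S.polar x (t, φ)).1 I) -
        (Real.cos (S.polar x (t, φ)).2 * fderiv ℝ S.ext.lam (S.polar x (t, φ)).1 1 +
          Real.sin (S.polar x (t, φ)).2 * fderiv ℝ S.ext.lam (S.polar x (t, φ)).1 I) *
          (S.jac x (t, φ)).2 -
        Real.sin (S.polar x (t, φ)).2 *
          ((S.jac x (t, φ)).1.re * fderiv ℝ (fun z => fderiv ℝ S.ext.lam z 1) (S.polar x (t, φ)).1 1 +
          (S.jac x (t, φ)).1.im * fderiv ℝ (fun z => fderiv ℝ S.ext.lam z 1) (S.polar x (t, φ)).1 I) +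
        Real.cos (S.polar x (t, φ)).2 *
          ((S.jac x (t, φ)).1.re * fderiv ℝ (fun z => fderiv ℝ S.ext.lam z I) (S.polar x (t, φ)).1 1 +
          (S.jac x (t, φ)).1.im *
            fderiv ℝ (fun z => fderiv ℝ S.ext.lam z I) (S.polar x (t, φ)).1 I))) t := by
  refine S.hasDerivAt_jac_component x t φ (ContinuousLinearMap.snd ℝ ℂ ℝ) ?_
  have e : ∀ φ, (ContinuousLinearMap.snd ℝ ℂ ℝ) (S.ext.geodField (S.polar x (t, φ))) =
      Real.exp (-S.ext.lam (S.polar x (t, φ)).1) *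
      (-Real.sin (S.polar x (t, φ)).2 * fderiv ℝ S.ext.lam (S.polar x (t, φ)).1 1 +
        Real.cos (S.polar x (t, φ)).2 * fderiv ℝ S.ext.lam (S.polar x (t, φ)).1 I) := fun φ =>
    S.ext.geodField_snd _
  simp only [e]
  have hp := S.hasDerivAt_polar_dir x t φ
  have h2 := hasDerivAt_snd hp
  have h1 : HasDerivAt (fun φ => Real.exp (-S.ext.lam (S.polar x (t, φ)).1) *
      (-Real.sin (S.polar x (t, φ)).2 * fderiv ℝ S.ext.lam (S.polar x (t, φ)).1 1 +
        Real.cos (S.polar x (t, φ)).2 * fderiv ℝ S.ext.lam (S.polar x (t, φ)).1 I)) _ φ :=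
    (hasDerivAt_base S.ext.lam_smooth hp).neg.exp.mul
      ((h2.sin.neg.mul (hasDerivAt_base (contDiff_fderiv_apply S.ext.lam_smooth 1) hp)).add
        (h2.cos.mul (hasDerivAt_base (contDiff_fderiv_apply S.ext.lam_smooth I) hp)))
  refine h1.congr_deriv ?_
  simp only [Pi.mul_apply, Pi.neg_apply, Pi.add_apply]
  ring

/-- Gauss lemma: the tangential component vanishes at time zero and the linearized geodesic equation
makes its time derivative identically zero. -/
theorem jacA_eq_zero : S.jacA x (t, φ) = 0 := by
  have h0 : S.jacA x (0, φ) = 0 := by simp [jacA, jac_zero]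
  rw [← h0]
  have hd : ∀ t, HasDerivAt (fun t => S.jacA x (t, φ)) 0 t := by
    intro t
    have hϑ := S.hasDerivAt_angle_time x t φ
    have h1 : HasDerivAt (fun t => S.jacA x (t, φ)) _ t :=
      (S.hasDerivAt_ofBase_time x t φ S.ext.lam_smooth).exp.mul
        ((hϑ.cos.mul (S.hasDerivAt_jac_re x t φ)).add (hϑ.sin.mul (S.hasDerivAt_jac_im x t φ)))
    refine h1.congr_deriv ?_
    generalize Real.exp (S.ext.lam (S.polar x (t, φ)).1) = e1
    generalize Real.exp (-S.ext.lam (S.polar x (t, φ)).1) = e2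
    generalize Real.cos (S.polar x (t, φ)).2 = c at *
    generalize Real.sin (S.polar x (t, φ)).2 = s at *
    generalize (S.jac x (t, φ)).1.re = ξ
    generalize (S.jac x (t, φ)).1.im = η
    generalize fderiv ℝ S.ext.lam (S.polar x (t, φ)).1 1 = p
    generalize fderiv ℝ S.ext.lam (S.polar x (t, φ)).1 I = q
    ring
  exact is_const_of_deriv_eq_zero (fun t => (hd t).differentiableAt) (fun t => (hd t).deriv) t 0

theorem jac_tangential : Real.cos (S.polar x (t, φ)).2 * (S.jac x (t, φ)).1.re +
    Real.sin (S.polar x (t, φ)).2 * (S.jac x (t, φ)).1.im = 0 :=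
  (mul_eq_zero.1 (S.jacA_eq_zero x t φ)).resolve_left (Real.exp_pos _).ne'

theorem hasDerivAt_jacB : HasDerivAt (fun t => S.jacB x (t, φ)) (S.jacB' x (t, φ)) t := by
  have hϑ := S.hasDerivAt_angle_time x t φ
  have h1 : HasDerivAt (fun t => S.jacB x (t, φ)) _ t :=
    (S.hasDerivAt_ofBase_time x t φ S.ext.lam_smooth).exp.mul
      ((hϑ.sin.neg.mul (S.hasDerivAt_jac_re x t φ)).add (hϑ.cos.mul (S.hasDerivAt_jac_im x t φ)))
  refine h1.congr_deriv ?_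
  simp only [Pi.mul_apply, Pi.neg_apply, Pi.add_apply, jacB']
  have hcs := Real.sin_sq_add_cos_sq (S.polar x (t, φ)).2
  have ht := S.jac_tangential x t φ
  have he : Real.exp (S.ext.lam (S.polar x (t, φ)).1) *
    Real.exp (-S.ext.lam (S.polar x (t, φ)).1) = 1 := by rw [← Real.exp_add]; simp
  generalize Real.exp (S.ext.lam (S.polar x (t, φ)).1) = e1 at *
  generalize Real.exp (-S.ext.lam (S.polar x (t, φ)).1) = e2 at *
  generalize Real.cos (S.polar x (t, φ)).2 = c at *
  generalize Real.sin (S.polar x (t, φ)).2 = s at *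
  generalize (S.jac x (t, φ)).1.re = ξ at *
  generalize (S.jac x (t, φ)).1.im = η at *
  generalize (S.jac x (t, φ)).2 = σ
  generalize fderiv ℝ S.ext.lam (S.polar x (t, φ)).1 1 = p
  generalize fderiv ℝ S.ext.lam (S.polar x (t, φ)).1 I = q
  linear_combination ((c * p + s * q) * (-s * ξ + c * η) + σ) * he +
    e1 * e2 * σ * hcs - e1 * e2 * (-s * p + c * q) * ht

/-- The Jacobi equation. With no tangential component the base variation is β (-sin, cos); after
this substitution the first derivatives of λ cancel and the second derivatives combine into its
Laplacian. -/
theorem hasDerivAt_jacB' : HasDerivAt (fun t => S.jacB' x (t, φ))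
    (-S.ext.curv (S.polar x (t, φ)).1 * S.jacB x (t, φ)) t := by
  have hϑ := S.hasDerivAt_angle_time x t φ
  have h1 : HasDerivAt (fun t => S.jacB' x (t, φ)) _ t :=
    (((hϑ.cos.mul (S.hasDerivAt_ofBase_time x t φ (contDiff_fderiv_apply S.ext.lam_smooth 1))).add
      (hϑ.sin.mul (S.hasDerivAt_ofBase_time x t φ (contDiff_fderiv_apply S.ext.lam_smooth I)))).mul
      ((hϑ.sin.neg.mul (S.hasDerivAt_jac_re x t φ)).add
        (hϑ.cos.mul (S.hasDerivAt_jac_im x t φ)))).add (S.hasDerivAt_jac_snd x t φ)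
  refine h1.congr_deriv ?_
  simp only [Pi.mul_apply, Pi.neg_apply, Pi.add_apply, jacB, curv, laplacian_lam]
  have hcs := Real.sin_sq_add_cos_sq (S.polar x (t, φ)).2
  have ht := S.jac_tangential x t φ
  have he : Real.exp (S.ext.lam (S.polar x (t, φ)).1) *
    Real.exp (-S.ext.lam (S.polar x (t, φ)).1) = 1 := by rw [← Real.exp_add]; simp
  have he2 : Real.exp (-2 * S.ext.lam (S.polar x (t, φ)).1) =
      Real.exp (-S.ext.lam (S.polar x (t, φ)).1) ^ 2 := by
    rw [← Real.exp_nat_mul]; congr 1; push_cast; ring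
  rw [he2]
  generalize Real.exp (S.ext.lam (S.polar x (t, φ)).1) = e1 at *
  generalize Real.exp (-S.ext.lam (S.polar x (t, φ)).1) = e2 at *
  generalize Real.cos (S.polar x (t, φ)).2 = c at *
  generalize Real.sin (S.polar x (t, φ)).2 = s at *
  have hξ : (S.jac x (t, φ)).1.re = -s * (-s * (S.jac x (t, φ)).1.re + c * (S.jac x (t, φ)).1.im) := by
    linear_combination c * ht - (S.jac x (t, φ)).1.re * hcs
  have hη : (S.jac x (t, φ)).1.im = c * (-s * (S.jac x (t, φ)).1.re + c * (S.jac x (t, φ)).1.im) := by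
    linear_combination s * ht - (S.jac x (t, φ)).1.im * hcs
  generalize -s * (S.jac x (t, φ)).1.re + c * (S.jac x (t, φ)).1.im = β at *
  rw [hξ, hη]
  generalize (S.jac x (t, φ)).2 = σ
  generalize fderiv ℝ S.ext.lam (S.polar x (t, φ)).1 1 = p
  generalize fderiv ℝ S.ext.lam (S.polar x (t, φ)).1 I = q
  generalize fderiv ℝ (fun z => fderiv ℝ S.ext.lam z 1) (S.polar x (t, φ)).1 1 = p1
  generalize fderiv ℝ (fun z => fderiv ℝ S.ext.lam z 1) (S.polar x (t, φ)).1 I = p2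
  generalize fderiv ℝ (fun z => fderiv ℝ S.ext.lam z I) (S.polar x (t, φ)).1 1 = q1
  generalize fderiv ℝ (fun z => fderiv ℝ S.ext.lam z I) (S.polar x (t, φ)).1 I = q2
  linear_combination e2 * (β * (p1 + q2) + (c * p + s * q) * σ) * hcs - e2 * β * (p1 + q2) * he

/-- By the Gauss lemma the variation has no X-component. This is the identity that lets X_⊥ be
replaced by ∂_φ in polar coordinates. -/
theorem jac_eq : S.jac x (t, φ) =
    -S.jacB x (t, φ) • S.ext.perpField (S.polar x (t, φ)) + S.jacB' x (t, φ) • ((0 : ℂ), (1 : ℝ)) := by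
  have hcs := Real.sin_sq_add_cos_sq (S.polar x (t, φ)).2
  have ht := S.jac_tangential x t φ
  have he : Real.exp (S.ext.lam (S.polar x (t, φ)).1) *
    Real.exp (-S.ext.lam (S.polar x (t, φ)).1) = 1 := by rw [← Real.exp_add]; simp
  have h1 : (S.ext.perpField (S.polar x (t, φ))).1.re =
      Real.exp (-S.ext.lam (S.polar x (t, φ)).1) * Real.sin (S.polar x (t, φ)).2 := by
    rw [perpField, Complex.neg_re, Complex.smul_re, smul_eq_mul, I_mul_re, exp_ofReal_mul_I_im]; ring
  have h2 : (S.ext.perpField (S.polar x (t, φ))).1.im =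
      -(Real.exp (-S.ext.lam (S.polar x (t, φ)).1) * Real.cos (S.polar x (t, φ)).2) := by
    rw [perpField, Complex.neg_im, Complex.smul_im, smul_eq_mul, I_mul_im, exp_ofReal_mul_I_re]
  have h3 : (S.ext.perpField (S.polar x (t, φ))).2 = Real.exp (-S.ext.lam (S.polar x (t, φ)).1) *
      (Real.cos (S.polar x (t, φ)).2 * fderiv ℝ S.ext.lam (S.polar x (t, φ)).1 1 +
        Real.sin (S.polar x (t, φ)).2 * fderiv ℝ S.ext.lam (S.polar x (t, φ)).1 I) := by
    rw [perpField, fderiv_expansion, exp_ofReal_mul_I_re, exp_ofReal_mul_I_im]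
  refine Prod.ext (Complex.ext ?_ ?_) ?_
  · simp only [Prod.fst_add, Prod.smul_fst, Complex.add_re, Complex.smul_re, h1, smul_eq_mul, jacB,
      Complex.zero_re]
    linear_combination (Real.cos (S.polar x (t, φ)).2) * ht - (S.jac x (t, φ)).1.re * hcs +
      (Real.sin (S.polar x (t, φ)).2 * (-Real.sin (S.polar x (t, φ)).2 * (S.jac x (t, φ)).1.re +
        Real.cos (S.polar x (t, φ)).2 * (S.jac x (t, φ)).1.im)) * he
  · simp only [Prod.fst_add, Prod.smul_fst, Complex.add_im, Complex.smul_im, h2, smul_eq_mul, jacB,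
      Complex.zero_im]
    linear_combination (Real.sin (S.polar x (t, φ)).2) * ht - (S.jac x (t, φ)).1.im * hcs -
      (Real.cos (S.polar x (t, φ)).2 * (-Real.sin (S.polar x (t, φ)).2 * (S.jac x (t, φ)).1.re +
        Real.cos (S.polar x (t, φ)).2 * (S.jac x (t, φ)).1.im)) * he
  · simp only [Prod.snd_add, Prod.smul_snd, h3, smul_eq_mul, jacB, jacB']
    linear_combination ((Real.cos (S.polar x (t, φ)).2 * fderiv ℝ S.ext.lam (S.polar x (t, φ)).1 1 +
      Real.sin (S.polar x (t, φ)).2 * fderiv ℝ S.ext.lam (S.polar x (t, φ)).1 I) *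
      (-Real.sin (S.polar x (t, φ)).2 * (S.jac x (t, φ)).1.re +
        Real.cos (S.polar x (t, φ)).2 * (S.jac x (t, φ)).1.im)) * he

theorem norm_jac_fst : ‖(S.jac x (t, φ)).1‖ =
    Real.exp (-S.ext.lam (S.polar x (t, φ)).1) * |S.jacB x (t, φ)| := by
  rw [jac_eq]
  simp only [Prod.fst_add, Prod.smul_fst, smul_zero, add_zero, norm_smul, norm_neg, Real.norm_eq_abs,
    perpField, norm_mul, norm_I, norm_exp_ofReal_mul_I, abs_of_pos (Real.exp_pos _), mul_one]
  rw [mul_comm]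

theorem jacB_zero : S.jacB x (0, φ) = 0 := by simp [jacB, jac_zero]

theorem jacB'_zero : S.jacB' x (0, φ) = 1 := by simp [jacB', jac_zero]

/-- The derivative of the normal component with respect to the direction. -/
def jacC (y : ℝ × ℝ) : ℝ := fderiv ℝ (S.jacB x) y (0, 1)

/-- The time derivative of `jacC`. -/
def jacC' (y : ℝ × ℝ) : ℝ := fderiv ℝ (S.jacB' x) y (0, 1)

theorem hasDerivAt_jacB_dir : HasDerivAt (fun φ => S.jacB x (t, φ)) (S.jacC x (t, φ)) φ :=
  hasDerivAt_dir (S.contDiff_jacB x) t φ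

theorem fderiv_time_eq {F G : ℝ × ℝ → ℝ} (hF : ContDiff ℝ ∞ F)
    (h : ∀ t φ, HasDerivAt (fun t => F (t, φ)) (G (t, φ)) t) :
    (fun y => fderiv ℝ F y (1, 0)) = G :=
  funext fun y => (hasDerivAt_time hF y.1 y.2).unique (h y.1 y.2)

theorem hasDerivAt_jacC : HasDerivAt (fun t => S.jacC x (t, φ)) (S.jacC' x (t, φ)) t := by
  have h1 := hasDerivAt_time (contDiff_fderiv_apply (S.contDiff_jacB x) (0, 1)) t φ
  rw [fderiv_fderiv_comm (S.contDiff_jacB x),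
    fderiv_time_eq (S.contDiff_jacB x) fun t φ => S.hasDerivAt_jacB x t φ] at h1
  exact h1

/-- The φ-derivative of the Jacobi equation. The curvature is differentiated along the variation,
and this source term is the reason for a bound on ∇κ. -/
theorem hasDerivAt_jacC' : HasDerivAt (fun t => S.jacC' x (t, φ))
    (-S.ext.curv (S.polar x (t, φ)).1 * S.jacC x (t, φ) -
      fderiv ℝ S.ext.curv (S.polar x (t, φ)).1 (S.jac x (t, φ)).1 * S.jacB x (t, φ)) t := by
  have h1 := hasDerivAt_time (contDiff_fderiv_apply (S.contDiff_jacB' x) (0, 1)) t φ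
  rw [fderiv_fderiv_comm (S.contDiff_jacB' x),
    fderiv_time_eq (G := fun y => -S.ext.curv (S.polar x y).1 * S.jacB x y)
      (S.contDiff_jacB' x) fun t φ => S.hasDerivAt_jacB' x t φ] at h1
  refine h1.congr_deriv ?_
  have h2 : HasDerivAt (fun φ => -S.ext.curv (S.polar x (t, φ)).1 * S.jacB x (t, φ)) _ φ :=
    ((hasDerivAt_base S.ext.contDiff_curv (S.hasDerivAt_polar_dir x t φ)).neg).mul
      (S.hasDerivAt_jacB_dir x t φ)
  rw [(hasDerivAt_dir (F := fun y => -S.ext.curv (S.polar x y).1 * S.jacB x y)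
    (((S.contDiff_polar_comp x S.ext.contDiff_curv).neg).mul (S.contDiff_jacB x)) t φ).unique h2,
    ← fderiv_expansion]
  simp only [Pi.neg_apply]
  ring

theorem jacC_zero : S.jacC x (0, φ) = 0 :=
  (S.hasDerivAt_jacB_dir x 0 φ).unique
    ((hasDerivAt_const φ (0 : ℝ)).congr_of_eventuallyEq
      (Filter.Eventually.of_forall fun ψ => S.jacB_zero x ψ))

theorem jacC'_zero : S.jacC' x (0, φ) = 0 :=
  (hasDerivAt_dir (S.contDiff_jacB' x) 0 φ).unique
    ((hasDerivAt_const φ (1 : ℝ)).congr_of_eventuallyEq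
      (Filter.Eventually.of_forall fun ψ => S.jacB'_zero x ψ))

end derivatives

end IsothermalSurface

end

/-! ### Comparison of Jacobi fields with the flat case -/

noncomputable section

/-- An a priori estimate for second order equations on short intervals. -/
theorem second_order_bound {f f' f'' : ℝ → ℝ} {T K s : ℝ} (hT : 0 ≤ T) (hK : 0 ≤ K) (hs : 0 ≤ s)
    (hKT : K * T ^ 2 ≤ 1 / 2) (hf : ∀ t ∈ Icc 0 T, HasDerivAt f (f' t) t)
    (hf' : ∀ t ∈ Icc 0 T, HasDerivAt f' (f'' t) t) (h0 : f 0 = 0) (h0' : f' 0 = 0)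
    (hb : ∀ t ∈ Icc 0 T, |f'' t| ≤ K * |f t| + s) : |f T| ≤ 2 * s * T ^ 2 ∧ |f' T| ≤ 2 * s * T := by
  have hc : ContinuousOn (fun t => |f t|) (Icc 0 T) := fun t ht =>
    (hf t ht).continuousAt.abs.continuousWithinAt
  obtain ⟨t₀, ht₀, hmax⟩ := isCompact_Icc.exists_isMaxOn (nonempty_Icc.2 hT) hc
  have hM : ∀ t ∈ Icc 0 T, |f t| ≤ |f t₀| := fun t ht => hmax ht
  set M := |f t₀| with hMdef
  have hM0 : 0 ≤ M := abs_nonneg _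
  have e1 : ∀ t ∈ Icc 0 T, |f' t| ≤ (K * M + s) * T := by
    intro t ht
    have h := norm_image_sub_le_of_norm_deriv_le_segment' (f := f') (f' := f'') (C := K * M + s)
      (fun y hy => (hf' y hy).hasDerivWithinAt) (fun y hy => (hb y ⟨hy.1, hy.2.le⟩).trans
        (by gcongr; exact hM y ⟨hy.1, hy.2.le⟩)) t ht
    rw [h0', sub_zero, sub_zero, Real.norm_eq_abs] at h
    exact h.trans (by gcongr; exact ht.2)
  have e2 : ∀ t ∈ Icc 0 T, |f t| ≤ (K * M + s) * T * T := by
    intro t ht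
    have h := norm_image_sub_le_of_norm_deriv_le_segment' (f := f) (f' := f') (C := (K * M + s) * T)
      (fun y hy => (hf y hy).hasDerivWithinAt) (fun y hy => e1 y ⟨hy.1, hy.2.le⟩) t ht
    rw [h0, sub_zero, sub_zero, Real.norm_eq_abs] at h
    exact h.trans (by gcongr; exact ht.2)
  -- At a maximum point of |f| this reads M ≤ (K M + s) T², and K T² ≤ 1/2 absorbs the term in M.
  have e3 := e2 t₀ ht₀
  have e4 : M ≤ 2 * s * T ^ 2 := by nlinarith
  have e5 : K * M + s ≤ 2 * s := by nlinarith
  have hTm : T ∈ Icc 0 T := ⟨hT, le_rfl⟩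
  exact ⟨(hM T hTm).trans e4, (e1 T hTm).trans (by gcongr)⟩

namespace IsothermalSurface

variable {S : IsothermalSurface}

theorem ext_curv_eq {z : ℂ} (hz : z ∈ Metric.ball 0 S.radius) : S.ext.curv z = S.curv z := by
  have h := S.ext_lam_eventuallyEq hz
  have h1 : ∀ w, (fun y => fderiv ℝ S.ext.lam y w) =ᶠ[nhds z] fun y => fderiv ℝ S.lam y w :=
    fun w => h.fderiv.fun_comp fun L => L w
  simp only [curv, laplacian_lam, h.eq_of_nhds, (h1 _).fderiv_eq]

theorem fderiv_ext_curv_eq {z : ℂ} (hz : z ∈ S.M) : fderiv ℝ S.ext.curv z = fderiv ℝ S.curv z := by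
  have : S.ext.curv =ᶠ[nhds z] S.curv := by
    filter_upwards [Metric.isOpen_ball.mem_nhds (S.M_subset_ball hz)] with w hw
    exact ext_curv_eq hw
  exact this.fderiv_eq

variable (h : S.IsSimple) {K K' D : ℝ} (hK : ∀ z ∈ S.M, |S.curv z| ≤ K)
  (hK' : ∀ z ∈ S.M, Real.exp (-S.lam z) * ‖fderiv ℝ S.curv z‖ ≤ K')
  (hD : ∀ p ∈ S.SM, S.exitTime p ≤ D) (hKD : K * D ^ 2 ≤ 1 / 4) {x : ℂ}

include h hK hD hKD in
-- Applied to b - t, whose second derivative is at most K |b - t| + K t in modulus,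
-- `second_order_bound` gives |b - t| ≤ 2 K t³. This is at most t / 2 because K t² ≤ 1/4.
theorem IsSimple.jacB_bounds (hx : x ∈ S.M) {t φ : ℝ} (ht : t ∈ Icc 0 (S.exitTime (x, φ))) :
    t / 2 ≤ S.jacB x (t, φ) ∧ S.jacB x (t, φ) ≤ 2 * t ∧ |S.jacB' x (t, φ) - 1| ≤ 2 * K * t ^ 2 := by
  have hK0 : 0 ≤ K := (abs_nonneg _).trans (hK x hx)
  have htD : t ≤ D := ht.2.trans (hD (x, φ) hx)
  have hKt : K * t ^ 2 ≤ 1 / 4 := le_trans (by gcongr; exact ht.1) hKD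
  have hmem : ∀ s ∈ Icc 0 t, (S.polar x (s, φ)).1 ∈ S.M := fun s hs =>
    h.gflow_mem (p := (x, φ)) hx ⟨hs.1, hs.2.trans ht.2⟩
  obtain ⟨h1, h2⟩ := second_order_bound (f := fun t => S.jacB x (t, φ) - t)
    (f' := fun t => S.jacB' x (t, φ) - 1)
    (f'' := fun t => -S.ext.curv (S.polar x (t, φ)).1 * S.jacB x (t, φ)) (s := K * t) ht.1 hK0
    (mul_nonneg hK0 ht.1) (by linarith)
    (fun s _ => (S.hasDerivAt_jacB x s φ).sub (hasDerivAt_id s))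
    (fun s _ => (S.hasDerivAt_jacB' x s φ).sub_const 1)
    (by simp [jacB_zero]) (by simp [jacB'_zero]) fun s hs => by
      have hκ := hK _ (hmem s hs)
      rw [abs_mul, abs_neg, ext_curv_eq (S.M_subset_ball (hmem s hs))]
      have hb : |S.jacB x (s, φ)| ≤ |S.jacB x (s, φ) - s| + t := by
        calc |S.jacB x (s, φ)| = |(S.jacB x (s, φ) - s) + s| := by ring_nf
          _ ≤ |S.jacB x (s, φ) - s| + |s| := abs_add_le _ _
          _ ≤ _ := by rw [abs_of_nonneg hs.1]; gcongr; exact hs.2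
      calc |S.curv (S.polar x (s, φ)).1| * |S.jacB x (s, φ)|
          ≤ K * (|S.jacB x (s, φ) - s| + t) := by gcongr
        _ = _ := by ring
  have h3 := abs_le.1 h1
  have h4 : 2 * (K * t) * t ^ 2 ≤ t / 2 := by nlinarith [ht.1]
  refine ⟨by linarith, by linarith [ht.1], h2.trans (le_of_eq (by ring))⟩

include h hK hK' hD hKD in
-- The base variation has g-length |b| ≤ 2t, so the source is at most K' (2t)(2t). Inserting s = 4
-- K' t² in the a priori estimate yields 8 K' t⁴, two orders better than the b² by which it is later
-- divided.
theorem IsSimple.jacC_bound (hx : x ∈ S.M) {t φ : ℝ} (ht : t ∈ Icc 0 (S.exitTime (x, φ))) :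
    |S.jacC x (t, φ)| ≤ 8 * K' * t ^ 4 := by
  have hK0 : 0 ≤ K := (abs_nonneg _).trans (hK x hx)
  have hK0' : 0 ≤ K' := le_trans (by positivity) (hK' x hx)
  have htD : t ≤ D := ht.2.trans (hD (x, φ) hx)
  have hKt : K * t ^ 2 ≤ 1 / 4 := le_trans (by gcongr; exact ht.1) hKD
  have hmem : ∀ s ∈ Icc 0 t, (S.polar x (s, φ)).1 ∈ S.M := fun s hs =>
    h.gflow_mem (p := (x, φ)) hx ⟨hs.1, hs.2.trans ht.2⟩
  obtain ⟨h1, -⟩ := second_order_bound (f := fun t => S.jacC x (t, φ))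
    (f' := fun t => S.jacC' x (t, φ))
    (f'' := fun t => -S.ext.curv (S.polar x (t, φ)).1 * S.jacC x (t, φ) -
      fderiv ℝ S.ext.curv (S.polar x (t, φ)).1 (S.jac x (t, φ)).1 * S.jacB x (t, φ))
    (s := 4 * K' * t ^ 2) ht.1 hK0
    (by positivity) (by linarith)
    (fun s _ => S.hasDerivAt_jacC x s φ)
    (fun s _ => S.hasDerivAt_jacC' x s φ)
    (S.jacC_zero x φ) (S.jacC'_zero x φ) fun s hs => by
      have hκ := hK _ (hmem s hs)
      have hκ' := hK' _ (hmem s hs)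
      obtain ⟨hb1, hb2, -⟩ := h.jacB_bounds hK hD hKD hx (φ := φ) ⟨hs.1, hs.2.trans ht.2⟩
      have hbabs : |S.jacB x (s, φ)| ≤ 2 * t := by
        rw [abs_of_nonneg (by linarith [hs.1])]; linarith [hs.2]
      refine (abs_sub _ _).trans ?_
      rw [abs_mul, abs_neg, abs_mul, ext_curv_eq (S.M_subset_ball (hmem s hs)),
        fderiv_ext_curv_eq (hmem s hs)]
      have e1 : |fderiv ℝ S.curv (S.polar x (s, φ)).1 (S.jac x (s, φ)).1| ≤ K' * (2 * t) := by
        refine ((fderiv ℝ S.curv (S.polar x (s, φ)).1).le_opNorm _).trans ?_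
        rw [norm_jac_fst, (S.ext_lam_eventuallyEq (S.M_subset_ball (hmem s hs))).eq_of_nhds]
        calc _ = (Real.exp (-S.lam (S.polar x (s, φ)).1) *
              ‖fderiv ℝ S.curv (S.polar x (s, φ)).1‖) * |S.jacB x (s, φ)| := by ring
          _ ≤ _ := by gcongr
      calc _ ≤ K * |S.jacC x (s, φ)| + (K' * (2 * t)) * (2 * t) := by
            have := ht.1
            gcongr
        _ = _ := by ring
  exact h1.trans (le_of_eq (by ring))

end IsothermalSurface

end

/-! ### The kernel of W_k^* in polar coordinates -/

noncomputable section

namespace IsothermalSurface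

variable {S : IsothermalSurface}

/-- The times and directions for which the geodesics issued from `x` lie in the surface. -/
def polarDomain (S : IsothermalSurface) (x : ℂ) : Set (ℝ × ℝ) := {y | y.1 ≤ S.exitTime (x, y.2)}

/-- A function on the unit circle bundle in polar coordinates, extended by zero. -/
def inPolar (S : IsothermalSurface) (x : ℂ) {E : Type*} [Zero E] (q : ℂ × ℝ → E) : ℝ × ℝ → E :=
  (S.polarDomain x).indicator fun y => q (S.polar x y)

/-- The measure on times and directions. -/
def polarMeasure (D : ℝ) : Measure (ℝ × ℝ) :=
  (volume.restrict (Ioc 0 D)).prod (volume.restrict (Ioc 0 (2 * Real.pi)))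

instance (D : ℝ) : IsFiniteMeasure (polarMeasure D) := by
  unfold polarMeasure; infer_instance

theorem polarMeasure_univ {D : ℝ} (hD : 0 ≤ D) : (polarMeasure D).real univ = D * (2 * Real.pi) := by
  rw [polarMeasure, ← univ_prod_univ, measureReal_prod_prod, measureReal_restrict_apply_univ,
    measureReal_restrict_apply_univ, Real.volume_real_Ioc_of_le hD,
    Real.volume_real_Ioc_of_le Real.two_pi_pos.le]
  ring

variable (h : S.IsSimple) {x : ℂ} (hx : x ∈ S.M) {D : ℝ} (hD : ∀ p ∈ S.SM, S.exitTime p ≤ D)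

section measure

include h hx

theorem IsSimple.continuous_exitTime_fibre : Continuous fun φ => S.exitTime (x, φ) :=
  h.continuousOn_exitTime.comp_continuous (by fun_prop) fun _ => hx

theorem IsSimple.isClosed_polarDomain : IsClosed (S.polarDomain x) :=
  isClosed_le continuous_fst ((h.continuous_exitTime_fibre hx).comp continuous_snd)

theorem IsSimple.integrable_inPolar {E : Type*} [NormedAddCommGroup E] {q : ℂ × ℝ → E}
    (hq : Continuous q) (D : ℝ) : Integrable (S.inPolar x q) (polarMeasure D) := by
  have h1 : IntegrableOn (fun y => q (S.polar x y)) (Ioc 0 D ×ˢ Ioc 0 (2 * Real.pi)) :=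
    ((hq.comp (S.contDiff_polar x).continuous).continuousOn.integrableOn_compact
      (isCompact_Icc.prod isCompact_Icc)).mono_set
      (prod_mono Ioc_subset_Icc_self Ioc_subset_Icc_self)
  rw [IntegrableOn, Measure.volume_eq_prod, ← Measure.prod_restrict] at h1
  exact h1.indicator (h.isClosed_polarDomain hx).measurableSet

include hD

theorem IsSimple.integral_inPolar_time {E : Type*} [NormedAddCommGroup E] [NormedSpace ℝ E]
    (q : ℂ × ℝ → E) (φ : ℝ) :
    ∫ t in Ioc 0 D, S.inPolar x q (t, φ) = ∫ t in (0 : ℝ)..S.exitTime (x, φ), q (S.gflow t (x, φ)) := by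
  have h0 := h.exitTime_nonneg (p := (x, φ)) hx
  have hle := hD (x, φ) hx
  have h1 := intervalIntegral.integral_indicator (f := fun t => q (S.gflow t (x, φ))) (μ := volume)
    (show S.exitTime (x, φ) ∈ Icc 0 D from ⟨h0, hle⟩)
  rw [← h1, intervalIntegral.integral_of_le (h0.trans hle)]
  rfl

theorem IsSimple.integral_inPolar {E : Type*} [NormedAddCommGroup E] [NormedSpace ℝ E]
    [CompleteSpace E] {q : ℂ × ℝ → E} (hq : Continuous q) :
    ∫ y, S.inPolar x q y ∂(polarMeasure D) = ∫ φ in (0 : ℝ)..2 * Real.pi,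
      ∫ t in (0 : ℝ)..S.exitTime (x, φ), q (S.gflow t (x, φ)) := by
  rw [polarMeasure, integral_prod_symm _ (h.integrable_inPolar hx hq D),
    intervalIntegral.integral_of_le Real.two_pi_pos.le]
  simp only [h.integral_inPolar_time hx hD]

end measure

variable {K K' : ℝ} (hK : ∀ z ∈ S.M, |S.curv z| ≤ K)
  (hK' : ∀ z ∈ S.M, Real.exp (-S.lam z) * ‖fderiv ℝ S.curv z‖ ≤ K')
  (hKD : K * D ^ 2 ≤ 1 / 4) {k : ℤ} {f : ℂ × ℝ → ℂ} (hf : f ∈ Omega k)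
  (hf0 : ∀ p, S.bdf p = 0 → f =ᶠ[nhds p] 0)

/-- The bound for the kernel of the smoothing operator. -/
def kernelBound (k : ℤ) (K K' D : ℝ) : ℝ := 4 * |(k : ℝ)| * K * D + 32 * K' * D ^ 2

/-- The primitive which is integrated by parts in the fibre of polar coordinates. -/
def polarPrimitive (S : IsothermalSurface) (x : ℂ) (k : ℤ) (f : ℂ × ℝ → ℂ) (t φ : ℝ) : ℂ :=
  exp (-(k * φ * I)) * (S.inPolar x f (t, φ) * ((S.jacB x (t, φ))⁻¹ : ℝ))

theorem hasDerivAt_exp_neg (k : ℤ) (φ : ℝ) : HasDerivAt (fun φ : ℝ => exp (-(k * φ * I)))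
    (exp (-(k * φ * I)) * (-(k * I))) φ := by
  have e2 : HasDerivAt (fun φ : ℝ => -((k : ℂ) * φ * I)) (-(k * I)) φ := by
    have h := (((hasDerivAt_id φ).ofReal_comp.const_mul (k : ℂ)).mul_const I).neg
    simp only [id, ofReal_one, mul_one] at h
    exact h
  exact e2.cexp

include hf in
-- The decomposition of the variation into X_⊥ and V, together with V f = i k f.
theorem hasDerivAt_comp_polar_dir {t φ : ℝ} (hm : (S.polar x (t, φ)).1 ∈ S.M) :
    HasDerivAt (fun φ => f (S.polar x (t, φ)))
      (-(S.jacB x (t, φ) : ℂ) * S.Xperp f (S.polar x (t, φ)) +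
        S.jacB' x (t, φ) * (I * k * f (S.polar x (t, φ)))) φ := by
  have h1 := (hf.1.differentiable (by simp) (S.polar x (t, φ))).hasFDerivAt.comp_hasDerivAt φ
    (S.hasDerivAt_polar_dir x t φ)
  refine h1.congr_deriv ?_
  rw [jac_eq, map_add, map_smul, map_smul, hf.2, S.ext_perpField (S.M_subset_ball hm), Xperp]
  simp only [real_smul, ofReal_neg]

include h hx hf hf0 in
-- The geodesic reaches the boundary at its exit time, and f vanishes near the boundary. Hence
-- truncation at the φ-dependent exit time creates no jump, and the integration by parts has no
-- extra terms.
theorem IsSimple.inPolar_eventually_eq_zero {t φ : ℝ} (ht : S.exitTime (x, φ) ≤ t) :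
    (fun φ => S.inPolar x f (t, φ)) =ᶠ[nhds φ] 0 := by
  rcases ht.eq_or_lt with he | hlt
  · have h1 : S.bdf (S.polar x (t, φ)) = 0 := by
      rw [polar, ← he]; exact h.bdf_exit (p := (x, φ)) hx
    have h2 : ContinuousAt (fun φ => S.polar x (t, φ)) φ :=
      ((S.contDiff_polar x).continuous.comp (by fun_prop : Continuous fun φ : ℝ => (t, φ))).continuousAt
    filter_upwards [h2.eventually (hf0 _ h1)] with ψ hψ
    by_cases hm : (t, ψ) ∈ S.polarDomain x
    · exact (indicator_of_mem hm _).trans hψ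
    · exact indicator_of_notMem hm _
  · filter_upwards [(h.continuous_exitTime_fibre hx).continuousAt.eventually_lt_const hlt] with ψ hψ
    have hm : (t, ψ) ∉ S.polarDomain x := fun hm =>
      absurd (show t ≤ S.exitTime (x, ψ) from hm) (not_le.2 hψ)
    exact indicator_of_notMem hm _

include h hx hD hK hKD in
theorem IsSimple.contDiffAt_jacB_inv {t φ : ℝ} (ht0 : 0 < t) (ht : t < S.exitTime (x, φ)) :
    S.jacB x (t, φ) ≠ 0 := by
  have := (h.jacB_bounds hK hD hKD hx (φ := φ) ⟨ht0.le, ht.le⟩).1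
  exact (by linarith : (0 : ℝ) < S.jacB x (t, φ)).ne'

include h hx hD hK hKD hf hf0

theorem IsSimple.contDiff_polarPrimitive {t : ℝ} (ht0 : 0 < t) :
    ContDiff ℝ 1 (S.polarPrimitive x k f t) := by
  refine contDiff_iff_contDiffAt.2 fun φ => ?_
  have hexp : ContDiff ℝ 1 fun φ : ℝ => exp (-(k * φ * I)) :=
    ((contDiff_const.mul ofRealCLM.contDiff).mul contDiff_const).neg.cexp
  rcases le_or_gt (S.exitTime (x, φ)) t with ht | ht
  · refine (contDiffAt_const (c := (0 : ℂ))).congr_of_eventuallyEq ?_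
    filter_upwards [h.inPolar_eventually_eq_zero hx hf hf0 ht] with ψ hψ
    rw [polarPrimitive, show S.inPolar x f (t, ψ) = 0 from hψ, zero_mul, mul_zero]
  · have hb := h.contDiffAt_jacB_inv hx hD hK hKD ht0 ht
    have hpair : ContDiff ℝ 1 fun φ : ℝ => (t, φ) := contDiff_const.prodMk contDiff_id
    have h1 : ContDiffAt ℝ 1 (fun φ => ((S.jacB x (t, φ))⁻¹ : ℝ)) φ :=
      ((((S.contDiff_jacB x).of_le (by simp)).comp hpair).contDiffAt).inv hb
    have h2 : ContDiff ℝ 1 fun φ => f (S.polar x (t, φ)) :=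
      (hf.1.of_le (by simp)).comp (((S.contDiff_polar x).of_le (by simp)).comp hpair)
    have h3 := hexp.contDiffAt.mul (h2.contDiffAt.mul (ofRealCLM.contDiff.contDiffAt.comp φ h1))
    refine h3.congr_of_eventuallyEq ?_
    filter_upwards [(h.continuous_exitTime_fibre hx).continuousAt.eventually_const_lt ht] with ψ hψ
    rw [polarPrimitive, inPolar, indicator_of_mem (show (t, ψ) ∈ S.polarDomain x from hψ.le)]
    rfl

include hK' in
-- Adding the φ-derivative of e^{-ikφ} f / b eliminates X_⊥ f and leaves f times i k (b' - 1)/b -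
-- ∂_φ b / b². With b ≥ t / 2, the bounds 2 K t² and 8 K' t⁴ give quotients at most 4 K D and 32 K'
-- D²; the singularity at t = 0 disappears.
theorem IsSimple.norm_add_deriv_polarPrimitive_le {t : ℝ} (ht0 : 0 < t) (φ : ℝ) :
    ‖exp (-(k * φ * I)) * S.inPolar x (S.Xperp f) (t, φ) + deriv (S.polarPrimitive x k f t) φ‖ ≤
      kernelBound k K K' D * S.inPolar x (fun p => ‖f p‖) (t, φ) := by
  have hK0 : 0 ≤ K := (abs_nonneg _).trans (hK x hx)
  have hK0' : 0 ≤ K' := le_trans (by positivity) (hK' x hx)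
  rcases le_or_gt (S.exitTime (x, φ)) t with ht | ht
  · have h0 : S.polarPrimitive x k f t =ᶠ[nhds φ] fun _ => 0 := by
      filter_upwards [h.inPolar_eventually_eq_zero hx hf hf0 ht] with ψ hψ
      rw [polarPrimitive, show S.inPolar x f (t, ψ) = 0 from hψ, zero_mul, mul_zero]
    rw [h0.deriv_eq, deriv_const, add_zero]
    rcases ht.eq_or_lt with he | hlt
    · have h1 : S.bdf (S.polar x (t, φ)) = 0 := by
        rw [polar, ← he]; exact h.bdf_exit (p := (x, φ)) hx
      have hm : (t, φ) ∈ S.polarDomain x := he.ge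
      rw [inPolar, inPolar, indicator_of_mem hm, indicator_of_mem hm, (hf0 _ h1).eq_of_nhds, Xperp,
        (hf0 _ h1).fderiv_eq]
      simp
    · have hm : (t, φ) ∉ S.polarDomain x := fun hm =>
        absurd (show t ≤ S.exitTime (x, φ) from hm) (not_le.2 hlt)
      rw [inPolar, inPolar, indicator_of_notMem hm, indicator_of_notMem hm]
      simp
  · have hm : (t, φ) ∈ S.polarDomain x := ht.le
    have hbne := h.contDiffAt_jacB_inv hx hD hK hKD ht0 ht
    have hmem : (S.polar x (t, φ)).1 ∈ S.M := h.gflow_mem (p := (x, φ)) hx ⟨ht0.le, ht.le⟩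
    have h1 : HasDerivAt (fun φ : ℝ => exp (-(k * φ * I)) *
        (f (S.polar x (t, φ)) * ((S.jacB x (t, φ))⁻¹ : ℝ))) _ φ :=
      (hasDerivAt_exp_neg k φ).mul ((hasDerivAt_comp_polar_dir hf hmem).mul
        ((S.hasDerivAt_jacB_dir x t φ).inv hbne).ofReal_comp)
    have h2 : S.polarPrimitive x k f t =ᶠ[nhds φ] fun φ : ℝ => exp (-(k * φ * I)) *
        (f (S.polar x (t, φ)) * ((S.jacB x (t, φ))⁻¹ : ℝ)) := by
      filter_upwards [(h.continuous_exitTime_fibre hx).continuousAt.eventually_const_lt ht] with ψ hψ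
      rw [polarPrimitive, inPolar, indicator_of_mem (show (t, ψ) ∈ S.polarDomain x from hψ.le)]
    rw [h2.deriv_eq, h1.deriv, inPolar, inPolar, indicator_of_mem hm, indicator_of_mem hm]
    obtain ⟨hb1, hb2, hb3⟩ := h.jacB_bounds hK hD hKD hx (φ := φ) ⟨ht0.le, ht.le⟩
    have hc := h.jacC_bound hK hK' hD hKD hx (φ := φ) ⟨ht0.le, ht.le⟩
    have htD : t ≤ D := ht.le.trans (hD (x, φ) hx)
    set b := S.jacB x (t, φ) with hb
    set b' := S.jacB' x (t, φ) with hb'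
    set c := S.jacC x (t, φ) with hcdef
    have hbc : (b : ℂ) ≠ 0 := by exact_mod_cast hbne
    have key : exp (-(k * φ * I)) * S.Xperp f (S.polar x (t, φ)) +
        (exp (-(k * φ * I)) * (-(k * I)) * (f (S.polar x (t, φ)) * ((b⁻¹ : ℝ) : ℂ)) +
        exp (-(k * φ * I)) * ((-(b : ℂ) * S.Xperp f (S.polar x (t, φ)) +
          b' * (I * k * f (S.polar x (t, φ)))) * ((b⁻¹ : ℝ) : ℂ) +
          f (S.polar x (t, φ)) * ((-c / b ^ 2 : ℝ) : ℂ))) =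
        exp (-(k * φ * I)) * (I * k * (((b' - 1) / b : ℝ) : ℂ) - ((c / b ^ 2 : ℝ) : ℂ)) *
          f (S.polar x (t, φ)) := by
      push_cast
      field_simp
      ring
    rw [key, norm_mul, norm_mul, norm_exp_neg_int_mul, one_mul]
    refine mul_le_mul_of_nonneg_right ((norm_sub_le _ _).trans ?_) (norm_nonneg _)
    rw [norm_mul, norm_mul, norm_I, one_mul, norm_real, norm_real, Complex.norm_intCast,
      Real.norm_eq_abs, Real.norm_eq_abs, abs_div, abs_div]
    have hbpos : 0 < b := by linarith
    have e1 : |b' - 1| / |b| ≤ 4 * K * D := by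
      have hD0 : 0 ≤ D := ht0.le.trans htD
      rw [abs_of_pos hbpos, div_le_iff₀ hbpos]
      calc |b' - 1| ≤ 2 * K * t ^ 2 := hb3
        _ = 4 * K * t * (t / 2) := by ring
        _ ≤ 4 * K * D * b := by gcongr
    have e2 : |c| / |b ^ 2| ≤ 32 * K' * D ^ 2 := by
      rw [abs_of_pos (pow_pos hbpos 2), div_le_iff₀ (pow_pos hbpos 2)]
      calc |c| ≤ 8 * K' * t ^ 4 := hc
        _ = 32 * K' * t ^ 2 * (t / 2) ^ 2 := by ring
        _ ≤ 32 * K' * D ^ 2 * b ^ 2 := by gcongr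
    calc |(k : ℝ)| * (|b' - 1| / |b|) + |c| / |b ^ 2| ≤
        |(k : ℝ)| * (4 * K * D) + 32 * K' * D ^ 2 := by gcongr
      _ = kernelBound k K K' D := by rw [kernelBound]; ring

include hK' in
-- For fixed t > 0 the primitive takes the same values at φ = 0 and φ = 2π, so its derivative has
-- integral zero and may be added to the integrand; the pointwise kernel estimate then applies.
theorem IsSimple.norm_fcoef_transport_Xperp_le (hD0 : 0 ≤ D) :
    2 * Real.pi * ‖fcoef k (S.transport (S.Xperp f)) x‖ ≤
      kernelBound k K K' D * ∫ y, S.inPolar x (fun p => ‖f p‖) y ∂(polarMeasure D) := by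
  have hX : Continuous (S.Xperp f) := (S.contDiff_Xperp hf.1).continuous
  have hexp : Continuous fun y : ℝ × ℝ => exp (-(k * y.2 * I)) := by fun_prop
  set E : ℝ × ℝ → ℂ := fun y => exp (-(k * y.2 * I)) * S.inPolar x (S.Xperp f) y with hE
  have hEi : Integrable E (polarMeasure D) :=
    (h.integrable_inPolar hx hX D).bdd_mul (c := 1) hexp.aestronglyMeasurable
      (Filter.Eventually.of_forall fun y => (norm_exp_neg_int_mul k y.2).le)
  have hai := h.integrable_inPolar hx hf.1.continuous.norm D
  have hpi : (2 * Real.pi : ℂ) ≠ 0 := by exact_mod_cast Real.two_pi_pos.ne'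
  have h1 : (2 * Real.pi : ℂ) * fcoef k (S.transport (S.Xperp f)) x = ∫ y, E y ∂(polarMeasure D) := by
    rw [fcoef, ← mul_assoc, mul_one_div_cancel hpi, one_mul, polarMeasure, integral_prod_symm _ hEi,
      intervalIntegral.integral_of_le Real.two_pi_pos.le]
    refine integral_congr_ae (Filter.Eventually.of_forall fun φ => ?_)
    simp only [hE]
    rw [integral_const_mul, h.integral_inPolar_time hx hD, ← flowInt_eq,
      ← h.transport_eq (p := (x, φ)) hx, mul_comm]
  have h2 : ‖(2 * Real.pi : ℂ) * fcoef k (S.transport (S.Xperp f)) x‖ =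
      2 * Real.pi * ‖fcoef k (S.transport (S.Xperp f)) x‖ := by
    rw [norm_mul, norm_mul, norm_real, Real.norm_of_nonneg Real.pi_pos.le]; simp
  rw [← h2, h1, polarMeasure, integral_prod _ hEi, integral_prod _ hai, ← integral_const_mul]
  refine norm_integral_le_of_norm_le (hai.integral_prod_left.const_mul _) ?_
  filter_upwards [ae_restrict_mem measurableSet_Ioc, hEi.prod_right_ae, hai.prod_right_ae]
    with t ht hEt hat
  have hP := h.contDiff_polarPrimitive hx hD hK hKD hf hf0 ht.1
  have hPd : Continuous (deriv (S.polarPrimitive x k f t)) := hP.continuous_deriv le_rfl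
  -- Each factor of the primitive, including the truncation and the Jacobi field, is unchanged from
  -- φ = 0 to φ = 2π.
  have h3 : ∫ φ in (0 : ℝ)..2 * Real.pi, deriv (S.polarPrimitive x k f t) φ = 0 := by
    rw [intervalIntegral.integral_deriv_eq_sub (fun φ _ => hP.differentiable (by simp) φ)
      (hPd.intervalIntegrable _ _), sub_eq_zero]
    have e1 : S.inPolar x f (t, 2 * Real.pi) = S.inPolar x f (t, 0) := by
      have e2 : S.exitTime (x, 2 * Real.pi) = S.exitTime (x, 0) := by
        have := h.exitTime_rev_rev (p := (x, 0)) hx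
        rwa [rev_rev_eq, zero_add] at this
      have e3 : f (S.polar x (t, 2 * Real.pi)) = f (S.polar x (t, 0)) := by
        have := S.gflow_rev_rev t (x, 0)
        rw [rev_rev_eq, zero_add] at this
        rw [polar, this]; exact Omega_isPeriodic hf _
      by_cases hm : (t, (0 : ℝ)) ∈ S.polarDomain x
      · have hm' : (t, 2 * Real.pi) ∈ S.polarDomain x :=
          (show t ≤ S.exitTime (x, 0) from hm).trans e2.ge
        rw [inPolar, indicator_of_mem hm, indicator_of_mem hm', e3]
      · have hm' : (t, 2 * Real.pi) ∉ S.polarDomain x := fun hc =>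
          hm ((show t ≤ S.exitTime (x, 2 * Real.pi) from hc).trans e2.le)
        rw [inPolar, indicator_of_notMem hm, indicator_of_notMem hm']
    have e4 : S.jacB x (t, 2 * Real.pi) = S.jacB x (t, 0) := by
      have hper : ∀ y : ℝ × ℝ, S.polar x (y + (0, 2 * Real.pi)) = rev (rev (S.polar x y)) := by
        intro y
        rw [polar, polar, ← S.gflow_rev_rev, rev_rev_eq]; simp
      have hj : S.jac x (t, 2 * Real.pi) = S.jac x (t, 0) := by
        have g1 := fderiv_comp_add_right (𝕜 := ℝ) (f := S.polar x) (x := (t, (0 : ℝ))) (0, 2 * Real.pi)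
        simp only [hper, rev_eq_add, fderiv_add_const] at g1
        rw [jac, jac, g1]; simp
      have hp : S.polar x (t, 2 * Real.pi) = rev (rev (S.polar x (t, 0))) := by
        rw [← hper]; simp
      rw [jacB, jacB, hj, hp, rev_rev_eq, Real.sin_add_two_pi, Real.cos_add_two_pi]
    have e5 := exp_fibre_periodic (-k) 0
    simp only [Int.cast_neg, neg_mul, zero_add] at e5
    rw [polarPrimitive, polarPrimitive, e1, e4, e5]
  rw [intervalIntegral.integral_of_le Real.two_pi_pos.le] at h3
  have hPi : IntegrableOn (deriv (S.polarPrimitive x k f t)) (Ioc 0 (2 * Real.pi)) :=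
    (hPd.intervalIntegrable 0 (2 * Real.pi)).1
  have h4 : ∫ φ in Ioc 0 (2 * Real.pi), E (t, φ) =
      ∫ φ in Ioc 0 (2 * Real.pi), (E (t, φ) + deriv (S.polarPrimitive x k f t) φ) := by
    rw [integral_add hEt hPi, h3, add_zero]
  rw [h4, ← integral_const_mul]
  exact norm_integral_le_of_norm_le (hat.const_mul _) (Filter.Eventually.of_forall fun φ =>
    h.norm_add_deriv_polarPrimitive_le hx hD hK hK' hKD hf hf0 ht.1 φ)

/-- The square of the modulus of a function, as a complex valued function. -/
def normSqFun (f : ℂ × ℝ → ℂ) (p : ℂ × ℝ) : ℂ := f p * (starRingEnd ℂ) (f p)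

omit h hx hD hK hKD hf hf0 in
theorem normSqFun_eq (f : ℂ × ℝ → ℂ) (p : ℂ × ℝ) : normSqFun f p = ((‖f p‖ ^ 2 : ℝ) : ℂ) := by
  rw [normSqFun, mul_conj, normSq_eq_norm_sq]

omit h hx hD hK hKD hf0 in
include hf in
theorem contDiff_normSqFun : ContDiff ℝ ∞ (normSqFun f) :=
  hf.1.mul (conjCLE.contDiff.comp hf.1)

omit hf0 hK hKD in
theorem IsSimple.integral_inPolar_sq (hD0 : 0 ≤ D) :
    ∫ y, S.inPolar x (fun p => ‖f p‖) y ^ 2 ∂(polarMeasure D) =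
      2 * Real.pi * (fcoef 0 (S.transport (normSqFun f)) x).re := by
  have hc := (contDiff_normSqFun hf).continuous
  have h1 := h.integral_inPolar hx hD hc
  have h2 : ∫ y, S.inPolar x (normSqFun f) y ∂(polarMeasure D) =
      ((∫ y, S.inPolar x (fun p => ‖f p‖) y ^ 2 ∂(polarMeasure D) : ℝ) : ℂ) := by
    rw [← integral_complex_ofReal]
    refine integral_congr_ae (Filter.Eventually.of_forall fun y => ?_)
    by_cases hm : y ∈ S.polarDomain x
    · simp only [inPolar, indicator_of_mem hm, normSqFun_eq]
    · simp only [inPolar, indicator_of_notMem hm]; simp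
  have hpi : (2 * Real.pi : ℂ) ≠ 0 := by exact_mod_cast Real.two_pi_pos.ne'
  have h3 : (2 * Real.pi : ℂ) * fcoef 0 (S.transport (normSqFun f)) x =
      ∫ y, S.inPolar x (normSqFun f) y ∂(polarMeasure D) := by
    rw [h1, fcoef, ← mul_assoc, mul_one_div_cancel hpi, one_mul]
    refine intervalIntegral.integral_congr fun φ _ => ?_
    simp only [Int.cast_zero, zero_mul, neg_zero, Complex.exp_zero, mul_one]
    rw [h.transport_eq (p := (x, φ)) hx, flowInt_eq]
  have h4 := congrArg Complex.re (h3.trans h2)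
  rw [ofReal_re] at h4
  rw [← h4, show (2 * Real.pi : ℂ) = ((2 * Real.pi : ℝ) : ℂ) by push_cast; rfl, re_ofReal_mul]

include hK' in
-- Cauchy–Schwarz for the polar measure, of total mass 2πD. The integral of |f|² over all geodesics
-- from x is 2π times the zeroth Fourier coefficient of u^{|f|²}.
theorem IsSimple.sq_norm_opWstar_le (hD0 : 0 ≤ D) (hK'0 : 0 ≤ K') (θ : ℝ) :
    ‖S.opWstar k f (x, θ)‖ ^ 2 ≤
      kernelBound k K K' D ^ 2 * D * (mode 0 (S.transport (normSqFun f)) (x, θ)).re := by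
  have hπ := Real.pi_pos
  have hK0 : 0 ≤ K := (abs_nonneg _).trans (hK x hx)
  have h1 := h.norm_fcoef_transport_Xperp_le hx hD hK hK' hKD hf hf0 hD0
  have h2 := h.integral_inPolar_sq hx hD hf hD0
  have hai := h.integrable_inPolar hx hf.1.continuous.norm D
  have hai2 : Integrable (fun y => S.inPolar x (fun p => ‖f p‖) y ^ 2) (polarMeasure D) := by
    refine (h.integrable_inPolar hx (hf.1.continuous.norm.pow 2) D).congr
      (Filter.Eventually.of_forall fun y => ?_)
    by_cases hm : y ∈ S.polarDomain x
    · simp only [inPolar, indicator_of_mem hm, Pi.pow_apply]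
    · simp only [inPolar, indicator_of_notMem hm]; simp
  have h3 := sq_integral_le hai hai2
  rw [polarMeasure_univ hD0, h2] at h3
  have h5 : mode 0 (S.transport (normSqFun f)) (x, θ) = fcoef 0 (S.transport (normSqFun f)) x := by
    simp [mode_eq]
  rw [opWstar, norm_mode, h5]
  have h6 : (2 * Real.pi * ‖fcoef k (S.transport (S.Xperp f)) x‖) ^ 2 ≤
      (kernelBound k K K' D * ∫ y, S.inPolar x (fun p => ‖f p‖) y ∂(polarMeasure D)) ^ 2 := by
    gcongr
  have h7 : (2 * Real.pi) ^ 2 * ‖fcoef k (S.transport (S.Xperp f)) x‖ ^ 2 ≤ (2 * Real.pi) ^ 2 *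
      (kernelBound k K K' D ^ 2 * D * (fcoef 0 (S.transport (normSqFun f)) x).re) := by
    calc _ = (2 * Real.pi * ‖fcoef k (S.transport (S.Xperp f)) x‖) ^ 2 := by ring
      _ ≤ _ := h6
      _ = kernelBound k K K' D ^ 2 *
          (∫ y, S.inPolar x (fun p => ‖f p‖) y ∂(polarMeasure D)) ^ 2 := by ring
      _ ≤ kernelBound k K K' D ^ 2 * (D * (2 * Real.pi) *
          (2 * Real.pi * (fcoef 0 (S.transport (normSqFun f)) x).re)) :=
        mul_le_mul_of_nonneg_left h3 (by positivity)
      _ = _ := by ring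
  exact le_of_mul_le_mul_left h7 (by positivity)

end IsothermalSurface

end

/-! ### Duality for the transport equation, L² bound and formal adjointness -/

noncomputable section

namespace IsothermalSurface

variable {S : IsothermalSurface}

theorem fderiv_mul_conj {A B : ℂ × ℝ → ℂ} {p : ℂ × ℝ} (hA : DifferentiableAt ℝ A p)
    (hB : DifferentiableAt ℝ B p) (v : ℂ × ℝ) :
    fderiv ℝ (fun q => A q * (starRingEnd ℂ) (B q)) p v =
      fderiv ℝ A p v * (starRingEnd ℂ) (B p) + A p * (starRingEnd ℂ) (fderiv ℝ B p v) := by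
  have h1 : HasFDerivAt (fun q => (starRingEnd ℂ) (B q)) _ p :=
    conjCLE.toContinuousLinearMap.hasFDerivAt.comp p hB.hasFDerivAt
  have h2 : HasFDerivAt (fun q => A q * (starRingEnd ℂ) (B q)) _ p := hA.hasFDerivAt.mul h1
  rw [h2.fderiv]
  simp
  ring

theorem X_mul_conj {A B : ℂ × ℝ → ℂ} {p : ℂ × ℝ} (hA : DifferentiableAt ℝ A p)
    (hB : DifferentiableAt ℝ B p) : S.X (fun q => A q * (starRingEnd ℂ) (B q)) p =
      S.X A p * (starRingEnd ℂ) (B p) + A p * (starRingEnd ℂ) (S.X B p) := fderiv_mul_conj hA hB _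

theorem Xperp_mul_conj {A B : ℂ × ℝ → ℂ} {p : ℂ × ℝ} (hA : DifferentiableAt ℝ A p)
    (hB : DifferentiableAt ℝ B p) : S.Xperp (fun q => A q * (starRingEnd ℂ) (B q)) p =
      S.Xperp A p * (starRingEnd ℂ) (B p) + A p * (starRingEnd ℂ) (S.Xperp B p) :=
  fderiv_mul_conj hA hB _

theorem contDiffAt_mul_conj {n : WithTop ℕ∞} {A B : ℂ × ℝ → ℂ} {p : ℂ × ℝ}
    (hA : ContDiffAt ℝ n A p) (hB : ContDiffAt ℝ n B p) :
    ContDiffAt ℝ n (fun q => A q * (starRingEnd ℂ) (B q)) p :=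
  hA.mul (conjCLE.contDiff.contDiffAt.comp p hB)

theorem continuousOn_conj {B : ℂ × ℝ → ℂ} {s : Set (ℂ × ℝ)} (hB : ContinuousOn B s) :
    ContinuousOn (fun q => (starRingEnd ℂ) (B q)) s := continuous_conj.comp_continuousOn hB

theorem interior_subset_SM : {p | 0 < S.bdf p} ⊆ S.SM := fun p hp => (show 0 < S.bdf p from hp).le

theorem integrable_of_continuousOn {A : ℂ × ℝ → ℂ} (hA : ContinuousOn A S.SM) (hp : IsPeriodic A) :
    Integrable A S.volSM := by
  obtain ⟨C, -, hC⟩ := hp.exists_bound hA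
  exact S.integrable_of_continuousOn_of_bounded (hA.mono interior_subset_SM)
    fun p hp => hC p (interior_subset_SM hp)

theorem continuousOn_fcoef {u : ℂ × ℝ → ℂ} {s : Set ℂ} (hu : ContinuousOn u {p | p.1 ∈ s}) (k : ℤ) :
    ContinuousOn (fcoef k u) s := by
  rw [continuousOn_iff_continuous_restrict]
  refine continuous_const.mul (intervalIntegral.continuous_parametric_intervalIntegral_of_continuous'
    (f := fun (z : s) (φ : ℝ) => u (z, φ) * exp (-(k * φ * I))) ?_ 0 (2 * Real.pi))
  refine Continuous.mul ?_ (by fun_prop)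
  exact hu.comp_continuous (by fun_prop) fun q => q.1.2

theorem continuousOn_mode_of_fibre {u : ℂ × ℝ → ℂ} {s : Set ℂ} (hu : ContinuousOn u {p | p.1 ∈ s})
    (k : ℤ) : ContinuousOn (mode k u) {p | p.1 ∈ s} :=
  (contDiff_exp_fibre k).continuous.continuousOn.mul
    ((continuousOn_fcoef hu k).comp continuous_fst.continuousOn fun p hp => hp)

theorem continuousOn_mode {u : ℂ × ℝ → ℂ} (hu : ContinuousOn u S.SM) (k : ℤ) :
    ContinuousOn (mode k u) S.SM := continuousOn_mode_of_fibre hu k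

/-- Green's formula for fields whose flux through the boundary vanishes in square mean. -/
theorem integral_eq_zero_of_flux {A₁ A₂ v a b : ℂ × ℝ → ℂ}
    (h₁ : ∀ p, 0 < S.bdf p → ContDiffAt ℝ 1 A₁ p) (h₂ : ∀ p, 0 < S.bdf p → ContDiffAt ℝ 1 A₂ p)
    (hp₁ : IsPeriodic A₁) (hp₂ : IsPeriodic A₂)
    (hint : Integrable (fun p => S.X A₁ p + S.Xperp A₂ p) S.volSM)
    (hflux : ∀ p, 0 < S.bdf p → S.flux A₁ A₂ p = a p * v p + b p)
    (hv : ∀ x, S.rho x = 0 → S.FibreTendsto v x) (hcv : ∀ z ∈ S.M, Continuous fun θ => v (z, θ))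
    (ha : ContinuousOn a S.SM) (hb : ContinuousOn b S.SM) (hap : IsPeriodic a) (hbp : IsPeriodic b)
    (h0 : ∀ p, S.bdf p = 0 → a p * v p + b p = 0) :
    ∫ p, (S.X A₁ p + S.Xperp A₂ p) ∂S.volSM = 0 := by
  have hin : ∀ z ∈ S.inside, z ∈ S.M := fun z (hz : 0 < S.rho z) => hz.le
  obtain ⟨A, -, hA⟩ := hap.exists_bound ha
  obtain ⟨B, -, hB⟩ := hbp.exists_bound hb
  refine S.integral_X_add_Xperp_eq_zero h₁ h₂ hp₁ hp₂ hint fun x hx => ?_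
  have hxM : x ∈ S.M := hx.ge
  refine (tendsto_integral_of_fibreTendsto (hv x hx) hcv hxM
    (fun z hz => continuous_fibre_of_continuousOn ha (hin z hz))
    (fun z hz => continuous_fibre_of_continuousOn hb (hin z hz))
    (fun p hp => hA p (hin _ hp)) (fun p hp => hB p (hin _ hp)) fun θ => ?_).congr' ?_
  · have hm : Filter.Tendsto (fun z : ℂ => (z, θ)) (nhdsWithin x S.inside)
        (nhdsWithin (x, θ) S.SM) :=
      tendsto_nhdsWithin_iff.2 ⟨((by fun_prop : Continuous fun z : ℂ => (z, θ)).tendsto x).mono_left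
        nhdsWithin_le_nhds, Filter.eventually_of_mem self_mem_nhdsWithin fun z hz => hin z hz⟩
    have h1 := (((ha (x, θ) hxM).tendsto.comp hm).mul_const (v (x, θ))).add
      ((hb (x, θ) hxM).tendsto.comp hm)
    rw [h0 (x, θ) hx] at h1
    exact h1
  · filter_upwards [self_mem_nhdsWithin] with z hz
    simp only [hflux (z, _) hz]

theorem integral_eq_zero_of_continuousOn {A₁ A₂ : ℂ × ℝ → ℂ}
    (h₁ : ∀ p, 0 < S.bdf p → ContDiffAt ℝ 1 A₁ p) (h₂ : ∀ p, 0 < S.bdf p → ContDiffAt ℝ 1 A₂ p)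
    (hp₁ : IsPeriodic A₁) (hp₂ : IsPeriodic A₂)
    (hc₁ : ContinuousOn A₁ S.SM) (hc₂ : ContinuousOn A₂ S.SM)
    (hint : Integrable (fun p => S.X A₁ p + S.Xperp A₂ p) S.volSM)
    (h0 : ∀ p, S.bdf p = 0 → S.flux A₁ A₂ p = 0) :
    ∫ p, (S.X A₁ p + S.Xperp A₂ p) ∂S.volSM = 0 := by
  refine integral_eq_zero_of_flux (v := fun _ => 0) (a := fun _ => 0) (b := S.flux A₁ A₂) h₁ h₂ hp₁ hp₂
    hint (fun p _ => by simp) (fun x _ => by simp [FibreTendsto, tendsto_const_nhds]) (fun _ _ => continuous_const)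
    continuousOn_const ?_ (fun _ => rfl) ?_ fun p hp => by simp [h0 p hp]
  · exact (S.contDiff_X_bdf.continuous.continuousOn.smul hc₁).add
      (S.contDiff_Xperp_bdf.continuous.continuousOn.smul hc₂)
  · intro p
    simp only [flux, hp₁ p, hp₂ p, S.isPeriodic_bdf.X p, S.isPeriodic_bdf.Xperp p]

section energy

variable (h : S.IsSimple)
include h

theorem IsSimple.X_transport_rev {q : ℂ × ℝ → ℂ} (hq : ContDiff ℝ ∞ q) {p : ℂ × ℝ}
    (hp : 0 < S.bdf p) : S.X (fun p => S.transport q (rev p)) p = q (rev p) := by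
  rw [X_comp_rev, h.X_transport hq (p := rev p) hp, neg_neg]

theorem IsSimple.transport_rev_eq_zero {q : ℂ × ℝ → ℂ} {p : ℂ × ℝ} (hp : S.bdf p = 0)
    (hp1 : 0 ≤ S.X S.bdf p) : S.transport q (rev p) = 0 :=
  h.transport_eq_zero (p := rev p) hp (by rw [X_bdf_rev]; linarith)

theorem IsSimple.contDiffAt_transport_rev {q : ℂ × ℝ → ℂ} (hq : ContDiff ℝ ∞ q) {p : ℂ × ℝ}
    (hp : 0 < S.bdf p) : ContDiffAt ℝ ∞ (fun p => S.transport q (rev p)) p :=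
  ContDiffAt.comp p (g := S.transport q) (f := rev) (h.contDiffAt_transport (p := rev p) hq hp)
    contDiff_rev.contDiffAt

theorem IsSimple.continuousOn_transport_rev {q : ℂ × ℝ → ℂ} (hq : ContDiff ℝ ∞ q) :
    ContinuousOn (fun p => S.transport q (rev p)) S.SM :=
  (h.continuousOn_transport hq).comp continuous_rev.continuousOn fun _ hp => hp

/-- Duality between the transport equations for the two orientations of the geodesics. -/
theorem IsSimple.integral_transport_mul {f g : ℂ × ℝ → ℂ} (hf : ContDiff ℝ ∞ f) (hg : ContDiff ℝ ∞ g)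
    (hfp : IsPeriodic f) (hgp : IsPeriodic g) :
    ∫ p, S.transport f p * (starRingEnd ℂ) (g (rev p)) ∂S.volSM =
      ∫ p, f p * (starRingEnd ℂ) (S.transport g (rev p)) ∂S.volSM := by
  have hc1 := h.continuousOn_transport hf
  have hc2 := h.continuousOn_transport_rev hg
  have hp1 := h.isPeriodic_transport hfp
  have hp2 : IsPeriodic fun p => S.transport g (rev p) := (h.isPeriodic_transport hgp).comp_rev
  have i1 : Integrable (fun p => S.transport f p * (starRingEnd ℂ) (g (rev p))) S.volSM :=
    integrable_of_continuousOn (hc1.mul (continuousOn_conj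
      (hg.continuous.comp continuous_rev).continuousOn)) (hp1.mul hgp.comp_rev.conj)
  have i2 : Integrable (fun p => f p * (starRingEnd ℂ) (S.transport g (rev p))) S.volSM :=
    integrable_of_continuousOn (hf.continuous.continuousOn.mul (continuousOn_conj hc2))
      (hfp.mul hp2.conj)
  have hX : ∀ p, 0 < S.bdf p → S.X (fun p => S.transport f p *
      (starRingEnd ℂ) (S.transport g (rev p))) p + S.Xperp (fun _ => (0 : ℂ)) p =
      S.transport f p * (starRingEnd ℂ) (g (rev p)) -
        f p * (starRingEnd ℂ) (S.transport g (rev p)) := fun p hp => by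
    rw [X_mul_conj (B := fun p => S.transport g (rev p))
      ((h.contDiffAt_transport hf hp).differentiableAt (by simp))
      ((h.contDiffAt_transport_rev hg hp).differentiableAt (by simp)), h.X_transport hf hp,
      h.X_transport_rev hg hp]
    simp [Xperp]; ring
  have hX' : (fun p => S.X (fun p => S.transport f p *
      (starRingEnd ℂ) (S.transport g (rev p))) p + S.Xperp (fun _ => (0 : ℂ)) p) =ᵐ[S.volSM]
      fun p => S.transport f p * (starRingEnd ℂ) (g (rev p)) -
        f p * (starRingEnd ℂ) (S.transport g (rev p)) := S.ae_bdf_pos.mono fun p hp => hX p hp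
  -- The flux vanishes because u^f is zero where X ρ ≤ 0 and u^g ∘ rev is zero where X ρ ≥ 0.
  have h0 := integral_eq_zero_of_continuousOn (S := S)
    (A₁ := fun p => S.transport f p * (starRingEnd ℂ) (S.transport g (rev p))) (A₂ := fun _ => 0)
    (fun p hp => (contDiffAt_mul_conj (h.contDiffAt_transport hf hp)
      (h.contDiffAt_transport_rev hg hp)).of_le (by simp)) (fun _ _ => contDiffAt_const)
    (hp1.mul hp2.conj) (fun _ => rfl) (hc1.mul (continuousOn_conj hc2)) continuousOn_const
    ((i1.sub i2).congr hX'.symm) fun p hp => by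
      rcases le_total (S.X S.bdf p) 0 with h1 | h1
      · simp [flux, h.transport_eq_zero hp h1]
      · simp [flux, h.transport_rev_eq_zero hp h1]
  rw [integral_congr_ae hX', integral_sub i1 i2] at h0
  exact sub_eq_zero.1 h0

theorem IsSimple.transport_one {p : ℂ × ℝ} (hp : p ∈ S.SM) :
    S.transport (fun _ => 1) p = S.exitTime p := by
  simp [transport]

/-- The energy estimate for the transport equation. -/
theorem IsSimple.re_integral_transport_normSqFun_le {D : ℝ} (hD : ∀ p ∈ S.SM, S.exitTime p ≤ D)
    {k : ℤ} {f : ℂ × ℝ → ℂ} (hf : f ∈ Omega k) :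
    (∫ p, S.transport (normSqFun f) p ∂S.volSM).re ≤ D * ∫ p, ‖f p‖ ^ 2 ∂S.volSM := by
  have hp := Omega_isPeriodic hf
  have hq : ContDiff ℝ ∞ (normSqFun f) := contDiff_normSqFun hf
  have hqp : IsPeriodic (normSqFun f) := hp.mul hp.conj
  -- Duality against the constant 1, for which the reversed solution is the time elapsed since
  -- entry, at most D.
  have h1 := h.integral_transport_mul hq (contDiff_const (c := (1 : ℂ))) hqp fun _ => rfl
  simp only [map_one, mul_one] at h1
  have i1 : Integrable (fun p => ‖f p‖ ^ 2) S.volSM :=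
    S.integrable_of_continuous (hf.1.continuous.norm.pow 2) fun p => by simp only [hp p]
  have hτ := (h.continuousOn_exitTime).comp (continuous_rev.continuousOn (s := S.SM)) fun _ hp => hp
  have i2 : Integrable (fun p => ‖f p‖ ^ 2 * S.exitTime (rev p)) S.volSM := by
    refine i1.mul_bdd (c := D) (S.aestronglyMeasurable_of_continuousOn (hτ.mono interior_subset_SM)) ?_
    filter_upwards [S.ae_bdf_pos] with p hp
    have hm : rev p ∈ S.SM := hp.le
    rw [Real.norm_of_nonneg (h.exitTime_nonneg hm)]
    exact hD _ hm
  have h2 : ∫ p, normSqFun f p * (starRingEnd ℂ) (S.transport (fun _ => 1) (rev p)) ∂S.volSM =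
      ((∫ p, ‖f p‖ ^ 2 * S.exitTime (rev p) ∂S.volSM : ℝ) : ℂ) := by
    rw [← integral_complex_ofReal]
    refine integral_congr_ae (S.ae_bdf_pos.mono fun p hp => ?_)
    simp only
    rw [h.transport_one (p := rev p) (show 0 ≤ S.bdf p from le_of_lt hp), normSqFun_eq, conj_ofReal, ofReal_mul]
  rw [h1, h2, ofReal_re, ← integral_const_mul]
  refine integral_mono_ae i2 (i1.const_mul D) (S.ae_bdf_pos.mono fun p hp => ?_)
  simp only
  rw [mul_comm]
  exact mul_le_mul_of_nonneg_right (hD _ (show 0 ≤ S.bdf p from le_of_lt hp)) (by positivity)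

omit h in
theorem Omega_eq_lift {k : ℤ} {f : ℂ × ℝ → ℂ} (hf : f ∈ Omega k) : lift k (fun z => f (z, 0)) = f :=
  funext fun p => by rw [Omega_eq hf p, lift, mul_comm]

omit h in
theorem integral_mode_mul_Omega {k : ℤ} {f u : ℂ × ℝ → ℂ} (hf : f ∈ Omega k)
    (h1 : Integrable (fun p => mode k u p * (starRingEnd ℂ) (f p)) S.volSM)
    (h2 : Integrable (fun p => u p * (starRingEnd ℂ) (f p)) S.volSM) :
    ∫ p, mode k u p * (starRingEnd ℂ) (f p) ∂S.volSM = ∫ p, u p * (starRingEnd ℂ) (f p) ∂S.volSM := by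
  rw [← Omega_eq_lift hf] at h1 h2 ⊢
  exact integral_mode_mul h1 h2

omit h in
theorem integral_Omega_mul_mode {k : ℤ} {f u : ℂ × ℝ → ℂ} (hf : f ∈ Omega k)
    (hu : ContinuousOn u S.SM) (hp : IsPeriodic u) :
    ∫ p, f p * (starRingEnd ℂ) (mode k u p) ∂S.volSM =
      ∫ p, f p * (starRingEnd ℂ) (u p) ∂S.volSM := by
  have hfc := continuousOn_conj (s := S.SM) hf.1.continuous.continuousOn
  have hfp := (Omega_isPeriodic hf).conj
  have h1 := congrArg (starRingEnd ℂ) (integral_mode_mul_Omega hf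
    (integrable_of_continuousOn ((continuousOn_mode hu k).mul hfc) ((isPeriodic_mode k u).mul hfp))
    (integrable_of_continuousOn (hu.mul hfc) (hp.mul hfp)))
  rw [← integral_conj, ← integral_conj] at h1
  simpa only [map_mul, conj_conj, mul_comm] using h1

/-- `W_k^*` is bounded in the mean by the kernel bound. -/
theorem IsSimple.integral_sq_norm_opWstar_le {D K K' : ℝ} (hD : ∀ p ∈ S.SM, S.exitTime p ≤ D)
    (hK : ∀ z ∈ S.M, |S.curv z| ≤ K)
    (hK' : ∀ z ∈ S.M, Real.exp (-S.lam z) * ‖fderiv ℝ S.curv z‖ ≤ K')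
    (hKD : K * D ^ 2 ≤ 1 / 4) (hD0 : 0 ≤ D) (hK'0 : 0 ≤ K') {k : ℤ} {f : ℂ × ℝ → ℂ}
    (hf : f ∈ Omega k) (hf0 : ∀ p, S.bdf p = 0 → f =ᶠ[nhds p] 0) :
    ∫ p, ‖S.opWstar k f p‖ ^ 2 ∂S.volSM ≤
      (kernelBound k K K' D * D) ^ 2 * ∫ p, ‖f p‖ ^ 2 ∂S.volSM := by
  have hp := Omega_isPeriodic hf
  have hq : ContDiff ℝ ∞ (normSqFun f) := contDiff_normSqFun hf
  have hqp : IsPeriodic (normSqFun f) := hp.mul hp.conj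
  have hc := h.continuousOn_transport hq
  have hcp := h.isPeriodic_transport hqp
  have i1 : Integrable (mode 0 (S.transport (normSqFun f))) S.volSM :=
    integrable_of_continuousOn (continuousOn_mode hc 0) (isPeriodic_mode 0 _)
  have h1 : ∫ p, mode 0 (S.transport (normSqFun f)) p ∂S.volSM =
      ∫ p, S.transport (normSqFun f) p ∂S.volSM := by
    have h2 := integral_Omega_mul_mode (k := 0) (f := fun _ => (1 : ℂ)) ⟨contDiff_const, fun p => by simp⟩ hc hcp
    simp only [one_mul] at h2
    rw [integral_conj, integral_conj] at h2
    exact (starRingEnd ℂ).injective h2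
  have hcW : ContinuousOn (S.opWstar k f) S.SM :=
    continuousOn_mode (h.continuousOn_transport (S.contDiff_Xperp hf.1)) k
  have i2 : Integrable (fun p => ‖S.opWstar k f p‖ ^ 2) S.volSM := by
    obtain ⟨C, -, hC⟩ := (isPeriodic_mode k (S.transport (S.Xperp f))).exists_bound hcW
    refine S.integrable_of_continuousOn_of_bounded (C := C ^ 2)
      ((hcW.mono interior_subset_SM).norm.pow 2) fun p hp => ?_
    rw [norm_pow, norm_norm]
    exact pow_le_pow_left₀ (norm_nonneg _) (hC p (interior_subset_SM hp)) 2
  calc ∫ p, ‖S.opWstar k f p‖ ^ 2 ∂S.volSM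
      ≤ ∫ p, kernelBound k K K' D ^ 2 * D * (mode 0 (S.transport (normSqFun f)) p).re ∂S.volSM :=
        integral_mono_ae i2 (i1.re.const_mul _) (S.ae_bdf_pos.mono fun p hp =>
          h.sq_norm_opWstar_le (x := p.1) (interior_subset_SM hp) hD hK hK' hKD hf hf0 hD0 hK'0 p.2)
    _ = kernelBound k K K' D ^ 2 * D * (∫ p, S.transport (normSqFun f) p ∂S.volSM).re := by
        rw [integral_const_mul, ← h1]
        congr 1
        exact integral_re i1
    _ ≤ kernelBound k K K' D ^ 2 * D * (D * ∫ p, ‖f p‖ ^ 2 ∂S.volSM) :=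
        mul_le_mul_of_nonneg_left (h.re_integral_transport_normSqFun_le hD hf) (by positivity)
    _ = _ := by ring

/-- Duality against X_⊥ g. Reversal produces the sign of k + 1 from X_⊥ g and the sign of k from the
k-th mode; their product is the minus sign. -/
theorem IsSimple.integral_transport_mul_Xperp {k : ℤ} {f g : ℂ × ℝ → ℂ} (hf : f ∈ Omega k)
    (hg : g ∈ Omega k) :
    ∫ p, S.transport f p * (starRingEnd ℂ) (S.Xperp g p) ∂S.volSM =
      -∫ p, f p * (starRingEnd ℂ) (S.opWstar k g p) ∂S.volSM := by
  have hq := S.contDiff_Xperp hg.1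
  have hqp : IsPeriodic (S.Xperp g) := (Omega_isPeriodic hg).Xperp
  have hc := h.continuousOn_transport_rev hq
  have hcp : IsPeriodic fun p => S.transport (S.Xperp g) (rev p) := (h.isPeriodic_transport hqp).comp_rev
  have hpar : ∀ n : ℤ, (starRingEnd ℂ) (par n) = par n := fun n => by unfold par; split_ifs <;> simp
  have h1 := h.integral_transport_mul hf.1 hq (Omega_isPeriodic hf) hqp
  rw [← integral_Omega_mul_mode hf hc hcp] at h1
  simp only [Omega_Xperp_rev S hg, mode_comp_rev (h.isPeriodic_transport hqp), map_mul, hpar,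
    par_add_one, map_neg] at h1
  have e1 : ∀ p, S.transport f p * (-par k * (starRingEnd ℂ) (S.Xperp g p)) =
      -par k * (S.transport f p * (starRingEnd ℂ) (S.Xperp g p)) := fun p => by ring
  have e2 : ∀ p, f p * (par k * (starRingEnd ℂ) (mode k (S.transport (S.Xperp g)) p)) =
      par k * (f p * (starRingEnd ℂ) (S.opWstar k g p)) := fun p => by rw [opWstar]; ring
  simp only [e1, e2, integral_const_mul] at h1
  have h3 := par_mul_self k
  linear_combination (-par k) * h1 - (∫ p, S.transport f p * (starRingEnd ℂ) (S.Xperp g p) ∂S.volSM +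
    ∫ p, f p * (starRingEnd ℂ) (S.opWstar k g p) ∂S.volSM) * h3

/-- `W_k` and `W_k^*` are formally adjoint. -/
theorem IsSimple.integral_opW_mul {k : ℤ} {f g : ℂ × ℝ → ℂ} (hf : f ∈ Omega k) (hg : g ∈ Omega k)
    (hg0 : S.VanishesOnBoundary g)
    (h1 : Integrable (fun p => S.Xperp (S.transport f) p * (starRingEnd ℂ) (g p)) S.volSM)
    (h2 : Integrable (fun p => S.opW k f p * (starRingEnd ℂ) (g p)) S.volSM) :
    ∫ p, S.opW k f p * (starRingEnd ℂ) (g p) ∂S.volSM =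
      ∫ p, f p * (starRingEnd ℂ) (S.opWstar k g p) ∂S.volSM := by
  have hq := S.contDiff_Xperp hg.1
  have hfp := Omega_isPeriodic hf
  have hgp := Omega_isPeriodic hg
  have hqp : IsPeriodic (S.Xperp g) := hgp.Xperp
  have hc := h.continuousOn_transport hf.1
  have hcp := h.isPeriodic_transport hfp
  have i3 : Integrable (fun p => S.transport f p * (starRingEnd ℂ) (S.Xperp g p)) S.volSM :=
    integrable_of_continuousOn (hc.mul (continuousOn_conj hq.continuous.continuousOn))
      (hcp.mul hqp.conj)
  have hX : (fun p => S.X (fun _ => (0 : ℂ)) p + S.Xperp (fun p => S.transport f p *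
      (starRingEnd ℂ) (g p)) p) =ᵐ[S.volSM] fun p => S.Xperp (S.transport f) p *
        (starRingEnd ℂ) (g p) + S.transport f p * (starRingEnd ℂ) (S.Xperp g p) :=
    S.ae_bdf_pos.mono fun p hp => by
      simp only
      rw [Xperp_mul_conj ((h.contDiffAt_transport hf.1 hp).differentiableAt (by simp))
        (hg.1.differentiable (by simp) p)]
      simp [X]
  -- X_⊥ is integrated by parts; there is no flux because g vanishes on the boundary.
  have h0 := integral_eq_zero_of_continuousOn (S := S) (A₁ := fun _ => 0)
    (A₂ := fun p => S.transport f p * (starRingEnd ℂ) (g p)) (fun _ _ => contDiffAt_const)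
    (fun p hp => (contDiffAt_mul_conj (h.contDiffAt_transport hf.1 hp) hg.1.contDiffAt).of_le
      (by simp)) (fun _ => rfl) (hcp.mul hgp.conj) continuousOn_const
    (hc.mul (continuousOn_conj hg.1.continuous.continuousOn)) ((h1.add i3).congr hX.symm)
    fun p hp => by simp [flux, hg0 p hp]
  rw [integral_congr_ae hX, integral_add h1 i3, h.integral_transport_mul_Xperp hf hg] at h0
  rw [opW, integral_mode_mul_Omega hg h2 h1]
  exact add_neg_eq_zero.1 h0

end energy

end IsothermalSurface

end

/-! ### Uniform control near the boundary for compactly supported data -/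

noncomputable section

namespace IsothermalSurface

variable {S : IsothermalSurface} (h : S.IsSimple)
include h

open Filter Topology in
-- f vanishes near the exit point of p, so the moving upper limit may be frozen at the exit time of
-- p. The resulting function is smooth even when p is a boundary vector.
theorem IsSimple.transport_eq_flowInt_near {f : ℂ × ℝ → ℂ} (hf : Continuous f)
    (hf0 : ∀ p, S.bdf p = 0 → f =ᶠ[𝓝 p] 0) {p : ℂ × ℝ} (hp : p ∈ S.SM) :
    ∀ᶠ x in 𝓝[S.SM] p, S.transport f x = S.flowInt f (x, S.exitTime p) := by
  set t := S.exitTime p with ht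
  have h1 : ∀ᶠ z : ℝ × (ℂ × ℝ) in 𝓝 (t, p), f (S.gflow z.1 z.2) = 0 :=
    (S.continuous_gflow.tendsto (t, p)).eventually (hf0 _ (h.bdf_exit hp))
  rw [nhds_prod_eq] at h1
  obtain ⟨U, hU, V, hV, hUV⟩ := mem_prod_iff.1 h1
  obtain ⟨ε, hε, hball⟩ := Metric.mem_nhds_iff.1 hU
  have h2 : ∀ᶠ x in 𝓝[S.SM] p, S.exitTime x ∈ Metric.ball t ε :=
    (h.continuousOn_exitTime p hp).eventually (Metric.ball_mem_nhds t hε)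
  filter_upwards [h2, self_mem_nhdsWithin, mem_nhdsWithin_of_mem_nhds hV] with x hx hxM hxV
  have hc := continuous_comp_gflow (S := S) hf x
  rw [h.transport_eq hxM, flowInt_eq, flowInt_eq, ← sub_eq_zero,
    intervalIntegral.integral_interval_sub_left (hc.intervalIntegrable _ _)
      (hc.intervalIntegrable _ _)]
  have hz : ∀ s ∈ uIcc t (S.exitTime x), f (S.gflow s x) = 0 := fun s hs => by
    have hs' : s ∈ Metric.ball t ε := by
      have hcv : Convex ℝ (Metric.ball t ε) := convex_ball t ε
      exact hcv.ordConnected.uIcc_subset (Metric.mem_ball_self hε) hx hs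
    exact hUV (show (s, x) ∈ U ×ˢ V from ⟨hball hs', hxV⟩)
  rw [intervalIntegral.integral_congr (g := fun _ => (0 : ℂ)) hz, intervalIntegral.integral_zero]

open Filter Topology in
/-- The transverse derivative of `u^f` is bounded if `f` vanishes close to the boundary. -/
theorem IsSimple.exists_bound_Xperp_transport {f : ℂ × ℝ → ℂ} (hf : ContDiff ℝ ∞ f)
    (hfp : IsPeriodic f) (hf0 : ∀ p, S.bdf p = 0 → f =ᶠ[𝓝 p] 0) :
    ∃ C : ℝ, ∀ p, 0 < S.bdf p → ‖S.Xperp (S.transport f) p‖ ≤ C := by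
  have hK : IsCompact (S.M ×ˢ Icc 0 (2 * Real.pi)) := S.isCompact_domain.prod isCompact_Icc
  obtain ⟨C, hC⟩ : ∃ C : ℝ, ∀ p ∈ S.M ×ˢ Icc 0 (2 * Real.pi), 0 < S.bdf p →
      ‖S.Xperp (S.transport f) p‖ ≤ C := by
    -- Local bounds near each point of a compact fundamental domain, boundary included, are patched
    -- together.
    refine hK.induction_on (p := fun s => ∃ C : ℝ, ∀ p ∈ s, 0 < S.bdf p →
      ‖S.Xperp (S.transport f) p‖ ≤ C) ⟨0, fun p hp => hp.elim⟩
      (fun s t hst ⟨C, hC⟩ => ⟨C, fun p hp => hC p (hst hp)⟩) ?_ ?_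
    · rintro s t ⟨C, hC⟩ ⟨C', hC'⟩
      exact ⟨max C C', fun p hp h0 => hp.elim (fun h1 => (hC p h1 h0).trans (le_max_left _ _))
        fun h1 => (hC' p h1 h0).trans (le_max_right _ _)⟩
    · intro p hp
      have hpM : p ∈ S.SM := hp.1
      set t := S.exitTime p
      set G : ℂ × ℝ → ℂ := fun x => S.flowInt f (x, t) with hG
      have hGs : ContDiff ℝ ∞ G := (contDiff_flowInt hf).comp (contDiff_id.prodMk contDiff_const)
      obtain ⟨U, hU, hUe⟩ := mem_nhdsWithin_iff_exists_mem_nhds_inter.1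
        (h.transport_eq_flowInt_near hf.continuous hf0 hpM)
      obtain ⟨U', hU', hUo, hpU⟩ := mem_nhds_iff.1 hU
      have hb := ((S.contDiff_Xperp hGs).continuous.norm.tendsto p).eventually
        (gt_mem_nhds (lt_add_one ‖S.Xperp G p‖))
      refine ⟨U' ∩ {x | ‖S.Xperp G x‖ < ‖S.Xperp G p‖ + 1},
        mem_nhdsWithin_of_mem_nhds (inter_mem (hUo.mem_nhds hpU) hb), ‖S.Xperp G p‖ + 1,
        fun x hx hx0 => ?_⟩
      have he : S.transport f =ᶠ[𝓝 x] G := by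
        filter_upwards [hUo.mem_nhds hx.1, S.isOpen_interior_bdf.mem_nhds hx0] with y hy hy0
        exact hUe ⟨hU' hy, interior_subset_SM hy0⟩
      rw [Xperp, he.fderiv_eq]
      exact le_of_lt hx.2
  refine ⟨C, fun p hp => ?_⟩
  have hper : IsPeriodic (S.Xperp (S.transport f)) := (h.isPeriodic_transport hfp).Xperp
  obtain ⟨θ, hθ, he⟩ := hper.exists_eq p
  rw [he]
  exact hC (p.1, θ) ⟨interior_subset_SM hp, hθ⟩ hp

theorem IsSimple.exitTime_rev_rev' (p : ℂ × ℝ) : S.exitTime (rev (rev p)) = S.exitTime p := by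
  by_cases hp : p ∈ S.SM
  · exact h.exitTime_rev_rev hp
  · have h1 : ∀ p, p ∉ S.SM → S.exitTime p = 0 := fun p hp => by
      have : S.geodTimes p = ∅ := by
        ext T
        simp only [mem_empty_iff_false, iff_false, mem_geodTimes_iff]
        rintro ⟨hT, h⟩
        exact hp (by simpa using h 0 ⟨le_rfl, hT⟩)
      rw [exitTime, this, Real.sSup_empty]
    rw [h1 p hp, h1 (rev (rev p)) hp]

theorem IsSimple.entry_rev_rev (p : ℂ × ℝ) : S.entry (rev (rev p)) = rev (rev (S.entry p)) := by
  rw [entry, h.exitTime_rev_rev' (rev p), gflow_rev_rev, entry]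

theorem IsSimple.isPeriodic_comp_entry {w : ℂ × ℝ → ℂ} (hw : IsPeriodic w) :
    IsPeriodic fun p => w (S.entry p) := fun p => by
  simp only [h.entry_rev_rev, hw _]

theorem IsSimple.continuousOn_comp_entry {w : ℂ × ℝ → ℂ} (hw : ContinuousOn w {p | S.bdf p = 0}) :
    ContinuousOn (fun p => w (S.entry p)) S.SM :=
  hw.comp h.continuousOn_entry fun _ hp => h.bdf_entry hp

/-- Geodesics which meet a compact subset of the interior are uniformly transversal to the
boundary. -/
theorem IsSimple.exists_X_bdf_entry_ge {f : ℂ × ℝ → ℂ} {K : Set ℂ} (hK : IsCompact K)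
    (hKS : K ⊆ S.inside) (hf : ∀ p : ℂ × ℝ, p.1 ∉ K → f p = 0) :
    ∃ c > 0, ∀ p ∈ S.SM, S.transport f p ≠ 0 → c ≤ S.X S.bdf (S.entry p) := by
  have hin : K ×ˢ Icc 0 (2 * Real.pi) ⊆ {p : ℂ × ℝ | 0 < S.bdf p} := fun p hp => hKS hp.1
  have hcont : ContinuousOn (fun p => S.X S.bdf (S.entry p)) (K ×ˢ Icc 0 (2 * Real.pi)) :=
    S.contDiff_X_bdf.continuous.comp_continuousOn
      (h.continuousOn_entry.mono (hin.trans interior_subset_SM))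
  -- Over K the entry vector depends continuously on the point and is strictly inward, so X ρ has a
  -- positive minimum. The value is constant along geodesics, and u^f ≠ 0 requires the geodesic to
  -- meet K.
  obtain ⟨c, hc, hcb⟩ : ∃ c > 0, ∀ p ∈ K ×ˢ Icc 0 (2 * Real.pi), c ≤ S.X S.bdf (S.entry p) := by
    rcases (K ×ˢ Icc 0 (2 * Real.pi)).eq_empty_or_nonempty with he | hne
    · exact ⟨1, one_pos, fun p hp => by rw [he] at hp; exact hp.elim⟩
    · obtain ⟨p, hp, hmin⟩ := (hK.prod isCompact_Icc).exists_isMinOn hne hcont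
      exact ⟨_, h.X_bdf_entry_pos_of_interior (hin hp), fun q hq => hmin hq⟩
  refine ⟨c, hc, fun p hp hne => ?_⟩
  obtain ⟨s, hs, hfs⟩ : ∃ s ∈ Icc 0 (S.exitTime p), f (S.gflow s p) ≠ 0 := by
    by_contra! hcon
    refine hne ?_
    rw [h.transport_eq hp, flowInt_eq, intervalIntegral.integral_congr (g := fun _ => (0 : ℂ)),
      intervalIntegral.integral_zero]
    intro s hs
    rw [uIcc_of_le (h.exitTime_nonneg hp)] at hs
    exact hcon s hs
  have hmem : (S.gflow s p).1 ∈ K := by_contra fun hn => hfs (hf _ hn)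
  have hper : IsPeriodic fun p => S.X S.bdf (S.entry p) := fun p => by
    simp only [h.entry_rev_rev, S.isPeriodic_bdf.X (S.entry p)]
  obtain ⟨θ, hθ, he⟩ := hper.exists_eq (S.gflow s p)
  rw [← h.entry_gflow hp hs, he]
  exact hcb _ ⟨hmem, hθ⟩

end IsothermalSurface

end

/-! ### Weak reconstruction formulas -/

noncomputable section

namespace IsothermalSurface

variable {S : IsothermalSurface} {k : ℤ}

theorem continuousOn_Xperp {u : ℂ × ℝ → ℂ} (hu : ∀ p, 0 < S.bdf p → ContDiffAt ℝ 1 u p) :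
    ContinuousOn (S.Xperp u) {p | 0 < S.bdf p} := fun p hp =>
  (((hu p hp).continuousAt_fderiv one_ne_zero).clm_apply
    S.contDiff_perpField.continuous.continuousAt).continuousWithinAt

theorem integrable_mul_conj_lift {u : ℂ × ℝ → ℂ} (hu : ContinuousOn u {p | 0 < S.bdf p})
    (hp : IsPeriodic u) (g : S.testSpace) :
    Integrable (fun p => u p * (starRingEnd ℂ) (lift k g p)) S.volSM := by
  refine S.integrable_of_continuous (continuous_of_eq_zero (K := tsupport (g : ℂ → ℂ))
    (isClosed_tsupport _) (testSpace_tsupport_subset g)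
    (hu.mul (continuousOn_conj (lift_mem_Omega k g.2.1).1.continuous.continuousOn)) fun p hp => ?_)
    (hp.mul (isPeriodic_lift k g).conj)
  rw [lift_eq_zero k hp, map_zero, mul_zero]

theorem integral_mode_mul_lift {u : ℂ × ℝ → ℂ} (hu : ContinuousOn u {p | 0 < S.bdf p})
    (hp : IsPeriodic u) (g : S.testSpace) :
    ∫ p, mode k u p * (starRingEnd ℂ) (lift k g p) ∂S.volSM =
      ∫ p, u p * (starRingEnd ℂ) (lift k g p) ∂S.volSM :=
  integral_mode_mul (integrable_mul_conj_lift (continuousOn_mode_of_fibre (s := S.inside) hu k)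
    (isPeriodic_mode k u) g) (integrable_mul_conj_lift hu hp g)

theorem lift_eventuallyEq_zero (g : S.testSpace) {p : ℂ × ℝ} (hp : S.bdf p = 0) :
    lift k (g : ℂ → ℂ) =ᶠ[nhds p] 0 := by
  have h1 : p.1 ∉ tsupport (g : ℂ → ℂ) := fun hm =>
    (show 0 < S.rho p.1 from testSpace_tsupport_subset g hm).ne' hp
  filter_upwards [((isClosed_tsupport (g : ℂ → ℂ)).isOpen_compl.preimage continuous_fst).mem_nhds h1]
    with q hq using lift_eq_zero k hq

theorem integrable_conj_swap {A B : ℂ × ℝ → ℂ}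
    (hi : Integrable (fun p => A p * (starRingEnd ℂ) (B p)) S.volSM) :
    Integrable (fun p => B p * (starRingEnd ℂ) (A p)) S.volSM := by
  refine (conjCLE.toContinuousLinearMap.integrable_comp hi).congr
    (Filter.Eventually.of_forall fun p => ?_)
  simp [mul_comm]

theorem integrable_lift_mul_conj {u : ℂ × ℝ → ℂ} (hu : ContinuousOn u {p | 0 < S.bdf p})
    (hp : IsPeriodic u) (g : S.testSpace) :
    Integrable (fun p => lift k g p * (starRingEnd ℂ) (u p)) S.volSM :=
  integrable_conj_swap (integrable_mul_conj_lift hu hp g)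

theorem integral_lift_mul_mode {u : ℂ × ℝ → ℂ} (hu : ContinuousOn u {p | 0 < S.bdf p})
    (hp : IsPeriodic u) (g : S.testSpace) :
    ∫ p, lift k g p * (starRingEnd ℂ) (mode k u p) ∂S.volSM =
      ∫ p, lift k g p * (starRingEnd ℂ) (u p) ∂S.volSM := by
  have h1 := congrArg (starRingEnd ℂ) (integral_mode_mul_lift (k := k) hu hp g)
  rw [← integral_conj, ← integral_conj] at h1
  simpa only [map_mul, conj_conj, mul_comm] using h1

variable (S) in
theorem continuous_X_bdf_ofReal : Continuous fun p => ((S.X S.bdf p : ℝ) : ℂ) :=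
  continuous_ofReal.comp S.contDiff_X_bdf.continuous

variable (S) in
theorem continuous_Xperp_bdf_ofReal : Continuous fun p => ((S.Xperp S.bdf p : ℝ) : ℂ) :=
  continuous_ofReal.comp S.contDiff_Xperp_bdf.continuous

variable (h : S.IsSimple)
include h

open Filter Topology in
-- On boundary fibres the k-th mode of u^q is that of its part of the parity of k, and this part
-- extends smoothly across the boundary.
theorem IsSimple.contDiffAt_mode_transport_entry {q : ℂ × ℝ → ℂ} (hq : ContDiff ℝ ∞ q)
    (hqp : IsPeriodic q) (hn : ∀ p, q (rev p) = par (k + 1) * q p) {p : ℂ × ℝ} (hp : 0 < S.bdf p) :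
    ContDiffAt ℝ 1 (fun p => mode k (S.transport q) (S.entry p)) p := by
  have hbM : ∀ {q : ℂ × ℝ}, S.bdf q = 0 → q ∈ S.SM := fun hq => hq.ge
  have hpe : S.bdf (S.entry p) = 0 := h.bdf_entry hp.le
  obtain ⟨O, hO, hxO, B, hB, hBe⟩ := h.exists_extension_parityPart_ray hq hqp hn
    (x := (S.entry p).1) hpe
  have he : ContDiffAt ℝ 1 S.entry p := (h.contDiffAt_entry hp).of_le (by simp)
  have h1 := ContDiffAt.comp (g := mode k B) p (((hB.mode hO k).2 _ hxO).of_le (by simp)) he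
  refine h1.congr_of_eventuallyEq ?_
  filter_upwards [he.continuousAt.eventually ((hO.preimage continuous_fst).mem_nhds hxO),
    S.isOpen_interior_bdf.mem_nhds hp] with x hxO' hx
  have hb : S.bdf (S.entry x) = 0 := h.bdf_entry (show 0 < S.bdf x from hx).le
  have hc := continuous_fibre_of_continuousOn (h.continuousOn_transport hq) (z := (S.entry x).1) hb.ge
  rw [← mode_parityPart_self (h.isPeriodic_transport hqp) hc k]
  refine mode_congr (v := fun q => B q) fun θ => ?_
  rw [← hBe _ hxO' hb θ, parityPart_eq, parityPart_eq, h.ray_eq (p := ((S.entry x).1, θ)) hb,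
    h.ray_eq (p := rev ((S.entry x).1, θ)) hb]

/-- The weak form of the reconstruction formula for `W_k`. -/
theorem IsSimple.integral_reconstruction_W {f : ℂ × ℝ → ℂ} (hf : f ∈ Omega k) (g : S.testSpace)
    (hW : MemLp (S.opW k f) 2 S.volSM) :
    ∫ p, S.opW k f p * (starRingEnd ℂ) (S.opWstar k (lift k g) p) ∂S.volSM +
      ∫ p, f p * (starRingEnd ℂ) (lift k g p) ∂S.volSM +
      ∫ p, mode k (S.Xperp fun p => hilbertW S k f (S.entry p)) p *
        (starRingEnd ℂ) (lift k g p) ∂S.volSM = 0 := by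
  set G : ℂ × ℝ → ℂ := lift k g with hG
  have hg : G ∈ Omega k := lift_mem_Omega k g.2.1
  have hfp := Omega_isPeriodic hf
  have hgp := Omega_isPeriodic hg
  set q := S.Xperp G with hq
  have hqs : ContDiff ℝ ∞ q := S.contDiff_Xperp hg.1
  have hqp : IsPeriodic q := hgp.Xperp
  set U := S.transport q with hU
  have hUc : ContinuousOn U S.SM := h.continuousOn_transport hqs
  have hUp : IsPeriodic U := h.isPeriodic_transport hqp
  have hUs : ∀ p, 0 < S.bdf p → ContDiffAt ℝ 1 U p := fun p hp =>
    (h.contDiffAt_transport hqs hp).of_le (by simp)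
  have hn : ∀ p, f (rev p) = par (k + 1 + 1) * f p := fun p => by
    rw [par_add_one, par_add_one, neg_neg, Omega_rev hf]
  set V := hilbertW S k f with hV
  set E : ℂ × ℝ → ℂ := fun p => V (S.entry p) with hE
  have hVs : ∀ p, 0 < S.bdf p → ContDiffAt ℝ 1 V p := fun p hp =>
    h.contDiffAt_hilbertTransport hf.1 hfp k (k + 1) hp
  have hEs : ∀ p, 0 < S.bdf p → ContDiffAt ℝ 1 E p := fun p hp =>
    h.contDiffAt_hilbertTransport_entry hf.1 hfp hn k hp
  have hVp : IsPeriodic V := isPeriodic_hilbert k _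
  have hEp : IsPeriodic E := h.isPeriodic_comp_entry hVp
  have hEc : ContinuousOn E S.SM :=
    h.continuousOn_comp_entry (h.continuousOn_hilbertTransport hf.1 hfp hn k)
  have hd : ∀ {A : ℂ × ℝ → ℂ} {p}, ContDiffAt ℝ 1 A p → DifferentiableAt ℝ A p := fun hA =>
    hA.differentiableAt one_ne_zero
  obtain ⟨CU, -, hCU⟩ := hUp.exists_bound hUc
  have i1 : Integrable (fun p => S.opW k f p * (starRingEnd ℂ) (U p)) S.volSM := by
    refine (hW.integrable (by norm_num)).mul_bdd (c := CU)
      (S.aestronglyMeasurable_of_continuousOn (continuousOn_conj (hUc.mono interior_subset_SM))) ?_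
    filter_upwards [S.ae_bdf_pos] with p hp
    rw [RCLike.norm_conj]
    exact hCU p (interior_subset_SM hp)
  have i1' : Integrable (fun p => S.opW k f p * (starRingEnd ℂ) (S.opWstar k G p)) S.volSM := by
    have hc := continuousOn_mode hUc k
    obtain ⟨C, -, hC⟩ := (isPeriodic_mode k U).exists_bound hc
    refine (hW.integrable (by norm_num)).mul_bdd (c := C)
      (S.aestronglyMeasurable_of_continuousOn (continuousOn_conj (hc.mono interior_subset_SM))) ?_
    filter_upwards [S.ae_bdf_pos] with p hp
    rw [RCLike.norm_conj]
    exact hC p (interior_subset_SM hp)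
  have i2 : Integrable (fun p => S.Xperp V p * (starRingEnd ℂ) (G p)) S.volSM :=
    integrable_mul_conj_lift (continuousOn_Xperp hVs) hVp.Xperp g
  have i3 : Integrable (fun p => S.Xperp E p * (starRingEnd ℂ) (G p)) S.volSM :=
    integrable_mul_conj_lift (continuousOn_Xperp hEs) hEp.Xperp g
  -- W_k f is homogeneous of degree k in the fibres, so it pairs only with the k-th mode of U, which
  -- is W_k^* G.
  have e1 : ∫ p, S.opW k f p * (starRingEnd ℂ) (U p) ∂S.volSM =
      ∫ p, S.opW k f p * (starRingEnd ℂ) (S.opWstar k G p) ∂S.volSM := by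
    have h2 := integral_mode_mul (k := k) (u := U) (c := fcoef k (S.Xperp (S.transport f)))
      (by rw [lift_fcoef]; exact integrable_conj_swap i1') (by rw [lift_fcoef]; exact integrable_conj_swap i1)
    rw [lift_fcoef] at h2
    have h3 := congrArg (starRingEnd ℂ) h2
    rw [← integral_conj, ← integral_conj] at h3
    simp only [map_mul, conj_conj] at h3
    simp only [opW, opWstar]
    simp only [mul_comm (mode k (S.Xperp (S.transport f)) _)]
    exact h3.symm
  have e2 : ∫ p, S.Xperp V p * (starRingEnd ℂ) (G p) ∂S.volSM =
      -∫ p, f p * (starRingEnd ℂ) (G p) ∂S.volSM := by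
    rw [hG, ← integral_mode_mul_lift (continuousOn_Xperp hVs) hVp.Xperp g, ← integral_neg]
    refine integral_congr_ae (S.ae_bdf_pos.mono fun p hp => ?_)
    simp only
    rw [h.mode_Xperp_hilbertW hf hp, neg_mul]
  have e3 := integral_mode_mul_lift (k := k) (continuousOn_Xperp hEs) hEp.Xperp g
  -- Since X U = -X_⊥ G, the two terms in which V - E is not differentiated cancel in the
  -- divergence.
  have hX : (fun p => S.X (fun p => (V p - E p) * (starRingEnd ℂ) (U p)) p +
      S.Xperp (fun p => (V p - E p) * (starRingEnd ℂ) (G p)) p) =ᵐ[S.volSM] fun p =>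
      (S.Xperp V p * (starRingEnd ℂ) (G p) - S.Xperp E p * (starRingEnd ℂ) (G p)) -
        S.opW k f p * (starRingEnd ℂ) (U p) := S.ae_bdf_pos.mono fun p hp => by
    have hv : ∀ w, fderiv ℝ (fun p => V p - E p) p w = fderiv ℝ V p w - fderiv ℝ E p w := fun w => by
      rw [fderiv_fun_sub (hd (hVs p hp)) (hd (hEs p hp))]; rfl
    have x1 : S.X (fun p => V p - E p) p = -S.opW k f p := by
      rw [X, hv, ← X, ← X, h.X_comp_entry hp (hd (hEs p hp)), h.X_hilbertW hf hp, sub_zero]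
    have x2 : S.Xperp (fun p => V p - E p) p = S.Xperp V p - S.Xperp E p := hv _
    have x3 : S.X U p = -q p := h.X_transport hqs hp
    have hdv : DifferentiableAt ℝ (fun p => V p - E p) p := (hd (hVs p hp)).sub (hd (hEs p hp))
    simp only
    rw [X_mul_conj hdv (hd (hUs p hp)), Xperp_mul_conj hdv (hg.1.differentiable (by simp) p), x1, x2, x3,
      map_neg]
    ring
  have i23 : Integrable (fun p => S.Xperp V p * (starRingEnd ℂ) (G p) -
      S.Xperp E p * (starRingEnd ℂ) (G p)) S.volSM := i2.sub i3
  set a : ℂ × ℝ → ℂ := fun p => ((S.X S.bdf p : ℝ) : ℂ) * (starRingEnd ℂ) (U p) +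
    ((S.Xperp S.bdf p : ℝ) : ℂ) * (starRingEnd ℂ) (G p) with ha
  have hac : ContinuousOn a S.SM :=
    (S.continuous_X_bdf_ofReal.continuousOn.mul (continuousOn_conj hUc)).add
      (S.continuous_Xperp_bdf_ofReal.continuousOn.mul
        (continuousOn_conj hg.1.continuous.continuousOn))
  have hap : IsPeriodic a := fun p => by
    simp only [ha, hUp p, hgp p, S.isPeriodic_bdf.X p, S.isPeriodic_bdf.Xperp p]
  -- The flux is (V - E) times a. Where X ρ ≥ 0 the entry point is the point itself, so V = E; where
  -- X ρ ≤ 0 the factor a vanishes because U and G do. V enters only through its square mean trace.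
  have h0 := integral_eq_zero_of_flux (S := S)
    (A₁ := fun p => (V p - E p) * (starRingEnd ℂ) (U p))
    (A₂ := fun p => (V p - E p) * (starRingEnd ℂ) (G p)) (v := V) (a := a) (b := fun p => -a p * E p)
    (fun p hp => contDiffAt_mul_conj ((hVs p hp).sub (hEs p hp)) (hUs p hp))
    (fun p hp => contDiffAt_mul_conj ((hVs p hp).sub (hEs p hp)) (hg.1.contDiffAt.of_le (by simp)))
    (fun p => by simp only [hVp p, hEp p, hUp p]) (fun p => by simp only [hVp p, hEp p, hgp p])
    ((i23.sub i1).congr hX.symm)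
    (fun p _ => by simp only [flux, ha, real_smul]; ring)
    (fun x hx => h.fibreTendsto_hilbertTransport hf.1 hfp hn k hx)
    (fun z hz => h.continuous_fibre_hilbertTransport hf.1 hfp hn k hz)
    hac (hac.neg.mul hEc) hap (fun p => by simp only [hap p, hEp p])
    (fun p hp => by
      rcases le_total 0 (S.X S.bdf p) with h1 | h1
      · simp only [hE, h.entry_of_influx hp h1]; ring
      · have u0 : U p = 0 := h.transport_eq_zero hp h1
        have g0 : G p = 0 := lift_vanishes k g p hp
        simp [ha, u0, g0])
  rw [integral_congr_ae hX, integral_sub i23 i1, integral_sub i2 i3, e1, e2, ← e3] at h0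
  linear_combination -h0

/-- The boundary term in terms of the values of `W_k^* g`. -/
def boundaryCorrection (S : IsothermalSurface) (k : ℤ) (g : ℂ × ℝ → ℂ) (p : ℂ × ℝ) : ℂ :=
  ((S.Xperp S.bdf p / S.X S.bdf p : ℝ) : ℂ) * S.opWstar k g p

theorem IsSimple.contDiffAt_recovered {g : ℂ × ℝ → ℂ} (hg : g ∈ Omega k) {p : ℂ × ℝ}
    (hp : 0 < S.bdf p) : ContDiffAt ℝ 1 (fun p => hilbertWstar S k g (S.entry p) +
      S.boundaryCorrection k g (S.entry p)) p := by
  have hqs : ContDiff ℝ ∞ (S.Xperp g) := S.contDiff_Xperp hg.1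
  have hqp : IsPeriodic (S.Xperp g) := (Omega_isPeriodic hg).Xperp
  have hn : ∀ p, S.Xperp g (rev p) = par (k + 1) * S.Xperp g p := fun p => Omega_Xperp_rev S hg p
  have he : ContDiffAt ℝ 1 S.entry p := (h.contDiffAt_entry hp).of_le (by simp)
  have b1 : ContDiffAt ℝ 1 (fun p => S.X S.bdf (S.entry p)) p :=
    (S.contDiff_X_bdf.contDiffAt.of_le (by simp)).comp p he
  have b2 : ContDiffAt ℝ 1 (fun p => S.Xperp S.bdf (S.entry p)) p :=
    (S.contDiff_Xperp_bdf.contDiffAt.of_le (by simp)).comp p he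
  exact (h.contDiffAt_hilbertTransport_entry hqs hqp hn k hp).add
    ((ofRealCLM.contDiff.contDiffAt.comp p
      (b2.div b1 (h.X_bdf_entry_pos_of_interior hp).ne')).mul
      (h.contDiffAt_mode_transport_entry hqs hqp hn hp))

/-- The weak form of the reconstruction formula for `W_k^*`. -/
theorem IsSimple.integral_reconstruction_Wstar {g : ℂ × ℝ → ℂ} (hg : g ∈ Omega k)
    (hg0 : S.VanishesOnBoundary g) (f : S.testSpace) :
    ∫ p, S.opW k (lift k f) p * (starRingEnd ℂ) (S.opWstar k g p) ∂S.volSM +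
      ∫ p, lift k f p * (starRingEnd ℂ) (g p) ∂S.volSM +
      ∫ p, lift k f p * (starRingEnd ℂ) (mode k (fun p => hilbertWstar S k g (S.entry p) +
        S.boundaryCorrection k g (S.entry p)) p) ∂S.volSM = 0 := by
  set F : ℂ × ℝ → ℂ := lift k f with hF
  have hf : F ∈ Omega k := lift_mem_Omega k f.2.1
  have hfp := Omega_isPeriodic hf
  have hgp := Omega_isPeriodic hg
  set q := S.Xperp g with hq
  have hqs : ContDiff ℝ ∞ q := S.contDiff_Xperp hg.1
  have hqp : IsPeriodic q := hgp.Xperp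
  have hn : ∀ p, q (rev p) = par (k + 1) * q p := fun p => Omega_Xperp_rev S hg p
  have hd : ∀ {A : ℂ × ℝ → ℂ} {p}, ContDiffAt ℝ 1 A p → DifferentiableAt ℝ A p := fun hA =>
    hA.differentiableAt one_ne_zero
  have hcont : ∀ {A : ℂ × ℝ → ℂ}, (∀ p, 0 < S.bdf p → ContDiffAt ℝ 1 A p) →
      ContinuousOn A {p | 0 < S.bdf p} := fun hA p hp => (hA p hp).continuousAt.continuousWithinAt
  set U := S.transport F with hU
  have hUc : ContinuousOn U S.SM := h.continuousOn_transport hf.1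
  have hUp : IsPeriodic U := h.isPeriodic_transport hfp
  have hUs : ∀ p, 0 < S.bdf p → ContDiffAt ℝ 1 U p := fun p hp =>
    (h.contDiffAt_transport hf.1 hp).of_le (by simp)
  set Y := S.opWstar k g with hY
  have hYc : ContinuousOn Y S.SM := continuousOn_mode (h.continuousOn_transport hqs) k
  have hYp : IsPeriodic Y := isPeriodic_mode k _
  have hYs : ∀ p, 0 < S.bdf p → ContDiffAt ℝ 1 Y p := fun p hp =>
    (((h.fibreSmooth_transport hqs hqp).mode S.isOpen_inside k).2 p hp).of_le (by simp)
  set V := hilbertWstar S k g with hV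
  have hVs : ∀ p, 0 < S.bdf p → ContDiffAt ℝ 1 V p := fun p hp =>
    h.contDiffAt_hilbertTransport hqs hqp k k hp
  have hVp : IsPeriodic V := isPeriodic_hilbert k _
  set w : ℂ × ℝ → ℂ := fun p => V (S.entry p) + S.boundaryCorrection k g (S.entry p) with hw
  have hws : ∀ p, 0 < S.bdf p → ContDiffAt ℝ 1 w p := fun p hp => h.contDiffAt_recovered hg hp
  have hbp : IsPeriodic (S.boundaryCorrection k g) := fun p => by
    simp only [boundaryCorrection, S.isPeriodic_bdf.X p, S.isPeriodic_bdf.Xperp p, ← hY, hYp p]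
  have hwp : IsPeriodic w := h.isPeriodic_comp_entry (w := fun p => V p + S.boundaryCorrection k g p)
    fun p => by simp only [hVp p, hbp p]
  obtain ⟨CY, hCY0, hCY⟩ := hYp.exists_bound hYc
  obtain ⟨CX, hCX⟩ := h.exists_bound_Xperp_transport hf.1 hfp fun p hp => lift_eventuallyEq_zero f hp
  have hXU : ContinuousOn (S.Xperp U) {p | 0 < S.bdf p} := continuousOn_Xperp hUs
  have hmul : ∀ {A : ℂ × ℝ → ℂ}, ContinuousOn A {p | 0 < S.bdf p} → (∀ p, 0 < S.bdf p → ‖A p‖ ≤ CX) →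
      Integrable (fun p => A p * (starRingEnd ℂ) (Y p)) S.volSM := fun {A} hA hAb => by
    refine S.integrable_of_continuousOn_of_bounded (C := CX * CY)
      (hA.mul (continuousOn_conj (hYc.mono interior_subset_SM))) fun p hp => ?_
    rw [norm_mul, RCLike.norm_conj]
    exact mul_le_mul (hAb p hp) (hCY p (interior_subset_SM hp)) (norm_nonneg _)
      ((norm_nonneg _).trans (hAb p hp))
  have i1 := hmul hXU hCX
  have i1' : Integrable (fun p => S.opW k F p * (starRingEnd ℂ) (Y p)) S.volSM :=
    hmul (continuousOn_mode_of_fibre (s := S.inside) hXU k) fun p hp => by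
      rw [opW, norm_mode]
      exact norm_fcoef_le k fun θ _ => hCX (p.1, θ) hp
  have e1 : ∫ p, S.opW k F p * (starRingEnd ℂ) (Y p) ∂S.volSM =
      ∫ p, S.Xperp U p * (starRingEnd ℂ) (Y p) ∂S.volSM := by
    have h2 := integral_mode_mul (S := S) (k := k) (u := S.Xperp U) (c := fcoef k (S.transport q))
      (by rw [lift_fcoef]; exact i1') (by rw [lift_fcoef]; exact i1)
    rw [lift_fcoef] at h2
    exact h2
  have iV := integrable_lift_mul_conj (k := k) (hcont hVs) hVp f
  have ig := integrable_lift_mul_conj (S := S) (k := k) hg.1.continuous.continuousOn hgp f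
  have iw := integrable_lift_mul_conj (k := k) (hcont hws) hwp f
  rw [← hF] at iV ig iw
  -- V has no k-th mode, since H_(k) annihilates degree k.
  have eV : ∫ p, F p * (starRingEnd ℂ) (V p) ∂S.volSM = 0 := by
    rw [hF, ← integral_lift_mul_mode (hcont hVs) hVp f, ← integral_zero (ℂ × ℝ) ℂ (μ := S.volSM)]
    refine integral_congr_ae (S.ae_bdf_pos.mono fun p hp => ?_)
    simp only
    rw [h.mode_hilbertWstar hg hp, map_zero, mul_zero]
  have ew : ∫ p, F p * (starRingEnd ℂ) (mode k w p) ∂S.volSM =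
      ∫ p, F p * (starRingEnd ℂ) (w p) ∂S.volSM := integral_lift_mul_mode (k := k) (hcont hws) hwp f
  -- With w constant along geodesics, X (V - g - w) = -X_⊥ Y, so the term U conj(X_⊥ Y) cancels
  -- between the two derivatives.
  have hX : (fun p => S.X (fun p => U p * (starRingEnd ℂ) (V p - g p - w p)) p +
      S.Xperp (fun p => U p * (starRingEnd ℂ) (Y p)) p) =ᵐ[S.volSM] fun p =>
      (S.Xperp U p * (starRingEnd ℂ) (Y p) - F p * (starRingEnd ℂ) (V p)) +
        (F p * (starRingEnd ℂ) (g p) + F p * (starRingEnd ℂ) (w p)) := S.ae_bdf_pos.mono fun p hp => by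
    have hdg : DifferentiableAt ℝ g p := hg.1.differentiable (by simp) p
    have hdVg : DifferentiableAt ℝ (fun p => V p - g p) p := (hd (hVs p hp)).sub hdg
    have hdv : DifferentiableAt ℝ (fun p => V p - g p - w p) p := hdVg.sub (hd (hws p hp))
    have x1 : S.X (fun p => V p - g p - w p) p = -S.Xperp Y p := by
      have e : S.X (fun p => V p - g p - w p) p = S.X V p - S.X g p - S.X w p := by
        simp only [X]
        rw [fderiv_fun_sub hdVg (hd (hws p hp)), fderiv_fun_sub (hd (hVs p hp)) hdg]; rfl
      rw [e, h.X_hilbertWstar hg hp, h.X_comp_entry (w := fun p => V p + S.boundaryCorrection k g p) hp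
        (hd (hws p hp))]
      ring
    have x3 : S.X U p = -F p := h.X_transport hf.1 hp
    simp only
    rw [X_mul_conj (hd (hUs p hp)) hdv, Xperp_mul_conj (hd (hUs p hp)) (hd (hYs p hp)), x1, x3]
    simp only [map_sub, map_neg]
    ring
  -- The correction has the denominator X ρ, which degenerates at glancing vectors; geodesics on
  -- which U is nonzero stay uniformly away from these.
  obtain ⟨c, hc, hcb⟩ := h.exists_X_bdf_entry_ge (testSpace_isCompact f) (testSpace_tsupport_subset f)
    (f := F) fun p hp => lift_eq_zero k hp
  -- With the denominator bounded below by c the correction is continuous on the whole boundary, and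
  -- after multiplication by U it is indistinguishable from the original.
  set bc : ℂ × ℝ → ℂ := fun p =>
    ((S.Xperp S.bdf p / max c (S.X S.bdf p) : ℝ) : ℂ) * Y p with hbc
  have hbcc : ContinuousOn (fun p => V p + bc p) {p | S.bdf p = 0} := by
    have h1 : Continuous fun p => S.Xperp S.bdf p / max c (S.X S.bdf p) :=
      S.contDiff_Xperp_bdf.continuous.div (continuous_const.max S.contDiff_X_bdf.continuous)
        fun p => (lt_max_of_lt_left hc).ne'
    exact (h.continuousOn_hilbertTransport hqs hqp hn k).add
      ((continuous_ofReal.comp h1).continuousOn.mul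
        (hYc.mono fun p (hp : S.bdf p = 0) => hp.ge))
  have hbcp : IsPeriodic fun p => V p + bc p := fun p => by
    simp only [hbc, hVp p, hYp p, S.isPeriodic_bdf.X p, S.isPeriodic_bdf.Xperp p]
  have hEc := h.continuousOn_comp_entry hbcc
  have hEp := h.isPeriodic_comp_entry hbcp
  have hUw : ∀ p ∈ S.SM, U p * (starRingEnd ℂ) (V (S.entry p) + bc (S.entry p)) =
      U p * (starRingEnd ℂ) (w p) := fun p hp => by
    by_cases hu : U p = 0
    · rw [hu, zero_mul, zero_mul]
    · simp only [hw, hbc, boundaryCorrection, max_eq_right (hcb p hp hu), ← hY]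
  set a : ℂ × ℝ → ℂ := fun p => ((S.X S.bdf p : ℝ) : ℂ) * U p with ha
  set b : ℂ × ℝ → ℂ := fun p => -((S.X S.bdf p : ℝ) : ℂ) *
    (U p * (starRingEnd ℂ) (g p) + U p * (starRingEnd ℂ) (V (S.entry p) + bc (S.entry p))) +
    ((S.Xperp S.bdf p : ℝ) : ℂ) * (U p * (starRingEnd ℂ) (Y p)) with hb
  have hac : ContinuousOn a S.SM := S.continuous_X_bdf_ofReal.continuousOn.mul hUc
  have hbcont : ContinuousOn b S.SM :=
    (S.continuous_X_bdf_ofReal.neg.continuousOn.mul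
      ((hUc.mul (continuousOn_conj hg.1.continuous.continuousOn)).add
        (hUc.mul (continuousOn_conj hEc)))).add
    (S.continuous_Xperp_bdf_ofReal.continuousOn.mul (hUc.mul (continuousOn_conj hYc)))
  have iA : Integrable (fun p => S.Xperp U p * (starRingEnd ℂ) (Y p) -
      F p * (starRingEnd ℂ) (V p)) S.volSM := i1.sub iV
  have iB : Integrable (fun p => F p * (starRingEnd ℂ) (g p) + F p * (starRingEnd ℂ) (w p)) S.volSM :=
    ig.add iw
  -- Where X ρ ≤ 0, U = 0. At influx vectors g = 0 and V - w is minus the correction, so X ρ conj(V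
  -- - g - w) + X_⊥ ρ conj(Y) = 0; this dictates the form of the boundary term.
  have h0 := integral_eq_zero_of_flux (S := S)
    (A₁ := fun p => U p * (starRingEnd ℂ) (V p - g p - w p))
    (A₂ := fun p => U p * (starRingEnd ℂ) (Y p)) (v := fun p => (starRingEnd ℂ) (V p)) (a := a) (b := b)
    (fun p hp => contDiffAt_mul_conj (hUs p hp)
      (((hVs p hp).sub (hg.1.contDiffAt.of_le (by simp))).sub (hws p hp)))
    (fun p hp => contDiffAt_mul_conj (hUs p hp) (hYs p hp))
    (fun p => by simp only [hUp p, hVp p, hgp p, hwp p]) (fun p => by simp only [hUp p, hYp p])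
    ((iA.add iB).congr hX.symm)
    (fun p hp => by
      simp only [flux, ha, hb, real_smul, hUw p (interior_subset_SM hp), map_sub]; ring)
    (fun x hx => by
      simp only [FibreTendsto, ← map_sub, RCLike.norm_conj]
      exact h.fibreTendsto_hilbertTransport hqs hqp hn k hx)
    (fun z hz => continuous_conj.comp (h.continuous_fibre_hilbertTransport hqs hqp hn k hz))
    hac hbcont (fun p => by simp only [ha, hUp p, S.isPeriodic_bdf.X p])
    (fun p => by
      simp only [hb, hUp p, hgp p, hYp p, S.isPeriodic_bdf.X p, S.isPeriodic_bdf.Xperp p, hEp p])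
    (fun p hp => by
      rcases le_or_gt (S.X S.bdf p) 0 with h1 | h1
      · have u0 : U p = 0 := h.transport_eq_zero hp h1
        simp [ha, hb, u0]
      · have he := h.entry_of_influx hp h1.le
        have h1' : ((S.X S.bdf p : ℝ) : ℂ) ≠ 0 := ofReal_ne_zero.2 h1.ne'
        simp only [ha, hb, hUw p hp.ge]
        simp only [hw, he, hg0 p hp, boundaryCorrection, ← hY, map_add, map_mul, map_zero, ofReal_div,
          map_div₀, conj_ofReal]
        field_simp
        ring)
  rw [integral_congr_ae hX, integral_add iA iB, integral_sub i1 iV, integral_add ig iw, eV, ← e1, ← ew] at h0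
  linear_combination h0

end IsothermalSurface

end

/-! ### Neumann series and bounded extensions to H_k -/

noncomputable section

/-- The Neumann series of `1 + A ^ 2` for a contraction `A`. -/
theorem hasSum_neumann {E : Type*} [NormedAddCommGroup E] [NormedSpace ℂ E] [CompleteSpace E]
    {A : E →L[ℂ] E} (hA : ‖A‖ < 1) {F R : E} (hR : R = -F - A (A F)) :
    HasSum (fun n : ℕ => -(((-(A ^ 2)) ^ n) R)) F := by
  have hB : ‖-(A ^ 2)‖ < 1 := by
    rw [norm_neg]
    exact (norm_pow_le' A two_pos).trans_lt (pow_lt_one₀ (norm_nonneg _) hA two_ne_zero)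
  have h1 := (summable_geometric_of_norm_lt_one hB).hasSum
  have h2 := ((ContinuousLinearMap.apply ℂ E R).hasSum h1).neg
  have h3 := geom_series_mul_neg (-(A ^ 2)) hB
  -- -R = (1 - (-A²)) F, so the geometric series of -A² recovers F.
  have h4 : -(∑' n : ℕ, (-(A ^ 2)) ^ n) R = F := by
    have h5 := congrArg (fun T : E →L[ℂ] E => T F) h3
    simp only [ContinuousLinearMap.mul_apply, ContinuousLinearMap.one_apply] at h5
    rw [hR, ← map_neg]
    refine Eq.trans (congrArg _ ?_) h5
    simp only [ContinuousLinearMap.sub_apply, ContinuousLinearMap.neg_apply,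
      ContinuousLinearMap.one_apply, pow_two, ContinuousLinearMap.mul_apply]
    abel
  rw [← h4]
  exact h2

theorem isUnit_one_add_sq {E : Type*} [NormedAddCommGroup E] [NormedSpace ℂ E] [CompleteSpace E]
    {A : E →L[ℂ] E} (hA : ‖A‖ < 1) : IsUnit (1 + A ^ 2) := by
  have hB : ‖-(A ^ 2)‖ < 1 := by
    rw [norm_neg]
    exact (norm_pow_le' A two_pos).trans_lt (pow_lt_one₀ (norm_nonneg _) hA two_ne_zero)
  simpa using isUnit_one_sub_of_norm_lt_one hB

namespace IsothermalSurface

variable {S : IsothermalSurface} {k : ℤ}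

instance : CompleteSpace (S.Hk k) := by unfold Hk; infer_instance

theorem Represents.norm_sq {F : S.Hk k} {f : ℂ × ℝ → ℂ} (hF : S.Represents F f) :
    ‖F‖ ^ 2 = ∫ p, ‖f p‖ ^ 2 ∂S.volSM := by
  have h1 : ((‖F‖ ^ 2 : ℝ) : ℂ) = inner ℂ F F := by
    rw [inner_self_eq_norm_sq_to_K (𝕜 := ℂ) F]; push_cast; rfl
  rw [inner_eq_of_represents hF hF] at h1
  have h2 : ∀ p, f p * (starRingEnd ℂ) (f p) = ((‖f p‖ ^ 2 : ℝ) : ℂ) := normSqFun_eq f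
  simp only [h2, integral_complex_ofReal] at h1
  exact_mod_cast h1

theorem exists_represents_Omega {f : ℂ × ℝ → ℂ} (hf : f ∈ Omega k) : ∃ F : S.Hk k, S.Represents F f := by
  obtain ⟨C, -, hC⟩ := (Omega_isPeriodic hf).exists_bound (S := S) hf.1.continuous.continuousOn
  have h1 := exists_represents (S := S) (k := k) (c := fun z => f (z, 0))
    (hf.1.continuous.comp (by fun_prop : Continuous fun z : ℂ => (z, (0 : ℝ)))).continuousOn (C := C)
    fun z hz => hC (z, 0) (interior_subset_SM (a := (z, 0)) hz)
  rwa [Omega_eq_lift hf] at h1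

theorem exists_represents_mode {u : ℂ × ℝ → ℂ} (hu : ContinuousOn u {p | 0 < S.bdf p}) {C : ℝ}
    (hC : ∀ p, 0 < S.bdf p → ‖u p‖ ≤ C) : ∃ F : S.Hk k, S.Represents F (mode k u) := by
  rw [← lift_fcoef]
  exact exists_represents (continuousOn_fcoef (s := S.inside) hu k)
    fun z hz => norm_fcoef_le k fun θ _ => hC (z, θ) hz

theorem represents_mode_of_forall_test {G : S.Hk k} {u : ℂ × ℝ → ℂ}
    (hu : ContinuousOn u {p | 0 < S.bdf p})
    (hG : ∀ g : S.testSpace, inner ℂ (testHk k g) G =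
      ∫ p, mode k u p * (starRingEnd ℂ) (lift k g p) ∂S.volSM) : S.Represents G (mode k u) := by
  rw [← lift_fcoef] at hG ⊢
  exact represents_of_forall_test (continuousOn_fcoef (s := S.inside) hu k) hG

theorem integral_mul_conj_symm (A B : ℂ × ℝ → ℂ) : ∫ p, A p * (starRingEnd ℂ) (B p) ∂S.volSM =
    (starRingEnd ℂ) (∫ p, B p * (starRingEnd ℂ) (A p) ∂S.volSM) := by
  rw [← integral_conj]
  simp only [map_mul, conj_conj, mul_comm]

section operators

variable (h : S.IsSimple)
include h

theorem IsSimple.continuousOn_Xperp_transport {f : ℂ × ℝ → ℂ} (hf : ContDiff ℝ ∞ f) :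
    ContinuousOn (S.Xperp (S.transport f)) {p | 0 < S.bdf p} :=
  continuousOn_Xperp fun _ hp => (h.contDiffAt_transport hf hp).of_le (by simp)

/-- `W_k` and `W_k^*` are formally adjoint against test functions in the second argument. -/
theorem IsSimple.integral_opW_mul_test {f : ℂ × ℝ → ℂ} (hf : f ∈ Omega k) (g : S.testSpace) :
    ∫ p, S.opW k f p * (starRingEnd ℂ) (lift k g p) ∂S.volSM =
      ∫ p, f p * (starRingEnd ℂ) (S.opWstar k (lift k g) p) ∂S.volSM := by
  have hc := h.continuousOn_Xperp_transport hf.1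
  exact h.integral_opW_mul hf (lift_mem_Omega k g.2.1) (lift_vanishes k g)
    (integrable_mul_conj_lift hc (h.isPeriodic_transport (Omega_isPeriodic hf)).Xperp g)
    (integrable_mul_conj_lift (continuousOn_mode_of_fibre (s := S.inside) hc k) (isPeriodic_mode k _) g)

theorem IsSimple.exists_bound_opW_test (f : S.testSpace) :
    ∃ C, ∀ p, 0 < S.bdf p → ‖S.Xperp (S.transport (lift k f)) p‖ ≤ C :=
  h.exists_bound_Xperp_transport (lift_mem_Omega k f.2.1).1 (isPeriodic_lift k f)
    fun _ hp => lift_eventuallyEq_zero f hp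

/-- `W_k` and `W_k^*` are formally adjoint against test functions in the first argument. -/
theorem IsSimple.integral_opW_test_mul (f : S.testSpace) {g : ℂ × ℝ → ℂ} (hg : g ∈ Omega k)
    (hg0 : S.VanishesOnBoundary g) :
    ∫ p, S.opW k (lift k f) p * (starRingEnd ℂ) (g p) ∂S.volSM =
      ∫ p, lift k f p * (starRingEnd ℂ) (S.opWstar k g p) ∂S.volSM := by
  have hf : lift k (f : ℂ → ℂ) ∈ Omega k := lift_mem_Omega k f.2.1
  have hc := h.continuousOn_Xperp_transport hf.1
  obtain ⟨C, hC⟩ := h.exists_bound_opW_test (k := k) f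
  obtain ⟨B, hB0, hB⟩ := (Omega_isPeriodic hg).exists_bound (S := S) hg.1.continuous.continuousOn
  have hmul : ∀ {A : ℂ × ℝ → ℂ}, ContinuousOn A {p | 0 < S.bdf p} → (∀ p, 0 < S.bdf p → ‖A p‖ ≤ C) →
      Integrable (fun p => A p * (starRingEnd ℂ) (g p)) S.volSM := fun {A} hA hAb => by
    refine S.integrable_of_continuousOn_of_bounded (C := C * B)
      (hA.mul (continuousOn_conj hg.1.continuous.continuousOn)) fun p hp => ?_
    rw [norm_mul, RCLike.norm_conj]
    exact mul_le_mul (hAb p hp) (hB p (interior_subset_SM hp)) (norm_nonneg _)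
      ((norm_nonneg _).trans (hAb p hp))
  refine h.integral_opW_mul hf hg hg0 (hmul hc hC)
    (hmul (continuousOn_mode_of_fibre (s := S.inside) hc k) fun p hp => ?_)
  rw [opW, norm_mode]
  exact norm_fcoef_le k fun θ _ => hC (p.1, θ) hp

/-- The bounded extension of `W_k^*` to `H_k`. -/
theorem IsSimple.exists_extension_opWstar {κ : ℝ} (hκ : 0 ≤ κ)
    (hb : ∀ g : S.testSpace, ∫ p, ‖S.opWstar k (lift k g) p‖ ^ 2 ∂S.volSM ≤
      κ ^ 2 * ∫ p, ‖lift k g p‖ ^ 2 ∂S.volSM) :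
    ∃ A : S.Hk k →L[ℂ] S.Hk k, ‖A‖ ≤ κ ∧
      ∀ g : S.testSpace, S.Represents (A (testHk k g)) (S.opWstar k (lift k g)) := by
  have hA : ∀ g : S.testSpace, ∃ F : S.Hk k, S.Represents F (S.opWstar k (lift k g)) := fun g => by
    have hq := S.contDiff_Xperp (lift_mem_Omega k g.2.1).1
    have hc := h.continuousOn_transport hq
    obtain ⟨C, -, hC⟩ := (h.isPeriodic_transport (isPeriodic_lift k g).Xperp).exists_bound hc
    exact exists_represents_mode (hc.mono interior_subset_SM) fun p hp => hC p (interior_subset_SM hp)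
  have hB : ∀ f : S.testSpace, ∃ F : S.Hk k, S.Represents F (S.opW k (lift k f)) := fun f => by
    obtain ⟨C, hC⟩ := h.exists_bound_opW_test (k := k) f
    exact exists_represents_mode (h.continuousOn_Xperp_transport (lift_mem_Omega k f.2.1).1) hC
  choose T hT using hA
  choose T' hT' using hB
  -- Representatives T g and T' f are chosen separately for each function; linearity of T follows by
  -- pairing with the dense test functions and moving T to T'.
  have hadj : ∀ f g : S.testSpace, inner ℂ (T g) (testHk k f) = inner ℂ (testHk k g) (T' f) := fun f g => by
    rw [inner_eq_of_represents (hT g) (represents_testHk k f),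
      inner_eq_of_represents (represents_testHk k g) (hT' f),
      h.integral_opW_mul_test (lift_mem_Omega k f.2.1) g]
  let L : S.testSpace →ₗ[ℂ] S.Hk k :=
    { toFun := T
      map_add' := fun g g' => (denseRange_testHk k).eq_of_inner_left ℂ fun f => by
        rw [inner_add_left, hadj, hadj, hadj, map_add, inner_add_left]
      map_smul' := fun c g => (denseRange_testHk k).eq_of_inner_left ℂ fun f => by
        rw [RingHom.id_apply, inner_smul_left, hadj, hadj, map_smul]
        exact inner_smul_left (𝕜 := ℂ) (testHk k g) (T' f) c }
  have hL : ∀ g, ‖L g‖ ≤ κ * ‖testHk k g‖ := fun g => by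
    refine abs_le_of_sq_le_sq' ?_ (by positivity) |>.2
    rw [show L g = T g from rfl, mul_pow, (hT g).norm_sq, (represents_testHk k g).norm_sq]
    exact hb g
  refine ⟨L.extendOfNorm (testHk k), LinearMap.opNorm_extendOfNorm_le (denseRange_testHk k) hκ hL,
    fun g => ?_⟩
  rw [LinearMap.extendOfNorm_eq (denseRange_testHk k) ⟨κ, hL⟩]
  exact hT g

theorem IsSimple.extend_dataW {f : ℂ × ℝ → ℂ} {p : ℂ × ℝ} (hp : p ∈ S.SM) :
    S.extend (S.dataW k f) p = hilbertW S k f (S.entry p) := by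
  rw [h.extend_eq (w := S.dataW k f) (isPeriodic_hilbert k _) hp]
  exact h.hilbertTransport_boundary k (k + 1) f (h.bdf_entry hp)

theorem IsSimple.extend_dataWstar {g : ℂ × ℝ → ℂ} {p : ℂ × ℝ} (hp : p ∈ S.SM) :
    S.extend (S.dataWstar k g) p = hilbertWstar S k g (S.entry p) := by
  rw [h.extend_eq (w := S.dataWstar k g) (isPeriodic_hilbert k _) hp]
  exact h.hilbertTransport_boundary k k (S.Xperp g) (h.bdf_entry hp)

theorem IsSimple.extend_dataWstar_add {g : ℂ × ℝ → ℂ} {p : ℂ × ℝ} (hp : p ∈ S.SM) :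
    S.extend (fun p => S.dataWstar k g p + S.boundaryTerm k g p) p =
      hilbertWstar S k g (S.entry p) + S.boundaryCorrection k g (S.entry p) := by
  have h1 : IsPeriodic (S.dataWstar k g) := isPeriodic_hilbert k _
  have h2 : IsPeriodic (S.boundaryTerm k g) := fun p => by
    have e1 := S.isPeriodic_bdf.X (S := S) p
    have e2 := S.isPeriodic_bdf.Xperp (S := S) p
    have e3 := isPeriodic_mode k (S.ray (S.Xperp g)) p
    simp only [boundaryTerm, e3]
    congr 2
    exact congrArg₂ _ e2 e1
  have hb := h.bdf_entry hp
  rw [h.extend_eq (fun p => by simp only [h1 p, h2 p]) hp]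
  congr 1
  · exact h.hilbertTransport_boundary k k (S.Xperp g) hb
  · rw [boundaryTerm, boundaryCorrection, opWstar]
    congr 1
    exact mode_congr (v := S.transport (S.Xperp g)) fun θ => h.ray_eq (p := ((S.entry p).1, θ)) hb

omit h in
theorem Represents.congr {F : S.Hk k} {f g : ℂ × ℝ → ℂ} (hF : S.Represents F f)
    (hfg : ∀ p, 0 < S.bdf p → f p = g p) : S.Represents F g :=
  Filter.EventuallyEq.trans hF (S.ae_bdf_pos.mono hfg)

section contraction

variable {A : S.Hk k →L[ℂ] S.Hk k}
  (hA : ∀ g : S.testSpace, S.Represents (A (testHk k g)) (S.opWstar k (lift k g)))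
include hA

/-- An element of H_k is determined by its pairings with test functions, and formal adjointness
computes these. In particular W_k f is square integrable for every f in Ω_k, with no condition at
the boundary. -/
theorem IsSimple.represents_opW {f : ℂ × ℝ → ℂ} (hf : f ∈ Omega k) {F : S.Hk k}
    (hF : S.Represents F f) : S.Represents (A.adjoint F) (S.opW k f) :=
  represents_mode_of_forall_test (h.continuousOn_Xperp_transport hf.1) fun g => by
    rw [ContinuousLinearMap.adjoint_inner_right, inner_eq_of_represents (hA g) hF]
    exact (h.integral_opW_mul_test hf g).symm

/-- The same weak argument passes from test functions to all g in Ω_k vanishing on the boundary, by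
moving the operator onto W_k of a test function. -/
theorem IsSimple.represents_opWstar {g : ℂ × ℝ → ℂ} (hg : g ∈ Omega k) (hg0 : S.VanishesOnBoundary g)
    {G : S.Hk k} (hG : S.Represents G g) : S.Represents (A G) (S.opWstar k g) :=
  represents_mode_of_forall_test ((h.continuousOn_transport (S.contDiff_Xperp hg.1)).mono
    interior_subset_SM) fun f => by
    rw [← ContinuousLinearMap.adjoint_inner_left, inner_eq_of_represents
      (h.represents_opW hA (lift_mem_Omega k f.2.1) (represents_testHk k f)) hG,
      integral_mul_conj_symm, h.integral_opW_test_mul f hg hg0, ← integral_mul_conj_symm]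
    rfl

/-- The weak reconstruction formula read as an identity in H_k, after replacing the influx values of
V by the data computed from I f; the square integrability it requires comes from `represents_opW`.
-/
theorem IsSimple.represents_residual_W {f : ℂ × ℝ → ℂ} (hf : f ∈ Omega k) {F : S.Hk k}
    (hF : S.Represents F f) : S.Represents (-F - A.adjoint (A.adjoint F))
      (mode k (S.Xperp (S.extend (S.dataW k f)))) := by
  have hn : ∀ p, f (rev p) = par (k + 1 + 1) * f p := fun p => by
    rw [par_add_one, par_add_one, neg_neg, Omega_rev hf]
  have hWF := h.represents_opW hA hf hF
  have h1 : S.Represents (-F - A.adjoint (A.adjoint F))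
      (mode k (S.Xperp fun p => hilbertW S k f (S.entry p))) := by
    refine represents_mode_of_forall_test (continuousOn_Xperp fun p hp =>
      h.contDiffAt_hilbertTransport_entry hf.1 (Omega_isPeriodic hf) hn k hp) fun g => ?_
    rw [inner_sub_right, inner_neg_right, ContinuousLinearMap.adjoint_inner_right,
      inner_eq_of_represents (hA g) hWF, inner_eq_of_represents (represents_testHk k g) hF]
    linear_combination -h.integral_reconstruction_W hf g hWF.memLp
  refine h1.congr fun p hp => mode_congr (v := S.Xperp (S.extend (S.dataW k f))) fun θ => ?_
  have he : (fun p => hilbertW S k f (S.entry p)) =ᶠ[nhds (p.1, θ)] S.extend (S.dataW k f) := by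
    filter_upwards [S.isOpen_interior_bdf.mem_nhds (show 0 < S.bdf (p.1, θ) from hp)] with x hx
    exact (h.extend_dataW (interior_subset_SM hx)).symm
  rw [Xperp, he.fderiv_eq, Xperp]

/-- Here the adjoint is moved onto the test function, where W_k is given by its formula, and the
pairings are conjugated to match the order of the factors in the weak formula. -/
theorem IsSimple.represents_residual_Wstar {g : ℂ × ℝ → ℂ} (hg : g ∈ Omega k)
    (hg0 : S.VanishesOnBoundary g) {G : S.Hk k} (hG : S.Represents G g) :
    S.Represents (-G - A (A G))
      (mode k (S.extend fun p => S.dataWstar k g p + S.boundaryTerm k g p)) := by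
  have hq := S.contDiff_Xperp hg.1
  have hqp : IsPeriodic (S.Xperp g) := (Omega_isPeriodic hg).Xperp
  have hAG := h.represents_opWstar hA hg hg0 hG
  have h1 : S.Represents (-G - A (A G)) (mode k fun p => hilbertWstar S k g (S.entry p) +
      S.boundaryCorrection k g (S.entry p)) := by
    refine represents_mode_of_forall_test (fun p hp => ContinuousAt.continuousWithinAt
      (h.contDiffAt_recovered hg hp).continuousAt) fun f => ?_
    rw [inner_sub_right, inner_neg_right, ← ContinuousLinearMap.adjoint_inner_left,
      inner_eq_of_represents (h.represents_opW hA (lift_mem_Omega k f.2.1) (represents_testHk k f)) hAG,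
      inner_eq_of_represents (represents_testHk k f) hG, integral_mul_conj_symm,
      integral_mul_conj_symm (S.opWstar k g), integral_mul_conj_symm (mode k _), ← map_neg, ← map_sub]
    congr 1
    linear_combination -h.integral_reconstruction_Wstar hg hg0 f
  exact h1.congr fun p hp => mode_congr (v := S.extend fun p => S.dataWstar k g p + S.boundaryTerm k g p)
    fun θ => (h.extend_dataWstar_add (p := (p.1, θ)) (interior_subset_SM (a := (p.1, θ)) hp)).symm

theorem IsSimple.represents_residual_Wstar_of_vanishes {g : ℂ × ℝ → ℂ} (hg : g ∈ Omega k)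
    (hg0 : S.VanishesOnBoundary g) (hg1 : S.VanishesOnBoundary (S.opWstar k g)) {G : S.Hk k}
    (hG : S.Represents G g) :
    S.Represents (-G - A (A G)) (mode k (S.extend (S.dataWstar k g))) :=
  (h.represents_residual_Wstar hA hg hg0 hG).congr fun p hp =>
    mode_congr (v := S.extend (S.dataWstar k g)) fun θ => by
      have hm : (p.1, θ) ∈ S.SM := interior_subset_SM (a := (p.1, θ)) hp
      rw [h.extend_dataWstar_add hm, h.extend_dataWstar hm, boundaryCorrection,
        hg1 _ (h.bdf_entry hm), mul_zero, add_zero]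

end contraction

end operators

variable (S)

theorem abs_curv_le {z : ℂ} (hz : z ∈ S.M) : |S.curv z| ≤ S.curvNorm := by
  have hb : BddAbove ((fun z => |S.curv z|) '' S.M) :=
    S.isCompact_domain.bddAbove_image S.contDiff_curv.continuous.abs.continuousOn
  rw [image_eq_range] at hb
  exact le_ciSup hb ⟨z, hz⟩

theorem norm_grad_curv_le {z : ℂ} (hz : z ∈ S.M) :
    Real.exp (-S.lam z) * ‖fderiv ℝ S.curv z‖ ≤ S.gradCurvNorm := by
  have hb : BddAbove ((fun z => Real.exp (-S.lam z) * ‖fderiv ℝ S.curv z‖) '' S.M) :=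
    S.isCompact_domain.bddAbove_image ((Real.continuous_exp.comp S.lam_smooth.continuous.neg).mul
      (S.contDiff_curv.continuous_fderiv (by simp)).norm).continuousOn
  rw [image_eq_range] at hb
  exact le_ciSup hb ⟨z, hz⟩

theorem curvNorm_nonneg : 0 ≤ S.curvNorm := Real.iSup_nonneg fun _ => abs_nonneg _

theorem gradCurvNorm_nonneg : 0 ≤ S.gradCurvNorm := Real.iSup_nonneg fun _ => by positivity

end IsothermalSurface

end

/-! ### Choice of the curvature bound and conclusion -/

theorem corollary5p7 (k : ℤ) (D : ℝ) (hD : 0 < D) :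
    ∃ C : ℝ, 0 < C ∧ ∀ S : IsothermalSurface, S.IsSimple →
      (∀ p ∈ S.SM, S.exitTime p ≤ D) →
      S.curvNorm + S.gradCurvNorm ≤ C →
      ∃ W Wstar : S.Hk k →L[ℂ] S.Hk k,
        -- `W` and `Wstar` are the extensions to `H_k` of the operators given by the formulas
        (∀ f ∈ IsothermalSurface.Omega k, ∃ F : S.Hk k,
          S.Represents F f ∧ S.Represents (W F) (S.opW k f)) ∧
        (∀ h ∈ IsothermalSurface.Omega k, S.VanishesOnBoundary h → ∃ F : S.Hk k,
          S.Represents F h ∧ S.Represents (Wstar F) (S.opWstar k h)) ∧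
        (∀ F G : S.Hk k, inner ℂ (W F) G = inner ℂ F (Wstar G)) ∧
        -- they are contractions
        ‖W‖ < 1 ∧ ‖Wstar‖ < 1 ∧
        -- invertibility in the algebra of bounded operators
        IsUnit (1 + W ^ 2) ∧ IsUnit (1 + Wstar ^ 2) ∧
        -- reconstruction of `f` from `I f`
        (∀ f ∈ IsothermalSurface.Omega k, ∃ F R : S.Hk k,
          S.Represents F f ∧
          S.Represents R (IsothermalSurface.mode k (S.Xperp (S.extend (S.dataW k f)))) ∧
          HasSum (fun n : ℕ => -(((-(W ^ 2)) ^ n) R)) F) ∧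
        -- reconstruction of `h` from `I [X_⊥ h]` when `W_k^* h` vanishes on the boundary
        (∀ h ∈ IsothermalSurface.Omega k, S.VanishesOnBoundary h →
          S.VanishesOnBoundary (S.opWstar k h) → ∃ F R : S.Hk k,
          S.Represents F h ∧
          S.Represents R (IsothermalSurface.mode k (S.extend (S.dataWstar k h))) ∧
          HasSum (fun n : ℕ => -(((-(Wstar ^ 2)) ^ n) R)) F) ∧
        -- reconstruction of `h` from `I [X_⊥ h]` in general
        (∀ h ∈ IsothermalSurface.Omega k, S.VanishesOnBoundary h → ∃ F R : S.Hk k,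
          S.Represents F h ∧
          S.Represents R (IsothermalSurface.mode k
            (S.extend fun p => S.dataWstar k h p + S.boundaryTerm k h p)) ∧
          HasSum (fun n : ℕ => -(((-(Wstar ^ 2)) ^ n) R)) F) := by
  have hpos : 0 < 4 * D ^ 2 + 8 * |(k : ℝ)| * D ^ 2 + 64 * D ^ 3 := by positivity
  -- With K = K' = C the first summand gives C D² ≤ 1/4, as the Jacobi estimates require, and the
  -- other two give 4|k| C D² + 32 C D³ ≤ 1/2 for the norm of W_k^*.
  set C : ℝ := 1 / (4 * D ^ 2 + 8 * |(k : ℝ)| * D ^ 2 + 64 * D ^ 3) with hC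
  have hC0 : 0 < C := by positivity
  have hC1 : C * (4 * D ^ 2 + 8 * |(k : ℝ)| * D ^ 2 + 64 * D ^ 3) = 1 := by
    rw [hC]; field_simp
  have hk : 0 ≤ C * (|(k : ℝ)| * D ^ 2) := by positivity
  have hD2 : 0 ≤ C * D ^ 2 := by positivity
  have hD3 : 0 ≤ C * D ^ 3 := by positivity
  refine ⟨C, hC0, fun S h hτ hcurv => ?_⟩
  have n1 := S.curvNorm_nonneg
  have n2 := S.gradCurvNorm_nonneg
  have hκ0 : 0 ≤ IsothermalSurface.kernelBound k C C D * D := by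
    unfold IsothermalSurface.kernelBound; positivity
  have hκ1 : IsothermalSurface.kernelBound k C C D * D < 1 := by
    unfold IsothermalSurface.kernelBound; nlinarith
  -- A extends W_k^*; its adjoint serves as W_k, which makes the adjointness relation and the
  -- equality of norms automatic.
  obtain ⟨A, hA1, hA⟩ := h.exists_extension_opWstar (k := k) hκ0 fun g =>
    h.integral_sq_norm_opWstar_le hτ (fun z hz => (S.abs_curv_le hz).trans (by linarith))
      (fun z hz => (S.norm_grad_curv_le hz).trans (by linarith)) (by nlinarith) hD.le hC0.le
      (IsothermalSurface.lift_mem_Omega k g.2.1)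
      fun p hp => IsothermalSurface.lift_eventuallyEq_zero g hp
  have hA' : ‖A‖ < 1 := hA1.trans_lt hκ1
  have hW' : ‖A.adjoint‖ < 1 := by rwa [LinearIsometryEquiv.norm_map]
  refine ⟨A.adjoint, A, fun f hf => ?_, fun g hg hg0 => ?_, fun F G => A.adjoint_inner_left G F,
    hW', hA', isUnit_one_add_sq hW', isUnit_one_add_sq hA', fun f hf => ?_, fun g hg hg0 hg1 => ?_,
    fun g hg hg0 => ?_⟩
  · obtain ⟨F, hF⟩ := IsothermalSurface.exists_represents_Omega (S := S) hf
    exact ⟨F, hF, h.represents_opW hA hf hF⟩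
  · obtain ⟨G, hG⟩ := IsothermalSurface.exists_represents_Omega (S := S) hg
    exact ⟨G, hG, h.represents_opWstar hA hg hg0 hG⟩
  · obtain ⟨F, hF⟩ := IsothermalSurface.exists_represents_Omega (S := S) hf
    exact ⟨F, _, hF, h.represents_residual_W hA hf hF, hasSum_neumann hW' rfl⟩
  · obtain ⟨G, hG⟩ := IsothermalSurface.exists_represents_Omega (S := S) hg
    exact ⟨G, _, hG, h.represents_residual_Wstar_of_vanishes hA hg hg0 hg1 hG, hasSum_neumann hA' rfl⟩
  · obtain ⟨G, hG⟩ := IsothermalSurface.exists_represents_Omega (S := S) hg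
    exact ⟨G, _, hG, h.represents_residual_Wstar hA hg hg0 hG, hasSum_neumann hA' rfl⟩
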